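/- Let a link diagram be given as a finite plane (multi)graph, loops and parallel edges allowed, whose vertices have degree four (crossings, with the information which of the two strings through the crossing is over and which is under) or degree two (subdivision points; in particular, crossing-free components of the link are cycles of subdivision points). The input lists, for every edge end in the cyclic order around its vertex, the other end of its edge. A diagram \emph{represents the unlink} (with any number of components) if it can be transformed into a diagram without crossings by Reidemeister moves of types I, II and III and their inverses, together with adding and removing subdivision points. The treewidth of a diagram is the treewidth of its underlying graph. There is an algorithm which, for every link diagram of treewidth at most $2$ with $n$ crossings and $m$ subdivision points, decides in time $O(n+m)$ whether the diagram represents the unlink. That is, there are a single program for a word RAM (unit cost per elementary operation) and a constant $K$ such that on each such diagram the program halts after at most $K(n+m+1)$ steps, uses only numbers that are at most $K(n+m+1)$, and outputs $1$ if the diagram represents the unlink and $0$ otherwise. -/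

import Mathlib

/-! ### Link diagrams -/

/-- The darts (edge ends) of a link diagram with set of crossings `C` and set of degree-two vertices
(subdivision points, called joints) `S`.  The dart `(c, i)` at a crossing `c` is the `i`-th of its
four edge ends in counterclockwise order; a joint has the two edge ends `(s, 0)` and `(s, 1)`. -/
abbrev Dart (C S : Type) : Type := (C × ZMod 4) ⊕ (S × ZMod 2)

namespace Dart

variable {C S : Type}

/-- The vertex at which a dart sits. -/
def vert : Dart C S → C ⊕ S := Sum.map Prod.fst Prod.fst

/-- The rotation system: the counterclockwise next dart at the same vertex. -/
def rot : Equiv.Perm (Dart C S) :=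
  Equiv.sumCongr (Equiv.prodCongr (Equiv.refl C) (Equiv.addRight (1 : ZMod 4)))
    (Equiv.prodCongr (Equiv.refl S) (Equiv.addRight (1 : ZMod 2)))

/-- At a crossing the string through the edge ends 1 and 3 passes over the string through the edge
ends 0 and 2: the ends 1 and 3 carry the label "up", the ends 0 and 2 the label "down". -/
def IsUp : Dart C S → Prop
  | Sum.inl (_, i) => i = 1 ∨ i = 3
  | Sum.inr _ => False

/-- The underlying simple graph of the map whose edges join the darts `d` and `edge d`. -/
def graph (edge : Equiv.Perm (Dart C S)) : SimpleGraph (C ⊕ S) :=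
  SimpleGraph.fromRel fun v w => ∃ d, vert d = v ∧ vert (edge d) = w

end Dart

/-- A link diagram with set of crossings `C` and set of joints `S`, as a planar combinatorial map:
a finite plane (multi)graph all of whose vertices have degree four (crossings, with over/under
information) or two (joints), given by its rotation system.  Components of the link without
crossings are cycles of joints.  Faces are the orbits of `d ↦ rot (edge d)`, and planarity is
Euler's formula `V - E + F = 2 K` with `K` the number of connected components (every connected
component has genus zero).  The relative position of different connected components, which has no
influence on the link type, is not recorded. -/
structure LinkDiagram (C S : Type) where
  finite_crossings : Finite C
  finite_joints : Finite S
  /-- The other end of the edge on which a dart lies. -/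
  edge : Equiv.Perm (Dart C S)
  edge_edge : ∀ d, edge (edge d) = d
  edge_ne : ∀ d, edge d ≠ d
  planar :
    Nat.card (C ⊕ S) + Nat.card (Quotient (Equiv.Perm.SameCycle.setoid (edge.trans Dart.rot))) =
      Nat.card (Quotient (Equiv.Perm.SameCycle.setoid edge)) +
        2 * Nat.card (Dart.graph edge).ConnectedComponent

namespace LinkDiagram

open Dart

variable {C S C' S' : Type}

/-- The underlying simple graph. -/
def graph (D : LinkDiagram C S) : SimpleGraph (C ⊕ S) := Dart.graph D.edge

/-- Isomorphism of diagrams (change of names). -/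
def Iso (D : LinkDiagram C S) (D' : LinkDiagram C' S') : Prop :=
  ∃ f : Dart C S ≃ Dart C' S',
    (∀ x, f (rot x) = rot (f x)) ∧ (∀ x, IsUp (f x) ↔ IsUp x) ∧
      ∀ x, f (D.edge x) = D'.edge (f x)

/-- `D'` arises from `D` by removing a joint `s` and joining its two neighbours.  (A joint which
alone forms a circle is not removed.) -/
def Unsubdivide (D : LinkDiagram C S) (D' : LinkDiagram C' S') : Prop :=
  ∃ (s : S) (f : Dart C' S' → Dart C S),
    D.edge (Sum.inr (s, 0)) ≠ Sum.inr (s, 1) ∧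
    Function.Injective f ∧ Set.range f = {x | vert x ≠ Sum.inr s} ∧
    (∀ x, f (rot x) = rot (f x)) ∧ (∀ x, IsUp (f x) ↔ IsUp x) ∧
    (∀ x, vert (D.edge (f x)) ≠ Sum.inr s → f (D'.edge x) = D.edge (f x)) ∧
    (∀ x, vert (D.edge (f x)) = Sum.inr s → f (D'.edge x) = D.edge (rot (D.edge (f x))))

/-- First Reidemeister move (untwist): two consecutive ends `i`, `i + 1` of a crossing `a` are
joined by an edge, which bounds a face.  The loop is deleted and `a` becomes a joint `s` between
the ends `i + 2` and `i + 3`.  The map `f` identifies the darts of `D'` with the remaining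
darts of `D`. -/
def Untwist (D : LinkDiagram C S) (D' : LinkDiagram C' S') : Prop :=
  ∃ (a : C) (i : ZMod 4) (s : S') (f : Dart C' S' → Dart C S),
    D.edge (Sum.inl (a, i)) = Sum.inl (a, i + 1) ∧
    Function.Injective f ∧
    Set.range f = {Sum.inl (a, i), Sum.inl (a, i + 1)}ᶜ ∧
    (∀ x, f (D'.edge x) = D.edge (f x)) ∧
    f (Sum.inr (s, 0)) = Sum.inl (a, i + 2) ∧ f (Sum.inr (s, 1)) = Sum.inl (a, i + 3) ∧
    ∀ x, vert x ≠ Sum.inr s → f (rot x) = rot (f x) ∧ (IsUp (f x) ↔ IsUp x)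

/-- Second Reidemeister move (unpoke): two different crossings `a`, `b` are joined by two edges
which bound a face with two sides, and one of the two strings is over at both crossings.
The two edges are deleted, and the crossings are replaced by a joint on each of the strings. -/
def Unpoke (D : LinkDiagram C S) (D' : LinkDiagram C' S') : Prop :=
  ∃ (a b : C) (i j : ZMod 4) (s t : S') (f : Dart C' S' → Dart C S),
    a ≠ b ∧
    D.edge (Sum.inl (a, i)) = Sum.inl (b, j + 1) ∧
    D.edge (Sum.inl (a, i + 1)) = Sum.inl (b, j) ∧
    (IsUp (Sum.inl (a, i) : Dart C S) ↔ IsUp (Sum.inl (b, j + 1) : Dart C S)) ∧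
    Function.Injective f ∧
    Set.range f = {Sum.inl (a, i), Sum.inl (a, i + 1), Sum.inl (b, j), Sum.inl (b, j + 1)}ᶜ ∧
    (∀ x, f (D'.edge x) = D.edge (f x)) ∧
    f (Sum.inr (s, 0)) = Sum.inl (a, i + 2) ∧ f (Sum.inr (s, 1)) = Sum.inl (b, j + 3) ∧
    f (Sum.inr (t, 0)) = Sum.inl (a, i + 3) ∧ f (Sum.inr (t, 1)) = Sum.inl (b, j + 2) ∧
    ∀ x, vert x ≠ Sum.inr s → vert x ≠ Sum.inr t →
      f (rot x) = rot (f x) ∧ (IsUp (f x) ↔ IsUp x)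

open Classical in
/-- The exchange of edge ends in a slide move at a triangle with corners `a`, `b`, `c`, where the
corner at `a` lies between the ends `i`, `i + 1`, and so on: along each of the three strings the
order of its two crossings is reversed. -/
noncomputable def slidePerm (a b c : C) (i j k : ZMod 4) : Equiv.Perm (Dart C S) :=
  Equiv.swap (Sum.inl (a, i + 3)) (Sum.inl (b, j)) *
  Equiv.swap (Sum.inl (a, i + 1)) (Sum.inl (b, j + 2)) *
  Equiv.swap (Sum.inl (b, j + 3)) (Sum.inl (c, k)) *
  Equiv.swap (Sum.inl (b, j + 1)) (Sum.inl (c, k + 2)) *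
  Equiv.swap (Sum.inl (c, k + 3)) (Sum.inl (a, i)) *
  Equiv.swap (Sum.inl (c, k + 1)) (Sum.inl (a, i + 2))

/-- Third Reidemeister move (slide): three different crossings `a`, `b`, `c` are the corners of a
face with three sides, and the string through `a` and `b` is over at both of these crossings. -/
def Slide (D D' : LinkDiagram C S) : Prop :=
  ∃ (a b c : C) (i j k : ZMod 4),
    a ≠ b ∧ b ≠ c ∧ c ≠ a ∧
    D.edge (Sum.inl (a, i + 1)) = Sum.inl (b, j) ∧
    D.edge (Sum.inl (b, j + 1)) = Sum.inl (c, k) ∧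
    D.edge (Sum.inl (c, k + 1)) = Sum.inl (a, i) ∧
    IsUp (Sum.inl (a, i + 1) : Dart C S) ∧ IsUp (Sum.inl (b, j) : Dart C S) ∧
    ∀ x, D'.edge (slidePerm a b c i j k x) = slidePerm a b c i j k (D.edge x)

/-- Equivalence of link diagrams: the equivalence relation generated by the Reidemeister moves and
by adding and removing subdivisions. -/
inductive Equivalent : ∀ {C S C' S' : Type}, LinkDiagram C S → LinkDiagram C' S' → Prop
  | iso {C S C' S' : Type} {D : LinkDiagram C S} {D' : LinkDiagram C' S'} :
      Iso D D' → Equivalent D D'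
  | unsubdivide {C S C' S' : Type} {D : LinkDiagram C S} {D' : LinkDiagram C' S'} :
      Unsubdivide D D' → Equivalent D D'
  | untwist {C S C' S' : Type} {D : LinkDiagram C S} {D' : LinkDiagram C' S'} :
      Untwist D D' → Equivalent D D'
  | unpoke {C S C' S' : Type} {D : LinkDiagram C S} {D' : LinkDiagram C' S'} :
      Unpoke D D' → Equivalent D D'
  | slide {C S : Type} {D D' : LinkDiagram C S} :
      Slide D D' → Equivalent D D'
  | symm {C S C' S' : Type} {D : LinkDiagram C S} {D' : LinkDiagram C' S'} :
      Equivalent D D' → Equivalent D' D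
  | trans {C S C' S' C'' S'' : Type} {D : LinkDiagram C S} {D' : LinkDiagram C' S'}
      {D'' : LinkDiagram C'' S''} :
      Equivalent D D' → Equivalent D' D'' → Equivalent D D''

/-- A diagram represents the unlink (with any number of components) if it is equivalent to a
diagram without crossings. -/
def IsUnlink (D : LinkDiagram C S) : Prop :=
  ∃ (C' S' : Type) (D' : LinkDiagram C' S'), IsEmpty C' ∧ Equivalent D D'

end LinkDiagram

/-! ### Treewidth -/

/-- The treewidth of `G` is at most `k`: there are a finite tree `T` and bags `X i` of at most
`k + 1` vertices such that every vertex lies in a bag, the two ends of every edge lie in a common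
bag, and the nodes whose bag holds a given vertex form a connected subtree. -/
def TreewidthLE {V : Type} (G : SimpleGraph V) (k : ℕ) : Prop :=
  ∃ (I : Type) (_ : Finite I) (T : SimpleGraph I) (X : I → Finset V),
    T.IsTree ∧
    (∀ v, ∃ i, v ∈ X i) ∧
    (∀ v w, G.Adj v w → ∃ i, v ∈ X i ∧ w ∈ X i) ∧
    (∀ v, (T.induce {i | v ∈ X i}).Connected) ∧
    ∀ i, (X i).card ≤ k + 1

/-! ### Random access machines

Programs for a word RAM with finitely many registers and finitely many random access arrays, with
unit cost for each elementary operation.  No number larger than the word bound `W` may occur. -/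

namespace RAM

/-- A memory state: the contents of the registers and of the arrays. -/
structure State where
  reg : ℕ → ℕ
  arr : ℕ → ℕ → ℕ

/-- The elementary operations on words; comparisons yield 0 or 1, subtraction is truncated. -/
inductive Op
  | add | sub | mul | div | mod | eq | lt

/-- The value of an operation. -/
def Op.eval : Op → ℕ → ℕ → ℕ
  | add, x, y => x + y
  | sub, x, y => x - y
  | mul, x, y => x * y
  | div, x, y => x / y
  | mod, x, y => x % y
  | eq, x, y => if x = y then 1 else 0
  | lt, x, y => if x < y then 1 else 0

/-- Expressions: constants, registers, array entries and operations. -/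
inductive Term
  | const (k : ℕ)
  | reg (r : ℕ)
  | read (a : ℕ) (index : Term)
  | op (o : Op) (e₁ e₂ : Term)

/-- The value of an expression. -/
def Term.eval (s : State) : Term → ℕ
  | const k => k
  | reg r => s.reg r
  | read a e => s.arr a (e.eval s)
  | op o e₁ e₂ => o.eval (e₁.eval s) (e₂.eval s)

/-- All values that occur in the evaluation of an expression are at most `W`. -/
def Term.Fits (W : ℕ) (s : State) : Term → Prop
  | const k => k ≤ W
  | reg r => s.reg r ≤ W
  | read a e => e.Fits W s ∧ s.arr a (e.eval s) ≤ W
  | op o e₁ e₂ => e₁.Fits W s ∧ e₂.Fits W s ∧ o.eval (e₁.eval s) (e₂.eval s) ≤ W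

/-- The number of steps for the evaluation of an expression. -/
def Term.cost : Term → ℕ
  | const _ => 1
  | reg _ => 1
  | read _ e => e.cost + 1
  | op _ e₁ e₂ => e₁.cost + e₂.cost + 1

/-- Programs. -/
inductive Program
  | skip
  | assign (r : ℕ) (e : Term)
  | write (a : ℕ) (index e : Term)
  | seq (p q : Program)
  | ite (test : Term) (p q : Program)
  | loop (test : Term) (p : Program)

/-- `Runs W p s s' t`: with word bound `W`, the program `p`, started in the state `s`, halts in the
state `s'` after `t` steps. -/
inductive Runs (W : ℕ) : Program → State → State → ℕ → Prop
  | skip (s : State) : Runs W Program.skip s s 1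
  | assign (s : State) (r : ℕ) (e : Term) : e.Fits W s →
      Runs W (Program.assign r e) s ⟨Function.update s.reg r (e.eval s), s.arr⟩ (e.cost + 1)
  | write (s : State) (a : ℕ) (i e : Term) : i.Fits W s → e.Fits W s →
      Runs W (Program.write a i e) s
        ⟨s.reg, Function.update s.arr a (Function.update (s.arr a) (i.eval s) (e.eval s))⟩
        (i.cost + e.cost + 1)
  | seq {p q : Program} {s s' s'' : State} {t t' : ℕ} : Runs W p s s' t → Runs W q s' s'' t' →
      Runs W (Program.seq p q) s s'' (t + t')
  | ite_true {e : Term} {p q : Program} {s s' : State} {t : ℕ} : e.Fits W s → e.eval s ≠ 0 →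
      Runs W p s s' t → Runs W (Program.ite e p q) s s' (e.cost + 1 + t)
  | ite_false {e : Term} {p q : Program} {s s' : State} {t : ℕ} : e.Fits W s → e.eval s = 0 →
      Runs W q s s' t → Runs W (Program.ite e p q) s s' (e.cost + 1 + t)
  | loop_true {e : Term} {p : Program} {s s' s'' : State} {t t' : ℕ} : e.Fits W s →
      e.eval s ≠ 0 → Runs W p s s' t → Runs W (Program.loop e p) s' s'' t' →
      Runs W (Program.loop e p) s s'' (e.cost + 1 + t + t')
  | loop_false {e : Term} {p : Program} {s : State} : e.Fits W s → e.eval s = 0 →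
      Runs W (Program.loop e p) s s (e.cost + 1)

end RAM

/-! ### Input format -/

/-- The number of a dart: crossing `c` has the darts `4 c, …, 4 c + 3`, and joint `s` has the darts
`4 n + 2 s` and `4 n + 2 s + 1`. -/
def Dart.code {n m : ℕ} : Dart (Fin n) (Fin m) → ℕ
  | Sum.inl (c, i) => 4 * c.val + i.val
  | Sum.inr (s, i) => 4 * n + 2 * s.val + i.val

/-- The initial memory on input `D`: the numbers `n` of crossings and `m` of joints in the first two
registers, the edges (the other end of each dart) in the first array, and zeros elsewhere. -/
structure LinkDiagram.IsInput {n m : ℕ} (D : LinkDiagram (Fin n) (Fin m)) (s : RAM.State) :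
    Prop where
  reg_zero : s.reg 0 = n
  reg_one : s.reg 1 = m
  reg_rest : ∀ r, 2 ≤ r → s.reg r = 0
  arr_zero : ∀ d, s.arr 0 (Dart.code d) = Dart.code (D.edge d)
  arr_zero_rest : ∀ k, 4 * n + 2 * m ≤ k → s.arr 0 k = 0
  arr_rest : ∀ a k, 1 ≤ a → s.arr a k = 0

/-! The algorithm removes the subdivision points and then reduces greedily. It performs every
untwist move it finds, and those unpoke moves (`IsPokeAt`) whose result can be obtained, on the
level of graphs, by contracting the bigon; thus the treewidth of the crossing graph stays at most
two. All steps are Reidemeister moves, so if no crossing is left, the diagram represents the unlink.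
The content is the converse, `not_isUnlink_of_irreducible`: if crossings are left and no such move
is possible, the diagram does not represent the unlink.

The obstruction comes from Fox colourings. A Reidemeister move induces a bijection between the
colourings of the two diagrams, for every abelian group and compatibly with reduction from `ℤ` to
`ZMod k`. Hence the property that every colouring modulo `k` lifts to an integral one (`Liftable`)
is invariant (`Equivalent.liftable_iff`), and it holds for diagrams without crossings. It fails in
the presence of a closed chain of `k ≥ 2` crossings, all twisted in the same sense
(`TwistChain.not_liftable`): modulo `k` there is a colouring which is an arithmetic progression
along the chain and constant elsewhere, whereas over the integers the closing edge forces `k` times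
the difference of the progression to vanish.

Such a chain exists by `PlaneMap.exists_chain`. Take a minimal nonempty set of crossings with at
most two outgoing edges and join these two edges. The result is a plane four-regular map without
loops and without cuts of at most two edges, still of treewidth at most two. In it all
multiplicities are even (`even_multiplicity`): a vertex with at most two neighbours can be
suppressed, and one uses induction. Planarity makes the parallel edges consecutive (`not_opposite`)
and lets them bound bigons (`bigon`). Following a face beside a bigon leads to the next bigon, so
there is a closed chain of bigons through any prescribed dart. Only one of its edges can be the
artificial one, so a chain closed by at least one genuine edge remains. If two consecutive crossings
of the chain were twisted in opposite senses, one string would be over at both corners of their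
bigon, and the rest of the chain would guarantee the side condition of the unpoke move. So in an
irreducible diagram the chain is twisted uniformly.

Planarity is used in homological form: Euler's formula holds if and only if every flow modulo two
has a potential on the faces (`planar_iff`). This serves both to show that the results of moves are
planar and to replace the Jordan curve theorem.

For the running time, a stack holds the ends that remain to be examined. A splice changes the array
at no more than two crossings, whose ends are pushed again. The height of the stack plus 17 times
the number of remaining crossings starts at `21 n` and decreases whenever an end is popped. -/

/-! ### Fox colourings -/

namespace Dart

variable {C S : Type}

@[simp] theorem rot_inl (c : C) (i : ZMod 4) :
    rot (Sum.inl (c, i) : Dart C S) = Sum.inl (c, i + 1) := rfl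

@[simp] theorem rot_inr (s : S) (i : ZMod 2) :
    rot (Sum.inr (s, i) : Dart C S) = Sum.inr (s, i + 1) := rfl

@[simp] theorem vert_inl (c : C) (i : ZMod 4) :
    vert (Sum.inl (c, i) : Dart C S) = Sum.inl c := rfl

@[simp] theorem vert_inr (s : S) (i : ZMod 2) :
    vert (Sum.inr (s, i) : Dart C S) = Sum.inr s := rfl

@[simp] theorem vert_rot (d : Dart C S) : vert (rot d) = vert d := by
  rcases d with ⟨c, i⟩ | ⟨s, i⟩ <;> rfl

@[simp] theorem isUp_inl (c : C) (i : ZMod 4) :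
    IsUp (Sum.inl (c, i) : Dart C S) ↔ i = 1 ∨ i = 3 := Iff.rfl

@[simp] theorem not_isUp_inr (x : S × ZMod 2) : ¬ IsUp (Sum.inr x : Dart C S) := fun h => h

theorem isUp_add_one (c : C) (i : ZMod 4) :
    IsUp (Sum.inl (c, i + 1) : Dart C S) ↔ ¬ IsUp (Sum.inl (c, i) : Dart C S) := by
  simp only [isUp_inl]; revert i; decide

theorem isUp_add_two (c : C) (i : ZMod 4) :
    IsUp (Sum.inl (c, i + 2) : Dart C S) ↔ IsUp (Sum.inl (c, i) : Dart C S) := by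
  simp only [isUp_inl]; revert i; decide

theorem isUp_add_three (c : C) (i : ZMod 4) :
    IsUp (Sum.inl (c, i + 3) : Dart C S) ↔ ¬ IsUp (Sum.inl (c, i) : Dart C S) := by
  simp only [isUp_inl]; revert i; decide

theorem eq_add_cases (i l : ZMod 4) : l = i ∨ l = i + 1 ∨ l = i + 2 ∨ l = i + 3 := by
  revert i l; decide

theorem eq_zero_or_one (i : ZMod 2) : i = 0 ∨ i = 1 := by
  revert i; decide

theorem vert_eq_inr {d : Dart C S} {s : S} (h : vert d = Sum.inr s) :
    d = Sum.inr (s, 0) ∨ d = Sum.inr (s, 1) := by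
  rcases d with ⟨c, i⟩ | ⟨t, i⟩
  · simp at h
  · simp only [vert_inr, Sum.inr.injEq] at h
    subst h
    rcases eq_zero_or_one i with rfl | rfl <;> simp

theorem vert_eq_inl {d : Dart C S} {a : C} (h : vert d = Sum.inl a) (i : ZMod 4) :
    d = Sum.inl (a, i) ∨ d = Sum.inl (a, i + 1) ∨ d = Sum.inl (a, i + 2) ∨
      d = Sum.inl (a, i + 3) := by
  rcases d with ⟨c, l⟩ | ⟨t, l⟩
  · simp only [vert_inl, Sum.inl.injEq] at h
    subst h
    rcases eq_add_cases i l with rfl | rfl | rfl | rfl <;> simp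
  · simp at h

end Dart

namespace LinkDiagram

open Dart

variable {C S C' S' : Type} {G : Type} [AddCommGroup G]

/-- Fox colourings of a diagram with values in an abelian group. -/
structure IsColouring (D : LinkDiagram C S) (γ : Dart C S → G) : Prop where
  edge : ∀ d, γ (D.edge d) = γ d
  overpass : ∀ d, IsUp d → γ (rot (rot d)) = γ d
  underpass : ∀ d, IsUp d → γ (rot d) + γ (rot (rot (rot d))) = γ d + γ d
  joint : ∀ d, ¬ IsUp d → ¬ IsUp (rot d) → γ (rot d) = γ d

/-- Every colouring modulo `k` lifts to an integer colouring. -/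
def Liftable (k : ℕ) (D : LinkDiagram C S) : Prop :=
  ∀ γ : Dart C S → ZMod k, D.IsColouring γ →
    ∃ γ' : Dart C S → ℤ, D.IsColouring γ' ∧ ∀ d, (γ' d : ZMod k) = γ d

theorem IsColouring.cast {D : LinkDiagram C S} {γ : Dart C S → ℤ} (h : D.IsColouring γ) (k : ℕ) :
    D.IsColouring (fun d => (γ d : ZMod k)) where
  edge d := by simp [h.edge]
  overpass d hd := by simp [h.overpass d hd]
  underpass d hd := by exact_mod_cast congrArg (Int.cast : ℤ → ZMod k) (h.underpass d hd)
  joint d h1 h2 := by simp [h.joint d h1 h2]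

theorem IsColouring.joint_eq {D : LinkDiagram C S} {γ : Dart C S → G} (h : D.IsColouring γ)
    {d : Dart C S} {s : S} (hd : vert d = Sum.inr s) : γ (rot d) = γ d := by
  rcases vert_eq_inr hd with rfl | rfl <;> exact h.joint _ (by simp) (by simp)

theorem Liftable.of_isEmpty (k : ℕ) (D : LinkDiagram C S) [IsEmpty C] : Liftable k D := by
  intro γ hγ
  have hd : ∀ d : Dart C S, ¬ IsUp d := by
    rintro (⟨c, -⟩ | x)
    · exact isEmptyElim c
    · simp
  refine ⟨fun d => (γ d).cast, ⟨fun d => ?_, fun d h => absurd h (hd d), fun d h => absurd h (hd d),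
    fun d h1 h2 => ?_⟩, fun d => ?_⟩
  · rw [hγ.edge]
  · rw [hγ.joint d h1 h2]
  · simp

/-- Transfer of the lifting property along a natural relation between colourings. -/
theorem Liftable.transfer {k : ℕ} {D : LinkDiagram C S} {D' : LinkDiagram C' S'}
    (h : Liftable k D)
    (R : (Dart C S → ZMod k) → (Dart C' S' → ZMod k) → Prop)
    (R' : (Dart C S → ℤ) → (Dart C' S' → ℤ) → Prop)
    (h1 : ∀ γ', D'.IsColouring γ' → ∃ γ, D.IsColouring γ ∧ R γ γ')
    (h2 : ∀ γ, D.IsColouring γ → ∃ γ', D'.IsColouring γ' ∧ R' γ γ')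
    (h3 : ∀ γ γ', R' γ γ' → R (fun d => (γ d : ZMod k)) (fun d => (γ' d : ZMod k)))
    (h4 : ∀ γ γ₁ γ₂, D.IsColouring γ → D'.IsColouring γ₁ → D'.IsColouring γ₂ → R γ γ₁ → R γ γ₂ →
      γ₁ = γ₂) : Liftable k D' := by
  intro γ' hγ'
  obtain ⟨γ, hγ, hR⟩ := h1 γ' hγ'
  obtain ⟨δ, hδ, hδγ⟩ := h γ hγ
  obtain ⟨δ', hδ', hR'⟩ := h2 δ hδ
  refine ⟨δ', hδ', fun d => ?_⟩
  -- The reduction of `δ'` and the given `γ'` both correspond to `γ`, so they agree.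
  have hR'' := h3 _ _ hR'
  have : (fun d => (δ d : ZMod k)) = γ := funext hδγ
  rw [this] at hR''
  exact congrFun (h4 γ _ γ' hγ (hδ'.cast k) hγ' hR'' hR) d

/-- Serves all moves for which the darts of one diagram embed into those of the other: there,
restriction of colourings is a bijection. The hypotheses range over all groups in order to apply to
both `ZMod k` and `ℤ`. -/
theorem liftable_iff_of_map {k : ℕ} {D : LinkDiagram C S} {D' : LinkDiagram C' S'}
    (f : Dart C' S' → Dart C S)
    (res : ∀ {G : Type} [AddCommGroup G] (γ : Dart C S → G), D.IsColouring γ →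
      D'.IsColouring (γ ∘ f))
    (ext : ∀ {G : Type} [AddCommGroup G] (γ' : Dart C' S' → G), D'.IsColouring γ' →
      ∃ γ : Dart C S → G, D.IsColouring γ ∧ γ ∘ f = γ')
    (uniq : ∀ {G : Type} [AddCommGroup G] (γ₁ γ₂ : Dart C S → G), D.IsColouring γ₁ →
      D.IsColouring γ₂ → γ₁ ∘ f = γ₂ ∘ f → γ₁ = γ₂) : Liftable k D ↔ Liftable k D' := by
  constructor
  · intro h
    refine h.transfer (fun γ γ' => γ ∘ f = γ') (fun γ γ' => γ ∘ f = γ') (fun γ' h => ext γ' h)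
      (fun γ h => ⟨_, res γ h, rfl⟩) ?_ ?_
    · rintro γ _ rfl; rfl
    · rintro γ _ _ _ _ _ rfl rfl; rfl
  · intro h
    refine h.transfer (fun γ' γ => γ ∘ f = γ') (fun γ' γ => γ ∘ f = γ')
      (fun γ h => ⟨_, res γ h, rfl⟩) (fun γ' h => ext γ' h) ?_ ?_
    · rintro _ γ rfl; rfl
    · intro γ γ₁ γ₂ _ h1 h2 e1 e2
      exact uniq γ₁ γ₂ h1 h2 (e1.trans e2.symm)

theorem Iso.liftable_iff {k : ℕ} {D : LinkDiagram C S} {D' : LinkDiagram C' S'} (h : Iso D D') :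
    Liftable k D ↔ Liftable k D' := by
  obtain ⟨f, hr, hu, he⟩ := h
  symm
  have res : ∀ {G : Type} [AddCommGroup G] (γ : Dart C' S' → G), D'.IsColouring γ →
      D.IsColouring (γ ∘ f) := by
    intro G _ γ h
    refine ⟨fun d => ?_, fun d hd => ?_, fun d hd => ?_, fun d h1 h2 => ?_⟩
    · simp [he, h.edge]
    · simp [hr, h.overpass _ ((hu d).2 hd)]
    · simp [hr, h.underpass _ ((hu d).2 hd)]
    · have := h.joint (f d) (by rwa [hu]) (by rwa [← hr, hu])
      simpa [hr] using this
  refine liftable_iff_of_map f res ?_ ?_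
  · intro G _ γ h
    have hr' : ∀ x, f.symm (rot x) = rot (f.symm x) := fun x => by
      rw [f.symm_apply_eq, hr, f.apply_symm_apply]
    have hu' : ∀ x, IsUp (f.symm x) ↔ IsUp x := fun x => by
      rw [← hu, f.apply_symm_apply]
    have he' : ∀ x, f.symm (D'.edge x) = D.edge (f.symm x) := fun x => by
      rw [f.symm_apply_eq, he, f.apply_symm_apply]
    refine ⟨γ ∘ f.symm, ⟨fun d => ?_, fun d hd => ?_, fun d hd => ?_, fun d h1 h2 => ?_⟩, ?_⟩
    · simp [he', h.edge]
    · simp [hr', h.overpass _ ((hu' d).2 hd)]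
    · simp [hr', h.underpass _ ((hu' d).2 hd)]
    · have := h.joint (f.symm d) (by rwa [hu']) (by rwa [← hr', hu'])
      simpa [hr'] using this
    · ext x; simp
  · intro G _ γ₁ γ₂ _ _ h
    exact f.surjective.injective_comp_right h

open Classical in
theorem Unsubdivide.liftable_iff {k : ℕ} {D : LinkDiagram C S} {D' : LinkDiagram C' S'}
    (h : Unsubdivide D D') : Liftable k D ↔ Liftable k D' := by
  obtain ⟨s, f, hs, hf, hrange, hr, hu, he, he'⟩ := h
  have hedge : ∀ d, vert d = Sum.inr s → vert (D.edge d) ≠ Sum.inr s := by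
    intro d hd h
    have key : D.edge (Sum.inr (s, 1)) ≠ Sum.inr (s, 0) := fun h => hs (by
      rw [← h, D.edge_edge])
    rcases vert_eq_inr hd with rfl | rfl <;> rcases vert_eq_inr h with h | h
    · exact D.edge_ne _ h
    · exact hs h
    · exact key h
    · exact D.edge_ne _ h
  have hfs : ∀ x, vert (f x) ≠ Sum.inr s := fun x => by
    have : f x ∈ Set.range f := ⟨x, rfl⟩
    rwa [hrange] at this
  have hex : ∀ d, vert d ≠ Sum.inr s → ∃ x, f x = d := fun d hd => by
    have : d ∈ Set.range f := by rw [hrange]; exact hd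
    exact this
  refine liftable_iff_of_map f ?_ ?_ ?_
  · intro G _ γ h
    refine ⟨fun d => ?_, fun d hd => ?_, fun d hd => ?_, fun d h1 h2 => ?_⟩
    · by_cases hd : vert (D.edge (f d)) = Sum.inr s
      · simp only [Function.comp, he' d hd]
        rw [h.edge, h.joint_eq hd, h.edge]
      · simp only [Function.comp, he d hd]
        rw [h.edge]
    · simp [hr, h.overpass _ ((hu d).2 hd)]
    · simp [hr, h.underpass _ ((hu d).2 hd)]
    · have := h.joint (f d) (by rwa [hu]) (by rwa [← hr, hu])
      simpa [hr] using this
  · intro G _ γ' h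
    let γ₀ := Function.extend f γ' 0
    have h0 : ∀ x, γ₀ (f x) = γ' x := fun x => hf.extend_apply _ _ _
    -- At the removed joint the colour is read off at the other end of the edge, which by `hedge` is
    -- not at the joint again.
    let γ : Dart C S → G := fun d => if vert d = Sum.inr s then γ₀ (D.edge d) else γ₀ d
    have h1 : ∀ x, γ (f x) = γ' x := fun x => by simp [γ, hfs, h0]
    refine ⟨γ, ⟨?_, ?_, ?_, ?_⟩, funext h1⟩
    · intro d
      by_cases hd : vert d = Sum.inr s
      · have := hedge d hd
        simp [γ, hd, this]
      · by_cases hd' : vert (D.edge d) = Sum.inr s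
        · simp [γ, hd, hd', D.edge_edge]
        · obtain ⟨x, rfl⟩ := hex d hd
          rw [← he x hd', h1, h1, h.edge]
    · intro d hd
      by_cases hd' : vert d = Sum.inr s
      · rcases vert_eq_inr hd' with rfl | rfl <;> simp at hd
      · obtain ⟨x, rfl⟩ := hex d hd'
        rw [← hr, ← hr, h1, h1, h.overpass _ ((hu x).1 hd)]
    · intro d hd
      by_cases hd' : vert d = Sum.inr s
      · rcases vert_eq_inr hd' with rfl | rfl <;> simp at hd
      · obtain ⟨x, rfl⟩ := hex d hd'
        rw [← hr, ← hr, ← hr, h1, h1, h1, h.underpass _ ((hu x).1 hd)]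
    · intro d hd1 hd2
      by_cases hd' : vert d = Sum.inr s
      · obtain ⟨x, hx⟩ := hex _ (hedge d hd')
        have hx' : vert (D.edge (f x)) = Sum.inr s := by rw [hx, D.edge_edge, hd']
        have := he' x hx'
        rw [hx, D.edge_edge] at this
        simp only [γ, vert_rot, hd', if_true]
        rw [← hx, ← this, h0, h0, h.edge]
      · obtain ⟨x, rfl⟩ := hex d hd'
        rw [← hr, h1, h1, h.joint _ (by rwa [← hu]) (by rwa [← hu, hr])]
  · intro G _ γ₁ γ₂ h1 h2 e
    funext d
    by_cases hd : vert d = Sum.inr s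
    · obtain ⟨x, hx⟩ := hex _ (hedge d hd)
      rw [← h1.edge, ← h2.edge, ← hx]
      exact congrFun e x
    · obtain ⟨x, rfl⟩ := hex d hd
      exact congrFun e x

end LinkDiagram

/-! ### Invariance of lifting under the first and second Reidemeister moves -/

namespace LinkDiagram

open Dart

variable {C S C' S' : Type} {G : Type} [AddCommGroup G]

theorem IsColouring.cross {D : LinkDiagram C S} {γ : Dart C S → G} (h : D.IsColouring γ) {a : C}
    {i : ZMod 4} (hi : IsUp (Sum.inl (a, i) : Dart C S)) :
    γ (Sum.inl (a, i + 2)) = γ (Sum.inl (a, i)) ∧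
      γ (Sum.inl (a, i + 1)) + γ (Sum.inl (a, i + 3)) =
        γ (Sum.inl (a, i)) + γ (Sum.inl (a, i)) := by
  have h1 := h.overpass _ hi
  have h2 := h.underpass _ hi
  simp only [rot_inl, add_assoc] at h1 h2
  exact ⟨h1, h2⟩

theorem IsColouring.cross' {D : LinkDiagram C S} {γ : Dart C S → G} (h : D.IsColouring γ) {a : C}
    {i : ZMod 4} (hi : ¬ IsUp (Sum.inl (a, i) : Dart C S)) :
    γ (Sum.inl (a, i + 3)) = γ (Sum.inl (a, i + 1)) ∧
      γ (Sum.inl (a, i)) + γ (Sum.inl (a, i + 2)) =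
        γ (Sum.inl (a, i + 1)) + γ (Sum.inl (a, i + 1)) := by
  have := h.cross ((isUp_add_one a i).2 hi)
  have e1 : i + 1 + 2 = i + 3 := by ring
  have e2 : i + 1 + 1 = i + 2 := by ring
  have e3 : i + 1 + 3 = i := by
    have : (4 : ZMod 4) = 0 := by decide
    linear_combination this
  rw [e1, e2, e3, add_comm (γ (Sum.inl (a, i + 2)))] at this
  exact this

/-- The crossing conditions at `a`, from the conditions at one of its ends. -/
theorem crossing_conditions {γ : Dart C S → G} {a : C} (i : ZMod 4)
    (h1 : IsUp (Sum.inl (a, i) : Dart C S) → γ (Sum.inl (a, i + 2)) = γ (Sum.inl (a, i)) ∧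
      γ (Sum.inl (a, i + 1)) + γ (Sum.inl (a, i + 3)) =
        γ (Sum.inl (a, i)) + γ (Sum.inl (a, i)))
    (h2 : ¬ IsUp (Sum.inl (a, i) : Dart C S) → γ (Sum.inl (a, i + 3)) = γ (Sum.inl (a, i + 1)) ∧
      γ (Sum.inl (a, i)) + γ (Sum.inl (a, i + 2)) =
        γ (Sum.inl (a, i + 1)) + γ (Sum.inl (a, i + 1)))
    (d : Dart C S) (hd : vert d = Sum.inl a) (hu : IsUp d) :
    γ (rot (rot d)) = γ d ∧ γ (rot d) + γ (rot (rot (rot d))) = γ d + γ d := by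
  have h4 : (4 : ZMod 4) = 0 := by decide
  have e5 : i + 5 = i + 1 := by linear_combination h4
  have e6 : i + 6 = i + 2 := by linear_combination h4
  have n1 : (1 : ZMod 4) + 1 = 2 := by decide
  have n2 : (2 : ZMod 4) + 1 = 3 := by decide
  have n3 : (3 : ZMod 4) + 1 = 0 := by decide
  rcases vert_eq_inl hd i with rfl | rfl | rfl | rfl
  · have := h1 hu
    simpa only [rot_inl, add_assoc, n1, n2] using this
  · have := h2 ((isUp_add_one a i).1 hu)
    simp only [rot_inl, add_assoc, n1, n2, n3, add_zero]
    exact ⟨this.1, by rw [add_comm, this.2]⟩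
  · have := h1 ((isUp_add_two a i).1 hu)
    simp only [rot_inl, add_assoc, n1, n2, n3, add_zero]
    exact ⟨this.1.symm, by rw [add_comm, this.2, this.1]⟩
  · have := h2 ((isUp_add_three a i).1 hu)
    simp only [rot_inl, add_assoc, n1, n2, n3, add_zero]
    exact ⟨this.1.symm, by rw [this.2, this.1]⟩

open Classical in
-- The loop gives two consecutive ends the same colour, and then the crossing relations force all
-- four ends to have this colour. So the crossing acts on colours like a joint.
theorem Untwist.liftable_iff {k : ℕ} {D : LinkDiagram C S} {D' : LinkDiagram C' S'}
    (h : Untwist D D') : Liftable k D ↔ Liftable k D' := by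
  obtain ⟨a, i, s, f, ha, hf, hrange, he, hs0, hs1, hr⟩ := h
  replace hr := fun x hx => (⟨(hr x hx).1, (hr x hx).2.symm⟩ :
    f (rot x) = rot (f x) ∧ (IsUp x ↔ IsUp (f x)))
  have ha' : D.edge (Sum.inl (a, i + 1)) = Sum.inl (a, i) := by rw [← ha, D.edge_edge]
  have hfs : ∀ x, f x ≠ Sum.inl (a, i) ∧ f x ≠ Sum.inl (a, i + 1) := fun x => by
    have : f x ∈ Set.range f := ⟨x, rfl⟩
    rw [hrange] at this
    simpa using this
  have hex : ∀ d, d ≠ Sum.inl (a, i) → d ≠ Sum.inl (a, i + 1) → ∃ x, f x = d := fun d h1 h2 => by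
    have : d ∈ Set.range f := by rw [hrange]; simp [h1, h2]
    exact this
  have hex' : ∀ d, vert d ≠ Sum.inl a → ∃ x, f x = d ∧ vert x ≠ Sum.inr s := fun d h => by
    obtain ⟨x, rfl⟩ := hex d (by rintro rfl; simp at h) (by rintro rfl; simp at h)
    refine ⟨x, rfl, fun hx => h ?_⟩
    rcases vert_eq_inr hx with rfl | rfl
    · rw [hs0]; rfl
    · rw [hs1]; rfl
  have hrr : ∀ x, vert x ≠ Sum.inr s → f (rot (rot x)) = rot (rot (f x)) := fun x hx => by
    rw [(hr _ (by simpa using hx)).1, (hr x hx).1]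
  have hrrr : ∀ x, vert x ≠ Sum.inr s → f (rot (rot (rot x))) = rot (rot (rot (f x))) :=
    fun x hx => by rw [(hr _ (by simpa using hx)).1, hrr x hx]
  have ns : ∀ x : Dart C' S', IsUp x → vert x ≠ Sum.inr s := fun x h1 h2 => by
    rcases vert_eq_inr h2 with rfl | rfl <;> simp at h1
  have forced : ∀ {G : Type} [AddCommGroup G] (γ : Dart C S → G), D.IsColouring γ →
      γ (Sum.inl (a, i)) = γ (f (Sum.inr (s, 0))) ∧
      γ (Sum.inl (a, i + 1)) = γ (f (Sum.inr (s, 0))) ∧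
      γ (f (Sum.inr (s, 1))) = γ (f (Sum.inr (s, 0))) := by
    intro G _ γ h
    have h1 := h.edge (Sum.inl (a, i))
    rw [ha] at h1
    rw [hs0, hs1]
    by_cases hu : IsUp (Sum.inl (a, i) : Dart C S)
    · obtain ⟨h2, h3⟩ := h.cross hu
      rw [h1] at h3 ⊢
      rw [h2]
      simpa using h3
    · obtain ⟨h2, h3⟩ := h.cross' hu
      rw [h1] at h3 h2 ⊢
      rw [h2]
      have : γ (Sum.inl (a, i + 2)) = γ (Sum.inl (a, i)) := by simpa using h3
      simp [this]
  refine liftable_iff_of_map f ?_ ?_ ?_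
  · intro G _ γ h
    refine ⟨fun d => ?_, fun d hd => ?_, fun d hd => ?_, fun d h1 h2 => ?_⟩
    · simp only [Function.comp, he, h.edge]
    · simp only [Function.comp, hrr d (ns d hd)]
      exact h.overpass _ ((hr d (ns d hd)).2.1 hd)
    · simp only [Function.comp, hrrr d (ns d hd), (hr d (ns d hd)).1]
      exact h.underpass _ ((hr d (ns d hd)).2.1 hd)
    · by_cases hd : vert d = Sum.inr s
      · have := (forced γ h).2.2
        rcases vert_eq_inr hd with rfl | rfl
        · simpa using this
        · simpa [show (1 : ZMod 2) + 1 = 0 by decide] using this.symm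
      · simp only [Function.comp, (hr d hd).1]
        refine h.joint _ (by rwa [← (hr d hd).2]) ?_
        rwa [← (hr d hd).1, ← (hr (rot d) (by simpa using hd)).2]
  · intro G _ γ' h
    let γ₀ := Function.extend f γ' 0
    have h0 : ∀ x, γ₀ (f x) = γ' x := fun x => hf.extend_apply _ _ _
    let γ : Dart C S → G := fun d =>
      if d = Sum.inl (a, i) ∨ d = Sum.inl (a, i + 1) then γ' (Sum.inr (s, 0)) else γ₀ d
    have g1 : ∀ x, γ (f x) = γ' x := fun x => by simp [γ, hfs, h0]
    have g2 : γ (Sum.inl (a, i)) = γ' (Sum.inr (s, 0)) := by simp [γ]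
    have g3 : γ (Sum.inl (a, i + 1)) = γ' (Sum.inr (s, 0)) := by simp [γ]
    have g4 : γ (Sum.inl (a, i + 2)) = γ' (Sum.inr (s, 0)) := by rw [← hs0, g1]
    have g5 : γ (Sum.inl (a, i + 3)) = γ' (Sum.inr (s, 0)) := by
      rw [← hs1, g1]
      exact h.joint (Sum.inr (s, 0)) (by simp) (by simp)
    have hc := crossing_conditions (S := S) (γ := γ) (a := a) i
      (fun _ => by rw [g2, g3, g4, g5]; simp) (fun _ => by rw [g2, g3, g4, g5]; simp)
    refine ⟨γ, ⟨?_, ?_, ?_, ?_⟩, funext g1⟩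
    · intro d
      by_cases h1 : d = Sum.inl (a, i)
      · rw [h1, ha, g2, g3]
      by_cases h2 : d = Sum.inl (a, i + 1)
      · rw [h2, ha', g2, g3]
      obtain ⟨x, rfl⟩ := hex d h1 h2
      rw [← he, g1, g1, h.edge]
    · intro d hd
      by_cases hv : vert d = Sum.inl a
      · exact (hc d hv hd).1
      · obtain ⟨x, rfl, hx⟩ := hex' d hv
        rw [← hrr x hx, g1, g1, h.overpass _ ((hr x hx).2.2 hd)]
    · intro d hd
      by_cases hv : vert d = Sum.inl a
      · exact (hc d hv hd).2
      · obtain ⟨x, rfl, hx⟩ := hex' d hv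
        rw [← hrrr x hx, ← (hr x hx).1, g1, g1, g1, h.underpass _ ((hr x hx).2.2 hd)]
    · intro d hd1 hd2
      have hv : vert d ≠ Sum.inl a := by
        intro hv
        rcases vert_eq_inl hv 0 with rfl | rfl | rfl | rfl <;> revert hd1 hd2 <;> simp <;> decide
      obtain ⟨x, rfl, hx⟩ := hex' d hv
      rw [← (hr x hx).1, g1, g1]
      refine h.joint _ (by rwa [(hr x hx).2]) ?_
      rwa [(hr (rot x) (by simpa using hx)).2, (hr x hx).1]
  · intro G _ γ₁ γ₂ h1 h2 e
    have e' : ∀ x, γ₁ (f x) = γ₂ (f x) := congrFun e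
    funext d
    by_cases hd : d = Sum.inl (a, i)
    · rw [hd, (forced γ₁ h1).1, (forced γ₂ h2).1, e']
    by_cases hd' : d = Sum.inl (a, i + 1)
    · rw [hd', (forced γ₁ h1).2.1, (forced γ₂ h2).2.1, e']
    obtain ⟨x, rfl⟩ := hex d hd hd'
    exact e' x

open Classical in
-- The over string keeps its colour, and the under string is reflected in it twice, so each string
-- has the same colour before and after the bigon. The colours of the two deleted edges are
-- determined by the others, as recorded in `forced`.
theorem Unpoke.liftable_iff {k : ℕ} {D : LinkDiagram C S} {D' : LinkDiagram C' S'}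
    (h : Unpoke D D') : Liftable k D ↔ Liftable k D' := by
  obtain ⟨a, b, i, j, s, t, f, hab, ha, hb, hup, hf, hrange, he, hs0, hs1, ht0, ht1, hr⟩ := h
  replace hr := fun x hx hx' => (⟨(hr x hx hx').1, (hr x hx hx').2.symm⟩ :
    f (rot x) = rot (f x) ∧ (IsUp x ↔ IsUp (f x)))
  have ha' : D.edge (Sum.inl (b, j + 1)) = Sum.inl (a, i) := by rw [← ha, D.edge_edge]
  have hb' : D.edge (Sum.inl (b, j)) = Sum.inl (a, i + 1) := by rw [← hb, D.edge_edge]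
  have hfs : ∀ x, f x ≠ Sum.inl (a, i) ∧ f x ≠ Sum.inl (a, i + 1) ∧ f x ≠ Sum.inl (b, j) ∧
      f x ≠ Sum.inl (b, j + 1) := fun x => by
    have : f x ∈ Set.range f := ⟨x, rfl⟩
    rw [hrange] at this
    simpa using this
  have hex : ∀ d, d ≠ Sum.inl (a, i) → d ≠ Sum.inl (a, i + 1) → d ≠ Sum.inl (b, j) →
      d ≠ Sum.inl (b, j + 1) → ∃ x, f x = d := fun d h1 h2 h3 h4 => by
    have : d ∈ Set.range f := by rw [hrange]; simp [h1, h2, h3, h4]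
    exact this
  have hex' : ∀ d, vert d ≠ Sum.inl a → vert d ≠ Sum.inl b → ∃ x, f x = d ∧
      vert x ≠ Sum.inr s ∧ vert x ≠ Sum.inr t := fun d h h' => by
    obtain ⟨x, rfl⟩ := hex d (by rintro rfl; simp at h) (by rintro rfl; simp at h)
      (by rintro rfl; simp at h') (by rintro rfl; simp at h')
    refine ⟨x, rfl, fun hx => ?_, fun hx => ?_⟩
    · rcases vert_eq_inr hx with rfl | rfl
      · apply h; rw [hs0]; rfl
      · apply h'; rw [hs1]; rfl
    · rcases vert_eq_inr hx with rfl | rfl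
      · apply h; rw [ht0]; rfl
      · apply h'; rw [ht1]; rfl
  have hrr : ∀ x, vert x ≠ Sum.inr s → vert x ≠ Sum.inr t → f (rot (rot x)) = rot (rot (f x)) :=
    fun x hx hx' => by
    rw [(hr _ (by simpa using hx) (by simpa using hx')).1, (hr x hx hx').1]
  have hrrr : ∀ x, vert x ≠ Sum.inr s → vert x ≠ Sum.inr t →
      f (rot (rot (rot x))) = rot (rot (rot (f x))) :=
    fun x hx hx' => by
      rw [(hr _ (by simpa using hx) (by simpa using hx')).1, hrr x hx hx']
  have ns : ∀ (r : S') (x : Dart C' S'), IsUp x → vert x ≠ Sum.inr r := fun r x h1 h2 => by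
    rcases vert_eq_inr h2 with rfl | rfl <;> simp at h1
  have forced : ∀ {G : Type} [AddCommGroup G] (γ : Dart C S → G), D.IsColouring γ →
      γ (Sum.inl (a, i)) = (if IsUp (Sum.inl (a, i) : Dart C S) then γ (f (Sum.inr (s, 0))) else
        γ (f (Sum.inr (t, 0))) + γ (f (Sum.inr (t, 0))) - γ (f (Sum.inr (s, 0)))) ∧
      γ (Sum.inl (a, i + 1)) = (if IsUp (Sum.inl (a, i) : Dart C S) then
        γ (f (Sum.inr (s, 0))) + γ (f (Sum.inr (s, 0))) - γ (f (Sum.inr (t, 0))) else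
        γ (f (Sum.inr (t, 0)))) ∧
      γ (f (Sum.inr (s, 1))) = γ (f (Sum.inr (s, 0))) ∧
      γ (f (Sum.inr (t, 1))) = γ (f (Sum.inr (t, 0))) := by
    intro G _ γ h
    have h1 := h.edge (Sum.inl (a, i))
    have h1' := h.edge (Sum.inl (a, i + 1))
    rw [ha] at h1
    rw [hb] at h1'
    rw [hs0, hs1, ht0, ht1]
    by_cases hu : IsUp (Sum.inl (a, i) : Dart C S)
    · obtain ⟨h2, h3⟩ := h.cross hu
      have hu' : ¬ IsUp (Sum.inl (b, j) : Dart C S) := by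
        rw [← isUp_add_one]; exact hup.1 hu
      obtain ⟨h4, h5⟩ := h.cross' hu'
      simp only [hu, if_true]
      rw [h1, ← h3, h1'] at h5
      refine ⟨h2.symm, ?_, ?_, ?_⟩
      · rw [h2, ← h3]; abel
      · rw [h4, h1, h2]
      · exact add_left_cancel h5
    · obtain ⟨h2, h3⟩ := h.cross' hu
      have hu' : IsUp (Sum.inl (b, j) : Dart C S) := by
        by_contra h'; rw [← isUp_add_one] at h'; exact hu (hup.2 h')
      obtain ⟨h4, h5⟩ := h.cross hu'
      simp only [hu, if_false]
      rw [h1', ← h3, h1] at h5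
      refine ⟨?_, h2.symm, ?_, ?_⟩
      · rw [h2, ← h3]; abel
      · exact add_left_cancel h5
      · rw [h4, h1', h2]
  refine liftable_iff_of_map f ?_ ?_ ?_
  · intro G _ γ h
    refine ⟨fun d => ?_, fun d hd => ?_, fun d hd => ?_, fun d h1 h2 => ?_⟩
    · simp only [Function.comp, he, h.edge]
    · simp only [Function.comp, hrr d (ns s d hd) (ns t d hd)]
      exact h.overpass _ ((hr d (ns s d hd) (ns t d hd)).2.1 hd)
    · simp only [Function.comp, hrrr d (ns s d hd) (ns t d hd), (hr d (ns s d hd) (ns t d hd)).1]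
      exact h.underpass _ ((hr d (ns s d hd) (ns t d hd)).2.1 hd)
    · by_cases hd : vert d = Sum.inr s
      · have := (forced γ h).2.2.1
        rcases vert_eq_inr hd with rfl | rfl
        · simpa using this
        · simpa [show (1 : ZMod 2) + 1 = 0 by decide] using this.symm
      by_cases hd' : vert d = Sum.inr t
      · have := (forced γ h).2.2.2
        rcases vert_eq_inr hd' with rfl | rfl
        · simpa using this
        · simpa [show (1 : ZMod 2) + 1 = 0 by decide] using this.symm
      · simp only [Function.comp, (hr d hd hd').1]
        refine h.joint _ (by rwa [← (hr d hd hd').2]) ?_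
        rwa [← (hr d hd hd').1, ← (hr (rot d) (by simpa using hd) (by simpa using hd')).2]
  · intro G _ γ' h
    let γ₀ := Function.extend f γ' 0
    have h0 : ∀ x, γ₀ (f x) = γ' x := fun x => hf.extend_apply _ _ _
    let σ := γ' (Sum.inr (s, 0))
    let τ := γ' (Sum.inr (t, 0))
    let γ : Dart C S → G := fun d =>
      if d = Sum.inl (a, i) ∨ d = Sum.inl (b, j + 1) then
        (if IsUp (Sum.inl (a, i) : Dart C S) then σ else τ + τ - σ) else
      if d = Sum.inl (a, i + 1) ∨ d = Sum.inl (b, j) then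
        (if IsUp (Sum.inl (a, i) : Dart C S) then σ + σ - τ else τ) else γ₀ d
    have g1 : ∀ x, γ (f x) = γ' x := fun x => by simp [γ, hfs, h0]
    have g2 : γ (Sum.inl (a, i)) = if IsUp (Sum.inl (a, i) : Dart C S) then σ else τ + τ - σ := by
      simp [γ]
    have g2' : γ (Sum.inl (b, j + 1)) =
        if IsUp (Sum.inl (a, i) : Dart C S) then σ else τ + τ - σ := by
      simp [γ]
    have g3 : γ (Sum.inl (a, i + 1)) =
        if IsUp (Sum.inl (a, i) : Dart C S) then σ + σ - τ else τ := by
      simp [γ, hab, show (1 : ZMod 4) ≠ 0 by decide]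
    have g3' : γ (Sum.inl (b, j)) =
        if IsUp (Sum.inl (a, i) : Dart C S) then σ + σ - τ else τ := by
      simp [γ, hab.symm, show (1 : ZMod 4) ≠ 0 by decide]
    have g4 : γ (Sum.inl (a, i + 2)) = σ := by rw [← hs0, g1]
    have g4' : γ (Sum.inl (b, j + 3)) = σ := by
      rw [← hs1, g1]
      exact h.joint (Sum.inr (s, 0)) (by simp) (by simp)
    have g5 : γ (Sum.inl (a, i + 3)) = τ := by rw [← ht0, g1]
    have g5' : γ (Sum.inl (b, j + 2)) = τ := by
      rw [← ht1, g1]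
      exact h.joint (Sum.inr (t, 0)) (by simp) (by simp)
    have hca := crossing_conditions (S := S) (γ := γ) (a := a) i
      (fun hu => by rw [g2, g3, g4, g5]; simp [hu]) (fun hu => by rw [g2, g3, g4, g5]; simp [hu])
    have hcb := crossing_conditions (S := S) (γ := γ) (a := b) j
      (fun hu => by
        have : ¬ IsUp (Sum.inl (a, i) : Dart C S) := by
          rw [hup, isUp_add_one, not_not]; exact hu
        rw [g2', g3', g4', g5']; simp [this])
      (fun hu => by
        have : IsUp (Sum.inl (a, i) : Dart C S) := by
          rw [hup, isUp_add_one]; exact hu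
        rw [g2', g3', g4', g5']; simp [this])
    refine ⟨γ, ⟨?_, ?_, ?_, ?_⟩, funext g1⟩
    · intro d
      by_cases h1 : d = Sum.inl (a, i)
      · rw [h1, ha, g2, g2']
      by_cases h2 : d = Sum.inl (a, i + 1)
      · rw [h2, hb, g3, g3']
      by_cases h3 : d = Sum.inl (b, j)
      · rw [h3, hb', g3, g3']
      by_cases h4 : d = Sum.inl (b, j + 1)
      · rw [h4, ha', g2, g2']
      obtain ⟨x, rfl⟩ := hex d h1 h2 h3 h4
      rw [← he, g1, g1, h.edge]
    · intro d hd
      by_cases hv : vert d = Sum.inl a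
      · exact (hca d hv hd).1
      by_cases hv' : vert d = Sum.inl b
      · exact (hcb d hv' hd).1
      · obtain ⟨x, rfl, hx, hx'⟩ := hex' d hv hv'
        rw [← hrr x hx hx', g1, g1, h.overpass _ ((hr x hx hx').2.2 hd)]
    · intro d hd
      by_cases hv : vert d = Sum.inl a
      · exact (hca d hv hd).2
      by_cases hv' : vert d = Sum.inl b
      · exact (hcb d hv' hd).2
      · obtain ⟨x, rfl, hx, hx'⟩ := hex' d hv hv'
        rw [← hrrr x hx hx', ← (hr x hx hx').1, g1, g1, g1,
          h.underpass _ ((hr x hx hx').2.2 hd)]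
    · intro d hd1 hd2
      have hv : ∀ c, vert d ≠ Sum.inl c := by
        intro c hv
        rcases vert_eq_inl hv 0 with rfl | rfl | rfl | rfl <;> revert hd1 hd2 <;> simp <;> decide
      obtain ⟨x, rfl, hx, hx'⟩ := hex' d (hv a) (hv b)
      rw [← (hr x hx hx').1, g1, g1]
      refine h.joint _ (by rwa [(hr x hx hx').2]) ?_
      rwa [(hr (rot x) (by simpa using hx) (by simpa using hx')).2, (hr x hx hx').1]
  · intro G _ γ₁ γ₂ h1 h2 e
    have e' : ∀ x, γ₁ (f x) = γ₂ (f x) := congrFun e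
    have ea : γ₁ (Sum.inl (a, i)) = γ₂ (Sum.inl (a, i)) := by
      rw [(forced γ₁ h1).1, (forced γ₂ h2).1]; simp only [e']
    have eb : γ₁ (Sum.inl (a, i + 1)) = γ₂ (Sum.inl (a, i + 1)) := by
      rw [(forced γ₁ h1).2.1, (forced γ₂ h2).2.1]; simp only [e']
    funext d
    by_cases k1 : d = Sum.inl (a, i)
    · rw [k1, ea]
    by_cases k2 : d = Sum.inl (a, i + 1)
    · rw [k2, eb]
    by_cases k3 : d = Sum.inl (b, j)
    · rw [k3, ← hb, h1.edge, h2.edge, eb]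
    by_cases k4 : d = Sum.inl (b, j + 1)
    · rw [k4, ← ha, h1.edge, h2.edge, ea]
    obtain ⟨x, rfl⟩ := hex d k1 k2 k3 k4
    exact e' x

open Classical in
theorem slidePerm_apply (a b c : C) (i j k : ZMod 4) (hab : a ≠ b) (hbc : b ≠ c) (hca : c ≠ a) :
    let π : Equiv.Perm (Dart C S) := slidePerm a b c i j k
    π (Sum.inl (a, i)) = Sum.inl (c, k + 3) ∧ π (Sum.inl (a, i + 1)) = Sum.inl (b, j + 2) ∧
    π (Sum.inl (a, i + 2)) = Sum.inl (c, k + 1) ∧ π (Sum.inl (a, i + 3)) = Sum.inl (b, j) ∧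
    π (Sum.inl (b, j)) = Sum.inl (a, i + 3) ∧ π (Sum.inl (b, j + 1)) = Sum.inl (c, k + 2) ∧
    π (Sum.inl (b, j + 2)) = Sum.inl (a, i + 1) ∧ π (Sum.inl (b, j + 3)) = Sum.inl (c, k) ∧
    π (Sum.inl (c, k)) = Sum.inl (b, j + 3) ∧ π (Sum.inl (c, k + 1)) = Sum.inl (a, i + 2) ∧
    π (Sum.inl (c, k + 2)) = Sum.inl (b, j + 1) ∧ π (Sum.inl (c, k + 3)) = Sum.inl (a, i) ∧
    ∀ d : Dart C S, vert d ≠ Sum.inl a → vert d ≠ Sum.inl b → vert d ≠ Sum.inl c → π d = d := by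
  have n1 : (1 : ZMod 4) ≠ 0 := by decide
  have n2 : (2 : ZMod 4) ≠ 0 := by decide
  have n3 : (3 : ZMod 4) ≠ 0 := by decide
  have n12 : (1 : ZMod 4) ≠ 2 := by decide
  have n13 : (1 : ZMod 4) ≠ 3 := by decide
  have n23 : (2 : ZMod 4) ≠ 3 := by decide
  intro π
  have hfix : ∀ d : Dart C S, vert d ≠ Sum.inl a → vert d ≠ Sum.inl b → vert d ≠ Sum.inl c →
      π d = d := by
    intro d h1 h2 h3
    have h : ∀ v l, vert d ≠ Sum.inl v → d ≠ Sum.inl (v, l) := by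
      rintro v l hv rfl; exact hv rfl
    simp only [π, slidePerm, Equiv.Perm.mul_apply]
    repeat rw [Equiv.swap_apply_of_ne_of_ne (h _ _ (by assumption)) (h _ _ (by assumption))]
  refine ⟨?_, ?_, ?_, ?_, ?_, ?_, ?_, ?_, ?_, ?_, ?_, ?_, hfix⟩
  all_goals
    simp [π, slidePerm, Equiv.swap_apply_def, hab, hab.symm, hbc, hbc.symm, hca, hca.symm,
      n1, n2, n3, n12, n13, n23, n12.symm, n13.symm, n23.symm]

end LinkDiagram

/-! ### Invariance of lifting under the third Reidemeister move -/

namespace LinkDiagram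

open Dart

variable {C S C' S' : Type} {G : Type} [AddCommGroup G]

theorem slidePerm_involutive {a b c : C} (i j k : ZMod 4) (hab : a ≠ b) (hbc : b ≠ c)
    (hca : c ≠ a) (d : Dart C S) :
    slidePerm a b c i j k (slidePerm a b c i j k d) = d := by
  obtain ⟨a0, a1, a2, a3, b0, b1, b2, b3, c0, c1, c2, c3, hfix⟩ :=
    slidePerm_apply (S := S) a b c i j k hab hbc hca
  by_cases h1 : vert d = Sum.inl a
  · rcases vert_eq_inl h1 i with rfl | rfl | rfl | rfl <;> simp only [*]
  by_cases h2 : vert d = Sum.inl b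
  · rcases vert_eq_inl h2 j with rfl | rfl | rfl | rfl <;> simp only [*]
  by_cases h3 : vert d = Sum.inl c
  · rcases vert_eq_inl h3 k with rfl | rfl | rfl | rfl <;> simp only [*]
  rw [hfix d h1 h2 h3, hfix d h1 h2 h3]

theorem slidePerm_add_two {a b c : C} (i j k : ZMod 4) (hab : a ≠ b) (hbc : b ≠ c)
    (hca : c ≠ a) :
    (slidePerm a b c (i + 2) (j + 2) (k + 2) : Equiv.Perm (Dart C S)) =
      slidePerm a b c i j k := by
  obtain ⟨a0, a1, a2, a3, b0, b1, b2, b3, c0, c1, c2, c3, hfix⟩ :=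
    slidePerm_apply (S := S) a b c i j k hab hbc hca
  obtain ⟨a0', a1', a2', a3', b0', b1', b2', b3', c0', c1', c2', c3', hfix'⟩ :=
    slidePerm_apply (S := S) a b c (i + 2) (j + 2) (k + 2) hab hbc hca
  have n1 : (2 : ZMod 4) + 1 = 3 := by decide
  have n2 : (2 : ZMod 4) + 2 = 0 := by decide
  have n3 : (2 : ZMod 4) + 3 = 1 := by decide
  simp only [add_assoc, n1, n2, n3, add_zero] at a0' a1' a2' a3' b0' b1' b2' b3' c0' c1' c2' c3'
  ext1 d
  by_cases h1 : vert d = Sum.inl a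
  · rcases vert_eq_inl h1 i with rfl | rfl | rfl | rfl <;> simp only [*]
  by_cases h2 : vert d = Sum.inl b
  · rcases vert_eq_inl h2 j with rfl | rfl | rfl | rfl <;> simp only [*]
  by_cases h3 : vert d = Sum.inl c
  · rcases vert_eq_inl h3 k with rfl | rfl | rfl | rfl <;> simp only [*]
  rw [hfix d h1 h2 h3, hfix' d h1 h2 h3]

/-- `D'` arises from `D` by a slide move at the triangle with the given corners. -/
structure SlideAt (D D' : LinkDiagram C S) (a b c : C) (i j k : ZMod 4) : Prop where
  ne₁ : a ≠ b
  ne₂ : b ≠ c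
  ne₃ : c ≠ a
  edge₁ : D.edge (Sum.inl (a, i + 1)) = Sum.inl (b, j)
  edge₂ : D.edge (Sum.inl (b, j + 1)) = Sum.inl (c, k)
  edge₃ : D.edge (Sum.inl (c, k + 1)) = Sum.inl (a, i)
  up₁ : IsUp (Sum.inl (a, i + 1) : Dart C S)
  up₂ : IsUp (Sum.inl (b, j) : Dart C S)
  conj : ∀ x, D'.edge (slidePerm a b c i j k x) = slidePerm a b c i j k (D.edge x)

/-- The ends at the corners of a triangle which lie on its sides. -/
def triangle (a b c : C) (i j k : ZMod 4) : Set (Dart C S) :=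
  {Sum.inl (a, i), Sum.inl (a, i + 1), Sum.inl (b, j),
    Sum.inl (b, j + 1), Sum.inl (c, k), Sum.inl (c, k + 1)}

/-- The permutation exchanges the ends on the sides of the triangle with the outer ends at its
corners, so the new triangle lies at the ends shifted by two, and shifting does not change the
permutation. Hence the inverse of a slide is a slide, and one direction of the invariance suffices.
-/
theorem SlideAt.symm {D D' : LinkDiagram C S} {a b c : C} {i j k : ZMod 4}
    (h : SlideAt D D' a b c i j k) : SlideAt D' D a b c (i + 2) (j + 2) (k + 2) := by
  obtain ⟨hab, hbc, hca, e1, e2, e3, u1, u2, he⟩ := h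
  obtain ⟨a0, a1, a2, a3, b0, b1, b2, b3, c0, c1, c2, c3, hfix⟩ :=
    slidePerm_apply (S := S) a b c i j k hab hbc hca
  have n1 : (2 : ZMod 4) + 1 = 3 := by decide
  refine ⟨hab, hbc, hca, ?_, ?_, ?_, ?_, ?_, fun x => ?_⟩
  · have := he (Sum.inl (b, j))
    rw [b0, ← e1, D.edge_edge, a1] at this
    rw [add_assoc, n1, this]
  · have := he (Sum.inl (c, k))
    rw [c0, ← e2, D.edge_edge, b1] at this
    rw [add_assoc, n1, this]
  · have := he (Sum.inl (a, i))
    rw [a0, ← e3, D.edge_edge, c1] at this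
    rw [add_assoc, n1, this]
  · rw [add_right_comm, isUp_add_two]; exact u1
  · rw [isUp_add_two]; exact u2
  · rw [slidePerm_add_two i j k hab hbc hca]
    have := he (slidePerm a b c i j k x)
    rw [slidePerm_involutive i j k hab hbc hca] at this
    rw [this, slidePerm_involutive i j k hab hbc hca]


open Classical in
-- The string through `a` and `b` has a single colour `o`, and passing under it is reflection in
-- `o`. This reflection preserves the crossing relation, so the relation at `c` holds for the
-- reflected colours too, whichever string is over at `c`.
theorem SlideAt.extend {D D' : LinkDiagram C S} {a b c : C} {i j k : ZMod 4}
    (hs : SlideAt D D' a b c i j k) {γ : Dart C S → G} (h : D.IsColouring γ) :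
    ∃ γ' : Dart C S → G, D'.IsColouring γ' ∧
      ∀ x, x ∉ triangle a b c i j k → γ' (slidePerm a b c i j k x) = γ x := by
  obtain ⟨hab, hbc, hca, e1, e2, e3, u1, u2, he⟩ := hs
  have m1 : (1 : ZMod 4) ≠ 0 := by decide
  have m2 : (2 : ZMod 4) ≠ 0 := by decide
  have m3 : (3 : ZMod 4) ≠ 0 := by decide
  have m12 : (2 : ZMod 4) ≠ 1 := by decide
  have m13 : (3 : ZMod 4) ≠ 1 := by decide
  unfold triangle
  obtain ⟨a0, a1, a2, a3, b0, b1, b2, b3, c0, c1, c2, c3, hfix⟩ :=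
    slidePerm_apply (S := S) a b c i j k hab hbc hca
  have hinv := slidePerm_involutive (S := S) i j k hab hbc hca
  have uai : ¬ IsUp (Sum.inl (a, i) : Dart C S) := (isUp_add_one a i).1 u1
  have e1' : D.edge (Sum.inl (b, j)) = Sum.inl (a, i + 1) := by rw [← e1, D.edge_edge]
  have e2' : D.edge (Sum.inl (c, k)) = Sum.inl (b, j + 1) := by rw [← e2, D.edge_edge]
  have e3' : D.edge (Sum.inl (a, i)) = Sum.inl (c, k + 1) := by rw [← e3, D.edge_edge]
  let o := γ (Sum.inl (a, i + 1))
  -- The colours of the two new sides on the strings through `c`: the outer ends at `c`, reflected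
  -- in `o`.
  let q := o + o - γ (Sum.inl (c, k + 2))
  let p := o + o - γ (Sum.inl (c, k + 3))
  -- `δ` is the new colouring read on the old darts; the colouring of `D'` is its composition with
  -- the permutation.
  let δ : Dart C S → G := fun d =>
    if d = Sum.inl (a, i + 1) ∨ d = Sum.inl (b, j) then o else
    if d = Sum.inl (b, j + 1) ∨ d = Sum.inl (c, k) then q else
    if d = Sum.inl (c, k + 1) ∨ d = Sum.inl (a, i) then p else γ d
  have da1 : δ (Sum.inl (a, i + 1)) = o := by simp [δ]
  have db0 : δ (Sum.inl (b, j)) = o := by simp [δ]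
  have db1 : δ (Sum.inl (b, j + 1)) = q := by simp [δ, hab.symm, m1]
  have dc0 : δ (Sum.inl (c, k)) = q := by simp [δ, hbc.symm, hca]
  have dc1 : δ (Sum.inl (c, k + 1)) = p := by simp [δ, hbc.symm, hca, m1]
  have da0 : δ (Sum.inl (a, i)) = p := by simp [δ, hab, hca.symm, m1]
  have hδ : ∀ d, d ∉ ({Sum.inl (a, i), Sum.inl (a, i + 1), Sum.inl (b, j),
        Sum.inl (b, j + 1), Sum.inl (c, k), Sum.inl (c, k + 1)} : Set (Dart C S)) →
        δ d = γ d := by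
    intro d hd
    simp only [Set.mem_insert_iff, Set.mem_singleton_iff, not_or] at hd
    simp [δ, hd]
  have da2 : δ (Sum.inl (a, i + 2)) = γ (Sum.inl (a, i + 2)) := hδ _ (by
    simp [m2, m12, hab, hca.symm])
  have da3 : δ (Sum.inl (a, i + 3)) = γ (Sum.inl (a, i + 3)) := hδ _ (by
    simp [m3, m13, hab, hca.symm])
  have db2 : δ (Sum.inl (b, j + 2)) = γ (Sum.inl (b, j + 2)) := hδ _ (by
    simp [m2, m12, hab.symm, hbc])
  have db3 : δ (Sum.inl (b, j + 3)) = γ (Sum.inl (b, j + 3)) := hδ _ (by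
    simp [m3, m13, hab.symm, hbc])
  have dc2 : δ (Sum.inl (c, k + 2)) = γ (Sum.inl (c, k + 2)) := hδ _ (by
    simp [m2, m12, hca, hbc.symm])
  have dc3 : δ (Sum.inl (c, k + 3)) = γ (Sum.inl (c, k + 3)) := hδ _ (by
    simp [m3, m13, hca, hbc.symm])
  have ga := h.cross' uai
  have gb := h.cross u2
  have g1 := h.edge (Sum.inl (a, i + 1))
  have g2 := h.edge (Sum.inl (b, j + 1))
  have g3 := h.edge (Sum.inl (c, k + 1))
  rw [e1] at g1
  rw [e2] at g2
  rw [e3] at g3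
  have hoff : ∀ d, vert d ≠ Sum.inl a → vert d ≠ Sum.inl b → vert d ≠ Sum.inl c →
      δ (slidePerm a b c i j k d) = γ d := by
    intro d h1 h2 h3
    rw [hfix d h1 h2 h3]
    apply hδ
    simp only [Set.mem_insert_iff, Set.mem_singleton_iff]
    rintro (rfl | rfl | rfl | rfl | rfl | rfl) <;> first | exact h1 rfl | exact h2 rfl | exact h3 rfl
  have hc : ∀ v, v = a ∨ v = b ∨ v = c → ∀ d : Dart C S, vert d = Sum.inl v → IsUp d →
      δ (slidePerm a b c i j k (rot (rot d))) = δ (slidePerm a b c i j k d) ∧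
      δ (slidePerm a b c i j k (rot d)) + δ (slidePerm a b c i j k (rot (rot (rot d)))) =
        δ (slidePerm a b c i j k d) + δ (slidePerm a b c i j k d) := by
    rintro v (rfl | rfl | rfl)
    · apply crossing_conditions (S := S) (γ := δ ∘ slidePerm v b c i j k) (a := v) i
      · intro hu; exact absurd hu uai
      · intro _
        simp only [Function.comp, a0, a1, a2, a3, db0, dc1, db2, dc3, p]
        refine ⟨?_, ?_⟩
        · rw [gb.1, g1]
        · rw [gb.1, g1]; simp [o]
    · apply crossing_conditions (S := S) (γ := δ ∘ slidePerm a v c i j k) (a := v) j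
      · intro _
        simp only [Function.comp, b0, b1, b2, b3, da1, da3, dc2, dc0, q]
        refine ⟨?_, ?_⟩
        · rw [ga.1]
        · rw [ga.1]; simp [o]
      · intro hu; exact absurd u2 hu
    · apply crossing_conditions (S := S) (γ := δ ∘ slidePerm a b v i j k) (a := v) k
      · intro hu
        have gc := h.cross hu
        simp only [Function.comp, c0, c1, c2, c3, db3, db1, da0, da2, p, q]
        have x1 : γ (Sum.inl (b, j + 3)) = o + o - γ (Sum.inl (b, j + 1)) := by
          rw [eq_sub_iff_add_eq, add_comm, gb.2, g1]
        have x2 : γ (Sum.inl (a, i + 2)) = o + o - γ (Sum.inl (a, i)) := by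
          rw [eq_sub_iff_add_eq, add_comm, ga.2]
        have x3 : γ (Sum.inl (v, k + 3)) =
            γ (Sum.inl (b, j + 1)) + γ (Sum.inl (b, j + 1)) - γ (Sum.inl (a, i)) := by
          rw [← g2, eq_sub_iff_add_eq, add_comm, ← gc.2, g3]
        rw [x1, x2, x3, gc.1, g2]
        refine ⟨rfl, ?_⟩
        abel
      · intro hu
        have gc := h.cross' hu
        simp only [Function.comp, c0, c1, c2, c3, db3, db1, da0, da2, p, q]
        have x1 : γ (Sum.inl (b, j + 3)) = o + o - γ (Sum.inl (b, j + 1)) := by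
          rw [eq_sub_iff_add_eq, add_comm, gb.2, g1]
        have x2 : γ (Sum.inl (a, i + 2)) = o + o - γ (Sum.inl (a, i)) := by
          rw [eq_sub_iff_add_eq, add_comm, ga.2]
        have x3 : γ (Sum.inl (v, k + 2)) =
            γ (Sum.inl (a, i)) + γ (Sum.inl (a, i)) - γ (Sum.inl (b, j + 1)) := by
          rw [← g2, eq_sub_iff_add_eq, add_comm, gc.2, g3]
        rw [x1, x2, x3, gc.1, g3]
        refine ⟨rfl, ?_⟩
        abel
  refine ⟨fun d => δ (slidePerm a b c i j k d), ⟨?_, ?_, ?_, ?_⟩, ?_⟩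
  · intro d
    have := he (slidePerm a b c i j k d)
    rw [hinv] at this
    rw [this, hinv]
    generalize slidePerm a b c i j k d = x
    by_cases h1 : x = Sum.inl (a, i)
    · rw [h1, e3', da0, dc1]
    by_cases h2 : x = Sum.inl (a, i + 1)
    · rw [h2, e1, da1, db0]
    by_cases h3 : x = Sum.inl (b, j)
    · rw [h3, e1', da1, db0]
    by_cases h4 : x = Sum.inl (b, j + 1)
    · rw [h4, e2, db1, dc0]
    by_cases h5 : x = Sum.inl (c, k)
    · rw [h5, e2', db1, dc0]
    by_cases h6 : x = Sum.inl (c, k + 1)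
    · rw [h6, e3, da0, dc1]
    rw [hδ x (by simp [h1, h2, h3, h4, h5, h6]), hδ, h.edge]
    simp only [Set.mem_insert_iff, Set.mem_singleton_iff, not_or]
    have hh : ∀ y z, D.edge y = z → ¬ x = y → ¬ D.edge x = z := fun y z h1 h2 h3 =>
      h2 (D.edge.injective (h3.trans h1.symm))
    exact ⟨hh _ _ e3 h6, hh _ _ e1' h3, hh _ _ e1 h2, hh _ _ e2' h5, hh _ _ e2 h4, hh _ _ e3' h1⟩
  · intro d hd
    by_cases h1 : vert d = Sum.inl a
    · exact (hc a (by simp) d h1 hd).1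
    by_cases h2 : vert d = Sum.inl b
    · exact (hc b (by simp) d h2 hd).1
    by_cases h3 : vert d = Sum.inl c
    · exact (hc c (by simp) d h3 hd).1
    rw [hoff d h1 h2 h3, hoff _ (by simpa) (by simpa) (by simpa), h.overpass d hd]
  · intro d hd
    by_cases h1 : vert d = Sum.inl a
    · exact (hc a (by simp) d h1 hd).2
    by_cases h2 : vert d = Sum.inl b
    · exact (hc b (by simp) d h2 hd).2
    by_cases h3 : vert d = Sum.inl c
    · exact (hc c (by simp) d h3 hd).2
    rw [hoff d h1 h2 h3, hoff _ (by simpa) (by simpa) (by simpa),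
      hoff _ (by simpa) (by simpa) (by simpa), h.underpass d hd]
  · intro d hd1 hd2
    have hv : ∀ c, vert d ≠ Sum.inl c := by
      intro c hv
      rcases vert_eq_inl hv 0 with rfl | rfl | rfl | rfl <;> revert hd1 hd2 <;> simp <;> decide
    rw [hoff d (hv a) (hv b) (hv c), hoff _ (by simp [hv]) (by simp [hv]) (by simp [hv]),
      h.joint d hd1 hd2]
  · intro x hx
    simp only [hinv, hδ x hx]

/-- The hypothesis fixes the ends that are outer ends in `D'`. The relations at `a` and `b` then
give the remaining ends there, and the sides of the new triangle carry these values to the remaining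
ends at `c`. -/
theorem SlideAt.unique {D D' : LinkDiagram C S} {a b c : C} {i j k : ZMod 4}
    (hs : SlideAt D D' a b c i j k) {γ₁ γ₂ : Dart C S → G} (h1 : D'.IsColouring γ₁)
    (h2 : D'.IsColouring γ₂) (hT : ∀ x, x ∉ triangle a b c i j k →
      γ₁ (slidePerm a b c i j k x) = γ₂ (slidePerm a b c i j k x)) : γ₁ = γ₂ := by
  obtain ⟨hab, hbc, hca, e1, e2, e3, u1, u2, he⟩ := hs
  obtain ⟨a0, a1, a2, a3, b0, b1, b2, b3, c0, c1, c2, c3, hfix⟩ :=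
    slidePerm_apply (S := S) a b c i j k hab hbc hca
  have uai : ¬ IsUp (Sum.inl (a, i) : Dart C S) := (isUp_add_one a i).1 u1
  have m2 : (2 : ZMod 4) ≠ 0 := by decide
  have m3 : (3 : ZMod 4) ≠ 0 := by decide
  have m12 : (2 : ZMod 4) ≠ 1 := by decide
  have m13 : (3 : ZMod 4) ≠ 1 := by decide
  have t2 : γ₁ (Sum.inl (c, k + 1)) = γ₂ (Sum.inl (c, k + 1)) := by
    rw [← a2]; exact hT _ (by simp [triangle, m2, m12, hab, hca.symm])
  have t3 : γ₁ (Sum.inl (b, j)) = γ₂ (Sum.inl (b, j)) := by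
    rw [← a3]; exact hT _ (by simp [triangle, m3, m13, hab, hca.symm])
  have t4 : γ₁ (Sum.inl (a, i + 1)) = γ₂ (Sum.inl (a, i + 1)) := by
    rw [← b2]; exact hT _ (by simp [triangle, m2, m12, hab.symm, hbc])
  have t5 : γ₁ (Sum.inl (c, k)) = γ₂ (Sum.inl (c, k)) := by
    rw [← b3]; exact hT _ (by simp [triangle, m3, m13, hab.symm, hbc])
  have t6 : γ₁ (Sum.inl (b, j + 1)) = γ₂ (Sum.inl (b, j + 1)) := by
    rw [← c2]; exact hT _ (by simp [triangle, m2, m12, hca, hbc.symm])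
  have t7 : γ₁ (Sum.inl (a, i)) = γ₂ (Sum.inl (a, i)) := by
    rw [← c3]; exact hT _ (by simp [triangle, m3, m13, hca, hbc.symm])
  have A1 := h1.cross' uai
  have A2 := h2.cross' uai
  have B1 := h1.cross u2
  have B2 := h2.cross u2
  have s1 : γ₁ (Sum.inl (a, i + 3)) = γ₂ (Sum.inl (a, i + 3)) := by rw [A1.1, A2.1, t4]
  have s2 : γ₁ (Sum.inl (a, i + 2)) = γ₂ (Sum.inl (a, i + 2)) := by
    have := A1.2; rw [t4, ← A2.2, t7] at this; exact add_left_cancel this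
  have s3 : γ₁ (Sum.inl (b, j + 2)) = γ₂ (Sum.inl (b, j + 2)) := by rw [B1.1, B2.1, t3]
  have s4 : γ₁ (Sum.inl (b, j + 3)) = γ₂ (Sum.inl (b, j + 3)) := by
    have := B1.2; rw [t3, ← B2.2, t6] at this; exact add_left_cancel this
  have s5 : γ₁ (Sum.inl (c, k + 2)) = γ₂ (Sum.inl (c, k + 2)) := by
    have := he (Sum.inl (c, k)); rw [c0, ← e2, D.edge_edge, b1] at this
    rw [← this, h1.edge, h2.edge, s4]
  have s6 : γ₁ (Sum.inl (c, k + 3)) = γ₂ (Sum.inl (c, k + 3)) := by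
    have := he (Sum.inl (c, k + 1)); rw [c1, e3, a0] at this
    rw [← this, h1.edge, h2.edge, s2]
  funext d
  by_cases g1 : vert d = Sum.inl a
  · rcases vert_eq_inl g1 i with rfl | rfl | rfl | rfl <;> assumption
  by_cases g2 : vert d = Sum.inl b
  · rcases vert_eq_inl g2 j with rfl | rfl | rfl | rfl <;> assumption
  by_cases g3 : vert d = Sum.inl c
  · rcases vert_eq_inl g3 k with rfl | rfl | rfl | rfl <;> assumption
  have := hT d ?_
  · rwa [hfix d g1 g2 g3] at this
  · simp only [triangle, Set.mem_insert_iff, Set.mem_singleton_iff]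
    rintro (rfl | rfl | rfl | rfl | rfl | rfl) <;>
      first | exact g1 rfl | exact g2 rfl | exact g3 rfl

theorem SlideAt.liftable {n : ℕ} {D D' : LinkDiagram C S} {a b c : C} {i j k : ZMod 4}
    (h : SlideAt D D' a b c i j k) (hD : Liftable n D) : Liftable n D' := by
  refine hD.transfer (fun γ γ' => ∀ x, x ∉ triangle a b c i j k → γ' (slidePerm a b c i j k x) = γ x)
    (fun γ γ' => ∀ x, x ∉ triangle a b c i j k → γ' (slidePerm a b c i j k x) = γ x)
    ?_ (fun γ hγ => h.extend hγ) ?_ ?_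
  · intro γ' hγ'
    obtain ⟨γ, hγ, hR⟩ := h.symm.extend hγ'
    obtain ⟨hab, hbc, hca, -⟩ := h
    obtain ⟨a0, a1, a2, a3, b0, b1, b2, b3, c0, c1, c2, c3, hfix⟩ :=
      slidePerm_apply (S := S) a b c i j k hab hbc hca
    have hinv := slidePerm_involutive (S := S) i j k hab hbc hca
    have hs := slidePerm_add_two (S := S) i j k hab hbc hca
    refine ⟨γ, hγ, fun x hx => ?_⟩
    have := hR (slidePerm a b c i j k x) ?_
    · rw [hs, hinv] at this
      exact this.symm
    · intro hx'
      apply hx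
      have n1 : (2 : ZMod 4) + 1 = 3 := by decide
      simp only [triangle, Set.mem_insert_iff, Set.mem_singleton_iff, add_assoc, n1] at hx'
      have : ∀ y z : Dart C S, slidePerm a b c i j k y = z → slidePerm a b c i j k x = y →
          x = z := fun y z h1 h2 => by
        rw [← h1, ← h2]; exact (hinv x).symm
      rcases hx' with hx' | hx' | hx' | hx' | hx' | hx'
      · rw [this _ _ a2 hx']; simp [triangle]
      · rw [this _ _ a3 hx']; simp [triangle]
      · rw [this _ _ b2 hx']; simp [triangle]
      · rw [this _ _ b3 hx']; simp [triangle]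
      · rw [this _ _ c2 hx']; simp [triangle]
      · rw [this _ _ c3 hx']; simp [triangle]
  · intro γ γ' h x hx
    simp [h x hx]
  · intro γ γ₁ γ₂ _ h1 h2 r1 r2
    exact h.unique h1 h2 fun x hx => (r1 x hx).trans (r2 x hx).symm

theorem Slide.liftable_iff {n : ℕ} {D D' : LinkDiagram C S} (h : Slide D D') :
    Liftable n D ↔ Liftable n D' := by
  obtain ⟨a, b, c, i, j, k, hab, hbc, hca, e1, e2, e3, u1, u2, he⟩ := h
  have h : SlideAt D D' a b c i j k := ⟨hab, hbc, hca, e1, e2, e3, u1, u2, he⟩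
  exact ⟨h.liftable, h.symm.liftable⟩

theorem Equivalent.liftable_iff {k : ℕ} {C S C' S' : Type} {D : LinkDiagram C S}
    {D' : LinkDiagram C' S'} (h : Equivalent D D') : Liftable k D ↔ Liftable k D' := by
  induction h with
  | iso h => exact h.liftable_iff
  | unsubdivide h => exact h.liftable_iff
  | untwist h => exact h.liftable_iff
  | unpoke h => exact h.liftable_iff
  | slide h => exact h.liftable_iff
  | symm _ ih => exact ih.symm
  | trans _ _ ih1 ih2 => exact ih1.trans ih2

theorem IsUnlink.liftable {D : LinkDiagram C S} (h : D.IsUnlink) (k : ℕ) : Liftable k D := by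
  obtain ⟨C', S', D', hC, h⟩ := h
  exact h.liftable_iff.2 (Liftable.of_isEmpty k D')

end LinkDiagram

/-! ### Closed twist chains have colourings that do not lift -/

namespace LinkDiagram

open Dart

variable {C S C' S' : Type}

/-- A closed chain of `k` crossings in which consecutive crossings are the corners of a face with
two sides, and an edge joins the last crossing to the first one. -/
structure TwistChain (D : LinkDiagram C S) (k : ℕ) (v : ℕ → C × ZMod 4) : Prop where
  two_le : 2 ≤ k
  inj : ∀ s t, s < k → t < k → (v s).1 = (v t).1 → s = t
  lower : ∀ t, t + 1 < k →
    D.edge (Sum.inl ((v t).1, (v t).2)) = Sum.inl ((v (t + 1)).1, (v (t + 1)).2 + 3)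
  upper : ∀ t, t + 1 < k →
    D.edge (Sum.inl ((v t).1, (v t).2 + 1)) = Sum.inl ((v (t + 1)).1, (v (t + 1)).2 + 2)
  closing : D.edge (Sum.inl ((v (k - 1)).1, (v (k - 1)).2)) = Sum.inl ((v 0).1, (v 0).2 + 3) ∨
    D.edge (Sum.inl ((v (k - 1)).1, (v (k - 1)).2 + 1)) = Sum.inl ((v 0).1, (v 0).2 + 2)

open Classical in
/-- A colouring which is an arithmetic progression along a chain and constant elsewhere. -/
noncomputable def chainColouring (k : ℕ) (v : ℕ → C × ZMod 4) (ε σ : ZMod k) : Dart C S → ZMod k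
  | Sum.inl (c, i) =>
    if h : ∃ t, t < k ∧ (v t).1 = c then
      if i = (v h.choose).2 then h.choose + 1 + ε else
      if i = (v h.choose).2 + 1 then h.choose + 1 else
      if i = (v h.choose).2 + 2 then h.choose else h.choose + ε
    else σ
  | Sum.inr _ => σ

section

variable {D : LinkDiagram C S} {k : ℕ} {v : ℕ → C × ZMod 4}

theorem TwistChain.chainColouring_apply (h : TwistChain D k v) (ε σ : ZMod k) {t : ℕ} (ht : t < k) :
    (chainColouring k v ε σ : Dart C S → ZMod k) (Sum.inl ((v t).1, (v t).2)) = t + 1 + ε ∧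
    (chainColouring k v ε σ : Dart C S → ZMod k) (Sum.inl ((v t).1, (v t).2 + 1)) = t + 1 ∧
    (chainColouring k v ε σ : Dart C S → ZMod k) (Sum.inl ((v t).1, (v t).2 + 2)) = t ∧
    (chainColouring k v ε σ : Dart C S → ZMod k) (Sum.inl ((v t).1, (v t).2 + 3)) = t + ε := by
  have hex : ∃ s, s < k ∧ (v s).1 = (v t).1 := ⟨t, ht, rfl⟩
  have hc : hex.choose = t := h.inj _ _ hex.choose_spec.1 ht hex.choose_spec.2
  have m1 : (1 : ZMod 4) ≠ 0 := by decide
  have m2 : (2 : ZMod 4) ≠ 0 := by decide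
  have m3 : (3 : ZMod 4) ≠ 0 := by decide
  have m12 : (2 : ZMod 4) ≠ 1 := by decide
  have m13 : (3 : ZMod 4) ≠ 1 := by decide
  have m23 : (3 : ZMod 4) ≠ 2 := by decide
  simp only [chainColouring, dif_pos hex, hc]
  simp [m1, m2, m3, m12, m13, m23]

theorem chainColouring_eq (ε σ : ZMod k) {d : Dart C S}
    (hd : ∀ t, t < k → vert d ≠ Sum.inl (v t).1) : chainColouring k v ε σ d = σ := by
  rcases d with ⟨c, i⟩ | x
  · have : ¬ ∃ t, t < k ∧ (v t).1 = c := by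
      rintro ⟨t, ht, rfl⟩
      exact hd t ht rfl
    simp [chainColouring, this]
  · rfl

/-- `M` collects the starting darts of the edges of the chain, including the closing edges that are
present. Along these the progression matches, at the closing edges because `k` vanishes modulo `k`.
All darts on other edges have the colour `σ`: for the free ends of the chain this is the choice of
`σ`. -/
theorem TwistChain.isColouring_edge (h : TwistChain D k v) (ε σ : ZMod k)
    (hσ : D.edge (Sum.inl ((v (k - 1)).1, (v (k - 1)).2)) = Sum.inl ((v 0).1, (v 0).2 + 3) ∧ σ = 0 ∨
      D.edge (Sum.inl ((v (k - 1)).1, (v (k - 1)).2 + 1)) = Sum.inl ((v 0).1, (v 0).2 + 2) ∧ σ = ε)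
    (d : Dart C S) : chainColouring k v ε σ (D.edge d) = chainColouring k v ε σ d := by
  have hk := h.two_le
  let M : Dart C S → Prop := fun d =>
    (∃ t, t + 1 < k ∧ (d = Sum.inl ((v t).1, (v t).2) ∨ d = Sum.inl ((v t).1, (v t).2 + 1))) ∨
    (d = Sum.inl ((v (k - 1)).1, (v (k - 1)).2) ∧ D.edge d = Sum.inl ((v 0).1, (v 0).2 + 3)) ∨
    (d = Sum.inl ((v (k - 1)).1, (v (k - 1)).2 + 1) ∧ D.edge d = Sum.inl ((v 0).1, (v 0).2 + 2))
  have hM : ∀ d, M d → chainColouring k v ε σ (D.edge d) = chainColouring k v ε σ d := by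
    have hk1 : ((k - 1 : ℕ) : ZMod k) + 1 = 0 := by
      rw [← Nat.cast_add_one, Nat.sub_add_cancel (by omega), ZMod.natCast_self]
    rintro d (⟨t, ht, rfl | rfl⟩ | ⟨rfl, hd⟩ | ⟨rfl, hd⟩)
    · rw [h.lower t ht, (h.chainColouring_apply ε σ ht).2.2.2,
        (h.chainColouring_apply ε σ (by omega)).1]
      push_cast; ring
    · rw [h.upper t ht, (h.chainColouring_apply ε σ ht).2.2.1,
        (h.chainColouring_apply ε σ (by omega)).2.1]
      push_cast; ring
    · rw [hd, (h.chainColouring_apply ε σ (by omega)).2.2.2,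
        (h.chainColouring_apply ε σ (by omega)).1, hk1]
      simp
    · rw [hd, (h.chainColouring_apply ε σ (by omega)).2.2.1,
        (h.chainColouring_apply ε σ (by omega)).2.1, hk1]
      simp
  have hσ' : ∀ d, ¬ M d → ¬ M (D.edge d) → chainColouring k v ε σ d = σ := by
    intro d h1 h2
    by_cases hd : ∃ t, t < k ∧ vert d = Sum.inl (v t).1
    · obtain ⟨t, ht, hd⟩ := hd
      have hk1 : ((k - 1 : ℕ) : ZMod k) + 1 = 0 := by
        rw [← Nat.cast_add_one, Nat.sub_add_cancel (by omega), ZMod.natCast_self]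
      have hlow : t + 1 < k ∨ t = k - 1 := by omega
      have hhigh : t = 0 ∨ ∃ s, t = s + 1 := by
        cases t
        · exact Or.inl rfl
        · exact Or.inr ⟨_, rfl⟩
      rcases vert_eq_inl hd (v t).2 with rfl | rfl | rfl | rfl
      · rcases hlow with hl | rfl
        · exact absurd (Or.inl ⟨t, hl, Or.inl rfl⟩) h1
        rcases hσ with ⟨hc, hs⟩ | ⟨hc, hs⟩
        · exact absurd (Or.inr (Or.inl ⟨rfl, hc⟩)) h1
        · rw [(h.chainColouring_apply ε σ ht).1, hk1, hs]; simp
      · rcases hlow with hl | rfl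
        · exact absurd (Or.inl ⟨t, hl, Or.inr rfl⟩) h1
        rcases hσ with ⟨hc, hs⟩ | ⟨hc, hs⟩
        · rw [(h.chainColouring_apply ε σ ht).2.1, hk1, hs]
        · exact absurd (Or.inr (Or.inr ⟨rfl, hc⟩)) h1
      · rcases hhigh with rfl | ⟨s, rfl⟩
        · rcases hσ with ⟨hc, hs⟩ | ⟨hc, hs⟩
          · rw [(h.chainColouring_apply ε σ ht).2.2.1, hs]; simp
          · exact absurd (Or.inr (Or.inr ⟨by rw [← hc, D.edge_edge], by rw [D.edge_edge]⟩)) h2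
        · exact absurd (Or.inl ⟨s, ht, Or.inr (by rw [← h.upper s ht, D.edge_edge])⟩) h2
      · rcases hhigh with rfl | ⟨s, rfl⟩
        · rcases hσ with ⟨hc, hs⟩ | ⟨hc, hs⟩
          · exact absurd (Or.inr (Or.inl ⟨by rw [← hc, D.edge_edge], by rw [D.edge_edge]⟩)) h2
          · rw [(h.chainColouring_apply ε σ ht).2.2.2, hs]; simp
        · exact absurd (Or.inl ⟨s, ht, Or.inl (by rw [← h.lower s ht, D.edge_edge])⟩) h2
    · push Not at hd
      exact chainColouring_eq ε σ hd
  by_cases h1 : M d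
  · exact hM d h1
  by_cases h2 : M (D.edge d)
  · rw [← hM _ h2, D.edge_edge]
  · rw [hσ' d h1 h2, hσ' _ h2 (by rwa [D.edge_edge])]

open Classical in
-- Over the integers, the colours on the lower and on the upper edges are progressions with the same
-- difference, which up to sign is the difference of the initial colours `u` and `l`. The closing
-- edge returns to the initial colour after `k` steps, so `u = l`; but modulo `k` they differ by
-- `ε`, which is not zero.
theorem TwistChain.not_liftable (h : TwistChain D k v)
    (hup : ∀ t, t < k → (IsUp (Sum.inl (v t) : Dart C S) ↔ IsUp (Sum.inl (v 0) : Dart C S))) :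
    ¬ Liftable k D := by
  have hk := h.two_le
  -- The values `t + 1 + ε`, `t + 1`, `t`, `t + ε` at the four ends satisfy the crossing relation
  -- for `ε = -1` if the first of them is over, and for `ε = 1` if it is under.
  let ε : ZMod k := if IsUp (Sum.inl (v 0) : Dart C S) then -1 else 1
  obtain ⟨σ, hσ⟩ : ∃ σ : ZMod k,
      D.edge (Sum.inl ((v (k - 1)).1, (v (k - 1)).2)) = Sum.inl ((v 0).1, (v 0).2 + 3) ∧ σ = 0 ∨
      D.edge (Sum.inl ((v (k - 1)).1, (v (k - 1)).2 + 1)) = Sum.inl ((v 0).1, (v 0).2 + 2) ∧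
        σ = ε := by
    -- If the lower edge closes the chain, the free ends are the upper ones, of colour `0`; if the
    -- upper edge does, they are the lower ones, of colour `ε`.
    rcases h.closing with hc | hc
    · exact ⟨0, Or.inl ⟨hc, rfl⟩⟩
    · exact ⟨ε, Or.inr ⟨hc, rfl⟩⟩
  have hcross : ∀ t, t < k → ∀ d : Dart C S, vert d = Sum.inl (v t).1 → IsUp d →
      chainColouring k v ε σ (rot (rot d)) = chainColouring k v ε σ d ∧
      chainColouring k v ε σ (rot d) + chainColouring k v ε σ (rot (rot (rot d))) =
        chainColouring k v ε σ d + chainColouring k v ε σ d := by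
    intro t ht
    obtain ⟨g0, g1, g2, g3⟩ := h.chainColouring_apply (S := S) ε σ ht
    apply crossing_conditions (v t).2
    · intro hu
      have : ε = -1 := by simp only [ε, if_pos ((hup t ht).1 hu)]
      rw [g0, g1, g2, g3, this]
      constructor <;> ring
    · intro hu
      have : ε = 1 := by simp only [ε, if_neg (fun h => hu ((hup t ht).2 h))]
      rw [g0, g1, g2, g3, this]
      constructor <;> ring
  have hcol : D.IsColouring (chainColouring k v ε σ) := by
    refine ⟨h.isColouring_edge ε σ hσ, ?_, ?_, ?_⟩
    · intro d hd
      by_cases hv : ∃ t, t < k ∧ vert d = Sum.inl (v t).1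
      · obtain ⟨t, ht, hv⟩ := hv
        exact (hcross t ht d hv hd).1
      · push Not at hv
        rw [chainColouring_eq ε σ hv, chainColouring_eq ε σ (by simpa using hv)]
    · intro d hd
      by_cases hv : ∃ t, t < k ∧ vert d = Sum.inl (v t).1
      · obtain ⟨t, ht, hv⟩ := hv
        exact (hcross t ht d hv hd).2
      · push Not at hv
        rw [chainColouring_eq ε σ hv, chainColouring_eq ε σ (by simpa using hv),
          chainColouring_eq ε σ (by simpa using hv)]
    · intro d hd1 hd2
      have hv : ∀ t, t < k → vert d ≠ Sum.inl (v t).1 := by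
        intro t _ hv
        rcases vert_eq_inl hv 0 with rfl | rfl | rfl | rfl <;> revert hd1 hd2 <;> simp <;> decide
      rw [chainColouring_eq ε σ hv, chainColouring_eq ε σ (by simpa using hv)]
  intro hl
  obtain ⟨γ, hγ, hγ'⟩ := hl _ hcol
  have p0 : 0 < k := by omega
  have c2 := hγ' (Sum.inl ((v 0).1, (v 0).2 + 2))
  have c3 := hγ' (Sum.inl ((v 0).1, (v 0).2 + 3))
  rw [(h.chainColouring_apply ε σ p0).2.2.1] at c2
  rw [(h.chainColouring_apply ε σ p0).2.2.2] at c3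
  set u := γ (Sum.inl ((v 0).1, (v 0).2 + 2)) with hu
  set l := γ (Sum.inl ((v 0).1, (v 0).2 + 3)) with hl
  have main : l = u := by
    by_cases hU : IsUp (Sum.inl (v 0) : Dart C S)
    · have step : ∀ t, t < k → γ (Sum.inl ((v t).1, (v t).2)) = l + (t + 1) * (u - l) ∧
          γ (Sum.inl ((v t).1, (v t).2 + 1)) = u + (t + 1) * (u - l) := by
        intro t
        induction t with
        | zero =>
          intro ht
          have := hγ.cross (a := (v 0).1) (i := (v 0).2) hU
          rw [← hu, ← hl] at this
          refine ⟨?_, ?_⟩ <;> push_cast <;> linarith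
        | succ t ih =>
          intro ht
          obtain ⟨i1, i2⟩ := ih (by omega)
          have := hγ.cross (a := (v (t + 1)).1) (i := (v (t + 1)).2) ((hup _ ht).2 hU)
          rw [← h.lower t ht, ← h.upper t ht, hγ.edge, hγ.edge, i1, i2] at this
          refine ⟨?_, ?_⟩ <;> push_cast <;> linarith
      obtain ⟨s1, s2⟩ := step (k - 1) (by omega)
      have hk1 : (((k - 1 : ℕ) : ℤ) + 1) = k := by omega
      rw [hk1] at s1 s2
      have : (k : ℤ) * (u - l) = 0 := by
        rcases h.closing with hc | hc
        · have := hγ.edge (Sum.inl ((v (k - 1)).1, (v (k - 1)).2))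
          rw [hc, s1] at this; linarith
        · have := hγ.edge (Sum.inl ((v (k - 1)).1, (v (k - 1)).2 + 1))
          rw [hc, s2] at this; linarith
      rcases mul_eq_zero.1 this with h0 | h0
      · omega
      · omega
    · have step : ∀ t, t < k → γ (Sum.inl ((v t).1, (v t).2)) = l + (t + 1) * (l - u) ∧
          γ (Sum.inl ((v t).1, (v t).2 + 1)) = u + (t + 1) * (l - u) := by
        intro t
        induction t with
        | zero =>
          intro ht
          have := hγ.cross' (a := (v 0).1) (i := (v 0).2) hU
          rw [← hu, ← hl] at this
          refine ⟨?_, ?_⟩ <;> push_cast <;> linarith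
        | succ t ih =>
          intro ht
          obtain ⟨i1, i2⟩ := ih (by omega)
          have := hγ.cross' (a := (v (t + 1)).1) (i := (v (t + 1)).2)
            (fun h => hU ((hup _ ht).1 h))
          rw [← h.lower t ht, ← h.upper t ht, hγ.edge, hγ.edge, i1, i2] at this
          refine ⟨?_, ?_⟩ <;> push_cast <;> linarith
      obtain ⟨s1, s2⟩ := step (k - 1) (by omega)
      have hk1 : (((k - 1 : ℕ) : ℤ) + 1) = k := by omega
      rw [hk1] at s1 s2
      have : (k : ℤ) * (l - u) = 0 := by
        rcases h.closing with hc | hc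
        · have := hγ.edge (Sum.inl ((v (k - 1)).1, (v (k - 1)).2))
          rw [hc, s1] at this; linarith
        · have := hγ.edge (Sum.inl ((v (k - 1)).1, (v (k - 1)).2 + 1))
          rw [hc, s2] at this; linarith
      rcases mul_eq_zero.1 this with h0 | h0
      · omega
      · omega
  rw [main, c2] at c3
  have : Fact (1 < k) := ⟨by omega⟩
  simp only [ε] at c3
  split_ifs at c3 <;> simp at c3

end

end LinkDiagram

/-! ### Planarity in terms of flows modulo two -/

open Module

/-- Turns the numbers of vertices, edges, faces and components in Euler's formula into dimensions.
-/
theorem finrank_eq_natCard {X Y : Type} [Finite X] (q : X → Y) (hq : Function.Surjective q)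
    (M : Submodule (ZMod 2) (X → ZMod 2)) (hM : ∀ f, f ∈ M ↔ ∃ g : Y → ZMod 2, f = g ∘ q) :
    finrank (ZMod 2) M = Nat.card Y := by
  have : Finite Y := Finite.of_surjective q hq
  have := Fintype.ofFinite Y
  have hr : M = LinearMap.range (LinearMap.funLeft (ZMod 2) (ZMod 2) q) := by
    ext f
    rw [hM, LinearMap.mem_range]
    constructor
    · rintro ⟨g, rfl⟩; exact ⟨g, rfl⟩
    · rintro ⟨g, rfl⟩; exact ⟨g, rfl⟩
  rw [hr, LinearMap.finrank_range_of_inj (LinearMap.funLeft_injective_of_surjective _ _ q hq)]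
  simp

/-- Functions which are invariant under a permutation. -/
def invariants {X : Type} (σ : Equiv.Perm X) : Submodule (ZMod 2) (X → ZMod 2) where
  carrier := {f | ∀ x, f (σ x) = f x}
  add_mem' := fun h1 h2 x => by simp [h1 x, h2 x]
  zero_mem' := fun x => rfl
  smul_mem' := fun c f h x => by simp [h x]

theorem invariants_sameCycle {X : Type} {σ : Equiv.Perm X} {f : X → ZMod 2}
    (hf : f ∈ invariants σ) {x y : X} (h : σ.SameCycle x y) : f y = f x := by
  obtain ⟨n, rfl⟩ := h
  induction n with
  | zero => rfl
  | succ n ih => rw [add_comm, zpow_add, zpow_one, Equiv.Perm.mul_apply, hf, ih]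
  | pred n ih =>
    rw [← ih, ← hf ((σ ^ (-(n : ℤ) - 1)) x), ← Equiv.Perm.mul_apply, ← zpow_one_add]
    congr 3; ring

theorem finrank_invariants {X : Type} [Finite X] (σ : Equiv.Perm X) :
    finrank (ZMod 2) (invariants σ) =
      Nat.card (Quotient (Equiv.Perm.SameCycle.setoid σ)) := by
  refine finrank_eq_natCard (fun x => Quotient.mk (Equiv.Perm.SameCycle.setoid σ) x)
    Quotient.mk_surjective _ fun f => ⟨fun hf => ?_, ?_⟩
  · exact ⟨Quotient.lift f fun x y h => (invariants_sameCycle hf h).symm, rfl⟩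
  · rintro ⟨g, rfl⟩ x
    refine congrArg g (Quotient.sound ?_)
    exact ((Equiv.Perm.sameCycle_apply_left).2 (Equiv.Perm.SameCycle.refl σ x))

section

variable {X : Type} [Fintype X]

/-- The pairing of functions on a finite set. -/
def pairing : (X → ZMod 2) →ₗ[ZMod 2] (X → ZMod 2) →ₗ[ZMod 2] ZMod 2 :=
  LinearMap.mk₂ (ZMod 2) (fun f g => ∑ x, f x * g x)
    (fun f g h => by simp [add_mul, Finset.sum_add_distrib])
    (fun c f g => by simp [Finset.mul_sum, mul_assoc])
    (fun f g h => by simp [mul_add, Finset.sum_add_distrib])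
    (fun c f g => by simp [Finset.mul_sum, mul_left_comm])

theorem pairing_apply (f g : X → ZMod 2) : pairing f g = ∑ x, f x * g x := rfl

theorem add_self_zmod (a : ZMod 2) : a + a = 0 := by revert a; decide

/-- The invariant functions orthogonal to another space of functions. -/
def orthogonalInvariants (N : Submodule (ZMod 2) (X → ZMod 2)) (ε : Equiv.Perm X) :
    Submodule (ZMod 2) (X → ZMod 2) where
  carrier := {h | h ∈ invariants ε ∧ ∀ g ∈ N, pairing g h = 0}
  add_mem' := fun h1 h2 => ⟨Submodule.add_mem _ h1.1 h2.1, fun g hg => by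
    rw [map_add, h1.2 g hg, h2.2 g hg, add_zero]⟩
  zero_mem' := ⟨Submodule.zero_mem _, fun g _ => map_zero _⟩
  smul_mem' := fun c f h => ⟨Submodule.smul_mem _ _ h.1, fun g hg => by
    rw [map_smul, h.2 g hg, smul_zero]⟩

open Classical in
-- The invariant functions of an involution without fixed points form their own orthogonal
-- complement: test functions are the indicators of two-element orbits, and conversely the terms of
-- the sum cancel in pairs.
theorem pairing_eq_zero (ε : Equiv.Perm X) (h1 : ∀ x, ε (ε x) = x) (h2 : ∀ x, ε x ≠ x)
    (g : X → ZMod 2) : (∀ h ∈ invariants ε, pairing g h = 0) ↔ g ∈ invariants ε := by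
  constructor
  · intro h x
    have := h (fun y => if y = x ∨ y = ε x then 1 else 0) (fun y => by
      have e1 : ε y = x ↔ y = ε x := by
        constructor
        · rintro rfl; rw [h1]
        · rintro rfl; rw [h1]
      simp only [e1, ε.injective.eq_iff, or_comm])
    rw [pairing_apply] at this
    have e : ∀ y, g y * (if y = x ∨ y = ε x then (1 : ZMod 2) else 0) =
        (if y = x then g y else 0) + (if y = ε x then g y else 0) := by
      intro y
      have := h2 x
      by_cases h1 : y = x
      · subst h1; simp [this.symm]
      · simp [h1]
    simp only [e, Finset.sum_add_distrib, Finset.sum_ite_eq', Finset.mem_univ, if_true] at this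
    rwa [CharTwo.add_eq_zero, eq_comm] at this
  · intro hg h hh
    rw [pairing_apply]
    refine Finset.sum_involution (fun x _ => ε x) (fun x _ => ?_) (fun x _ _ => h2 x)
      (fun x _ => Finset.mem_univ _) (fun x _ => h1 x)
    rw [hg x, hh x, add_self_zmod]

/-- Rank and nullity of the pairing of `N` with the invariant functions, whose kernel is given by
`pairing_eq_zero`. If `N` consists of the functions on the vertices, this is the dimension `E - V +
K` of the cycle space. -/
theorem finrank_orthogonalInvariants (N : Submodule (ZMod 2) (X → ZMod 2)) (ε : Equiv.Perm X)
    (h1 : ∀ x, ε (ε x) = x) (h2 : ∀ x, ε x ≠ x) :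
    finrank (ZMod 2) (orthogonalInvariants N ε) + finrank (ZMod 2) N =
      finrank (ZMod 2) (invariants ε) +
        finrank (ZMod 2) (N ⊓ invariants ε : Submodule (ZMod 2) (X → ZMod 2)) := by
  let A := invariants ε
  let Φ : N →ₗ[ZMod 2] Dual (ZMod 2) A :=
    (A.subtype.dualMap ∘ₗ pairing) ∘ₗ N.subtype
  have hΦ : ∀ (g : N) (a : A), Φ g a = pairing g.1 a.1 := fun _ _ => rfl
  have hker : finrank (ZMod 2) (LinearMap.ker Φ) =
      finrank (ZMod 2) (N ⊓ A : Submodule (ZMod 2) (X → ZMod 2)) := by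
    have : (LinearMap.ker Φ).map N.subtype = N ⊓ A := by
      ext g
      simp only [Submodule.mem_map, LinearMap.mem_ker, Submodule.mem_inf, Submodule.subtype_apply]
      constructor
      · rintro ⟨g, hg, rfl⟩
        refine ⟨g.2, (pairing_eq_zero ε h1 h2 g.1).1 fun h hh => ?_⟩
        exact LinearMap.congr_fun hg (⟨h, hh⟩ : A)
      · rintro ⟨hg, hg'⟩
        refine ⟨⟨g, hg⟩, LinearMap.ext fun h => ?_, rfl⟩
        exact (pairing_eq_zero ε h1 h2 g).2 hg' h.1 h.2
    rw [← this]
    exact (LinearEquiv.finrank_eq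
      (Submodule.equivMapOfInjective _ N.injective_subtype (LinearMap.ker Φ)))
  have hZ : finrank (ZMod 2) (orthogonalInvariants N ε) =
      finrank (ZMod 2) (LinearMap.range Φ).dualCoannihilator := by
    have : (LinearMap.range Φ).dualCoannihilator.map A.subtype = orthogonalInvariants N ε := by
      ext h
      simp only [Submodule.mem_map, Submodule.mem_dualCoannihilator, Submodule.subtype_apply,
        LinearMap.mem_range]
      constructor
      · rintro ⟨h, hh, rfl⟩
        exact ⟨h.2, fun g hg => hh _ ⟨⟨g, hg⟩, rfl⟩⟩
      · rintro ⟨hh, hh'⟩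
        refine ⟨⟨h, hh⟩, ?_, rfl⟩
        rintro _ ⟨g, rfl⟩
        exact hh' g.1 g.2
    rw [← this]
    exact (LinearEquiv.finrank_eq
      (Submodule.equivMapOfInjective _ A.injective_subtype _)).symm
  have hrank := LinearMap.finrank_range_add_finrank_ker Φ
  have hco := Subspace.finrank_add_finrank_dualCoannihilator_eq (LinearMap.range Φ)
  rw [hZ]
  rw [hker] at hrank
  change _ = finrank (ZMod 2) A + finrank (ZMod 2) (N ⊓ A : Submodule (ZMod 2) (X → ZMod 2))
  omega

/-- The coboundary of a function on corners. -/
def coboundary (ρ : Equiv.Perm X) : (X → ZMod 2) →ₗ[ZMod 2] (X → ZMod 2) where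
  toFun φ x := φ x + φ (ρ x)
  map_add' φ ψ := by ext x; simp; ring
  map_smul' c φ := by ext x; simp [mul_add]

/-- The coboundary maps functions on the faces to flows, and its kernel consists of the functions
that are constant on components. So its image has dimension `F - K`, the flows have dimension `E - V
+ K`, and Euler's formula says that the coboundary is onto. -/
theorem euler_formula_iff (ρ ε : Equiv.Perm X) (h1 : ∀ x, ε (ε x) = x) (h2 : ∀ x, ε x ≠ x) :
    finrank (ZMod 2) (invariants ρ) + finrank (ZMod 2) (invariants (ε.trans ρ)) =
      finrank (ZMod 2) (invariants ε) + 2 *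
        finrank (ZMod 2) (invariants ρ ⊓ invariants ε : Submodule (ZMod 2) (X → ZMod 2)) ↔
    ∀ h ∈ orthogonalInvariants (invariants ρ) ε,
      ∃ φ ∈ invariants (ε.trans ρ), coboundary ρ φ = h := by
  let P := invariants (ε.trans ρ)
  let Ψ : P →ₗ[ZMod 2] (X → ZMod 2) := coboundary ρ ∘ₗ P.subtype
  have hP : ∀ φ ∈ P, ∀ x, φ (ρ x) = φ (ε x) := by
    intro φ hφ x
    have := hφ (ε x)
    simpa [h1] using this
  have hle : LinearMap.range Ψ ≤ orthogonalInvariants (invariants ρ) ε := by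
    rintro _ ⟨⟨φ, hφ⟩, rfl⟩
    refine ⟨fun x => ?_, fun g hg => ?_⟩
    · change φ (ε x) + φ (ρ (ε x)) = φ x + φ (ρ x)
      rw [hP φ hφ, hP φ hφ, h1, add_comm]
    · change ∑ x, g x * (φ x + φ (ρ x)) = 0
      simp only [mul_add, Finset.sum_add_distrib]
      rw [← Equiv.sum_comp ρ (fun x => g x * φ x)]
      simp only [hg _, add_self_zmod]
  have hker : finrank (ZMod 2) (LinearMap.ker Ψ) =
      finrank (ZMod 2) (invariants ρ ⊓ invariants ε : Submodule (ZMod 2) (X → ZMod 2)) := by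
    have : (LinearMap.ker Ψ).map P.subtype = invariants ρ ⊓ invariants ε := by
      ext φ
      simp only [Submodule.mem_map, LinearMap.mem_ker, Submodule.mem_inf, Submodule.subtype_apply]
      constructor
      · rintro ⟨⟨φ, hφ⟩, h0, rfl⟩
        have h0 : ∀ x, φ (ρ x) = φ x := fun x => by
          have : φ x + φ (ρ x) = 0 := congrFun h0 x
          rwa [CharTwo.add_eq_zero, eq_comm] at this
        exact ⟨h0, fun x => (hP φ hφ x).symm.trans (h0 x)⟩
      · rintro ⟨hφ, hφ'⟩
        refine ⟨⟨φ, fun x => ?_⟩, ?_, rfl⟩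
        · rw [Equiv.trans_apply, hφ, hφ']
        · ext x
          change φ x + φ (ρ x) = 0
          rw [hφ, add_self_zmod]
    rw [← this]
    exact (LinearEquiv.finrank_eq
      (Submodule.equivMapOfInjective _ P.injective_subtype (LinearMap.ker Ψ)))
  have hrank := LinearMap.finrank_range_add_finrank_ker Ψ
  have hZ := finrank_orthogonalInvariants (invariants ρ) ε h1 h2
  rw [hker] at hrank
  change finrank (ZMod 2) (invariants ρ) + finrank (ZMod 2) P = _ ↔ _
  have hiff : (∀ h ∈ orthogonalInvariants (invariants ρ) ε,
      ∃ φ ∈ invariants (ε.trans ρ), coboundary ρ φ = h) ↔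
      LinearMap.range Ψ = orthogonalInvariants (invariants ρ) ε := by
    constructor
    · intro h
      refine le_antisymm hle fun x hx => ?_
      obtain ⟨φ, hφ, rfl⟩ := h x hx
      exact ⟨⟨φ, hφ⟩, rfl⟩
    · intro h x hx
      rw [← h] at hx
      obtain ⟨φ, rfl⟩ := hx
      exact ⟨φ.1, φ.2, rfl⟩
  rw [hiff]
  constructor
  · intro h
    exact Submodule.eq_of_le_of_finrank_eq hle (by omega)
  · intro h
    have : finrank (ZMod 2) (LinearMap.range Ψ) =
        finrank (ZMod 2) (orthogonalInvariants (invariants ρ) ε) := by rw [h]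
    omega

end

/-! ### Flows and potentials on link diagrams -/

namespace LinkDiagram

open Dart

variable {C S : Type}

/-- Flows modulo two along the edges of a diagram. -/
structure IsFlow (edge : Equiv.Perm (Dart C S)) (h : Dart C S → ZMod 2) : Prop where
  edge : ∀ d, h (edge d) = h d
  crossing : ∀ c, h (Sum.inl (c, 0)) + h (Sum.inl (c, 1)) + h (Sum.inl (c, 2)) +
    h (Sum.inl (c, 3)) = 0
  joint : ∀ s, h (Sum.inr (s, 0)) = h (Sum.inr (s, 1))

/-- A potential of a flow: a function on the faces, stored at the corners. -/
structure IsPotential (edge : Equiv.Perm (Dart C S)) (h φ : Dart C S → ZMod 2) : Prop where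
  face : ∀ d, φ (rot (edge d)) = φ d
  flow : ∀ d, h d = φ d + φ (rot d)

theorem finrank_invariants_rot [Finite C] [Finite S] :
    finrank (ZMod 2) (invariants (rot : Equiv.Perm (Dart C S))) = Nat.card (C ⊕ S) := by
  refine finrank_eq_natCard vert ?_ _ fun f => ⟨fun hf => ?_, ?_⟩
  · rintro (c | s)
    · exact ⟨Sum.inl (c, 0), rfl⟩
    · exact ⟨Sum.inr (s, 0), rfl⟩
  · refine ⟨Sum.elim (fun c => f (Sum.inl (c, 0))) (fun s => f (Sum.inr (s, 0))), funext ?_⟩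
    rintro (⟨c, i⟩ | ⟨s, i⟩)
    · have h1 := hf (Sum.inl (c, 0))
      have h2 := hf (Sum.inl (c, 0 + 1))
      have h3 := hf (Sum.inl (c, 0 + 1 + 1))
      simp only [rot_inl] at h1 h2 h3
      change f _ = f (Sum.inl (c, 0))
      rcases eq_add_cases 0 i with rfl | rfl | rfl | rfl
      · rfl
      · exact h1
      · exact h2.trans h1
      · exact h3.trans (h2.trans h1)
    · have h1 := hf (Sum.inr (s, 0))
      change f _ = f (Sum.inr (s, 0))
      rcases eq_zero_or_one i with rfl | rfl
      · rfl
      · exact h1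
  · rintro ⟨g, rfl⟩ x
    simp

theorem finrank_invariants_inf [Finite C] [Finite S] (edge : Equiv.Perm (Dart C S)) :
    finrank (ZMod 2) (invariants rot ⊓ invariants edge :
      Submodule (ZMod 2) (Dart C S → ZMod 2)) =
    Nat.card (Dart.graph edge).ConnectedComponent := by
  have hsurj : Function.Surjective (vert : Dart C S → C ⊕ S) := by
    rintro (c | s)
    · exact ⟨Sum.inl (c, 0), rfl⟩
    · exact ⟨Sum.inr (s, 0), rfl⟩
  refine finrank_eq_natCard (fun d => (Dart.graph edge).connectedComponentMk (vert d)) ?_ _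
    fun f => ⟨fun hf => ?_, ?_⟩
  · intro K
    obtain ⟨v, rfl⟩ := K.exists_rep
    obtain ⟨d, rfl⟩ := hsurj v
    exact ⟨d, rfl⟩
  · obtain ⟨g, hg⟩ : ∃ g : C ⊕ S → ZMod 2, f = g ∘ vert := by
      refine ⟨fun v => f (hsurj v).choose, funext fun d => ?_⟩
      have hv := (hsurj (vert d)).choose_spec
      have : ∀ d d' : Dart C S, vert d = vert d' → f d = f d' := by
        intro d d' h
        have hrot : ∀ d, f (rot d) = f d := hf.1
        rcases d' with ⟨c, i⟩ | ⟨s, i⟩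
        · rcases vert_eq_inl h i with rfl | rfl | rfl | rfl
          · rfl
          · exact hrot (Sum.inl (c, i))
          · have h2 := hrot (Sum.inl (c, i + 1))
            rw [rot_inl, add_assoc] at h2
            exact h2.trans (hrot (Sum.inl (c, i)))
          · have h2 := hrot (Sum.inl (c, i + 3))
            rw [rot_inl, add_assoc, show (3 : ZMod 4) + 1 = 0 by decide, add_zero] at h2
            exact h2.symm
        · rcases vert_eq_inr h with rfl | rfl <;> rcases eq_zero_or_one i with rfl | rfl
          · rfl
          · exact (hrot (Sum.inr (s, 0))).symm
          · exact hrot (Sum.inr (s, 0))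
          · rfl
      exact this _ _ hv.symm
    have hadj : ∀ v w, (Dart.graph edge).Reachable v w → g v = g w := by
      rintro v w ⟨p⟩
      induction p with
      | nil => rfl
      | cons h p ih =>
        rw [← ih]
        have key : ∀ d, g (vert (edge d)) = g (vert d) := fun d => by
          have := hf.2 d
          rwa [hg] at this
        simp only [Dart.graph, SimpleGraph.fromRel_adj] at h
        obtain ⟨-, ⟨d, rfl, rfl⟩ | ⟨d, rfl, rfl⟩⟩ := h
        · exact (key d).symm
        · exact key d
    refine ⟨SimpleGraph.ConnectedComponent.lift g fun v w p _ => hadj v w ⟨p⟩, ?_⟩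
    rw [hg]; rfl
  · rintro ⟨g, rfl⟩
    refine ⟨fun d => by simp, fun d => ?_⟩
    refine congrArg g (SimpleGraph.ConnectedComponent.sound ?_)
    by_cases h : vert (edge d) = vert d
    · rw [h]
    · refine SimpleGraph.Adj.reachable ?_
      simp only [Dart.graph, SimpleGraph.fromRel_adj]
      exact ⟨h, Or.inr ⟨d, rfl, rfl⟩⟩

/-- Orthogonality to the functions on the vertices means that the flow sums to zero at every vertex.
So Euler's formula expresses the vanishing of first homology modulo two, a form which is easy to
transport through moves. -/
theorem planar_iff [Finite C] [Finite S] (edge : Equiv.Perm (Dart C S))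
    (h1 : ∀ d, edge (edge d) = d) (h2 : ∀ d, edge d ≠ d) :
    Nat.card (C ⊕ S) + Nat.card (Quotient (Equiv.Perm.SameCycle.setoid (edge.trans Dart.rot))) =
      Nat.card (Quotient (Equiv.Perm.SameCycle.setoid edge)) +
        2 * Nat.card (Dart.graph edge).ConnectedComponent ↔
    ∀ h, IsFlow edge h → ∃ φ, IsPotential edge h φ := by
  have := Fintype.ofFinite C
  have := Fintype.ofFinite S
  rw [← finrank_invariants_rot, ← finrank_invariants, ← finrank_invariants,
    ← finrank_invariants_inf, euler_formula_iff rot edge h1 h2]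
  have hflow : ∀ h, h ∈ orthogonalInvariants (invariants rot) edge ↔ IsFlow edge h := by
    classical
    intro h
    have hsum : ∀ g : Dart C S → ZMod 2, pairing g h =
        ∑ c, (g (Sum.inl (c, 0)) * h (Sum.inl (c, 0)) + g (Sum.inl (c, 1)) * h (Sum.inl (c, 1)) +
          g (Sum.inl (c, 2)) * h (Sum.inl (c, 2)) + g (Sum.inl (c, 3)) * h (Sum.inl (c, 3))) +
        ∑ s, (g (Sum.inr (s, 0)) * h (Sum.inr (s, 0)) +
          g (Sum.inr (s, 1)) * h (Sum.inr (s, 1))) := by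
      intro g
      rw [pairing_apply, Fintype.sum_sum_type, Fintype.sum_prod_type, Fintype.sum_prod_type]
      congr 1
      · refine Finset.sum_congr rfl fun c _ => ?_
        exact Fin.sum_univ_four (fun i : Fin 4 => g (Sum.inl (c, i)) * h (Sum.inl (c, i)))
      · refine Finset.sum_congr rfl fun c _ => ?_
        exact Fin.sum_univ_two (fun i : Fin 2 => g (Sum.inr (c, i)) * h (Sum.inr (c, i)))
    constructor
    · rintro ⟨he, hp⟩
      refine ⟨he, fun c => ?_, fun s => ?_⟩
      · have := hp (fun d => if vert d = Sum.inl c then 1 else 0) (fun d => by simp)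
        rw [hsum] at this
        simp only [vert_inl, vert_inr, Sum.inl.injEq, reduceCtorEq, if_false, zero_mul, add_zero,
          Finset.sum_const_zero, Finset.sum_add_distrib, ite_mul, one_mul, Finset.sum_ite_eq', Finset.mem_univ,
          if_true] at this
        exact this
      · have := hp (fun d => if vert d = Sum.inr s then 1 else 0) (fun d => by simp)
        rw [hsum] at this
        simp only [vert_inl, vert_inr, Sum.inr.injEq, reduceCtorEq, if_false, zero_mul, add_zero,
          Finset.sum_const_zero, Finset.sum_add_distrib, ite_mul, one_mul, Finset.sum_ite_eq', Finset.mem_univ,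
          if_true, zero_add] at this
        exact CharTwo.add_eq_zero.1 this
    · rintro ⟨he, hc, hs⟩
      refine ⟨he, fun g hg => ?_⟩
      rw [hsum, Finset.sum_eq_zero, Finset.sum_eq_zero, add_zero]
      · intro s _
        have : g (Sum.inr (s, 1)) = g (Sum.inr (s, 0)) := hg (Sum.inr (s, 0))
        rw [this, hs, add_self_zmod]
      · intro c _
        have e1 : g (Sum.inl (c, 1)) = g (Sum.inl (c, 0)) := hg (Sum.inl (c, 0))
        have e2 : g (Sum.inl (c, 2)) = g (Sum.inl (c, 1)) := hg (Sum.inl (c, 1))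
        have e3 : g (Sum.inl (c, 3)) = g (Sum.inl (c, 2)) := hg (Sum.inl (c, 2))
        rw [e3, e2, e1, ← mul_add, ← mul_add, ← mul_add, hc, mul_zero]
  refine forall_congr' fun h => ?_
  rw [hflow]
  refine imp_congr_right fun _ => exists_congr fun φ => ?_
  constructor
  · rintro ⟨h1, rfl⟩
    exact ⟨h1, fun d => rfl⟩
  · rintro ⟨h1, h2⟩
    exact ⟨h1, funext fun d => (h2 d).symm⟩

theorem exists_potential (D : LinkDiagram C S) {h : Dart C S → ZMod 2} (hh : IsFlow D.edge h) :
    ∃ φ, IsPotential D.edge h φ := by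
  have := D.finite_crossings
  have := D.finite_joints
  exact (planar_iff D.edge D.edge_edge D.edge_ne).1 D.planar h hh

/-- Construction of a diagram from an involution whose flows have potentials. -/
def ofInvolutive [Finite C] [Finite S] (e : Dart C S → Dart C S) (h1 : ∀ d, e (e d) = d)
    (h2 : ∀ d, e d ≠ d)
    (h3 : ∀ h, IsFlow (Function.Involutive.toPerm e h1) h →
      ∃ φ, IsPotential (Function.Involutive.toPerm e h1) h φ) : LinkDiagram C S where
  finite_crossings := ‹_›
  finite_joints := ‹_›
  edge := Function.Involutive.toPerm e h1
  edge_edge := h1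
  edge_ne := h2
  planar := (planar_iff _ h1 h2).2 h3

end LinkDiagram

/-! ### Construction of the results of moves -/

namespace LinkDiagram

open Dart

variable {C S C' S' : Type}

/-- Here `g` is the new edge map, read on the old darts. Planarity of the new diagram follows by
extending a flow to the old diagram, taking a potential there and restricting it. -/
theorem exists_of_map [Finite C'] [Finite S'] (D : LinkDiagram C S) (f : Dart C' S' → Dart C S)
    (hf : Function.Injective f) (g : Dart C S → Dart C S) (hg : ∀ x, ∃ y, f y = g (f x))
    (hgg : ∀ x, g (g (f x)) = f x) (hne : ∀ x, g (f x) ≠ f x)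
    (hflow : ∀ e : Equiv.Perm (Dart C' S'), (∀ x, f (e x) = g (f x)) → ∀ h', IsFlow e h' →
      ∃ h, IsFlow D.edge h ∧ ∀ φ, IsPotential D.edge h φ → IsPotential e h' (φ ∘ f)) :
    ∃ D' : LinkDiagram C' S', ∀ x, f (D'.edge x) = g (f x) := by
  choose e he using hg
  have h1 : ∀ x, e (e x) = x := fun x => hf (by rw [he, he, hgg])
  refine ⟨ofInvolutive e h1 (fun x h => hne x (by rw [← he, h])) fun h' hh' => ?_, he⟩
  obtain ⟨h, hh, hφ⟩ := hflow (Function.Involutive.toPerm e h1) he h' hh'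
  obtain ⟨φ, hp⟩ := D.exists_potential hh
  exact ⟨_, hφ φ hp⟩

/-- The darts which remain when a joint is removed. -/
def removeJoint (s : S) : Dart C {t : S // t ≠ s} → Dart C S :=
  Sum.map id (fun x => (x.1.1, x.2))

@[simp] theorem removeJoint_inl (s : S) (x : C × ZMod 4) :
    removeJoint s (Sum.inl x) = Sum.inl x := rfl

@[simp] theorem removeJoint_inr (s : S) (t : {t : S // t ≠ s}) (i : ZMod 2) :
    removeJoint (C := C) s (Sum.inr (t, i)) = Sum.inr (t.1, i) := rfl

theorem removeJoint_injective (s : S) :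
    Function.Injective (removeJoint s : Dart C {t : S // t ≠ s} → Dart C S) := by
  rintro (x | ⟨⟨t, ht⟩, i⟩) (y | ⟨⟨u, hu⟩, j⟩) h <;> simp_all [removeJoint]

theorem exists_removeJoint {s : S} {d : Dart C S} (hd : vert d ≠ Sum.inr s) :
    ∃ x, removeJoint s x = d := by
  rcases d with ⟨c, i⟩ | ⟨t, i⟩
  · exact ⟨Sum.inl (c, i), rfl⟩
  · exact ⟨Sum.inr (⟨t, fun h => hd (by simp [h])⟩, i), rfl⟩

theorem vert_removeJoint (s : S) (x : Dart C {t : S // t ≠ s}) :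
    vert (removeJoint s x) ≠ Sum.inr s := by
  rcases x with ⟨c, i⟩ | ⟨⟨t, ht⟩, i⟩ <;> simp [*]

theorem rot_removeJoint (s : S) (x : Dart C {t : S // t ≠ s}) :
    removeJoint s (rot x) = rot (removeJoint s x) := by
  rcases x with ⟨c, i⟩ | ⟨⟨t, ht⟩, i⟩ <;> simp

theorem isUp_removeJoint (s : S) (x : Dart C {t : S // t ≠ s}) :
    IsUp (removeJoint s x) ↔ IsUp x := by
  rcases x with ⟨c, i⟩ | ⟨⟨t, ht⟩, i⟩ <;> simp

open Classical in
theorem exists_unsubdivide (D : LinkDiagram C S) (s : S)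
    (hs : D.edge (Sum.inr (s, 0)) ≠ Sum.inr (s, 1)) :
    ∃ D' : LinkDiagram C {t : S // t ≠ s}, Unsubdivide D D' ∧
      ∀ x, removeJoint s (D'.edge x) =
        if vert (D.edge (removeJoint s x)) = Sum.inr s then
          D.edge (rot (D.edge (removeJoint s x))) else D.edge (removeJoint s x) := by
  have := D.finite_crossings
  have := D.finite_joints
  have hedge : ∀ d, vert d = Sum.inr s → vert (D.edge d) ≠ Sum.inr s := by
    intro d hd h
    have key : D.edge (Sum.inr (s, 1)) ≠ Sum.inr (s, 0) := fun h => hs (by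
      rw [← h, D.edge_edge])
    rcases vert_eq_inr hd with rfl | rfl <;> rcases vert_eq_inr h with h | h
    · exact D.edge_ne _ h
    · exact hs h
    · exact key h
    · exact D.edge_ne _ h
  have hrr : ∀ d : Dart C S, vert d = Sum.inr s → rot (rot d) = d ∧ rot d ≠ d := by
    intro d hd
    rcases vert_eq_inr hd with rfl | rfl <;> simp [show (1 : ZMod 2) + 1 = 0 by decide]
  let g : Dart C S → Dart C S := fun d =>
    if vert (D.edge d) = Sum.inr s then D.edge (rot (D.edge d)) else D.edge d
  have hg1 : ∀ d, vert (D.edge d) = Sum.inr s → g d = D.edge (rot (D.edge d)) :=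
    fun d h => if_pos h
  have hg2 : ∀ d, vert (D.edge d) ≠ Sum.inr s → g d = D.edge d := fun d h => if_neg h
  have hgv : ∀ d, vert (g d) ≠ Sum.inr s := by
    intro d
    by_cases h : vert (D.edge d) = Sum.inr s
    · rw [hg1 d h]
      exact hedge _ (by simpa using h)
    · rw [hg2 d h]
      exact h
  have hD : ∃ D' : LinkDiagram C {t : S // t ≠ s}, ∀ x,
      removeJoint s (D'.edge x) = g (removeJoint s x) := by
    refine D.exists_of_map (removeJoint s) (removeJoint_injective s) g
      (fun x => exists_removeJoint (hgv _))
      (by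
        intro x
        by_cases h : vert (D.edge (removeJoint s x)) = Sum.inr s
        · rw [hg1 _ h, hg1, D.edge_edge, (hrr _ h).1, D.edge_edge]
          rw [D.edge_edge, vert_rot, h]
        · rw [hg2 _ h, hg2, D.edge_edge]
          rw [D.edge_edge]; exact vert_removeJoint s x)
      (by
        intro x
        by_cases h : vert (D.edge (removeJoint s x)) = Sum.inr s
        · rw [hg1 _ h]
          intro h'
          refine (hrr _ h).2 ?_
          rw [← D.edge_edge (rot _), h']
        · rw [hg2 _ h]
          exact D.edge_ne _) ?_
    intro e he h' hh'
    let h₀ := Function.extend (removeJoint s) h' 0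
    have e0 : ∀ x, h₀ (removeJoint s x) = h' x := fun x =>
      (removeJoint_injective s).extend_apply _ _ _
    -- The removed joint carries the flow of the edge that runs through it.
    let h : Dart C S → ZMod 2 := fun d => if vert d = Sum.inr s then h₀ (D.edge d) else h₀ d
    have h1 : ∀ x, h (removeJoint s x) = h' x := fun x => by
      simp [h, vert_removeJoint s x, e0]
    refine ⟨h, ⟨?_, ?_, ?_⟩, fun φ hφ => ⟨fun x => ?_, fun x => ?_⟩⟩
    · intro d
      by_cases hd : vert d = Sum.inr s
      · simp [h, hd, hedge d hd]
      · by_cases hd' : vert (D.edge d) = Sum.inr s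
        · simp [h, hd, hd', D.edge_edge]
        · obtain ⟨x, rfl⟩ := exists_removeJoint hd
          rw [← hg2 _ hd', ← he, h1, h1, hh'.edge]
    · intro c
      have := hh'.crossing c
      rw [← h1, ← h1, ← h1, ← h1] at this
      exact this
    · intro t
      by_cases ht : t = s
      · subst ht
        obtain ⟨x, hx⟩ := exists_removeJoint (hedge (Sum.inr (t, 0)) rfl)
        have hx' := he x
        rw [hg1 _ (by rw [hx, D.edge_edge]; rfl), hx, D.edge_edge, rot_inr] at hx'
        have : h' (e x) = h' x := hh'.edge x
        simp only [h, vert_inr, if_true, ← hx]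
        rw [zero_add] at hx'
        rw [← hx', e0, e0, this]
      · have := hh'.joint ⟨t, ht⟩
        rw [← h1, ← h1] at this
        exact this
    · rw [Function.comp, Function.comp, rot_removeJoint, he]
      by_cases hx : vert (D.edge (removeJoint s x)) = Sum.inr s
      · rw [hg1 _ hx, hφ.face]
        exact hφ.face _
      · rw [hg2 _ hx]
        exact hφ.face _
    · rw [Function.comp, Function.comp, rot_removeJoint, ← hφ.flow, h1]
  obtain ⟨D', hD'⟩ := hD
  refine ⟨D', ⟨s, removeJoint s, hs, removeJoint_injective s, ?_, rot_removeJoint s,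
    isUp_removeJoint s, fun x h => by rw [hD', hg2 _ h], fun x h => by rw [hD', hg1 _ h]⟩,
    hD'⟩
  ext d
  exact ⟨by rintro ⟨x, rfl⟩; exact vert_removeJoint s x, exists_removeJoint⟩

/-- The darts which remain after an untwist move at the crossing `a`. -/
def untwistMap (a : C) (i : ZMod 4) : Dart {c : C // c ≠ a} (Option S) → Dart C S
  | Sum.inl (c, l) => Sum.inl (c.1, l)
  | Sum.inr (some t, l) => Sum.inr (t, l)
  | Sum.inr (none, l) => Sum.inl (a, if l = 0 then i + 2 else i + 3)

@[simp] theorem untwistMap_inl (a : C) (i : ZMod 4) (c : {c : C // c ≠ a}) (l : ZMod 4) :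
    untwistMap (S := S) a i (Sum.inl (c, l)) = Sum.inl (c.1, l) := rfl

@[simp] theorem untwistMap_none_zero (a : C) (i : ZMod 4) :
    untwistMap (S := S) a i (Sum.inr (none, 0)) = Sum.inl (a, i + 2) := rfl

@[simp] theorem untwistMap_some (a : C) (i : ZMod 4) (t : S) (l : ZMod 2) :
    untwistMap (S := S) a i (Sum.inr (some t, l)) = Sum.inr (t, l) := rfl

@[simp] theorem untwistMap_none_one (a : C) (i : ZMod 4) :
    untwistMap (S := S) a i (Sum.inr (none, 1)) = Sum.inl (a, i + 3) := rfl

theorem untwistMap_injective (a : C) (i : ZMod 4) :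
    Function.Injective (untwistMap (S := S) a i) := by
  have m23 : (2 : ZMod 4) ≠ 3 := by decide
  rintro (⟨⟨c, hc⟩, l⟩ | ⟨_ | t, l⟩) (⟨⟨c', hc'⟩, l'⟩ | ⟨_ | t', l'⟩) h
  · simpa using h
  · rcases eq_zero_or_one l' with rfl | rfl <;> simp at h <;> exact absurd h.1 hc
  · simp at h
  · rcases eq_zero_or_one l with rfl | rfl <;> simp at h <;> exact absurd h.1.symm hc'
  · rcases eq_zero_or_one l with rfl | rfl <;> rcases eq_zero_or_one l' with rfl | rfl <;>
      simp [m23, m23.symm] at h ⊢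
  · rcases eq_zero_or_one l with rfl | rfl <;> simp at h
  · simp at h
  · rcases eq_zero_or_one l' with rfl | rfl <;> simp at h
  · simpa using h

theorem range_untwistMap (a : C) (i : ZMod 4) :
    Set.range (untwistMap (S := S) a i) = {Sum.inl (a, i), Sum.inl (a, i + 1)}ᶜ := by
  have m2 : (2 : ZMod 4) ≠ 0 := by decide
  have m3 : (3 : ZMod 4) ≠ 0 := by decide
  have m12 : (2 : ZMod 4) ≠ 1 := by decide
  have m13 : (3 : ZMod 4) ≠ 1 := by decide
  ext d
  simp only [Set.mem_range, Set.mem_compl_iff, Set.mem_insert_iff, Set.mem_singleton_iff, not_or]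
  constructor
  · rintro ⟨⟨⟨c, hc⟩, l⟩ | ⟨_ | t, l⟩, rfl⟩
    · simp [hc]
    · rcases eq_zero_or_one l with rfl | rfl <;> simp [m2, m3, m12, m13]
    · simp
  · rintro ⟨h1, h2⟩
    by_cases hv : vert d = Sum.inl a
    · rcases vert_eq_inl hv i with rfl | rfl | rfl | rfl
      · exact absurd rfl h1
      · exact absurd rfl h2
      · exact ⟨Sum.inr (none, 0), rfl⟩
      · exact ⟨Sum.inr (none, 1), rfl⟩
    · rcases d with ⟨c, l⟩ | ⟨t, l⟩
      · exact ⟨Sum.inl (⟨c, fun h => hv (by simp [h])⟩, l), rfl⟩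
      · exact ⟨Sum.inr (some t, l), rfl⟩

theorem rot_untwistMap (a : C) (i : ZMod 4) (x : Dart {c : C // c ≠ a} (Option S))
    (hx : vert x ≠ Sum.inr none) : untwistMap a i (rot x) = rot (untwistMap a i x) ∧
      (IsUp (untwistMap a i x) ↔ IsUp x) := by
  rcases x with ⟨c, l⟩ | ⟨_ | t, l⟩
  · simp
  · simp at hx
  · simp

theorem sum_crossing (h : Dart C S → ZMod 2) (c : C) (i : ZMod 4) :
    h (Sum.inl (c, 0)) + h (Sum.inl (c, 1)) + h (Sum.inl (c, 2)) + h (Sum.inl (c, 3)) =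
    h (Sum.inl (c, i)) + h (Sum.inl (c, i + 1)) + h (Sum.inl (c, i + 2)) +
      h (Sum.inl (c, i + 3)) := by
  rcases eq_add_cases 0 i with rfl | rfl | rfl | rfl
  · rfl
  · simp only [zero_add, show (1 : ZMod 4) + 1 = 2 by decide,
      show (1 : ZMod 4) + 2 = 3 by decide, show (1 : ZMod 4) + 3 = 0 by decide]; ring
  · simp only [zero_add, show (2 : ZMod 4) + 1 = 3 by decide,
      show (2 : ZMod 4) + 2 = 0 by decide, show (2 : ZMod 4) + 3 = 1 by decide]; ring
  · simp only [zero_add, show (3 : ZMod 4) + 1 = 0 by decide,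
      show (3 : ZMod 4) + 2 = 1 by decide, show (3 : ZMod 4) + 3 = 2 by decide]; ring

open Classical in
theorem exists_untwist (D : LinkDiagram C S) (a : C) (i : ZMod 4)
    (ha : D.edge (Sum.inl (a, i)) = Sum.inl (a, i + 1)) :
    ∃ D' : LinkDiagram {c : C // c ≠ a} (Option S), Untwist D D' ∧
      ∀ x, untwistMap a i (D'.edge x) = D.edge (untwistMap a i x) := by
  have := D.finite_crossings
  have := D.finite_joints
  have ha' : D.edge (Sum.inl (a, i + 1)) = Sum.inl (a, i) := by rw [← ha, D.edge_edge]
  have hf := untwistMap_injective (S := S) a i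
  have hfs : ∀ x, untwistMap (S := S) a i x ≠ Sum.inl (a, i) ∧
      untwistMap (S := S) a i x ≠ Sum.inl (a, i + 1) := fun x => by
    have : untwistMap (S := S) a i x ∈ Set.range (untwistMap (S := S) a i) := ⟨x, rfl⟩
    rw [range_untwistMap] at this
    simpa using this
  have hex : ∀ d : Dart C S, d ≠ Sum.inl (a, i) → d ≠ Sum.inl (a, i + 1) →
      ∃ x, untwistMap a i x = d := fun d h1 h2 => by
    have : d ∈ Set.range (untwistMap (S := S) a i) := by rw [range_untwistMap]; simp [h1, h2]
    exact this
  have hD : ∃ D' : LinkDiagram {c : C // c ≠ a} (Option S), ∀ x,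
      untwistMap a i (D'.edge x) = D.edge (untwistMap a i x) := by
    refine D.exists_of_map (untwistMap a i) hf D.edge
      (fun x => hex _ (fun h => (hfs x).2 (by rw [← ha, ← h, D.edge_edge]))
        (fun h => (hfs x).1 (by rw [← ha', ← h, D.edge_edge])))
      (fun x => D.edge_edge _) (fun x => D.edge_ne _) ?_
    intro e he h' hh'
    -- The deleted loop carries no flow, so a potential does not change across it.
    let h : Dart C S → ZMod 2 := Function.extend (untwistMap a i) h' 0
    have h1 : ∀ x, h (untwistMap a i x) = h' x := fun x => hf.extend_apply _ _ _
    have hout : ∀ d, (∀ x, untwistMap a i x ≠ d) → h d = 0 := fun d hd =>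
      Function.extend_apply' _ _ _ (by rintro ⟨x, hx⟩; exact hd x hx)
    have o1 : h (Sum.inl (a, i)) = 0 := hout _ fun x => (hfs x).1
    have o2 : h (Sum.inl (a, i + 1)) = 0 := hout _ fun x => (hfs x).2
    have o3 : h (Sum.inl (a, i + 2)) = h' (Sum.inr (none, 0)) := h1 (Sum.inr (none, 0))
    have o4 : h (Sum.inl (a, i + 3)) = h' (Sum.inr (none, 0)) :=
      (h1 (Sum.inr (none, 1))).trans (hh'.joint none).symm
    refine ⟨h, ⟨?_, ?_, ?_⟩, fun φ hφ => ⟨fun x => ?_, fun x => ?_⟩⟩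
    · intro d
      by_cases d1 : d = Sum.inl (a, i)
      · rw [d1, ha, o1, o2]
      by_cases d2 : d = Sum.inl (a, i + 1)
      · rw [d2, ha', o1, o2]
      obtain ⟨x, rfl⟩ := hex d d1 d2
      rw [← he, h1, h1, hh'.edge]
    · intro c
      by_cases hc : c = a
      · subst hc
        rw [sum_crossing h c i, o1, o2, o3, o4]
        simp [add_self_zmod]
      · have := hh'.crossing ⟨c, hc⟩
        rw [← h1, ← h1, ← h1, ← h1] at this
        exact this
    · intro t
      have := hh'.joint (some t)
      rw [← h1, ← h1] at this
      exact this
    · have f0 := hφ.flow (Sum.inl (a, i))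
      have f1 := hφ.flow (Sum.inl (a, i + 1))
      have q := hφ.face (untwistMap a i x)
      rw [← he] at q
      simp only [Function.comp]
      rw [← q]
      by_cases hx : vert (e x) = Sum.inr none
      · rcases vert_eq_inr hx with hx | hx
        · rw [hx]
          simp only [rot_inr, untwistMap_none_zero, rot_inl, zero_add, untwistMap_none_one, add_assoc]
          rfl
        · rw [hx]
          simp only [rot_inr, untwistMap_none_one, rot_inl, add_assoc]
          rw [rot_inl, o1] at f0
          rw [rot_inl, o2] at f1
          rw [show (1 : ZMod 2) + 1 = 0 by decide, show (3 : ZMod 4) + 1 = 0 by decide, add_zero,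
            untwistMap_none_zero]
          rw [add_assoc, show (1 : ZMod 4) + 1 = 2 by decide] at f1
          rw [CharTwo.add_eq_zero.1 f0.symm, CharTwo.add_eq_zero.1 f1.symm]
      · rw [(rot_untwistMap a i _ hx).1]
    · have f2 := hφ.flow (Sum.inl (a, i + 2))
      rw [rot_inl, o3, add_assoc, show (2 : ZMod 4) + 1 = 3 by decide] at f2
      by_cases hx : vert x = Sum.inr none
      · rcases vert_eq_inr hx with rfl | rfl
        · exact f2
        · rw [← hh'.joint none, f2, add_comm]
          rfl
      · rw [Function.comp, Function.comp, (rot_untwistMap a i _ hx).1, ← hφ.flow, h1]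
  obtain ⟨D', hD'⟩ := hD
  exact ⟨D', ⟨a, i, none, untwistMap a i, ha, hf, range_untwistMap a i, hD', rfl, rfl,
    rot_untwistMap a i⟩, hD'⟩

end LinkDiagram

/-! ### The result of an unpoke move -/

namespace LinkDiagram

open Dart

variable {C S C' S' : Type}

/-- The darts which remain after an unpoke move at the crossings `a` and `b`. -/
def unpokeMap (a b : C) (i j : ZMod 4) :
    Dart {c : C // c ≠ a ∧ c ≠ b} (Option (Option S)) → Dart C S
  | Sum.inl (c, l) => Sum.inl (c.1, l)
  | Sum.inr (some (some t), l) => Sum.inr (t, l)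
  | Sum.inr (none, l) => Sum.inl (if l = 0 then (a, i + 2) else (b, j + 3))
  | Sum.inr (some none, l) => Sum.inl (if l = 0 then (a, i + 3) else (b, j + 2))

section

variable (a b : C) (i j : ZMod 4)

@[simp] theorem unpokeMap_inl (c : {c : C // c ≠ a ∧ c ≠ b}) (l : ZMod 4) :
    unpokeMap (S := S) a b i j (Sum.inl (c, l)) = Sum.inl (c.1, l) := rfl

@[simp] theorem unpokeMap_none_zero :
    unpokeMap (S := S) a b i j (Sum.inr (none, 0)) = Sum.inl (a, i + 2) := rfl

@[simp] theorem unpokeMap_none_one :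
    unpokeMap (S := S) a b i j (Sum.inr (none, 1)) = Sum.inl (b, j + 3) := rfl

@[simp] theorem unpokeMap_some (t : S) (l : ZMod 2) :
    unpokeMap (S := S) a b i j (Sum.inr (some (some t), l)) = Sum.inr (t, l) := rfl

@[simp] theorem unpokeMap_some_zero :
    unpokeMap (S := S) a b i j (Sum.inr (some none, 0)) = Sum.inl (a, i + 3) := rfl

@[simp] theorem unpokeMap_some_one :
    unpokeMap (S := S) a b i j (Sum.inr (some none, 1)) = Sum.inl (b, j + 2) := rfl

theorem unpokeMap_injective (hab : a ≠ b) : Function.Injective (unpokeMap (S := S) a b i j) := by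
  have m23 : (2 : ZMod 4) ≠ 3 := by decide
  rintro (⟨⟨c, hc, hc₂⟩, l⟩ | ⟨_ | _ | t, l⟩) (⟨⟨c', hc', hc₂'⟩, l'⟩ | ⟨_ | _ | t', l'⟩) h
  · simpa using h
  · rcases eq_zero_or_one l' with rfl | rfl <;> simp at h <;> simp_all
  · rcases eq_zero_or_one l' with rfl | rfl <;> simp at h <;> simp_all
  · simp at h
  · rcases eq_zero_or_one l with rfl | rfl <;> simp at h <;>
      first | exact (hc' h.1.symm).elim | exact (hc₂' h.1.symm).elim
  · rcases eq_zero_or_one l with rfl | rfl <;> rcases eq_zero_or_one l' with rfl | rfl <;>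
      simp [hab, hab.symm] at h ⊢
  · rcases eq_zero_or_one l with rfl | rfl <;> rcases eq_zero_or_one l' with rfl | rfl <;>
      simp [m23, m23.symm, hab, hab.symm] at h ⊢
  · rcases eq_zero_or_one l with rfl | rfl <;> simp at h
  · rcases eq_zero_or_one l with rfl | rfl <;> simp at h <;>
      first | exact (hc' h.1.symm).elim | exact (hc₂' h.1.symm).elim
  · rcases eq_zero_or_one l with rfl | rfl <;> rcases eq_zero_or_one l' with rfl | rfl <;>
      simp [m23, m23.symm, hab, hab.symm] at h ⊢
  · rcases eq_zero_or_one l with rfl | rfl <;> rcases eq_zero_or_one l' with rfl | rfl <;>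
      simp [hab, hab.symm] at h ⊢
  · rcases eq_zero_or_one l with rfl | rfl <;> simp at h
  · simp at h
  · rcases eq_zero_or_one l' with rfl | rfl <;> simp at h
  · rcases eq_zero_or_one l' with rfl | rfl <;> simp at h
  · simpa using h

theorem range_unpokeMap (hab : a ≠ b) : Set.range (unpokeMap (S := S) a b i j) =
    {Sum.inl (a, i), Sum.inl (a, i + 1), Sum.inl (b, j), Sum.inl (b, j + 1)}ᶜ := by
  have m2 : (2 : ZMod 4) ≠ 0 := by decide
  have m3 : (3 : ZMod 4) ≠ 0 := by decide
  have m12 : (2 : ZMod 4) ≠ 1 := by decide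
  have m13 : (3 : ZMod 4) ≠ 1 := by decide
  ext d
  simp only [Set.mem_range, Set.mem_compl_iff, Set.mem_insert_iff, Set.mem_singleton_iff, not_or]
  constructor
  · rintro ⟨⟨⟨c, hc, hc'⟩, l⟩ | ⟨_ | _ | t, l⟩, rfl⟩
    · simp [hc, hc']
    · rcases eq_zero_or_one l with rfl | rfl <;> simp [m2, m3, m12, m13, hab, hab.symm]
    · rcases eq_zero_or_one l with rfl | rfl <;> simp [m2, m3, m12, m13, hab, hab.symm]
    · simp
  · rintro ⟨h1, h2, h3, h4⟩
    by_cases hv : vert d = Sum.inl a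
    · rcases vert_eq_inl hv i with rfl | rfl | rfl | rfl
      · exact absurd rfl h1
      · exact absurd rfl h2
      · exact ⟨Sum.inr (none, 0), rfl⟩
      · exact ⟨Sum.inr (some none, 0), rfl⟩
    by_cases hv' : vert d = Sum.inl b
    · rcases vert_eq_inl hv' j with rfl | rfl | rfl | rfl
      · exact absurd rfl h3
      · exact absurd rfl h4
      · exact ⟨Sum.inr (some none, 1), rfl⟩
      · exact ⟨Sum.inr (none, 1), rfl⟩
    · rcases d with ⟨c, l⟩ | ⟨t, l⟩
      · exact ⟨Sum.inl (⟨c, fun h => hv (by simp [h]), fun h => hv' (by simp [h])⟩, l), rfl⟩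
      · exact ⟨Sum.inr (some (some t), l), rfl⟩

theorem rot_unpokeMap (x : Dart {c : C // c ≠ a ∧ c ≠ b} (Option (Option S)))
    (hx : vert x ≠ Sum.inr none) (hx' : vert x ≠ Sum.inr (some none)) :
    unpokeMap a b i j (rot x) = rot (unpokeMap a b i j x) ∧
      (IsUp (unpokeMap a b i j x) ↔ IsUp x) := by
  rcases x with ⟨c, l⟩ | ⟨_ | _ | t, l⟩
  · simp
  · simp at hx
  · simp at hx'
  · simp

end

open Classical in
theorem exists_unpoke (D : LinkDiagram C S) (a b : C) (i j : ZMod 4) (hab : a ≠ b)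
    (ha : D.edge (Sum.inl (a, i)) = Sum.inl (b, j + 1))
    (hb : D.edge (Sum.inl (a, i + 1)) = Sum.inl (b, j))
    (hup : IsUp (Sum.inl (a, i) : Dart C S) ↔ IsUp (Sum.inl (b, j + 1) : Dart C S)) :
    ∃ D' : LinkDiagram {c : C // c ≠ a ∧ c ≠ b} (Option (Option S)), Unpoke D D' ∧
      ∀ x, unpokeMap a b i j (D'.edge x) = D.edge (unpokeMap a b i j x) := by
  have := D.finite_crossings
  have := D.finite_joints
  have ha' : D.edge (Sum.inl (b, j + 1)) = Sum.inl (a, i) := by rw [← ha, D.edge_edge]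
  have hb' : D.edge (Sum.inl (b, j)) = Sum.inl (a, i + 1) := by rw [← hb, D.edge_edge]
  have hf := unpokeMap_injective (S := S) a b i j hab
  have hfs : ∀ x, unpokeMap (S := S) a b i j x ≠ Sum.inl (a, i) ∧
      unpokeMap (S := S) a b i j x ≠ Sum.inl (a, i + 1) ∧
      unpokeMap (S := S) a b i j x ≠ Sum.inl (b, j) ∧
      unpokeMap (S := S) a b i j x ≠ Sum.inl (b, j + 1) := fun x => by
    have : unpokeMap (S := S) a b i j x ∈ Set.range (unpokeMap (S := S) a b i j) := ⟨x, rfl⟩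
    rw [range_unpokeMap _ _ _ _ hab] at this
    simpa using this
  have hex : ∀ d : Dart C S, d ≠ Sum.inl (a, i) → d ≠ Sum.inl (a, i + 1) → d ≠ Sum.inl (b, j) →
      d ≠ Sum.inl (b, j + 1) → ∃ x, unpokeMap a b i j x = d := fun d h1 h2 h3 h4 => by
    have : d ∈ Set.range (unpokeMap (S := S) a b i j) := by
      rw [range_unpokeMap _ _ _ _ hab]; simp [h1, h2, h3, h4]
    exact this
  have n1 : (1 : ZMod 4) + 1 = 2 := by decide
  have n2 : (2 : ZMod 4) + 1 = 3 := by decide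
  have n3 : (3 : ZMod 4) + 1 = 0 := by decide
  have z1 : (1 : ZMod 2) + 1 = 0 := by decide
  have hD : ∃ D' : LinkDiagram {c : C // c ≠ a ∧ c ≠ b} (Option (Option S)), ∀ x,
      unpokeMap a b i j (D'.edge x) = D.edge (unpokeMap a b i j x) := by
    refine D.exists_of_map (unpokeMap a b i j) hf D.edge
      (fun x => hex _ (fun h => (hfs x).2.2.2 (by rw [← ha, ← h, D.edge_edge]))
        (fun h => (hfs x).2.2.1 (by rw [← hb, ← h, D.edge_edge]))
        (fun h => (hfs x).2.1 (by rw [← hb', ← h, D.edge_edge]))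
        (fun h => (hfs x).1 (by rw [← ha', ← h, D.edge_edge])))
      (fun x => D.edge_edge _) (fun x => D.edge_ne _) ?_
    intro e he h' hh'
    let h₀ : Dart C S → ZMod 2 := Function.extend (unpokeMap a b i j) h' 0
    have e0 : ∀ x, h₀ (unpokeMap a b i j x) = h' x := fun x => hf.extend_apply _ _ _
    let σ := h' (Sum.inr (none, 0))
    let τ := h' (Sum.inr (some none, 0))
    -- The flow goes straight through both crossings: each deleted edge carries the value of its
    -- string.
    let h : Dart C S → ZMod 2 := fun d =>
      if d = Sum.inl (a, i) ∨ d = Sum.inl (b, j + 1) then σ else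
      if d = Sum.inl (a, i + 1) ∨ d = Sum.inl (b, j) then τ else h₀ d
    have h1 : ∀ x, h (unpokeMap a b i j x) = h' x := fun x => by simp [h, hfs, e0]
    have a0 : h (Sum.inl (a, i)) = σ := by simp [h]
    have b1 : h (Sum.inl (b, j + 1)) = σ := by simp [h]
    have a1 : h (Sum.inl (a, i + 1)) = τ := by simp [h, hab, show (1 : ZMod 4) ≠ 0 by decide]
    have b0 : h (Sum.inl (b, j)) = τ := by simp [h, hab.symm, show (1 : ZMod 4) ≠ 0 by decide]
    have a2 : h (Sum.inl (a, i + 2)) = σ := h1 (Sum.inr (none, 0))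
    have b3 : h (Sum.inl (b, j + 3)) = σ := (h1 (Sum.inr (none, 1))).trans (hh'.joint none).symm
    have a3 : h (Sum.inl (a, i + 3)) = τ := h1 (Sum.inr (some none, 0))
    have b2 : h (Sum.inl (b, j + 2)) = τ :=
      (h1 (Sum.inr (some none, 1))).trans (hh'.joint (some none)).symm
    refine ⟨h, ⟨?_, ?_, ?_⟩, fun φ hφ => ?_⟩
    · intro d
      by_cases d1 : d = Sum.inl (a, i)
      · rw [d1, ha, a0, b1]
      by_cases d2 : d = Sum.inl (a, i + 1)
      · rw [d2, hb, a1, b0]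
      by_cases d3 : d = Sum.inl (b, j)
      · rw [d3, hb', a1, b0]
      by_cases d4 : d = Sum.inl (b, j + 1)
      · rw [d4, ha', a0, b1]
      obtain ⟨x, rfl⟩ := hex d d1 d2 d3 d4
      rw [← he, h1, h1, hh'.edge]
    · intro c
      by_cases hc : c = a
      · subst hc
        rw [sum_crossing h c i, a0, a1, a2, a3]
        linear_combination add_self_zmod σ + add_self_zmod τ
      by_cases hc' : c = b
      · subst hc'
        rw [sum_crossing h c j, b0, b1, b2, b3]
        linear_combination add_self_zmod σ + add_self_zmod τ
      · have := hh'.crossing ⟨c, hc, hc'⟩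
        rw [← h1, ← h1, ← h1, ← h1] at this
        exact this
    · intro t
      have := hh'.joint (some (some t))
      rw [← h1, ← h1] at this
      exact this
    · have fa0 := hφ.flow (Sum.inl (a, i))
      have fa1 := hφ.flow (Sum.inl (a, i + 1))
      have fa2 := hφ.flow (Sum.inl (a, i + 2))
      have fa3 := hφ.flow (Sum.inl (a, i + 3))
      have fb0 := hφ.flow (Sum.inl (b, j))
      have fb1 := hφ.flow (Sum.inl (b, j + 1))
      have fb2 := hφ.flow (Sum.inl (b, j + 2))
      have fb3 := hφ.flow (Sum.inl (b, j + 3))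
      have q1 := hφ.face (Sum.inl (a, i))
      have q2 := hφ.face (Sum.inl (a, i + 1))
      simp only [rot_inl, add_assoc, n1, n2, n3, add_zero, a0, a1, a2, a3] at fa0 fa1 fa2 fa3
      simp only [rot_inl, add_assoc, n1, n2, n3, add_zero, b0, b1, b2, b3] at fb0 fb1 fb2 fb3
      rw [ha, rot_inl, add_assoc, n1] at q1
      rw [hb, rot_inl] at q2
      -- At a new joint the rotation leads from an end at `a` to one at `b`. `r1` and `r2` identify
      -- the potential there with that at the next end at `a`, for which the flow equation is known.
      have r1 : φ (Sum.inl (b, j + 3)) = φ (Sum.inl (a, i + 3)) := by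
        linear_combination fa3 - fb2 - q1
      have r2 : φ (Sum.inl (b, j + 2)) = φ (Sum.inl (a, i)) := q1
      have hflow : ∀ x, h' x = φ (unpokeMap a b i j x) + φ (unpokeMap a b i j (rot x)) := by
        intro x
        by_cases hx : vert x = Sum.inr none
        · rcases vert_eq_inr hx with rfl | rfl
          · simp only [rot_inr, zero_add, unpokeMap_none_zero, unpokeMap_none_one, r1]
            exact fa2
          · rw [← hh'.joint none]
            simp only [rot_inr, z1, unpokeMap_none_zero, unpokeMap_none_one, r1]
            rw [add_comm]
            exact fa2
        by_cases hx' : vert x = Sum.inr (some none)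
        · rcases vert_eq_inr hx' with rfl | rfl
          · simp only [rot_inr, zero_add, unpokeMap_some_zero, unpokeMap_some_one, r2]
            exact fa3
          · rw [← hh'.joint (some none)]
            simp only [rot_inr, z1, unpokeMap_some_zero, unpokeMap_some_one, r2]
            rw [add_comm]
            exact fa3
        · rw [(rot_unpokeMap a b i j _ hx hx').1, ← hφ.flow, h1]
      refine ⟨fun x => ?_, hflow⟩
      have q := hφ.face (unpokeMap a b i j x)
      rw [← he] at q
      simp only [Function.comp]
      rw [← q]
      have hf1 := hflow (e x)
      have hf2 := hφ.flow (unpokeMap a b i j (e x))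
      rw [h1, hf1] at hf2
      exact add_left_cancel hf2
  obtain ⟨D', hD'⟩ := hD
  exact ⟨D', ⟨a, b, i, j, none, some none, unpokeMap a b i j, hab, ha, hb, hup, hf,
    range_unpokeMap a b i j hab, hD', rfl, rfl, rfl, rfl, rot_unpokeMap a b i j⟩, hD'⟩

end LinkDiagram

/-! ### Treewidth -/

section Treewidth

variable {V V' : Type} {G : SimpleGraph V} {G' : SimpleGraph V'} {k : ℕ}

/-- Treewidth does not increase under taking minors: every vertex of `G'` is a connected
branch set in `G`, and every edge of `G'` is realized by an edge of `G`. -/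
theorem TreewidthLE.of_branchSets [Finite V'] (hG : TreewidthLE G k) (B : V' → Set V)
    (hne : ∀ x, (B x).Nonempty) (hdisj : ∀ x y v, v ∈ B x → v ∈ B y → x = y)
    (hconn : ∀ x, ∀ v ∈ B x, ∀ w ∈ B x,
      Relation.ReflTransGen (fun p q => G.Adj p q ∧ q ∈ B x) v w)
    (hadj : ∀ x y, G'.Adj x y → ∃ v ∈ B x, ∃ w ∈ B y, G.Adj v w) : TreewidthLE G' k := by
  classical
  obtain ⟨I, hI, T, X, hT, hv, he, hc, hk⟩ := hG
  have hmem : ∀ i x, x ∈ (Set.toFinite {x | ∃ v ∈ B x, v ∈ X i}).toFinset ↔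
      ∃ v ∈ B x, v ∈ X i := fun i x => by simp
  refine ⟨I, hI, T, fun i => (Set.toFinite {x | ∃ v ∈ B x, v ∈ X i}).toFinset, hT, ?_, ?_, ?_, ?_⟩
  · intro x
    obtain ⟨v, hvx⟩ := hne x
    obtain ⟨i, hi⟩ := hv v
    exact ⟨i, (hmem i x).2 ⟨v, hvx, hi⟩⟩
  · intro x y hxy
    obtain ⟨v, hvx, w, hwy, h⟩ := hadj x y hxy
    obtain ⟨i, hi, hi'⟩ := he v w h
    exact ⟨i, (hmem i x).2 ⟨v, hvx, hi⟩, (hmem i y).2 ⟨w, hwy, hi'⟩⟩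
  · intro x
    set A := {i | x ∈ (Set.toFinite {x | ∃ v ∈ B x, v ∈ X i}).toFinset} with hA
    have hsub : ∀ v ∈ B x, ∀ i, v ∈ X i → i ∈ A := fun v hvx i hi => (hmem i x).2 ⟨v, hvx, hi⟩
    have hone : ∀ v (hvx : v ∈ B x) i j (hi : v ∈ X i) (hj : v ∈ X j),
        (T.induce A).Reachable ⟨i, hsub v hvx i hi⟩ ⟨j, hsub v hvx j hj⟩ := by
      intro v hvx i j hi hj
      exact ((hc v).preconnected ⟨i, hi⟩ ⟨j, hj⟩).map
        (SimpleGraph.induceHomOfLE T (s := {i | v ∈ X i}) (s' := A) (fun i hi => hsub v hvx i hi)).toHom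
    -- The subtrees of two adjacent vertices share a node, so a walk inside the branch set connects
    -- the subtrees of all its vertices.
    have key : ∀ v w (hvx : v ∈ B x) (i : I) (hi : v ∈ X i),
        Relation.ReflTransGen (fun p q => G.Adj p q ∧ q ∈ B x) v w →
        ∃ hw : w ∈ B x, ∀ j (hj : w ∈ X j),
          (T.induce A).Reachable ⟨i, hsub v hvx i hi⟩ ⟨j, hsub w hw j hj⟩ := by
      intro v w hvx i hi h
      induction h with
      | refl => exact ⟨hvx, fun j hj => hone v hvx i j hi hj⟩
      | tail _ h ih =>
        obtain ⟨hw, ih⟩ := ih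
        refine ⟨h.2, fun j hj => ?_⟩
        obtain ⟨l, hl, hl'⟩ := he _ _ h.1
        exact (ih l hl).trans (hone _ h.2 l j hl' hj)
    have : Nonempty A := by
      obtain ⟨v, hvx⟩ := hne x
      obtain ⟨i, hi⟩ := hv v
      exact ⟨i, hsub v hvx i hi⟩
    refine ⟨?_⟩
    rintro ⟨i, hi⟩ ⟨j, hj⟩
    obtain ⟨v, hvx, hvi⟩ := (hmem i x).1 hi
    obtain ⟨w, hwx, hwj⟩ := (hmem j x).1 hj
    exact (key v w hvx i hvi (hconn x v hvx w hwx)).2 j hwj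
  · intro i
    refine le_trans ?_ (hk i)
    -- Each branch set in the new bag is represented by a vertex of the old bag; disjointness makes
    -- this choice injective.
    have : ∀ x, ∃ v, x ∈ (Set.toFinite {x | ∃ v ∈ B x, v ∈ X i}).toFinset → v ∈ B x ∧ v ∈ X i := by
      intro x
      by_cases hx : x ∈ (Set.toFinite {x | ∃ v ∈ B x, v ∈ X i}).toFinset
      · obtain ⟨v, h1, h2⟩ := (hmem i x).1 hx
        exact ⟨v, fun _ => ⟨h1, h2⟩⟩
      · obtain ⟨v, _⟩ := hne x
        exact ⟨v, fun h => absurd h hx⟩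
    choose f hf using this
    refine Finset.card_le_card_of_injOn f (fun x hx => (hf x hx).2) fun x hx y hy hxy => ?_
    exact hdisj x y (f x) (hf x hx).1 (hxy ▸ (hf y hy).1)

/-- Treewidth does not increase under taking subgraphs on a subset of the vertices. -/
theorem TreewidthLE.of_injective [Finite V'] (hG : TreewidthLE G k) (f : V' → V)
    (hf : Function.Injective f) (h : ∀ x y, G'.Adj x y → G.Adj (f x) (f y)) :
    TreewidthLE G' k := by
  refine hG.of_branchSets (fun x => {f x}) (fun x => ⟨f x, rfl⟩) ?_ ?_
    fun x y hxy => ⟨_, rfl, _, rfl, h x y hxy⟩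
  · rintro x y v rfl h
    exact hf h
  · rintro x v rfl w rfl
    exact .refl

/-- In a tree, the unique path from the root to a node of a subtree runs through the node of the
subtree which is nearest to the root. -/
theorem exists_isPath_through {I : Type} {T : SimpleGraph I} (hT : T.IsTree) {A : Set I}
    (hA : (T.induce A).Preconnected) (r : I) {t i : I} (ht : t ∈ A) (hi : i ∈ A)
    (hmin : ∀ j ∈ A, T.dist r t ≤ T.dist r j) :
    ∃ (p : T.Walk r t) (q : T.Walk t i), (p.append q).IsPath ∧ p.length = T.dist r t ∧
      ∀ j ∈ q.support, j ∈ A := by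
  classical
  obtain ⟨p, hp, hpl⟩ := hT.connected.exists_path_of_dist r t
  obtain ⟨w⟩ := hA ⟨t, ht⟩ ⟨i, hi⟩
  let w' : T.Walk t i := w.map (SimpleGraph.Embedding.induce A).toHom
  have hw' : ∀ j ∈ w'.support, j ∈ A := by
    intro j hj
    rw [show w'.support = w.support.map Subtype.val from SimpleGraph.Walk.support_map _ _] at hj
    obtain ⟨x, _, rfl⟩ := List.mem_map.1 hj
    exact x.2
  refine ⟨p, w'.bypass, ?_, hpl, fun j hj => hw' j (w'.support_bypass_subset_support hj)⟩
  have hq := w'.bypass_isPath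
  rw [SimpleGraph.Walk.isPath_def] at hp hq ⊢
  rw [SimpleGraph.Walk.support_append, List.nodup_append']
  refine ⟨hp, hq.sublist (List.tail_sublist _), fun j hj hj' => ?_⟩
  have hjA : j ∈ A := hw' j (w'.support_bypass_subset_support (List.mem_of_mem_tail hj'))
  have hjt : j ≠ t := by
    rintro rfl
    have : w'.bypass.support = j :: w'.bypass.support.tail := by simp
    rw [this] at hq
    exact (List.nodup_cons.1 hq).1 hj'
  have h1 := hmin j hjA
  have h2 : T.dist r j ≤ (p.takeUntil j hj).length := SimpleGraph.dist_le _
  have h3 := congrArg SimpleGraph.Walk.length (p.take_spec hj)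
  rw [SimpleGraph.Walk.length_append] at h3
  have h4 : (p.dropUntil j hj).length ≠ 0 := fun h =>
    hjt (SimpleGraph.Walk.eq_of_length_eq_zero h)
  omega

/-- A nonempty graph of treewidth at most `k` has a vertex with at most `k` neighbours. -/
theorem TreewidthLE.exists_degree_le [Finite V] [Nonempty V] (hG : TreewidthLE G k) :
    ∃ (v : V) (N : Finset V), N.card ≤ k ∧ ∀ w, G.Adj v w → w ∈ N := by
  classical
  obtain ⟨I, hI, T, X, hT, hv, he, hc, hk⟩ := hG
  have : Nonempty I := hT.connected.nonempty
  obtain ⟨r⟩ := this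
  have htop : ∀ v, ∃ t, v ∈ X t ∧ ∀ j, v ∈ X j → T.dist r t ≤ T.dist r j := by
    intro v
    obtain ⟨t, ht⟩ := Set.exists_min_image {i | v ∈ X i} (T.dist r) (Set.toFinite _) (hv v)
    exact ⟨t, ht⟩
  choose top htop hmin using htop
  -- With the tree rooted at `r`, choose a vertex whose topmost node is farthest from the root; its
  -- neighbours all lie in the bag of that node.
  obtain ⟨v, hvmax⟩ := Finite.exists_max (fun v => T.dist r (top v))
  refine ⟨v, (X (top v)).erase v, ?_, fun w hw => ?_⟩
  · rw [Finset.card_erase_of_mem (htop v)]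
    have := hk (top v)
    omega
  · rw [Finset.mem_erase]
    refine ⟨hw.ne', ?_⟩
    obtain ⟨i, hvi, hwi⟩ := he v w hw
    obtain ⟨p, q, hpq, hp, hq⟩ := exists_isPath_through hT (hc v).preconnected r (htop v) hvi
      (hmin v)
    obtain ⟨p', q', hpq', hp', hq'⟩ := exists_isPath_through hT (hc w).preconnected r (htop w) hwi
      (hmin w)
    -- The two paths from `r` to the common node `i` coincide. At the depth of `top v` the path is
    -- at `top v`; as `top w` is at most that deep, this node belongs to the subtree of `w`.
    have h := congrArg (fun p : T.Path r i => p.1.getVert (T.dist r (top v)))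
      ((hT.isAcyclic.subsingleton_path r i).elim ⟨_, hpq⟩ ⟨_, hpq'⟩)
    simp only [SimpleGraph.Walk.getVert_append, hp, hp'] at h
    rw [if_neg (lt_irrefl _), if_neg (not_lt.2 (hvmax w)), Nat.sub_self,
      SimpleGraph.Walk.getVert_zero] at h
    rw [h]
    exact hq' _ (SimpleGraph.Walk.getVert_mem_support _ _)

end Treewidth

/-! ### Four-regular multigraphs of treewidth two -/

section Multiplicities

open Classical in
/-- The number of edges of a multigraph which leave a set of vertices. -/
noncomputable def cutSize {V : Type} [Fintype V] (m : V → V → ℕ) (p : V → Prop) : ℕ :=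
  ∑ u, ∑ w, if p u ∧ ¬ p w then m u w else 0

/-- The simple graph which underlies a multigraph given by its multiplicities. -/
def multiplicityGraph {V : Type} (m : V → V → ℕ) : SimpleGraph V :=
  SimpleGraph.fromRel fun v w => m v w ≠ 0

/-- The two degrees add up to eight, and the edges between `x` and `z` are counted in both. -/
theorem cutSize_pair {V : Type} [Fintype V] (m : V → V → ℕ) (hsymm : ∀ x y, m x y = m y x)
    (hdiag : ∀ x, m x x = 0) (hrow : ∀ x, ∑ y, m x y = 4) {x z : V} (hxz : x ≠ z) :
    cutSize m (fun u => u = x ∨ u = z) + 2 * m x z = 8 := by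
  classical
  have h1 : cutSize m (fun u => u = x ∨ u = z) =
      ∑ u, ((if u = x then ∑ w, (if ¬ (w = x ∨ w = z) then m x w else 0) else 0) +
        (if u = z then ∑ w, (if ¬ (w = x ∨ w = z) then m z w else 0) else 0)) := by
    refine Finset.sum_congr rfl fun u _ => ?_
    by_cases h1 : u = x
    · subst h1
      simp [hxz]
    · by_cases h2 : u = z
      · subst h2
        simp [hxz.symm]
      · simp [h1, h2]
  have h2 : ∀ v, ∑ w, m v w = (∑ w, if ¬ (w = x ∨ w = z) then m v w else 0) +
      ∑ w, ((if w = x then m v x else 0) + (if w = z then m v z else 0)) := by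
    intro v
    rw [← Finset.sum_add_distrib]
    refine Finset.sum_congr rfl fun w _ => ?_
    by_cases h1 : w = x
    · subst h1
      simp [hxz]
    · by_cases h2 : w = z
      · subst h2
        simp [hxz.symm]
      · simp [h1, h2]
  have hx := h2 x
  have hz := h2 z
  rw [hrow, Finset.sum_add_distrib, Finset.sum_ite_eq' Finset.univ, Finset.sum_ite_eq' Finset.univ] at hx hz
  rw [h1, Finset.sum_add_distrib, Finset.sum_ite_eq' Finset.univ, Finset.sum_ite_eq' Finset.univ]
  simp only [Finset.mem_univ, if_true, hdiag, hsymm z x] at hx hz ⊢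
  omega

/-- Removal of a vertex `x` whose edges lead, two each, to `y` and `z`. -/
noncomputable def suppress {V : Type} (m : V → V → ℕ) {x : V} (y z : {v : V // v ≠ x}) :
    {v : V // v ≠ x} → {v : V // v ≠ x} → ℕ :=
  open Classical in
  fun u w => m u w + ((if u = y ∧ w = z then 2 else 0) + (if u = z ∧ w = y then 2 else 0))

section Suppress

variable {V : Type} [Fintype V] (m : V → V → ℕ)

open Classical in
theorem suppress_row (hsymm : ∀ x y, m x y = m y x) (hrow : ∀ x, ∑ y, m x y = 4) {x : V}
    {y z : {v : V // v ≠ x}} (hyz : y ≠ z)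
    (hx : ∀ w : {v : V // v ≠ x}, m x w = (if w = y then 2 else 0) + (if w = z then 2 else 0))
    (u : {v : V // v ≠ x}) :
    ∑ w, suppress m y z u w = 4 := by
  have h := hrow u
  rw [Fintype.sum_eq_add_sum_subtype_ne _ x, hsymm, hx] at h
  rw [← h]
  simp only [suppress, Finset.sum_add_distrib]
  rw [add_comm]
  congr 1
  by_cases h1 : u = y
  · subst h1
    simp [hyz]
  by_cases h2 : u = z
  · subst h2
    simp [h1]
  · simp [h1, h2]

open Classical in
-- If `y` and `z` are on the same side, `x` joins them and nothing changes. Otherwise `x` lies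
-- outside `p`, and its two edges to the neighbour in `p` correspond to the two new edges.
theorem cutSize_suppress (hsymm : ∀ x y, m x y = m y x) {x : V}
    {y z : {v : V // v ≠ x}} (hyz : y ≠ z)
    (hx : ∀ w : {v : V // v ≠ x}, m x w = (if w = y then 2 else 0) + (if w = z then 2 else 0))
    (p : V → Prop) (hp : p x ↔ p y ∧ p z) :
    cutSize (suppress m y z) (fun u => p u.1) = cutSize m p := by
  unfold cutSize
  rw [Fintype.sum_eq_add_sum_subtype_ne _ x]
  simp_rw [Fintype.sum_eq_add_sum_subtype_ne (fun w => if p _ ∧ ¬ p w then m _ w else 0) x]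
  rw [Finset.sum_add_distrib]
  have e1 : ∀ u : {v : V // v ≠ x}, ∑ w : {v : V // v ≠ x},
      (if p u.1 ∧ ¬ p w.1 then suppress m y z u w else 0) =
      (∑ w : {v : V // v ≠ x}, if p u.1 ∧ ¬ p w.1 then m u.1 w.1 else 0) +
      ((if u = y then (if p y.1 ∧ ¬ p z.1 then 2 else 0) else 0) +
      (if u = z then (if p z.1 ∧ ¬ p y.1 then 2 else 0) else 0)) := by
    intro u
    have : ∀ w : {v : V // v ≠ x}, (if p u.1 ∧ ¬ p w.1 then suppress m y z u w else 0) =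
      (if p u.1 ∧ ¬ p w.1 then m u.1 w.1 else 0) +
      ((if w = z then (if u = y then (if p y.1 ∧ ¬ p z.1 then 2 else 0) else 0) else 0) +
      (if w = y then (if u = z then (if p z.1 ∧ ¬ p y.1 then 2 else 0) else 0) else 0)) := by
      intro w
      unfold suppress
      by_cases h3 : u = y
      · subst h3
        by_cases h2 : w = z
        · subst h2
          by_cases hp : p u.1 ∧ ¬ p w.1 <;> simp [hp, hyz, hyz.symm]
        · simp [h2, hyz]
      by_cases h4 : u = z
      · subst h4
        by_cases h1 : w = y
        · subst h1
          by_cases hp : p u.1 ∧ ¬ p w.1 <;> simp [hp, hyz, hyz.symm]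
        · simp [h1, h3]
      · simp [h3, h4]
    rw [Finset.sum_congr rfl fun w _ => this w, Finset.sum_add_distrib, Finset.sum_add_distrib,
      Finset.sum_ite_eq' Finset.univ, Finset.sum_ite_eq' Finset.univ]
    simp
  have e2 : ∑ w : {v : V // v ≠ x}, (if p x ∧ ¬ p w.1 then m x w.1 else 0) = 0 := by
    refine Finset.sum_eq_zero fun w _ => ?_
    rw [hx]
    by_cases h1 : w = y
    · subst h1
      rw [if_neg fun h => h.2 (hp.1 h.1).1]
    by_cases h2 : w = z
    · subst h2
      rw [if_neg fun h => h.2 (hp.1 h.1).2]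
    · simp [h1, h2]
  have e3 : ∑ u : {v : V // v ≠ x}, (if p u.1 ∧ ¬ p x then m u.1 x else 0) =
      (if p y.1 ∧ ¬ p x then 2 else 0) + (if p z.1 ∧ ¬ p x then 2 else 0) := by
    have : ∀ u : {v : V // v ≠ x}, (if p u.1 ∧ ¬ p x then m u.1 x else 0) =
        (if u = y then (if p y.1 ∧ ¬ p x then 2 else 0) else 0) +
        (if u = z then (if p z.1 ∧ ¬ p x then 2 else 0) else 0) := by
      intro u
      rw [hsymm, hx]
      by_cases h1 : u = y
      · subst h1
        simp [hyz]
      by_cases h2 : u = z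
      · subst h2
        simp [h1]
      · simp [h1, h2]
    rw [Finset.sum_congr rfl fun w _ => this w, Finset.sum_add_distrib,
      Finset.sum_ite_eq' Finset.univ, Finset.sum_ite_eq' Finset.univ]
    simp
  rw [Finset.sum_congr rfl fun u _ => e1 u, Finset.sum_add_distrib, Finset.sum_add_distrib,
      Finset.sum_ite_eq' Finset.univ, Finset.sum_ite_eq' Finset.univ, e2, e3]
  simp only [Finset.mem_univ, if_true]
  by_cases h1 : p y <;> by_cases h2 : p z <;> simp [h1, h2, hp, add_comm]

end Suppress

/-- In a four-regular multigraph without loops, of treewidth at most two and without cuts of at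
most two edges, all multiplicities are even. -/
theorem even_multiplicity (n : ℕ) : ∀ (V : Type) [Fintype V], Fintype.card V = n →
    ∀ m : V → V → ℕ, (∀ x y, m x y = m y x) → (∀ x, m x x = 0) → (∀ x, ∑ y, m x y = 4) →
    (∀ p : V → Prop, (∃ x, p x) → (∃ x, ¬ p x) → 3 ≤ cutSize m p) →
    TreewidthLE (multiplicityGraph m) 2 → ∀ x y, Even (m x y) := by
  classical
  induction n with
  | zero =>
    intro V _ hV m _ _ _ _ _ x
    exact ((Fintype.card_eq_zero_iff.1 hV).false x).elim
  | succ n ih =>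
    intro V _ hV m hsymm hdiag hrow hcut htw x₀ y₀
    have : Nonempty V := ⟨x₀⟩
    obtain ⟨x, N, hN, hxN⟩ := htw.exists_degree_le
    have hN0 : ∀ w, w ∉ N → m x w = 0 := by
      intro w hw
      by_contra h
      refine hw (hxN w ?_)
      rw [multiplicityGraph, SimpleGraph.fromRel_adj]
      exact ⟨by rintro rfl; exact h (hdiag x), Or.inl h⟩
    -- If all four edges at `x` lead to `y`, no edge leaves the pair, so it is the whole graph.
    have hpair : ∀ y, m x y = 4 → Even (m x₀ y₀) := by
      intro y hy
      have hxy : x ≠ y := by rintro rfl; rw [hdiag] at hy; omega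
      have h := cutSize_pair m hsymm hdiag hrow hxy
      have hall : ∀ v, v = x ∨ v = y := by
        by_contra! hv
        obtain ⟨v, hv⟩ := hv
        have := hcut (fun u => u = x ∨ u = y) ⟨x, Or.inl rfl⟩ ⟨v, by simp [hv]⟩
        omega
      have hy' := hsymm x y
      rw [hy] at hy'
      rcases hall x₀ with h1 | h1 <;> rcases hall y₀ with h2 | h2 <;> rw [h1, h2]
      · simp [hdiag]
      · rw [hy]; decide
      · rw [← hy']; decide
      · simp [hdiag]
    have hsum : ∑ w ∈ N, m x w = 4 := by
      rw [← hrow x]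
      exact Finset.sum_subset (Finset.subset_univ _) fun w _ hw => hN0 w hw
    obtain ⟨y, z, hyz, hy, hz, h0⟩ : (∃ y z, y ≠ z ∧ m x y = 2 ∧ m x z = 2 ∧
        ∀ w, w ≠ y → w ≠ z → m x w = 0) ∨ Even (m x₀ y₀) := by
      interval_cases hc : N.card
      · simp [Finset.card_eq_zero.1 hc] at hsum
      · obtain ⟨y, rfl⟩ := Finset.card_eq_one.1 hc
        exact Or.inr (hpair y (by simpa using hsum))
      · obtain ⟨y, z, hyz, rfl⟩ := Finset.card_eq_two.1 hc
        rw [Finset.sum_pair hyz] at hsum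
        -- Multiplicities one and three would leave a cut of two edges around `x` and `z`.
        have key : ∀ y z, y ≠ z → m x y = 1 → m x z = 3 → False := by
          intro y z hyz hy hz
          have hxz : x ≠ z := by rintro rfl; rw [hdiag] at hz; omega
          have hxy : x ≠ y := by rintro rfl; rw [hdiag] at hy; omega
          have h := cutSize_pair m hsymm hdiag hrow hxz
          have := hcut (fun u => u = x ∨ u = z) ⟨x, Or.inl rfl⟩ ⟨y, by simp [hxy.symm, hyz]⟩
          omega
        have : m x y = 0 ∨ m x y = 1 ∨ m x y = 2 ∨ m x y = 3 ∨ m x y = 4 := by omega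
        rcases this with h | h | h | h | h
        · exact Or.inr (hpair z (by omega))
        · exact (key y z hyz h (by omega)).elim
        · exact Or.inl ⟨y, z, hyz, h, by omega, fun w h1 h2 => hN0 w (by simp [h1, h2])⟩
        · exact (key z y hyz.symm (by omega) h).elim
        · exact Or.inr (hpair y h)
    swap
    · assumption
    have hyx : y ≠ x := by rintro rfl; rw [hdiag] at hy; omega
    have hzx : z ≠ x := by rintro rfl; rw [hdiag] at hz; omega
    let y' : {v : V // v ≠ x} := ⟨y, hyx⟩
    let z' : {v : V // v ≠ x} := ⟨z, hzx⟩
    have hyz' : y' ≠ z' := fun h => hyz (congrArg Subtype.val h)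
    have hx : ∀ w : {v : V // v ≠ x},
        m x w = (if w = y' then 2 else 0) + (if w = z' then 2 else 0) := by
      rintro ⟨w, hw⟩
      by_cases h1 : w = y
      · subst h1; simp [y', z', hy, hyz]
      by_cases h2 : w = z
      · subst h2; simp [y', z', hz, h1]
      · simp [y', z', h1, h2, h0 w h1 h2]
    have hev := ih {v : V // v ≠ x} (by simp [Fintype.card_subtype_compl, hV])
      (suppress m y' z')
      (fun u w => by
        unfold suppress
        rw [hsymm u w, add_comm (if u = y' ∧ w = z' then 2 else 0)]
        simp only [and_comm])
      (fun u => by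
        unfold suppress
        have h1 : ¬ (u = y' ∧ u = z') := fun h => hyz' (h.1.symm.trans h.2)
        have h2 : ¬ (u = z' ∧ u = y') := fun h => hyz' (h.2.symm.trans h.1)
        simp only [hdiag, h1, h2, if_false])
      (suppress_row m hsymm hrow hyz' hx)
      (by
        rintro p ⟨u, hu⟩ ⟨w, hw⟩
        -- The side of `x` is chosen such that the cut has the same size before suppression.
        let q : V → Prop := fun v => if h : v ≠ x then p ⟨v, h⟩ else p y' ∧ p z'
        have hq : ∀ u : {v : V // v ≠ x}, q u.1 ↔ p u := fun u => by simp [q, u.2]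
        have hqx : q x ↔ q y' ∧ q z' := by rw [hq, hq]; simp [q]
        have := cutSize_suppress m hsymm hyz' hx q hqx
        rw [show (fun u : {v : V // v ≠ x} => q u.1) = p from funext fun u => propext (hq u)] at this
        rw [this]
        exact hcut q ⟨u, (hq u).2 hu⟩ ⟨w, fun h => hw ((hq w).1 h)⟩)
      (by
        have hxy : (multiplicityGraph m).Adj x y := by
          rw [multiplicityGraph, SimpleGraph.fromRel_adj]; exact ⟨hyx.symm, Or.inl (by omega)⟩
        have hxz : (multiplicityGraph m).Adj x z := by
          rw [multiplicityGraph, SimpleGraph.fromRel_adj]; exact ⟨hzx.symm, Or.inl (by omega)⟩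
        -- The suppressed graph is a minor: `x` is contracted into `y`.
        refine htw.of_branchSets (fun u => {v | v = u.1 ∨ v = x ∧ u = y'}) (fun u => ⟨u.1, Or.inl rfl⟩)
          ?_ ?_ ?_
        · rintro u w v (rfl | ⟨rfl, rfl⟩) (h | ⟨h, rfl⟩)
          · exact Subtype.ext h
          · exact (u.2 h).elim
          · exact (w.2 h.symm).elim
          · rfl
        · rintro u v (rfl | ⟨rfl, rfl⟩) w (rfl | ⟨rfl, h⟩)
          · exact .refl
          · subst h
            exact .single ⟨hxy.symm, Or.inr ⟨rfl, rfl⟩⟩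
          · exact .single ⟨hxy, Or.inl rfl⟩
          · exact .refl
        · intro u w huw
          rw [multiplicityGraph, SimpleGraph.fromRel_adj] at huw
          obtain ⟨hne, h⟩ := huw
          have key : ∀ u w : {v : V // v ≠ x}, u ≠ w → suppress m y' z' u w ≠ 0 →
              (multiplicityGraph m).Adj u.1 w.1 ∨ (u = y' ∧ w = z') ∨ (u = z' ∧ w = y') := by
            intro u w huw h
            by_cases h1 : u = y' ∧ w = z'
            · exact Or.inr (Or.inl h1)
            by_cases h2 : u = z' ∧ w = y'
            · exact Or.inr (Or.inr h2)
            left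
            unfold suppress at h
            rw [if_neg h1, if_neg h2] at h
            rw [multiplicityGraph, SimpleGraph.fromRel_adj]
            exact ⟨fun h => huw (Subtype.ext h), Or.inl h⟩
          have : (multiplicityGraph m).Adj u.1 w.1 ∨ (u = y' ∧ w = z') ∨ (u = z' ∧ w = y') := by
            rcases h with h | h
            · exact key u w hne h
            · rcases key w u hne.symm h with h | h | h
              · exact Or.inl h.symm
              · exact Or.inr (Or.inr h.symm)
              · exact Or.inr (Or.inl h.symm)
          rcases this with h | ⟨rfl, rfl⟩ | ⟨rfl, rfl⟩
          · exact ⟨_, Or.inl rfl, _, Or.inl rfl, h⟩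
          · exact ⟨x, Or.inr ⟨rfl, rfl⟩, z, Or.inl rfl, hxz⟩
          · exact ⟨z, Or.inl rfl, x, Or.inr ⟨rfl, rfl⟩, hxz.symm⟩)
    have hxev : ∀ w, Even (m x w) := by
      intro w
      by_cases h1 : w = y
      · subst h1; simp [hy]
      by_cases h2 : w = z
      · subst h2; simp [hz]
      · simp [h0 w h1 h2]
    by_cases h1 : x₀ = x
    · subst h1; exact hxev _
    by_cases h2 : y₀ = x
    · subst h2; rw [hsymm]; exact hxev _
    -- Away from `x`, suppression changes multiplicities by zero or two, so parity is preserved.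
    have h := hev ⟨x₀, h1⟩ ⟨y₀, h2⟩
    unfold suppress at h
    rw [Nat.even_add] at h
    refine h.2 ?_
    split_ifs <;> decide

end Multiplicities

/-! ### Closed plane four-regular maps of treewidth two -/

theorem sum_zmod_four {M : Type*} [AddCommMonoid M] (g : ZMod 4 → M) (i : ZMod 4) :
    ∑ l, g l = g i + g (i + 1) + g (i + 2) + g (i + 3) := by
  rw [← Equiv.sum_comp (Equiv.addLeft i) g]
  refine (Fin.sum_univ_four (fun l : ZMod 4 => g (i + l))).trans ?_
  simp only [show ((0 : Fin 4) : ZMod 4) = (0 : ZMod 4) from rfl, show ((1 : Fin 4) : ZMod 4) = (1 : ZMod 4) from rfl,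
    show ((2 : Fin 4) : ZMod 4) = (2 : ZMod 4) from rfl, show ((3 : Fin 4) : ZMod 4) = (3 : ZMod 4) from rfl]
  exact congrArg (fun z => g z + g (i + 1) + g (i + 2) + g (i + 3)) (add_zero i)

/-- If all values of a function on four ends are taken an even number of times, then the ends
are paired. -/
theorem pairing_of_even {V : Type*} [DecidableEq V] (f : ZMod 4 → V)
    (hf : ∀ y, Even (∑ i, if f i = y then 1 else 0)) (i : ZMod 4) :
    (f i = f (i + 1) → f (i + 2) = f (i + 3)) ∧ (f i = f (i + 2) → f (i + 1) = f (i + 3)) ∧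
      (f i = f (i + 1) ∨ f i = f (i + 2) ∨ f i = f (i + 3)) := by
  have key : ∀ y, Even ((if f i = y then 1 else 0) + (if f (i + 1) = y then 1 else 0) +
      (if f (i + 2) = y then 1 else 0) + (if f (i + 3) = y then 1 else 0)) := fun y => by
    rw [← sum_zmod_four (fun i => if f i = y then 1 else 0) i]
    exact hf y
  refine ⟨fun h => ?_, fun h => ?_, ?_⟩
  · have := key (f (i + 2))
    rw [h] at this
    by_contra h'
    rw [if_pos rfl, if_neg (Ne.symm h')] at this
    split_ifs at this <;> exact absurd this (by decide)
  · have := key (f (i + 1))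
    rw [h] at this
    by_contra h'
    rw [if_pos rfl, if_neg (Ne.symm h')] at this
    split_ifs at this <;> exact absurd this (by decide)
  · have := key (f i)
    by_contra! h'
    rw [if_pos rfl, if_neg h'.1.symm, if_neg h'.2.1.symm, if_neg h'.2.2.symm] at this
    exact absurd this (by decide)

/-- A four-regular map all of whose components are spheres (flows modulo two have potentials).
The map `E` gives the other end of a dart. -/
structure PlaneMap {V : Type} (E : V × ZMod 4 → V × ZMod 4) : Prop where
  invol : ∀ d, E (E d) = d
  exists_potential : ∀ h : V × ZMod 4 → ZMod 2, (∀ d, h (E d) = h d) →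
    (∀ c, h (c, 0) + h (c, 1) + h (c, 2) + h (c, 3) = 0) →
    ∃ φ : V × ZMod 4 → ZMod 2, (∀ d, φ ((E d).1, (E d).2 + 1) = φ d) ∧
      ∀ d, h d = φ d + φ (d.1, d.2 + 1)

/-- A checkerboard colouring of the faces. -/
theorem PlaneMap.exists_checkerboard {V : Type} {E : V × ZMod 4 → V × ZMod 4} (hE : PlaneMap E) :
    ∃ χ : V × ZMod 4 → ZMod 2,
      (∀ d, χ (E d) = χ d + 1) ∧ ∀ c i, χ (c, i + 1) = χ (c, i) + 1 := by
  obtain ⟨φ, h1, h2⟩ := hE.exists_potential (fun _ => 1) (fun _ => rfl) (fun _ => by decide)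
  have h3 : ∀ c i, φ (c, i + 1) = φ (c, i) + 1 := fun c i =>
    (by decide : ∀ a b : ZMod 2, 1 = a + b → b = a + 1) _ _ (h2 (c, i))
  refine ⟨φ, fun d => ?_, h3⟩
  have := h1 d
  rw [h3] at this
  exact (by decide : ∀ a b : ZMod 2, a + 1 = b → a = b + 1) _ _ this

/-- A plane four-regular map without loops, of treewidth at most two, such that every cut has at
least three edges. -/
structure ClosedPlaneMap {V : Type} (E : V × ZMod 4 → V × ZMod 4) : Prop extends PlaneMap E where
  loopless : ∀ d, (E d).1 ≠ d.1
  cut : ∀ p : V → Prop, (∃ x, p x) → (∃ x, ¬ p x) →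
    ¬ ∃ d₁ d₂, ∀ d, p d.1 → ¬ p (E d).1 → d = d₁ ∨ d = d₂
  treewidth : TreewidthLE (SimpleGraph.fromRel fun v w => ∃ i, (E (v, i)).1 = w) 2

namespace ClosedPlaneMap

variable {V : Type} {E : V × ZMod 4 → V × ZMod 4}

theorem injective (hE : ClosedPlaneMap E) : Function.Injective E :=
  Function.Involutive.injective hE.invol

/-- Translation of `even_multiplicity` to darts: `m x y` counts the darts from `x` to `y`. It is
symmetric because `E` is an involution, and its cuts count outgoing darts. -/
theorem even [Fintype V] [DecidableEq V] (hE : ClosedPlaneMap E) (x y : V) :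
    Even (∑ i, if (E (x, i)).1 = y then 1 else 0) := by
  let m : V → V → ℕ := fun x y => ∑ i, if (E (x, i)).1 = y then 1 else 0
  have hm : ∀ x y, m x y = ∑ i, ∑ j, if E (x, i) = (y, j) then 1 else 0 := by
    intro x y
    refine Finset.sum_congr rfl fun i _ => ?_
    by_cases h : (E (x, i)).1 = y
    · subst h
      rw [if_pos rfl, Finset.sum_eq_single (E (x, i)).2]
      · simp
      · intro j _ hj
        rw [if_neg]
        intro h
        exact hj (by rw [h])
      · simp
    · rw [if_neg h, Finset.sum_eq_zero]
      intro j _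
      rw [if_neg]
      intro h'
      exact h (by rw [h'])
  refine even_multiplicity _ V rfl m ?_ ?_ ?_ ?_ ?_ x y
  · intro x y
    rw [hm, hm, Finset.sum_comm]
    refine Finset.sum_congr rfl fun j _ => Finset.sum_congr rfl fun i _ => ?_
    refine if_congr ⟨fun h => ?_, fun h => ?_⟩ rfl rfl <;> rw [← h, hE.invol]
  · intro x
    exact Finset.sum_eq_zero fun i _ => if_neg (hE.loopless (x, i))
  · intro x
    simp only [m]
    rw [Finset.sum_comm]
    simp [ZMod.card]
  · intro p hp hp'
    by_contra hlt
    classical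
    let F : Finset (V × ZMod 4) := Finset.univ.filter fun d => p d.1 ∧ ¬ p (E d).1
    have hF : F.card = cutSize m p := by
      simp only [F, Finset.card_filter, cutSize, m]
      rw [Fintype.sum_prod_type]
      refine Finset.sum_congr rfl fun u _ => ?_
      have : ∀ w, (if p u ∧ ¬ p w then ∑ i, (if (E (u, i)).1 = w then 1 else 0) else 0) =
          ∑ i, (if (E (u, i)).1 = w then (if p u ∧ ¬ p (E (u, i)).1 then 1 else 0) else 0) := by
        intro w
        by_cases h : p u ∧ ¬ p w
        · rw [if_pos h]
          refine Finset.sum_congr rfl fun i _ => ?_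
          split_ifs with h1 h2
          · rfl
          · subst h1; exact (h2 h).elim
          · rfl
        · rw [if_neg h, Finset.sum_eq_zero]
          intro i _
          split_ifs with h1 h2
          · subst h1; exact (h h2).elim
          · rfl
          · rfl
      rw [Finset.sum_congr rfl fun w _ => this w, Finset.sum_comm]
      simp
    obtain ⟨x, hx⟩ := hp
    refine hE.cut p ⟨x, hx⟩ hp' ?_
    have hle : F.card ≤ 2 := by omega
    have hmem : ∀ d, p d.1 → ¬ p (E d).1 → d ∈ F := fun d h1 h2 => by simp [F, h1, h2]
    interval_cases hc : F.card
    · rw [Finset.card_eq_zero] at hc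
      exact ⟨(x, 0), (x, 0), fun d h1 h2 => by have := hmem d h1 h2; simp [hc] at this⟩
    · obtain ⟨d₁, h⟩ := Finset.card_eq_one.1 hc
      exact ⟨d₁, d₁, fun d h1 h2 => by have := hmem d h1 h2; simp_all⟩
    · obtain ⟨d₁, d₂, _, h⟩ := Finset.card_eq_two.1 hc
      exact ⟨d₁, d₂, fun d h1 h2 => by have := hmem d h1 h2; simpa [h] using this⟩
  · refine hE.treewidth.of_injective id Function.injective_id fun x y hxy => ?_
    rw [multiplicityGraph, SimpleGraph.fromRel_adj] at hxy
    rw [SimpleGraph.fromRel_adj]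
    have key : ∀ x y, m x y ≠ 0 → ∃ i, (E (x, i)).1 = y := by
      intro x y h
      by_contra! h'
      exact h (Finset.sum_eq_zero fun i _ => if_neg (h' i))
    exact ⟨hxy.1, hxy.2.imp (key _ _) (key _ _)⟩

/-- The two edges form a cycle, whose indicator is a flow. Its potential distinguishes the two sides
of the cycle and plays the role of the Jordan curve theorem. -/
theorem exists_bigon_potential [DecidableEq V] (hE : ClosedPlaneMap E) {x y : V} {i i' l l' : ZMod 4}
    (h1 : E (x, i) = (y, l)) (h2 : E (x, i') = (y, l')) (hi : i ≠ i') :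
    ∃ φ : V × ZMod 4 → ZMod 2, (∀ d, φ ((E d).1, (E d).2 + 1) = φ d) ∧
      ∀ d, (if (d.1 = x ∧ (d.2 = i ∨ d.2 = i')) ∨ (d.1 = y ∧ (d.2 = l ∨ d.2 = l')) then 1 else 0) =
        φ d + φ (d.1, d.2 + 1) := by
  have hxy : y ≠ x := by
    have := hE.loopless (x, i)
    rwa [h1] at this
  have h1' : E (y, l) = (x, i) := by rw [← h1, hE.invol]
  have h2' : E (y, l') = (x, i') := by rw [← h2, hE.invol]
  have hl : l ≠ l' := by
    rintro rfl
    exact hi (by simpa using h1'.symm.trans h2')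
  have key : ∀ i i' : ZMod 4, i ≠ i' → (if (0 = i ∨ 0 = i') then (1 : ZMod 2) else 0) +
      (if (1 = i ∨ 1 = i') then 1 else 0) + (if (2 = i ∨ 2 = i') then 1 else 0) +
      (if (3 = i ∨ 3 = i') then 1 else 0) = 0 := by decide
  have hiff : ∀ d, ((d.1 = x ∧ (d.2 = i ∨ d.2 = i')) ∨ (d.1 = y ∧ (d.2 = l ∨ d.2 = l'))) ↔
      (d = (x, i) ∨ d = (x, i') ∨ d = (y, l) ∨ d = (y, l')) := by
    rintro ⟨c, j⟩
    simp only [Prod.mk.injEq]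
    tauto
  refine hE.exists_potential _ (fun d => if_congr ?_ rfl rfl) fun c => ?_
  · have hinv : ∀ d d', E d = d' ↔ d = E d' := fun d d' =>
      ⟨fun h => by rw [← h, hE.invol], fun h => by rw [h, hE.invol]⟩
    rw [hiff, hiff, hinv, hinv, hinv, hinv, h1, h2, h1', h2']
    tauto
  · by_cases hcx : c = x
    · subst hcx
      have := key i i' hi
      simpa [hxy.symm] using this
    by_cases hcy : c = y
    · subst hcy
      have := key l l' hl
      simpa [hxy] using this
    · simp [hcx, hcy]

theorem eq_of_const {φ : V × ZMod 4 → ZMod 2} {c : V} (h : ∀ i, φ (c, i) = φ (c, i + 1))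
    (i j : ZMod 4) : φ (c, i) = φ (c, j) := by
  have n1 : (1 : ZMod 4) + 1 = 2 := by decide
  have n2 : (2 : ZMod 4) + 1 = 3 := by decide
  have h1 := h i
  have h2 := h (i + 1)
  have h3 := h (i + 2)
  rw [add_assoc, n1] at h2
  rw [add_assoc, n2] at h3
  rcases Dart.eq_add_cases i j with rfl | rfl | rfl | rfl
  · rfl
  · exact h1
  · exact h1.trans h2
  · exact h1.trans (h2.trans h3)

/-- Opposite ends of a vertex are not paired. -/
theorem not_opposite (hE : ClosedPlaneMap E) {x : V} {i : ZMod 4}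
    (h1 : (E (x, i)).1 = (E (x, i + 2)).1) (h2 : (E (x, i + 1)).1 = (E (x, i + 3)).1) :
    (E (x, i)).1 = (E (x, i + 1)).1 := by
  classical
  by_contra hne
  -- The cycle through the ends `i` and `i + 2` separates the ends `i + 1` and `i + 3`; yet both
  -- lead to the same vertex off the cycle.
  obtain ⟨φ, hφ, hf⟩ := hE.exists_bigon_potential (x := x) (y := (E (x, i)).1) (i := i)
    (i' := i + 2) (l := (E (x, i)).2) (l' := (E (x, i + 2)).2) rfl (by rw [h1])
    (by simpa using (show (2 : ZMod 4) ≠ 0 by decide))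
  have n2 : (2 : ZMod 4) + 1 = 3 := by decide
  have n1 : (1 : ZMod 4) + 1 = 2 := by decide
  have hy := hE.loopless (x, i)
  have hz := hE.loopless (x, i + 1)
  have f1 := hf (x, i + 1)
  have f2 := hf (x, i + 2)
  rw [if_neg (by simp [hy.symm, show (1 : ZMod 4) ≠ 0 by decide, show (1 : ZMod 4) ≠ 2 by decide]),
    add_assoc, n1] at f1
  rw [if_pos (by simp), add_assoc, n2] at f2
  have hc : ∀ j, φ ((E (x, i + 1)).1, j) = φ ((E (x, i + 1)).1, j + 1) := fun j => by
    have := hf ((E (x, i + 1)).1, j)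
    rw [if_neg (by simp only [not_or, not_and]; exact ⟨fun h => (hz h).elim, fun h => (hne h.symm).elim⟩)] at this
    exact CharTwo.add_eq_zero.1 this.symm
  have g1 := hφ (x, i + 1)
  have g2 := hφ (x, i + 3)
  rw [← h2, eq_of_const hc _ ((E (x, i + 1)).2 + 1), g1] at g2
  rw [← CharTwo.add_eq_zero.1 f1.symm, g2, add_self_zmod] at f2
  exact absurd f2 (by decide)

/-- Two consecutive ends which lead to the same vertex bound a face with two sides. -/
theorem bigon (hE : ClosedPlaneMap E) {x y : V} {i l l' : ZMod 4} (h1 : E (x, i) = (y, l))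
    (h2 : E (x, i + 1) = (y, l')) : l = l' + 1 := by
  classical
  have n1 : (1 : ZMod 4) + 1 = 2 := by decide
  have n2 : (2 : ZMod 4) + 1 = 3 := by decide
  have n3 : (3 : ZMod 4) + 1 = 0 := by decide
  have hxy : y ≠ x := by
    have := hE.loopless (x, i)
    rwa [h1] at this
  obtain ⟨χ, hχ, hχr⟩ := hE.exists_checkerboard
  rcases Dart.eq_add_cases l l' with rfl | rfl | rfl | rfl
  · have := hE.injective (h1.trans h2.symm)
    exact absurd (add_left_cancel ((add_zero i).trans (congrArg Prod.snd this)))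
      (by decide : (0 : ZMod 4) ≠ 1)
  -- Here `l' = l + 1`, and the other two ends of `x` and the other two ends of `y` lie on different
  -- sides of the cycle. Then the vertices on the side of the ends `i + 2` and `i + 3` can be left
  -- only through these two ends, a cut of two edges.
  · exfalso
    obtain ⟨φ, hφ, hf⟩ := hE.exists_bigon_potential h1 h2
      (by simpa using (show (1 : ZMod 4) ≠ 0 by decide))
    have hx0 := hf (x, i)
    have hx1 := hf (x, i + 1)
    have hx2 := hf (x, i + 2)
    have hx3 := hf (x, i + 3)
    have hy0 := hf (y, l)
    have hy1 := hf (y, l + 1)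
    have hy2 := hf (y, l + 2)
    have g1 := hφ (x, i)
    have g2 := hφ (x, i + 1)
    simp only [hxy, hxy.symm, true_and, false_and, or_false, true_or, or_true, if_true,
      add_assoc, n1, n2, n3, add_zero, add_eq_left, add_right_inj,
      show (1 : ZMod 4) ≠ 0 by decide, show (2 : ZMod 4) ≠ 0 by decide,
      show (2 : ZMod 4) ≠ 1 by decide, show (3 : ZMod 4) ≠ 0 by decide,
      show (3 : ZMod 4) ≠ 1 by decide, if_false] at hx0 hx1 hx2 hx3 hy0 hy1 hy2
    rw [h1] at g1
    rw [h2, add_assoc, n1] at g2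
    simp only at g1 g2
    have hconst : ∀ v, v ≠ x → v ≠ y → ∀ j, φ (v, j) = φ (v, j + 1) := fun v hv hv' j => by
      have := hf (v, j)
      rw [if_neg (by simp [hv, hv'])] at this
      exact CharTwo.add_eq_zero.1 this.symm
    have hother : ∀ d, ¬ (d.1 = x ∧ (d.2 = i ∨ d.2 = i + 1)) → ¬ (d.1 = y ∧ (d.2 = l ∨ d.2 = l + 1)) →
        ¬ ((E d).1 = x ∧ ((E d).2 = i ∨ (E d).2 = i + 1)) ∧
        ¬ ((E d).1 = y ∧ ((E d).2 = l ∨ (E d).2 = l + 1)) := by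
      intro d h3 h4
      constructor
      · rintro ⟨h5, h6 | h6⟩
        · have : E d = (x, i) := Prod.ext h5 h6
          have : d = (y, l) := by rw [← hE.invol d, this, h1]
          exact h4 (by simp [this])
        · have : E d = (x, i + 1) := Prod.ext h5 h6
          have : d = (y, l + 1) := by rw [← hE.invol d, this, h2]
          exact h4 (by simp [this])
      · rintro ⟨h5, h6 | h6⟩
        · have : E d = E (x, i) := by rw [h1]; exact Prod.ext h5 h6
          exact h3 (by simp [hE.injective this])
        · have : E d = E (x, i + 1) := by rw [h2]; exact Prod.ext h5 h6
          exact h3 (by simp [hE.injective this])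
    have hedge : ∀ d, ¬ (d.1 = x ∧ (d.2 = i ∨ d.2 = i + 1)) →
        ¬ (d.1 = y ∧ (d.2 = l ∨ d.2 = l + 1)) → φ (E d) = φ d := by
      intro d h3 h4
      have := hf (E d)
      obtain ⟨h5, h6⟩ := hother d h3 h4
      rw [if_neg (by tauto), hφ] at this
      exact CharTwo.add_eq_zero.1 this.symm
    have ya : ∀ j, ¬ (j = l ∨ j = l + 1) → φ (y, j) ≠ φ (x, i + 2) := by
      intro j hj h
      rcases Dart.eq_add_cases l j with rfl | rfl | rfl | rfl
      · exact hj (Or.inl rfl)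
      · exact hj (Or.inr rfl)
      · have : (1 : ZMod 2) = 0 := by
          rw [g2] at h
          rw [hx1, h, add_self_zmod]
        exact absurd this (by decide)
      · have h' := CharTwo.add_eq_zero.1 hy2.symm
        have : (1 : ZMod 2) = 0 := by
          rw [← h', g2] at h
          rw [hx1, h, add_self_zmod]
        exact absurd this (by decide)
    have xa : ∀ j, ¬ (j = i ∨ j = i + 1) → φ (x, j) = φ (x, i + 2) := by
      intro j hj
      rcases Dart.eq_add_cases i j with rfl | rfl | rfl | rfl
      · exact (hj (Or.inl rfl)).elim
      · exact (hj (Or.inr rfl)).elim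
      · rfl
      · exact (CharTwo.add_eq_zero.1 hx2.symm).symm
    have hbad : ¬ ((x, i + 2).1 = x ∧ ((x, i + 2).2 = i ∨ (x, i + 2).2 = i + 1)) := by
      simp [show (2 : ZMod 4) ≠ 0 by decide, show (2 : ZMod 4) ≠ 1 by decide]
    have hbad' : ¬ ((x, i + 2).1 = y ∧ ((x, i + 2).2 = l ∨ (x, i + 2).2 = l + 1)) := by
      simp [hxy.symm]
    refine hE.cut (fun v => v ≠ x ∧ v ≠ y ∧ φ (v, 0) = φ (x, i + 2)) ⟨(E (x, i + 2)).1, ?_, ?_, ?_⟩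
      ⟨x, by simp⟩ ⟨E (x, i + 2), E (x, i + 3), ?_⟩
    · exact hE.loopless _
    · intro h
      refine ya (E (x, i + 2)).2 (fun h' => (hother _ hbad hbad').2 ⟨h, h'⟩) ?_
      rw [← h]
      exact hedge _ hbad hbad'
    · have hx' := hE.loopless (x, i + 2)
      have hy' : (E (x, i + 2)).1 ≠ y := fun h => by
        refine ya (E (x, i + 2)).2 (fun h' => (hother _ hbad hbad').2 ⟨h, h'⟩) ?_
        rw [← h]
        exact hedge _ hbad hbad'
      rw [eq_of_const (hconst _ hx' hy') 0 (E (x, i + 2)).2]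
      exact hedge _ hbad hbad'
    · rintro ⟨c, j⟩ ⟨hcx, hcy, hcφ⟩ hd
      simp only at hcx hcy hcφ
      have b1 : ¬ ((c, j).1 = x ∧ ((c, j).2 = i ∨ (c, j).2 = i + 1)) := by simp [hcx]
      have b2 : ¬ ((c, j).1 = y ∧ ((c, j).2 = l ∨ (c, j).2 = l + 1)) := by simp [hcy]
      have he := hedge _ b1 b2
      obtain ⟨b3, b4⟩ := hother _ b1 b2
      rw [eq_of_const (hconst c hcx hcy) j 0, hcφ] at he
      by_cases hx' : (E (c, j)).1 = x
      · have h5 : ¬ ((E (c, j)).2 = i ∨ (E (c, j)).2 = i + 1) := fun h => b3 ⟨hx', h⟩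
        rcases Dart.eq_add_cases i (E (c, j)).2 with h | h | h | h
        · exact (h5 (Or.inl h)).elim
        · exact (h5 (Or.inr h)).elim
        · exact Or.inl (by rw [← hE.invol (c, j)]; exact congrArg E (Prod.ext hx' h))
        · exact Or.inr (by rw [← hE.invol (c, j)]; exact congrArg E (Prod.ext hx' h))
      by_cases hy' : (E (c, j)).1 = y
      · refine (ya (E (c, j)).2 (fun h => b4 ⟨hy', h⟩) ?_).elim
        rw [← hy']
        exact he
      · refine (hd ⟨hx', hy', ?_⟩).elim
        rw [eq_of_const (hconst _ hx' hy') 0 (E (c, j)).2]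
        exact he
  -- Here `l' = l + 2`, which contradicts the checkerboard colouring.
  · have e1 := hχ (x, i)
    have e2 := hχ (x, i + 1)
    rw [h1] at e1
    rw [h2, hχr, ← n1, ← add_assoc, hχr, hχr, e1] at e2
    exact absurd e2 ((by decide : ∀ z : ZMod 2, z + 1 + 1 + 1 ≠ z + 1 + 1) _)
  · rw [add_assoc, n3, add_zero]

end ClosedPlaneMap

/-! ### Closed chains of bigons -/

namespace ClosedPlaneMap

variable {V : Type} {E : V × ZMod 4 → V × ZMod 4}

/-- A dart and its successor lead to the same vertex. -/
def IsDouble (E : V × ZMod 4 → V × ZMod 4) (d : V × ZMod 4) : Prop :=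
  (E d).1 = (E (d.1, d.2 + 1)).1

theorem IsDouble.add_two [Fintype V] (hE : ClosedPlaneMap E) {x : V} {i : ZMod 4}
    (h : IsDouble E (x, i)) : IsDouble E (x, i + 2) := by
  classical
  have := (pairing_of_even (fun i => (E (x, i)).1) (hE.even x) i).1 h
  rw [IsDouble, add_assoc, show (2 : ZMod 4) + 1 = 3 by decide]
  exact this

/-- Even multiplicities pair the four ends of a vertex, and `not_opposite` excludes the pairing of
opposite ends. -/
theorem isDouble_or [Fintype V] (hE : ClosedPlaneMap E) (x : V) (i : ZMod 4) :
    IsDouble E (x, i) ∨ IsDouble E (x, i + 3) := by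
  classical
  obtain ⟨-, h2, h3⟩ := pairing_of_even (fun i => (E (x, i)).1) (hE.even x) i
  rcases h3 with h3 | h3 | h3
  · exact Or.inl h3
  · exact Or.inl (hE.not_opposite h3 (h2 h3))
  · right
    rw [IsDouble, add_assoc, show (3 : ZMod 4) + 1 = 0 by decide, add_zero]
    exact h3.symm

/-- The next dart around a face. -/
def next (E : V × ZMod 4 → V × ZMod 4) (d : V × ZMod 4) : V × ZMod 4 := ((E d).1, (E d).2 + 1)

theorem next_injective (hE : ClosedPlaneMap E) : Function.Injective (next E) := by
  intro d d' h
  simp only [next, Prod.mk.injEq, add_left_inj] at h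
  exact hE.injective (Prod.ext h.1 h.2)

theorem edge_eq_next (d : V × ZMod 4) : E d = ((next E d).1, (next E d).2 + 3) := by
  simp [next, add_assoc, show (1 : ZMod 4) + 3 = 0 by decide]

theorem edge_add_one_eq_next (hE : ClosedPlaneMap E) {d : V × ZMod 4} (h : IsDouble E d) :
    E (d.1, d.2 + 1) = ((next E d).1, (next E d).2 + 2) := by
  have h1 : E (d.1, d.2 + 1) = ((E d).1, (E (d.1, d.2 + 1)).2) := by rw [h]
  have h2 := hE.bigon (x := d.1) (i := d.2) (y := (E d).1) (l := (E d).2) rfl h1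
  rw [h1]
  simp only [next]
  rw [h2, add_assoc, add_assoc, show (1 : ZMod 4) + (1 + 2) = 0 by decide, add_zero]

/-- The bigon arrives at the ends `+ 2` and `+ 3` relative to the next dart, so these lead to a
common vertex, and by parity so do the two other ends, where the following bigon starts. -/
theorem IsDouble.next [Fintype V] (hE : ClosedPlaneMap E) {d : V × ZMod 4} (h : IsDouble E d) :
    IsDouble E (next E d) := by
  have h1 := edge_eq_next (E := E) d
  have h2 := edge_add_one_eq_next hE h
  have h1' := congrArg E h1
  have h2' := congrArg E h2
  rw [hE.invol] at h1' h2'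
  have : IsDouble E ((ClosedPlaneMap.next E d).1, (ClosedPlaneMap.next E d).2 + 2) := by
    rw [IsDouble, add_assoc, show (2 : ZMod 4) + 1 = 3 by decide, ← h1', ← h2']
  have := this.add_two hE
  rwa [add_assoc, show (2 : ZMod 4) + 2 = 0 by decide, add_zero] at this

/-- The involution which passes to the opposite dart at a vertex reverses the face orbits of
double darts. -/
theorem next_opposite_next (hE : ClosedPlaneMap E) {d : V × ZMod 4} (h : IsDouble E d) :
    next E ((next E d).1, (next E d).2 + 2) = (d.1, d.2 + 2) := by
  rw [← edge_add_one_eq_next hE h, next, hE.invol]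
  simp [add_assoc, show (1 : ZMod 4) + 1 = 2 by decide]

theorem iterate_isDouble [Fintype V] (hE : ClosedPlaneMap E) {d : V × ZMod 4} (h : IsDouble E d)
    (t : ℕ) : IsDouble E ((next E)^[t] d) := by
  induction t with
  | zero => exact h
  | succ t ih => rw [Function.iterate_succ_apply']; exact ih.next hE

theorem iterate_opposite [Fintype V] (hE : ClosedPlaneMap E) {d : V × ZMod 4} (h : IsDouble E d)
    (t : ℕ) : (next E)^[t] (((next E)^[t] d).1, ((next E)^[t] d).2 + 2) = (d.1, d.2 + 2) := by
  induction t with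
  | zero => rfl
  | succ t ih =>
    rw [Function.iterate_succ_apply, Function.iterate_succ_apply',
      next_opposite_next hE (iterate_isDouble hE h t), ih]

/-- Passing to the opposite dart reverses `next`. So halfway between a dart and its opposite in one
orbit there would be a dart equal to its own opposite, or one whose `next` is its own opposite; the
latter lies on a loop. -/
theorem opposite_notMem_orbit [Fintype V] (hE : ClosedPlaneMap E) {d : V × ZMod 4}
    (h : IsDouble E d) (j : ℕ) : (next E)^[j] d ≠ (d.1, d.2 + 2) := by
  intro hj
  rcases Nat.even_or_odd' j with ⟨u, rfl | rfl⟩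
  · rw [two_mul, Function.iterate_add_apply, ← iterate_opposite hE h u] at hj
    have := congrArg Prod.snd ((next_injective hE).iterate u hj)
    exact absurd (add_left_cancel ((add_zero _).trans this)) (by decide : (0 : ZMod 4) ≠ 2)
  · rw [two_mul, add_assoc, Function.iterate_add_apply, ← iterate_opposite hE h u] at hj
    have := congrArg Prod.fst ((next_injective hE).iterate u hj)
    rw [Function.iterate_succ_apply'] at this
    exact hE.loopless _ this

/-- Through every dart `d₁` of a closed map runs a closed chain of bigons. -/
theorem exists_chain [Fintype V] (hE : ClosedPlaneMap E) (d₁ : V × ZMod 4) :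
    ∃ (k : ℕ) (v : ℕ → V × ZMod 4), 2 ≤ k ∧ v k = v 0 ∧
      (∀ t, E (v t) = ((v (t + 1)).1, (v (t + 1)).2 + 3)) ∧
      (∀ t, E ((v t).1, (v t).2 + 1) = ((v (t + 1)).1, (v (t + 1)).2 + 2)) ∧
      (∀ s t, s < k → t < k → (v s).1 = (v t).1 → s = t) ∧
      (d₁ = ((v 0).1, (v 0).2 + 2) ∨ d₁ = ((v 0).1, (v 0).2 + 3)) := by
  obtain ⟨x, p⟩ := d₁
  -- The chain starts with the pair of ends at `x` to which `d₁` does not belong, so that `d₁` lies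
  -- on an edge from the last vertex of the chain to the first.
  obtain ⟨d₀, hx, hp, hd⟩ : ∃ d₀ : V × ZMod 4, d₀.1 = x ∧ (p = d₀.2 + 2 ∨ p = d₀.2 + 3) ∧
      IsDouble E d₀ := by
    rcases isDouble_or hE x p with h | h
    · refine ⟨(x, p + 2), rfl, Or.inl ?_, h.add_two hE⟩
      simp [add_assoc, show (2 : ZMod 4) + 2 = 0 by decide]
    · refine ⟨(x, p + 3 + 2), rfl, Or.inr ?_, h.add_two hE⟩
      simp [add_assoc, show (3 : ZMod 4) + (2 + 3) = 0 by decide]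
  have hfin : d₀ ∈ Function.periodicPts (next E) :=
    (next_injective hE).mem_periodicPts d₀
  have hpos := Function.minimalPeriod_pos_of_mem_periodicPts hfin
  set k := Function.minimalPeriod (next E) d₀ with hk
  obtain ⟨χ, hχ, hχr⟩ := hE.exists_checkerboard
  have hχn : ∀ d, χ (next E d) = χ d := fun d => by
    rw [next, hχr, hχ]
    exact (by decide : ∀ z : ZMod 2, z + 1 + 1 = z) _
  have hχt : ∀ t, χ ((next E)^[t] d₀) = χ d₀ := fun t => by
    induction t with
    | zero => rfl
    | succ t ih => rw [Function.iterate_succ_apply', hχn, ih]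
  refine ⟨k, fun t => (next E)^[t] d₀, ?_, Function.iterate_minimalPeriod, ?_, ?_, ?_, ?_⟩
  · by_contra hlt
    have h1 : k = 1 := by omega
    have : (next E)^[k] d₀ = d₀ := Function.iterate_minimalPeriod
    rw [h1, Function.iterate_one] at this
    exact hE.loopless d₀ (congrArg Prod.fst this : (next E d₀).1 = d₀.1)
  · intro t
    simp only [Function.iterate_succ_apply']
    exact edge_eq_next _
  · intro t
    simp only [Function.iterate_succ_apply']
    exact edge_add_one_eq_next hE (iterate_isDouble hE hd t)
  -- Two darts of the orbit at one vertex cannot differ by an odd rotation, because `χ` is constant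
  -- on the orbit, nor by two, because of `opposite_notMem_orbit`.
  · have hper : ∀ a b, b < k → (next E)^[a] d₀ =
        (((next E)^[b] d₀).1, ((next E)^[b] d₀).2 + 2) → False := by
      intro a b _ h
      have h' := congrArg ((next E)^[b]) h
      rw [iterate_opposite hE hd, ← Function.iterate_add_apply] at h'
      exact opposite_notMem_orbit hE hd _ h'
    intro s t hs ht hst
    simp only at hst
    have h1 := hχt s
    rw [← hχt t] at h1
    rcases Dart.eq_add_cases ((next E)^[t] d₀).2 ((next E)^[s] d₀).2 with h | h | h | h
    · exact Function.iterate_injOn_Iio_minimalPeriod hs ht (Prod.ext hst h)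
    · have : (next E)^[s] d₀ = (((next E)^[t] d₀).1, ((next E)^[t] d₀).2 + 1) := Prod.ext hst h
      rw [this, hχr] at h1
      exact absurd h1 ((by decide : ∀ z : ZMod 2, z + 1 ≠ z) _)
    · exact (hper s t ht (Prod.ext hst h)).elim
    · have : (next E)^[s] d₀ = (((next E)^[t] d₀).1, ((next E)^[t] d₀).2 + 1 + 1 + 1) :=
        Prod.ext hst (by rw [h]; simp only [add_assoc]; rfl)
      rw [this, hχr, hχr, hχr] at h1
      exact absurd h1 ((by decide : ∀ z : ZMod 2, z + 1 + 1 + 1 ≠ z) _)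
  · rcases hp with hp | hp
    · exact Or.inl (Prod.ext hx.symm hp)
    · exact Or.inr (Prod.ext hx.symm hp)

end ClosedPlaneMap

/-! ### Parts of a plane map with at most two outgoing edges -/

section

variable {C : Type} {e : C × ZMod 4 → C × ZMod 4} {χ : C × ZMod 4 → ZMod 2}

/-- The checkerboard colour changes along an edge and between consecutive ends, so a loop can only
join consecutive ends, which is excluded by `hloop`. -/
theorem fst_edge_ne (he : ∀ d, e (e d) = d) (hχ : ∀ d, χ (e d) = χ d + 1)
    (hχr : ∀ c i, χ (c, i + 1) = χ (c, i) + 1) (hloop : ∀ c i, e (c, i) ≠ (c, i + 1))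
    (d : C × ZMod 4) : (e d).1 ≠ d.1 := by
  obtain ⟨c, i⟩ := d
  intro h
  have h1 := hχ (c, i)
  rcases Dart.eq_add_cases i (e (c, i)).2 with h2 | h2 | h2 | h2
  · rw [show e (c, i) = (c, i) from Prod.ext h h2] at h1
    exact absurd h1 ((by decide : ∀ z : ZMod 2, z ≠ z + 1) _)
  · exact hloop c i (Prod.ext h h2)
  · rw [show e (c, i) = (c, i + 1 + 1) from
      Prod.ext h (by rw [h2, add_assoc]; rfl), hχr, hχr] at h1
    exact absurd h1 ((by decide : ∀ z : ZMod 2, z + 1 + 1 ≠ z + 1) _)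
  · have h3 : e (c, i) = (c, i + 3) := Prod.ext h h2
    refine hloop c (i + 3) ?_
    rw [← h3, he, add_assoc, show (3 : ZMod 4) + 1 = 0 by decide, add_zero]

/-- On the boundary of a part of the map both colours of the checkerboard occur. -/
theorem exists_boundary_ne [Finite C] (he : ∀ d, e (e d) = d) (hχ : ∀ d, χ (e d) = χ d + 1)
    (hχr : ∀ c i, χ (c, i + 1) = χ (c, i) + 1) (p : Set C) {d : C × ZMod 4} (hd : d.1 ∈ p)
    (hd' : (e d).1 ∉ p) : ∃ d', d'.1 ∈ p ∧ (e d').1 ∉ p ∧ χ d' ≠ χ d := by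
  classical
  have := Fintype.ofFinite C
  by_contra! hall
  -- Count the darts in `p` with signs given by their colour. The ends at each crossing cancel, and
  -- so do the two darts of each inner edge; so the outgoing darts cancel as well and cannot all
  -- have one colour.
  let σ : ZMod 2 → ℤ := fun z => if z = 0 then 1 else -1
  have hσ : ∀ z, σ z + σ (z + 1) = 0 := by decide
  have h1 : ∑ d : C × ZMod 4, (if d.1 ∈ p then σ (χ d) else 0) = 0 := by
    rw [Fintype.sum_prod_type]
    refine Finset.sum_eq_zero fun c _ => ?_
    by_cases hc : c ∈ p
    · simp only [hc, if_true]
      rw [sum_zmod_four (fun i => σ (χ (c, i))) 0, show (0 : ZMod 4) + 2 = 0 + 1 + 1 by decide,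
        show (0 : ZMod 4) + 3 = 0 + 1 + 1 + 1 by decide]
      simp only [hχr]
      rw [hσ, zero_add, hσ]
    · simp [hc]
  have h2 : ∑ d : C × ZMod 4, (if d.1 ∈ p ∧ (e d).1 ∈ p then σ (χ d) else 0) = 0 := by
    refine Finset.sum_involution (fun d _ => e d) ?_ ?_ (fun _ _ => Finset.mem_univ _)
      (fun d _ => he d)
    · intro d _
      rw [he, hχ]
      by_cases h : d.1 ∈ p ∧ (e d).1 ∈ p
      · rw [if_pos h, if_pos h.symm]
        exact hσ _
      · rw [if_neg h, if_neg fun h' => h h'.symm, add_zero]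
    · intro d _ _ h
      have := hχ d
      rw [h] at this
      exact absurd this ((by decide : ∀ z : ZMod 2, z ≠ z + 1) _)
  have h3 : ∑ d' : C × ZMod 4, (if d'.1 ∈ p ∧ (e d').1 ∉ p then σ (χ d) else 0) = 0 := by
    refine Eq.trans ?_ (sub_eq_zero.2 (h1.trans h2.symm))
    rw [← Finset.sum_sub_distrib]
    refine Finset.sum_congr rfl fun d' _ => ?_
    by_cases ha : d'.1 ∈ p <;> by_cases hb : (e d').1 ∈ p
    · simp [ha, hb]
    · simp [ha, hb, hall d' ha hb]
    · simp [ha, hb]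
    · simp [ha, hb]
  rw [← Finset.sum_filter, Finset.sum_const, smul_eq_zero] at h3
  rcases h3 with h3 | h3
  · rw [Finset.card_eq_zero] at h3
    have : d ∈ Finset.univ.filter fun d' : C × ZMod 4 => d'.1 ∈ p ∧ (e d').1 ∉ p := by
      simp [hd, hd']
    rw [h3] at this
    simp at this
  · revert h3
    exact (by decide : ∀ z, σ z ≠ 0) _

/-- The set `A` has at most two outgoing darts. -/
def AlmostClosed (e : C × ZMod 4 → C × ZMod 4) (A : Set C) : Prop :=
  ∃ d₁ d₂, ∀ d, d.1 ∈ A → (e d).1 ∉ A → d = d₁ ∨ d = d₂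

theorem exists_minimal_almostClosed [Finite C] [Nonempty C] (e : C × ZMod 4 → C × ZMod 4) :
    ∃ A : Set C, A.Nonempty ∧ AlmostClosed e A ∧
      ∀ B, B ⊂ A → B.Nonempty → ¬ AlmostClosed e B := by
  obtain ⟨c⟩ := ‹Nonempty C›
  obtain ⟨A, hA, hmin⟩ := Set.exists_min_image {A : Set C | A.Nonempty ∧ AlmostClosed e A} Set.ncard
    (Set.toFinite _) ⟨Set.univ, ⟨c, trivial⟩, (c, 0), (c, 0), fun d _ h => (h trivial).elim⟩
  refine ⟨A, hA.1, hA.2, fun B hB hB0 hB1 => ?_⟩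
  exact absurd (Set.ncard_lt_ncard hB (Set.toFinite A)) (not_lt.2 (hmin B ⟨hB0, hB1⟩))

/-- A minimal nonempty set with at most two outgoing darts; if there are any, then they are
`d₁` and `d₂`. -/
structure MinimalPart (e : C × ZMod 4 → C × ZMod 4) (χ : C × ZMod 4 → ZMod 2) (A : Set C)
    (d₁ d₂ : C × ZMod 4) : Prop where
  nonempty : A.Nonempty
  minimal : ∀ B, B ⊂ A → B.Nonempty → ¬ AlmostClosed e B
  mem₁ : d₁.1 ∈ A
  mem₂ : d₂.1 ∈ A
  boundary : ∀ d, d.1 ∈ A → (e d).1 ∉ A →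
    (d = d₁ ∨ d = d₂) ∧ (e d₁).1 ∉ A ∧ (e d₂).1 ∉ A ∧ χ d₂ = χ d₁ + 1

/-- By `exists_boundary_ne` outgoing darts occur in both colours or not at all, so a part with at
most two of them has none, or exactly two of different colours. -/
theorem exists_minimalPart [Finite C] [Nonempty C] (he : ∀ d, e (e d) = d) (hχ : ∀ d, χ (e d) = χ d + 1)
    (hχr : ∀ c i, χ (c, i + 1) = χ (c, i) + 1) : ∃ A d₁ d₂, MinimalPart e χ A d₁ d₂ := by
  obtain ⟨A, hA, ⟨d₁, d₂, hd⟩, hmin⟩ := exists_minimal_almostClosed e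
  by_cases hb : ∃ d : C × ZMod 4, d.1 ∈ A ∧ (e d).1 ∉ A
  · obtain ⟨x, hx, hx'⟩ := hb
    obtain ⟨y, hy, hy', hyx⟩ := exists_boundary_ne he hχ hχr A hx hx'
    refine ⟨A, x, y, hA, hmin, hx, hy, fun d h h' => ⟨?_, hx', hy',
      (by decide : ∀ a b : ZMod 2, a ≠ b → a = b + 1) _ _ hyx⟩⟩
    have hxy : x ≠ y := by rintro rfl; exact hyx rfl
    rcases hd x hx hx' with rfl | rfl <;> rcases hd y hy hy' with rfl | rfl <;>
      rcases hd d h h' with rfl | rfl <;> simp_all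
  · push Not at hb
    obtain ⟨c, hc⟩ := hA
    -- If no dart leaves `A`, then `boundary` is vacuous and the two darts are mere placeholders.
    exact ⟨A, (c, 0), (c, 0), ⟨c, hc⟩, hmin, hc, hc, fun d h h' => (h' (hb d h)).elim⟩

open Classical in
/-- The closure of a part: its two outgoing edges are joined. -/
noncomputable def closeUp (e : C × ZMod 4 → C × ZMod 4) (A : Set C) (d₁ d₂ x : C × ZMod 4) :
    C × ZMod 4 :=
  if (e x).1 ∈ A then e x else if x = d₁ then d₂ else d₁

namespace MinimalPart

variable {A : Set C} {d₁ d₂ : C × ZMod 4}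

theorem ne (h : MinimalPart e χ A d₁ d₂) {d : C × ZMod 4} (hd : d.1 ∈ A) (hd' : (e d).1 ∉ A) :
    d₁ ≠ d₂ := by
  rintro rfl
  exact absurd (h.boundary d hd hd').2.2.2 ((by decide : ∀ z : ZMod 2, z ≠ z + 1) _)

theorem symm (h : MinimalPart e χ A d₁ d₂) : MinimalPart e χ A d₂ d₁ :=
  ⟨h.nonempty, h.minimal, h.mem₂, h.mem₁, fun d hd hd' => by
    obtain ⟨h1, h2, h3, h4⟩ := h.boundary d hd hd'
    exact ⟨h1.symm, h3, h2, (by decide : ∀ a b : ZMod 2, a = b + 1 → b = a + 1) _ _ h4⟩⟩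

theorem closeUp_of_mem {x : C × ZMod 4} (hx : (e x).1 ∈ A) : closeUp e A d₁ d₂ x = e x :=
  if_pos hx

theorem closeUp_left (hx : (e d₁).1 ∉ A) : closeUp e A d₁ d₂ d₁ = d₂ := by
  rw [closeUp, if_neg hx, if_pos rfl]

theorem closeUp_right (h : MinimalPart e χ A d₁ d₂) (hx : (e d₂).1 ∉ A) : closeUp e A d₁ d₂ d₂ = d₁ := by
  rw [closeUp, if_neg hx, if_neg (h.ne h.mem₂ hx).symm]

theorem closeUp_mem (h : MinimalPart e χ A d₁ d₂) (x : C × ZMod 4) : (closeUp e A d₁ d₂ x).1 ∈ A := by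
  rw [closeUp]
  split_ifs with h1 h2
  · exact h1
  · exact h.mem₂
  · exact h.mem₁

/-- Either an edge of the part does not leave it, or it is one of the two joined edges. -/
theorem cases (h : MinimalPart e χ A d₁ d₂) {x : C × ZMod 4} (hx : x.1 ∈ A) :
    ((e x).1 ∈ A ∧ closeUp e A d₁ d₂ x = e x) ∨
    ((e x).1 ∉ A ∧ (e d₁).1 ∉ A ∧ (e d₂).1 ∉ A ∧ χ d₂ = χ d₁ + 1 ∧
      (x = d₁ ∧ closeUp e A d₁ d₂ x = d₂ ∨ x = d₂ ∧ closeUp e A d₁ d₂ x = d₁)) := by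
  by_cases hx' : (e x).1 ∈ A
  · exact Or.inl ⟨hx', closeUp_of_mem hx'⟩
  · obtain ⟨h1, h2, h3, h4⟩ := h.boundary x hx hx'
    refine Or.inr ⟨hx', h2, h3, h4, ?_⟩
    rcases h1 with rfl | rfl
    · exact Or.inl ⟨rfl, closeUp_left hx'⟩
    · exact Or.inr ⟨rfl, h.closeUp_right hx'⟩

theorem closeUp_closeUp (h : MinimalPart e χ A d₁ d₂) (he : ∀ d, e (e d) = d) {x : C × ZMod 4}
    (hx : x.1 ∈ A) : closeUp e A d₁ d₂ (closeUp e A d₁ d₂ x) = x := by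
  rcases h.cases hx with ⟨h1, h2⟩ | ⟨h1, h2, h3, h4, ⟨rfl, h5⟩ | ⟨rfl, h5⟩⟩
  · rw [h2, closeUp_of_mem (by rwa [he]), he]
  · rw [h5, h.closeUp_right h3]
  · rw [h5, closeUp_left h2]

/-- If both outgoing darts were at one vertex `x₀`, then `A` without `x₀` would be nonempty, and its
only outgoing darts would be those leading to the two other ends of `x₀`, contrary to minimality. -/
theorem closeUp_fst_ne (h : MinimalPart e χ A d₁ d₂) (hne : ∀ d, (e d).1 ≠ d.1) (he : ∀ d, e (e d) = d)
    {x : C × ZMod 4} (hx : x.1 ∈ A) : (closeUp e A d₁ d₂ x).1 ≠ x.1 := by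
  have key : (e d₁).1 ∉ A → (e d₂).1 ∉ A → d₁.1 ≠ d₂.1 := by
    intro h1 h2 h3
    have hd := h.ne h.mem₁ h1
    obtain ⟨x₀, p⟩ := d₁
    obtain ⟨y₀, q⟩ := d₂
    obtain rfl : x₀ = y₀ := h3
    have hpq : p ≠ q := fun h => hd (by rw [h])
    obtain ⟨r, s, hrp, hrq, hall⟩ := (by decide : ∀ p q : ZMod 4, p ≠ q →
      ∃ r s, r ≠ p ∧ r ≠ q ∧ ∀ i, i = p ∨ i = q ∨ i = r ∨ i = s) p q hpq
    have hr : (e (x₀, r)).1 ∈ A := by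
      by_contra hr
      rcases (h.boundary (x₀, r) h.mem₁ hr).1 with h | h
      · exact hrp (congrArg Prod.snd h)
      · exact hrq (congrArg Prod.snd h)
    refine h.minimal (A \ {x₀}) ⟨Set.sdiff_subset, fun h' => (h' h.mem₁).2 rfl⟩
      ⟨_, hr, hne (x₀, r)⟩ ⟨e (x₀, r), e (x₀, s), ?_⟩
    rintro d ⟨hdA, hdx⟩ hd'
    by_cases hdA' : (e d).1 ∈ A
    · have hv : (e d).1 = x₀ := by
        by_contra hv
        exact hd' ⟨hdA', hv⟩
      have hed : e d = (x₀, (e d).2) := Prod.ext hv rfl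
      have hdd : d = e (x₀, (e d).2) := by rw [← hed, he]
      rcases hall (e d).2 with h4 | h4 | h4 | h4
      · rw [h4] at hdd
        rw [hdd] at hdA
        exact (h1 hdA).elim
      · rw [h4] at hdd
        rw [hdd] at hdA
        exact (h2 hdA).elim
      · rw [h4] at hdd
        exact Or.inl hdd
      · rw [h4] at hdd
        exact Or.inr hdd
    · rcases (h.boundary d hdA hdA').1 with h4 | h4 <;> rw [h4] at hdx <;> exact (hdx rfl).elim
  rcases h.cases hx with ⟨h1, h2⟩ | ⟨h1, h2, h3, h4, ⟨rfl, h5⟩ | ⟨rfl, h5⟩⟩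
  · rw [h2]
    exact hne x
  · rw [h5]
    exact (key h2 h3).symm
  · rw [h5]
    exact key h2 h3

/-- The vertices outside `A` which are reached from the other end of `d₂`. -/
def Outside (e : C × ZMod 4 → C × ZMod 4) (A : Set C) (d : C × ZMod 4) : Set C :=
  {z | Relation.ReflTransGen (fun u w => w ∉ A ∧ ∃ i, (e (u, i)).1 = w) (e d).1 z}

theorem outside_notMem {d : C × ZMod 4} (hd : (e d).1 ∉ A) {z : C} (hz : z ∈ Outside e A d) :
    z ∉ A := by
  rcases Relation.ReflTransGen.cases_tail hz with h | ⟨_, _, h⟩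
  · rwa [h]
  · exact h.1

/-- The outgoing darts of the outside region also occur in both colours. Besides the edge of `d₂`
there must be another edge into `A`, and only that of `d₁` is available. So the joined edge stands
for a path outside `A`. -/
theorem mem_outside [Finite C] (h : MinimalPart e χ A d₁ d₂) (he : ∀ d, e (e d) = d)
    (hχ : ∀ d, χ (e d) = χ d + 1) (hχr : ∀ c i, χ (c, i + 1) = χ (c, i) + 1)
    (hd : (e d₂).1 ∉ A) : (e d₁).1 ∈ Outside e A d₂ := by
  have h0 : (e d₂).1 ∈ Outside e A d₂ := Relation.ReflTransGen.refl
  obtain ⟨d', h1, h2, h3⟩ := exists_boundary_ne he hχ hχr (Outside e A d₂) (d := e d₂) h0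
    (by rw [he]; exact fun h' => outside_notMem hd h' h.mem₂)
  have h4 : (e d').1 ∈ A := by
    by_contra h4
    exact h2 (Relation.ReflTransGen.tail h1 ⟨h4, d'.2, rfl⟩)
  have h5 := (h.boundary (e d') h4 (by rw [he]; exact outside_notMem hd h1)).1
  rcases h5 with h5 | h5
  · rw [← h5, he]
    exact h1
  · exact (h3 (by rw [← h5, he])).elim

/-- A flow on the closure is continued outside `A` by the constant `c = f d₁`, a multiple of the
flow with potential `χ`. So `φ + c χ` is constant on the connected outside region, which relates the
values of `φ` at `d₁` and `d₂`. -/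
theorem exists_potential [Finite C] (h : MinimalPart e χ A d₁ d₂) (hP : PlaneMap e)
    (hχ : ∀ d, χ (e d) = χ d + 1) (hχr : ∀ c i, χ (c, i + 1) = χ (c, i) + 1)
    (f : C × ZMod 4 → ZMod 2) (hf : ∀ x, x.1 ∈ A → f (closeUp e A d₁ d₂ x) = f x)
    (hsum : ∀ c ∈ A, f (c, 0) + f (c, 1) + f (c, 2) + f (c, 3) = 0) :
    ∃ φ : C × ZMod 4 → ZMod 2,
      (∀ d, d.1 ∈ A → φ ((closeUp e A d₁ d₂ d).1, (closeUp e A d₁ d₂ d).2 + 1) = φ d) ∧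
      ∀ d, d.1 ∈ A → f d = φ d + φ (d.1, d.2 + 1) := by
  classical
  have he := hP.invol
  obtain ⟨φ, h1, h2⟩ := hP.exists_potential (fun d => if d.1 ∈ A then f d else f d₁)
    (by
      have key : ∀ d, d.1 ∈ A → (if (e d).1 ∈ A then f (e d) else f d₁) = f d := by
        intro d hd
        have hfd := hf d hd
        rcases h.cases hd with ⟨h1, h2⟩ | ⟨h1, h2, h3, h4, ⟨rfl, h5⟩ | ⟨rfl, h5⟩⟩
        · rw [if_pos h1, ← hfd, h2]
        · rw [if_neg h1]
        · rw [if_neg h1, ← hfd, h5]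
      intro d
      by_cases hd : d.1 ∈ A
      · rw [if_pos hd]
        exact key d hd
      · rw [if_neg hd]
        by_cases hd' : (e d).1 ∈ A
        · have := key (e d) hd'
          rw [he, if_neg hd] at this
          rw [if_pos hd', this]
        · rw [if_neg hd'])
    (fun c => by
      by_cases hc : c ∈ A
      · simpa [hc] using hsum c hc
      · simp only [hc, if_false]
        exact (by decide : ∀ z : ZMod 2, z + z + z + z = 0) _)
  refine ⟨φ, fun d hd => ?_, fun d hd => by rw [← h2, if_pos hd]⟩
  have key : (e d₁).1 ∉ A → (e d₂).1 ∉ A → χ d₂ = χ d₁ + 1 →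
      φ (d₁.1, d₁.2 + 1) = φ d₂ ∧ φ (d₂.1, d₂.2 + 1) = φ d₁ := by
    intro b1 b2 b3
    have hf12 : f d₂ = f d₁ := by rw [← hf d₁ h.mem₁, closeUp_left b1]
    set c := f d₁ with hc
    have hrot : ∀ d, φ ((e d).1, (e d).2 + 1) + c * χ ((e d).1, (e d).2 + 1) = φ d + c * χ d := by
      intro d
      rw [h1, hχr]
      have := hχ d
      rw [show χ ((e d).1, (e d).2) = χ d + 1 from this, add_assoc, show (1 : ZMod 2) + 1 = 0 by decide,
        add_zero]
    have hconst : ∀ z, z ∉ A → ∀ i j, φ (z, i) + c * χ (z, i) = φ (z, j) + c * χ (z, j) := by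
      intro z hz
      refine ClosedPlaneMap.eq_of_const (φ := fun d => φ d + c * χ d) fun i => ?_
      have := h2 (z, i)
      rw [if_neg hz] at this
      simp only at this ⊢
      rw [hχr]
      exact (by decide : ∀ a b c x : ZMod 2, c = a + b → a + c * x = b + c * (x + 1)) _ _ _ _ this
    have hout : ∀ z ∈ Outside e A d₂, ∀ i, φ (z, i) + c * χ (z, i) = φ d₂ + c * χ d₂ := by
      intro z hz
      induction hz with
      | refl =>
        intro i
        rw [hconst _ b2 i ((e d₂).2 + 1), hrot]
      | @tail u w hu huw ih =>
        obtain ⟨hw, j, rfl⟩ := huw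
        intro i
        rw [hconst _ hw i ((e (u, j)).2 + 1), hrot, ih]
    have h3 := hout _ (h.mem_outside he hχ hχr b2) ((e d₁).2 + 1)
    rw [hrot, b3] at h3
    have h4 := h2 d₁
    have h5 := h2 d₂
    rw [if_pos h.mem₁] at h4
    rw [if_pos h.mem₂, hf12] at h5
    refine (by decide : ∀ a b c x y z : ZMod 2, a + c * x = b + c * (x + 1) → c = a + y → c = b + z →
      y = b ∧ z = a) (φ d₁) (φ d₂) c (χ d₁) _ _ h3 h4 h5
  rcases h.cases hd with ⟨h1', h2'⟩ | ⟨h1', h2', h3, h4, ⟨rfl, h5⟩ | ⟨rfl, h5⟩⟩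
  · rw [h2', h1]
  · rw [h5]
    exact (key h2' h3 h4).2
  · rw [h5]
    exact (key h2' h3 h4).1

end MinimalPart

end

/-! ### Cuts and treewidth of the closure of a minimal part -/

namespace MinimalPart

variable {C : Type} {e : C × ZMod 4 → C × ZMod 4} {χ : C × ZMod 4 → ZMod 2} {A : Set C}
  {d₁ d₂ : C × ZMod 4}

/-- If `p` contains the vertices of all outgoing darts of `A`, its complement in `A` would be a
smaller part, with the edges of the cut reversed. Otherwise `p` itself would be one, since its
outgoing darts remain outgoing in the closure. -/
theorem cut (h : MinimalPart e χ A d₁ d₂) (he : ∀ d, e (e d) = d) (p : Set C) (hp : p.Nonempty)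
    (hpA : p ⊂ A) (D₁ D₂ : C × ZMod 4) :
    ¬ ∀ d, d.1 ∈ p → (closeUp e A d₁ d₂ d).1 ∉ p → d = D₁ ∨ d = D₂ := by
  intro hD
  by_cases hb : ∀ d, d.1 ∈ A → (e d).1 ∉ A → d.1 ∈ p
  · refine h.minimal (A \ p) ⟨Set.sdiff_subset, ?_⟩ ?_ ⟨e D₁, e D₂, ?_⟩
    · obtain ⟨x, hx⟩ := hp
      exact fun h' => (h' (hpA.1 hx)).2 hx
    · obtain ⟨x, hx, hx'⟩ := Set.exists_of_ssubset hpA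
      exact ⟨x, hx, hx'⟩
    · rintro d ⟨hdA, hdp⟩ hd'
      have hed : (e d).1 ∈ A := by
        by_contra hed
        exact hdp (hb d hdA hed)
      have hedp : (e d).1 ∈ p := by
        by_contra hedp
        exact hd' ⟨hed, hedp⟩
      have h1 : closeUp e A d₁ d₂ (e d) = e (e d) := closeUp_of_mem (by rwa [he])
      rw [he] at h1
      have := hD (e d) hedp (by rwa [h1])
      rcases this with h2 | h2
      · exact Or.inl (by rw [← h2, he])
      · exact Or.inr (by rw [← h2, he])
  · push Not at hb
    obtain ⟨d₀, hd₀, hd₀', hd₀p⟩ := hb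
    refine h.minimal p hpA hp ⟨D₁, D₂, fun d hd hd' => hD d hd ?_⟩
    rcases h.cases (hpA.1 hd) with ⟨h1, h2⟩ | ⟨h1, h2, h3, h4, ⟨rfl, h5⟩ | ⟨rfl, h5⟩⟩
    · rwa [h2]
    · rcases (h.boundary d₀ hd₀ hd₀').1 with rfl | rfl
      · exact (hd₀p hd).elim
      · rwa [h5]
    · rcases (h.boundary d₀ hd₀ hd₀').1 with rfl | rfl
      · rwa [h5]
      · exact (hd₀p hd).elim

open Classical in
-- The closure is a minor: the outside region that connects the ends of `d₂` and `d₁` is contracted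
-- into the vertex of `d₂`.
theorem treewidth [Finite C] (h : MinimalPart e χ A d₁ d₂) (he : ∀ d, e (e d) = d)
    (hχ : ∀ d, χ (e d) = χ d + 1) (hχr : ∀ c i, χ (c, i + 1) = χ (c, i) + 1)
    (hne : ∀ d, (e d).1 ≠ d.1)
    (htw : TreewidthLE (SimpleGraph.fromRel fun v w => ∃ i, (e (v, i)).1 = w) 2) :
    TreewidthLE (SimpleGraph.fromRel fun v w : A => ∃ i, (closeUp e A d₁ d₂ (v, i)).1 = w) 2 := by
  set G := SimpleGraph.fromRel fun v w => ∃ i, (e (v, i)).1 = w with hG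
  have hadj : ∀ d, G.Adj d.1 (e d).1 := fun d => by
    rw [hG, SimpleGraph.fromRel_adj]
    exact ⟨(hne d).symm, Or.inl ⟨d.2, rfl⟩⟩
  by_cases hd : (e d₂).1 ∉ A
  · set R := Outside e A d₂
    have hR : ∀ z ∈ R, z ∉ A := fun z hz => outside_notMem hd hz
    have hR2 : (e d₂).1 ∈ R := Relation.ReflTransGen.refl
    have hR1 : (e d₁).1 ∈ R := h.mem_outside he hχ hχr hd
    let B : A → Set C := fun v => {z | z = v.1 ∨ v.1 = d₂.1 ∧ z ∈ R}
    have hpath : ∀ v : A, v.1 = d₂.1 → ∀ z ∈ R,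
        Relation.ReflTransGen (fun p q => G.Adj p q ∧ q ∈ B v) v.1 z ∧
        Relation.ReflTransGen (fun p q => G.Adj p q ∧ q ∈ B v) z v.1 := by
      intro v hv z hz
      have hz' : Relation.ReflTransGen (fun u w => w ∉ A ∧ ∃ i, (e (u, i)).1 = w) (e d₂).1 z := hz
      clear hz
      induction hz' with
      | refl =>
        rw [hv]
        exact ⟨.single ⟨hadj d₂, Or.inr ⟨hv, hR2⟩⟩, .single ⟨(hadj d₂).symm, Or.inl hv.symm⟩⟩
      | @tail u w hu huw ih =>
        have hwR : w ∈ R := Relation.ReflTransGen.tail hu huw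
        obtain ⟨_, i, rfl⟩ := huw
        exact ⟨ih.1.tail ⟨hadj (u, i), Or.inr ⟨hv, hwR⟩⟩,
          .head ⟨(hadj (u, i)).symm, Or.inr ⟨hv, hu⟩⟩ ih.2⟩
    refine htw.of_branchSets B (fun v => ⟨v.1, Or.inl rfl⟩) ?_ ?_ ?_
    · rintro v w z (rfl | ⟨hv, hz⟩) (h' | ⟨hw, hz'⟩)
      · exact Subtype.ext h'
      · exact (hR _ hz' v.2).elim
      · exact (hR _ hz (h' ▸ w.2)).elim
      · exact Subtype.ext (hv.trans hw.symm)
    · rintro v z (rfl | ⟨hv, hz⟩) w (rfl | ⟨hv', hw⟩)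
      · exact .refl
      · exact (hpath v hv' w hw).1
      · exact (hpath v hv z hz).2
      · exact (hpath v hv z hz).2.trans (hpath v hv w hw).1
    · intro v w hvw
      have key : ∀ v w : A, (∃ i, (closeUp e A d₁ d₂ (v, i)).1 = w) →
          ∃ p ∈ B v, ∃ q ∈ B w, G.Adj p q := by
        rintro v w ⟨i, hi⟩
        rcases h.cases (x := (v.1, i)) v.2 with ⟨h1, h2⟩ | ⟨h1, h2, h3, h4, ⟨h6, h5⟩ | ⟨h6, h5⟩⟩
        · rw [h2] at hi
          exact ⟨v, Or.inl rfl, w, Or.inl rfl, hi ▸ hadj (v.1, i)⟩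
        · rw [h5] at hi
          exact ⟨v, Or.inl rfl, (e d₁).1, Or.inr ⟨hi.symm, hR1⟩, by
            rw [← h6]; exact hadj (v.1, i)⟩
        · rw [h5] at hi
          have hv : v.1 = d₂.1 := congrArg Prod.fst h6
          exact ⟨(e d₁).1, Or.inr ⟨hv, hR1⟩, w, Or.inl rfl, hi ▸ (hadj d₁).symm⟩
      rw [SimpleGraph.fromRel_adj] at hvw
      rcases hvw.2 with h' | h'
      · exact key v w h'
      · obtain ⟨p, hp, q, hq, hpq⟩ := key w v h'
        exact ⟨q, hq, p, hp, hpq.symm⟩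
  · refine htw.of_injective Subtype.val Subtype.val_injective fun v w hvw => ?_
    rw [SimpleGraph.fromRel_adj] at hvw
    have key : ∀ v w : A, (∃ i, (closeUp e A d₁ d₂ (v, i)).1 = w) → G.Adj v.1 w.1 := by
      rintro v w ⟨i, hi⟩
      rcases h.cases (x := (v.1, i)) v.2 with ⟨h1, h2⟩ | ⟨h1, h2, h3, h4, _⟩
      · rw [h2] at hi
        exact hi ▸ hadj (v.1, i)
      · exact (hd h3).elim
    rcases hvw.2 with h' | h'
    · exact key v w h'
    · exact (key w v h').symm

/-- The closure of a minimal part is a closed map. -/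
theorem closedPlaneMap [Finite C] (h : MinimalPart e χ A d₁ d₂) (hP : PlaneMap e)
    (hχ : ∀ d, χ (e d) = χ d + 1) (hχr : ∀ c i, χ (c, i + 1) = χ (c, i) + 1)
    (hne : ∀ d, (e d).1 ≠ d.1)
    (htw : TreewidthLE (SimpleGraph.fromRel fun v w => ∃ i, (e (v, i)).1 = w) 2) :
    ClosedPlaneMap (V := A) fun d =>
      (⟨(closeUp e A d₁ d₂ (d.1, d.2)).1, h.closeUp_mem _⟩, (closeUp e A d₁ d₂ (d.1, d.2)).2) := by
  classical
  have he := hP.invol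
  refine { invol := ?_, exists_potential := ?_, loopless := ?_, cut := ?_, treewidth := ?_ }
  · rintro ⟨⟨c, hc⟩, i⟩
    have := h.closeUp_closeUp he (x := (c, i)) hc
    simp only [Prod.mk.eta, this]
  · intro f hf hsum
    let f' : C × ZMod 4 → ZMod 2 := fun d => if hd : d.1 ∈ A then f (⟨d.1, hd⟩, d.2) else 0
    have hf' : ∀ (d : C × ZMod 4) (hd : d.1 ∈ A), f' d = f (⟨d.1, hd⟩, d.2) := fun d hd => dif_pos hd
    obtain ⟨φ, h1, h2⟩ := h.exists_potential hP hχ hχr f'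
      (fun x hx => by
        rw [hf' x hx, hf' _ (h.closeUp_mem x)]
        exact hf (⟨x.1, hx⟩, x.2))
      (fun c hc => by
        rw [hf' (c, 0) hc, hf' (c, 1) hc, hf' (c, 2) hc, hf' (c, 3) hc]
        exact hsum ⟨c, hc⟩)
    exact ⟨fun d => φ (d.1, d.2), fun d => h1 (d.1, d.2) d.1.2, fun d => by
      rw [← h2 (d.1, d.2) d.1.2, hf' (d.1, d.2) d.1.2]⟩
  · intro d hd
    exact h.closeUp_fst_ne hne he (x := (d.1, d.2)) d.1.2 (congrArg Subtype.val hd)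
  · rintro p ⟨x, hx⟩ ⟨y, hy⟩ ⟨D₁, D₂, hD⟩
    refine h.cut he {c | ∃ hc : c ∈ A, p ⟨c, hc⟩} ⟨x, x.2, hx⟩
      ⟨fun c hc => hc.1, fun h' => hy (h' y.2).2⟩ (D₁.1, D₁.2) (D₂.1, D₂.2) ?_
    rintro d ⟨hdA, hdp⟩ hd'
    have := hD (⟨d.1, hdA⟩, d.2) hdp fun h' => hd' ⟨h.closeUp_mem _, h'⟩
    rcases this with h' | h'
    · exact Or.inl (by rw [← h'])
    · exact Or.inr (by rw [← h'])
  · convert h.treewidth he hχ hχr hne htw using 5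
    simp [Subtype.ext_iff]

end MinimalPart

/-- A plane four-regular map of treewidth at most two, without loops that bound a face, contains a
chain of bigons which is closed by at least one edge. -/
theorem PlaneMap.exists_chain {C : Type} [Finite C] [Nonempty C] {e : C × ZMod 4 → C × ZMod 4}
    (hP : PlaneMap e) (hloop : ∀ c i, e (c, i) ≠ (c, i + 1))
    (htw : TreewidthLE (SimpleGraph.fromRel fun v w => ∃ i, (e (v, i)).1 = w) 2) :
    ∃ (k : ℕ) (v : ℕ → C × ZMod 4), 2 ≤ k ∧
      (∀ s t, s < k → t < k → (v s).1 = (v t).1 → s = t) ∧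
      (∀ t, t + 1 < k → e (v t) = ((v (t + 1)).1, (v (t + 1)).2 + 3)) ∧
      (∀ t, t + 1 < k → e ((v t).1, (v t).2 + 1) = ((v (t + 1)).1, (v (t + 1)).2 + 2)) ∧
      (e (v (k - 1)) = ((v 0).1, (v 0).2 + 3) ∨
        e ((v (k - 1)).1, (v (k - 1)).2 + 1) = ((v 0).1, (v 0).2 + 2)) := by
  classical
  have := Fintype.ofFinite C
  obtain ⟨χ, hχ, hχr⟩ := hP.exists_checkerboard
  have he := hP.invol
  have hne := fst_edge_ne he hχ hχr hloop
  obtain ⟨A, d₁, d₂, h⟩ := exists_minimalPart he hχ hχr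
  have hclosed := h.closedPlaneMap hP hχ hχr hne htw
  -- The chain is made to start just after `d₁`, so that the joined edge, if there is one, is a
  -- closing edge.
  obtain ⟨k, v, hk, hvk, hlow, hupp, hinj, hd₁⟩ := hclosed.exists_chain (⟨d₁.1, h.mem₁⟩, d₁.2)
  let w : ℕ → C × ZMod 4 := fun t => ((v t).1, (v t).2)
  have hwA : ∀ t, (w t).1 ∈ A := fun t => (v t).1.2
  have hwk : w k = w 0 := by simp only [w, hvk]
  have hlow' : ∀ t, closeUp e A d₁ d₂ (w t) = ((w (t + 1)).1, (w (t + 1)).2 + 3) := fun t => by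
    have := hlow t
    rw [Prod.ext_iff, Subtype.ext_iff] at this
    exact Prod.ext this.1 this.2
  have hupp' : ∀ t, closeUp e A d₁ d₂ ((w t).1, (w t).2 + 1) =
      ((w (t + 1)).1, (w (t + 1)).2 + 2) := fun t => by
    have := hupp t
    rw [Prod.ext_iff, Subtype.ext_iff] at this
    exact Prod.ext this.1 this.2
  have hinj' : ∀ s t, s < k → t < k → (w s).1 = (w t).1 → s = t := fun s t hs ht hst =>
    hinj s t hs ht (Subtype.ext hst)
  have hd₁' : d₁ = ((w 0).1, (w 0).2 + 2) ∨ d₁ = ((w 0).1, (w 0).2 + 3) := by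
    rcases hd₁ with hd | hd <;> rw [Prod.ext_iff, Subtype.ext_iff] at hd
    · exact Or.inl (Prod.ext hd.1 hd.2)
    · exact Or.inr (Prod.ext hd.1 hd.2)
  have hlast := hlow' (k - 1)
  have hlast' := hupp' (k - 1)
  rw [Nat.sub_add_cancel (by omega), hwk] at hlast hlast'
  have n1 : ∀ z : ZMod 4, z ≠ z + 1 ∧ z ≠ z + 2 ∧ z ≠ z + 3 ∧ z + 1 ≠ z + 2 ∧ z + 1 ≠ z + 3 := by
    decide
  have hfirst1 : (w (k - 1)).1 ≠ (w 0).1 := fun h' => by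
    have := hinj' (k - 1) 0 (by omega) (by omega) h'
    omega
  have hd₂ : (e d₁).1 ∉ A → (d₂ = w (k - 1) ∧ d₁ = ((w 0).1, (w 0).2 + 3)) ∨
      (d₂ = ((w (k - 1)).1, (w (k - 1)).2 + 1) ∧ d₁ = ((w 0).1, (w 0).2 + 2)) := by
    intro hb
    have h2 : d₂ = closeUp e A d₁ d₂ d₁ := (MinimalPart.closeUp_left hb).symm
    rcases hd₁' with hd | hd
    · refine Or.inr ⟨?_, hd⟩
      have := h.closeUp_closeUp he (x := ((w (k - 1)).1, (w (k - 1)).2 + 1)) (hwA _)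
      rw [hlast', ← hd] at this
      exact h2.trans this
    · refine Or.inl ⟨?_, hd⟩
      have := h.closeUp_closeUp he (hwA (k - 1))
      rw [hlast, ← hd] at this
      exact h2.trans this
  -- `d₁` is one of the two rear ends of the first vertex, and `d₂` sits at the last vertex, so
  -- neither is the start of an edge inside the chain.
  have hinner : ∀ t, t + 1 < k → ∀ j, j = 0 ∨ j = 1 → ∀ x, x = ((w t).1, (w t).2 + j) →
      closeUp e A d₁ d₂ x = e x := by
    intro t ht j hj x hx
    have hxA : x.1 ∈ A := hx ▸ hwA t
    rcases h.cases hxA with ⟨_, h2⟩ | ⟨h1, h2, h3, h4, ⟨h5, -⟩ | ⟨h5, -⟩⟩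
    · exact h2
    · exfalso
      rw [h5] at hx
      have hw0 : (w 0).1 = d₁.1 := by rcases hd₁' with h' | h' <;> rw [h']
      have hv : (w t).1 = (w 0).1 := by rw [hw0, hx]
      obtain rfl := hinj' t 0 (by omega) (by omega) hv
      have h6 := congrArg Prod.snd hx
      have h7 := n1 (w 0).2
      rcases hd₁' with h' | h' <;> rw [h'] at h6 <;> rcases hj with rfl | rfl <;>
        simp only [add_zero] at h6
      · exact h7.2.1 h6.symm
      · exact h7.2.2.2.1 h6.symm
      · exact h7.2.2.1 h6.symm
      · exact h7.2.2.2.2 h6.symm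
    · exfalso
      rw [h5] at hx
      have hv : (w t).1 = (w (k - 1)).1 := by
        rcases hd₂ h2 with ⟨h', -⟩ | ⟨h', -⟩ <;> rw [h'] at hx
        · exact (congrArg Prod.fst hx).symm
        · exact (congrArg Prod.fst hx).symm
      have := hinj' t (k - 1) (by omega) (by omega) hv
      omega
  refine ⟨k, w, hk, hinj', fun t ht => ?_, fun t ht => ?_, ?_⟩
  · rw [← hlow' t, hinner t ht 0 (Or.inl rfl) (w t) (Prod.ext rfl (add_zero _).symm)]
  · rw [← hupp' t, hinner t ht 1 (Or.inr rfl) _ rfl]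
  · rcases h.cases (hwA (k - 1)) with ⟨_, h2⟩ | ⟨h1, h2, h3, h4, ⟨h5, -⟩ | ⟨h5, -⟩⟩
    · exact Or.inl (by rw [← h2, hlast])
    · exfalso
      refine hfirst1 ?_
      rw [h5]
      rcases hd₁' with h' | h' <;> rw [h']
    -- If the lower closing edge is the joined one, the upper closing edge belongs to the map
    -- itself.
    · right
      rcases hd₂ h2 with ⟨h', h6⟩ | ⟨h', -⟩
      · rcases h.cases (x := ((w (k - 1)).1, (w (k - 1)).2 + 1)) (hwA (k - 1)) with
          ⟨_, h8⟩ | ⟨-, -, -, -, ⟨h7, -⟩ | ⟨h7, -⟩⟩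
        · rw [← h8, hlast']
        · exfalso
          rw [h6] at h7
          have h9 := congrArg Prod.fst h7
          exact hfirst1 h9
        · rw [h'] at h7
          exact ((n1 _).1 (congrArg Prod.snd h7).symm).elim
      · rw [← h5] at h'
        exact ((n1 _).1 (congrArg Prod.snd h')).elim

/-! ### Irreducible diagrams with crossings are not unlinks -/

namespace LinkDiagram

open Dart

variable {C S : Type}

/-- The graph on the crossings in which two crossings are adjacent if they are joined by an edge
of the diagram. -/
def crossingGraph (D : LinkDiagram C S) : SimpleGraph C :=
  SimpleGraph.fromRel fun v w => ∃ i, vert (D.edge (Sum.inl (v, i))) = Sum.inl w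

/-- The second Reidemeister move is possible at the ends `i` and `i + 1` of `a`, and the strings
through the bigon are closed up in a way which allows to contract the bigon. -/
structure IsPokeAt (e : C × ZMod 4 → C × ZMod 4) (a : C) (i : ZMod 4) (b : C) (l : ZMod 4) :
    Prop where
  ne : a ≠ b
  lower : e (a, i) = (b, l)
  upper : e (a, i + 1) = (b, l + 3)
  up : i = 1 ∨ i = 3 ↔ l = 1 ∨ l = 3
  closed : e (a, i + 2) = (b, l + 2) ∨ e (a, i + 3) = (b, l + 1) ∨
    ((e (a, i + 2)).1 = (e (a, i + 3)).1 ∧ (e (a, i + 2)).1 ≠ a ∧ (e (a, i + 2)).1 ≠ b)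

/-- No edge leads from a crossing to a joint, so a flow on the crossings extends by zero. -/
theorem planeMap (D : LinkDiagram C S) {e : C × ZMod 4 → C × ZMod 4}
    (he : ∀ d, D.edge (Sum.inl d) = Sum.inl (e d)) : PlaneMap e := by
  have hinv : ∀ d, e (e d) = d := fun d => by
    have := D.edge_edge (Sum.inl d)
    rw [he, he] at this
    exact Sum.inl_injective this
  refine ⟨hinv, fun h hh hsum => ?_⟩
  have hflow : IsFlow D.edge (Sum.elim h fun _ => 0) := by
    refine ⟨fun d => ?_, hsum, fun _ => rfl⟩
    rcases d with d | d
    · rw [he]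
      exact hh d
    · rcases hd : D.edge (Sum.inr d) with d' | d'
      · have := D.edge_edge (Sum.inr d)
        rw [hd, he] at this
        cases this
      · rfl
  obtain ⟨φ, hφ⟩ := D.exists_potential hflow
  refine ⟨fun d => φ (Sum.inl d), fun d => ?_, fun d => hφ.flow (Sum.inl d)⟩
  have := hφ.face (Sum.inl d)
  rwa [he] at this

theorem isUp_iff_of_not {C S : Type} (a b : C) (i l : ZMod 4)
    (h : ¬ (IsUp (Sum.inl (a, i) : Dart C S) ↔ IsUp (Sum.inl (b, l + 3) : Dart C S))) :
    (IsUp (Sum.inl (a, i) : Dart C S) ↔ IsUp (Sum.inl (b, l) : Dart C S)) := by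
  revert h
  simp only [IsUp]
  revert i l
  decide

/-- A diagram with crossings and of treewidth at most two in which the moves of the algorithm are
not possible does not represent the unlink. -/
theorem not_isUnlink_of_irreducible (D : LinkDiagram C S) [Nonempty C]
    {e : C × ZMod 4 → C × ZMod 4} (he : ∀ d, D.edge (Sum.inl d) = Sum.inl (e d))
    (htw : TreewidthLE D.crossingGraph 2) (h1 : ∀ c i, e (c, i) ≠ (c, i + 1))
    (h2 : ∀ a i b l, ¬ IsPokeAt e a i b l) : ¬ D.IsUnlink := by
  have := D.finite_crossings
  have hP := D.planeMap he
  have hg : (SimpleGraph.fromRel fun v w => ∃ i, (e (v, i)).1 = w) = D.crossingGraph := by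
    simp [crossingGraph, he, Dart.vert]
  obtain ⟨k, v, hk, hinj, hlow, hupp, hclose⟩ := hP.exists_chain h1 (hg ▸ htw)
  have hT : TwistChain D k v := by
    refine ⟨hk, hinj, fun t ht => ?_, fun t ht => ?_, ?_⟩
    · rw [← hlow t ht, ← he]
    · rw [← hupp t ht, ← he]
    · exact hclose.imp (fun h => by rw [← h, ← he]) (fun h => by rw [← h, ← he])
  intro hD
  refine hT.not_liftable ?_ (hD.liftable k)
  have n31 : (3 : ZMod 4) + 1 = 0 := by decide
  have n33 : (3 : ZMod 4) + 3 = 2 := by decide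
  have n32 : (3 : ZMod 4) + 2 = 1 := by decide
  have n23 : (2 : ZMod 4) + 3 = 1 := by decide
  have n22 : (2 : ZMod 4) + 2 = 0 := by decide
  have n21 : (2 : ZMod 4) + 1 = 3 := by decide
  have n13 : (1 : ZMod 4) + 3 = 0 := by decide
  have n12 : (1 : ZMod 4) + 2 = 3 := by decide
  have n11 : (1 : ZMod 4) + 1 = 2 := by decide
  have hstep : ∀ t, t + 1 < k →
      (IsUp (Sum.inl (v t) : Dart C S) ↔ IsUp (Sum.inl (v (t + 1)) : Dart C S)) := by
    intro t ht
    -- Opposite twists at consecutive crossings put one string over at both corners of the bigon, so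
    -- that an unpoke move is possible there as soon as `closed` holds.
    by_contra hup
    have hne : (v t).1 ≠ (v (t + 1)).1 := fun h => by
      have := hinj t (t + 1) (by omega) ht h
      omega
    have hl := hlow t ht
    have hu := hupp t ht
    have hl' : e ((v (t + 1)).1, (v (t + 1)).2 + 3) = v t := by rw [← hl, hP.invol]
    have hu' : e ((v (t + 1)).1, (v (t + 1)).2 + 2) = ((v t).1, (v t).2 + 1) := by
      rw [← hu, hP.invol]
    have hup' : IsUp (Sum.inl ((v t).1, (v t).2) : Dart C S) ↔
        IsUp (Sum.inl ((v (t + 1)).1, (v (t + 1)).2 + 3) : Dart C S) := by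
      refine isUp_iff_of_not _ _ _ _ ?_
      rw [add_assoc, n33]
      have h4 : ∀ l : ZMod 4, (l + 2 = 1 ∨ l + 2 = 3) ↔ (l = 1 ∨ l = 3) := by decide
      simpa [IsUp, h4] using hup
    -- The condition `closed` concerns the free ends of the first crossing named. The first bigon is
    -- therefore read from `v 1`, whose free ends lead on to `v 2`, or are closed up if `k = 2`;
    -- every later one is read from `v t`, whose free ends lead back to `v (t - 1)`.
    by_cases ht0 : t = 0
    · subst ht0
      refine h2 (v 1).1 ((v 1).2 + 2) (v 0).1 ((v 0).2 + 1) ⟨hne.symm, hu', ?_, ?_, ?_⟩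
      · rw [add_assoc, n21, add_assoc, n13, add_zero]
        exact hl'
      · have h4 : ∀ l : ZMod 4, (l + 2 = 1 ∨ l + 2 = 3) ↔ (l = 1 ∨ l = 3) := by decide
        have h5 : ∀ l : ZMod 4, (l + 1 = 1 ∨ l + 1 = 3) ↔ ¬ (l = 1 ∨ l = 3) := by decide
        simp only [h4, h5]
        have : ¬ ((v 0).2 = 1 ∨ (v 0).2 = 3 ↔ (v 1).2 = 1 ∨ (v 1).2 = 3) := hup
        tauto
      · simp only [add_assoc, n22, n23, n12, n11, add_zero]
        by_cases hk2 : k = 2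
        · subst hk2
          exact hclose.imp id fun h => Or.inl h
        · refine Or.inr (Or.inr ?_)
          have ht1 : 1 + 1 < k := by omega
          have hl2 := hlow 1 ht1
          have hu2 := hupp 1 ht1
          rw [show ((v 1).1, (v 1).2) = v 1 from rfl, hl2, hu2]
          refine ⟨rfl, fun h => ?_, fun h => ?_⟩
          · have := hinj 2 1 (by omega) (by omega) h
            omega
          · have := hinj 2 0 (by omega) (by omega) h
            omega
    · refine h2 (v t).1 (v t).2 (v (t + 1)).1 ((v (t + 1)).2 + 3) ⟨hne, hl, ?_, hup', ?_⟩
      · rw [add_assoc, n33]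
        exact hu
      · refine Or.inr (Or.inr ?_)
        have ht1 : t - 1 + 1 < k := by omega
        have hl2 := congrArg e (hlow (t - 1) ht1)
        have hu2 := congrArg e (hupp (t - 1) ht1)
        rw [Nat.sub_add_cancel (by omega), hP.invol] at hl2 hu2
        rw [← hl2, ← hu2]
        refine ⟨rfl, fun h => ?_, fun h => ?_⟩
        · have := hinj (t - 1) t (by omega) (by omega) h
          omega
        · have := hinj (t - 1) (t + 1) (by omega) (by omega) h
          omega
  intro t ht
  induction t with
  | zero => rfl
  | succ t ih => exact (hstep t ht).symm.trans (ih (by omega))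

end LinkDiagram

/-! ### Diagrams stored as arrays -/

/-- The array operation which joins the edges at the ends `x` and `y`. -/
def splice (f : ℕ → ℕ) (x y : ℕ) : ℕ → ℕ :=
  if f x = y then f else Function.update (Function.update f (f x) (f y)) (f y) (f x)

namespace LinkDiagram

open Dart

variable {C S C' S' : Type}

/-- The array `f` stores the edges of `D`, where the dart `d` has the number `enc d`. -/
structure Encodes (D : LinkDiagram C S) (enc : Dart C S → ℕ) (f : ℕ → ℕ) : Prop where
  injective : Function.Injective enc
  edge : ∀ d, f (enc d) = enc (D.edge d)

/-- A joint which alone forms a circle. -/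
def IsCircle (D : LinkDiagram C S) (s : S) : Prop := D.edge (Sum.inr (s, 0)) = Sum.inr (s, 1)

open Classical in
/-- `D'` arises from `D` by the removal of the joint `s`. -/
def IsRemoval (D : LinkDiagram C S) (s : S) (D' : LinkDiagram C {t : S // t ≠ s}) : Prop :=
  ∀ x, removeJoint s (D'.edge x) =
    if vert (D.edge (removeJoint s x)) = Sum.inr s then
      D.edge (rot (D.edge (removeJoint s x))) else D.edge (removeJoint s x)

section Removal

variable {D : LinkDiagram C S} {s : S} {D' : LinkDiagram C {t : S // t ≠ s}}

theorem IsRemoval.of_ne (h : IsRemoval D s D') {x : Dart C {t : S // t ≠ s}}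
    (hx : vert (D.edge (removeJoint s x)) ≠ Sum.inr s) :
    removeJoint s (D'.edge x) = D.edge (removeJoint s x) := by
  rw [h x, if_neg hx]

theorem IsRemoval.of_eq (h : IsRemoval D s D') {x : Dart C {t : S // t ≠ s}} {l : ZMod 2}
    (hx : D.edge (removeJoint s x) = Sum.inr (s, l)) :
    removeJoint s (D'.edge x) = D.edge (Sum.inr (s, l + 1)) := by
  rw [h x, hx, if_pos (vert_inr _ _), rot_inr]

theorem IsRemoval.cases (h : IsRemoval D s D') (x : Dart C {t : S // t ≠ s}) :
    removeJoint s (D'.edge x) = D.edge (removeJoint s x) ∨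
      ∃ l, D.edge (removeJoint s x) = Sum.inr (s, l) ∧
        removeJoint s (D'.edge x) = D.edge (Sum.inr (s, l + 1)) := by
  by_cases hx : vert (D.edge (removeJoint s x)) = Sum.inr s
  · right
    rcases vert_eq_inr hx with hx | hx
    · exact ⟨0, hx, h.of_eq hx⟩
    · exact ⟨1, hx, h.of_eq hx⟩
  · exact Or.inl (h.of_ne hx)

theorem vert_removeJoint_eq_inl {x : Dart C {t : S // t ≠ s}} {v : C} :
    vert (removeJoint s x) = Sum.inl v ↔ vert x = Sum.inl v := by
  rcases x with ⟨c, i⟩ | ⟨t, i⟩ <;> simp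

theorem IsRemoval.isCircle (h : IsRemoval D s D') {t : {t : S // t ≠ s}} (ht : D.IsCircle t.1) :
    D'.IsCircle t := by
  refine removeJoint_injective s ?_
  have h1 : D.edge (removeJoint s (Sum.inr (t, 0))) = Sum.inr (t.1, 1) := ht
  rw [h.of_ne (by rw [h1]; simpa using t.2), h1]
  rfl

/-- Entries of removed darts stay in the array; an encoding concerns only the darts that are left,
so `splice` need only redirect the two neighbours of the joint. -/
theorem Encodes.removal {enc : Dart C S → ℕ} {f : ℕ → ℕ} (hf : Encodes D enc f)
    (h : IsRemoval D s D') (hs : ¬ D.IsCircle s) :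
    Encodes D' (enc ∘ removeJoint s) (splice f (enc (Sum.inr (s, 0))) (enc (Sum.inr (s, 1)))) := by
  refine ⟨hf.injective.comp (removeJoint_injective s), fun x => ?_⟩
  have hs1 : enc (D.edge (Sum.inr (s, 0))) ≠ enc (Sum.inr (s, 1)) := fun h => hs (hf.injective h)
  have hne : D.edge (Sum.inr (s, 0)) ≠ D.edge (Sum.inr (s, 1)) := fun h => by
    have := D.edge.injective h
    simp at this
  rw [splice, hf.edge, hf.edge, if_neg hs1]
  simp only [Function.comp]
  by_cases hx : vert (D.edge (removeJoint s x)) = Sum.inr s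
  · rcases vert_eq_inr hx with hx | hx
    · have hx' : removeJoint s x = D.edge (Sum.inr (s, 0)) := by rw [← hx, D.edge_edge]
      rw [h.of_eq hx, hx', Function.update_of_ne (hf.injective.ne hne), Function.update_self,
        zero_add]
    · have hx' : removeJoint s x = D.edge (Sum.inr (s, 1)) := by rw [← hx, D.edge_edge]
      rw [h.of_eq hx, hx', Function.update_self, show (1 : ZMod 2) + 1 = 0 by decide]
  · rw [h.of_ne hx, Function.update_of_ne, Function.update_of_ne, hf.edge]
    · refine hf.injective.ne fun h' => hx ?_
      rw [h', D.edge_edge]; rfl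
    · refine hf.injective.ne fun h' => hx ?_
      rw [h', D.edge_edge]; rfl

open Classical in
-- The joint is contracted into the vertex at the other end of its first edge.
theorem IsRemoval.treewidth (h : IsRemoval D s D') (hs : ¬ D.IsCircle s)
    (htw : TreewidthLE D.graph 2) : TreewidthLE D'.graph 2 := by
  have := D.finite_crossings
  have := D.finite_joints
  let j : C ⊕ {t : S // t ≠ s} → C ⊕ S := Sum.map id Subtype.val
  have hj : Function.Injective j := Sum.map_injective.2 ⟨Function.injective_id, Subtype.val_injective⟩
  have hjv : ∀ x : Dart C {t : S // t ≠ s}, vert (removeJoint s x) = j (vert x) := by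
    rintro (⟨c, i⟩ | ⟨t, i⟩) <;> rfl
  have hjs : ∀ v, j v ≠ Sum.inr s := by
    rintro (c | ⟨t, ht⟩) <;> simp [j, *]
  have hadj : ∀ d, vert d ≠ vert (D.edge d) → D.graph.Adj (vert d) (vert (D.edge d)) := fun d hd => by
    rw [graph, Dart.graph, SimpleGraph.fromRel_adj]
    exact ⟨hd, Or.inl ⟨d, rfl, rfl⟩⟩
  have hsv : ∀ i, vert (D.edge (Sum.inr (s, i))) ≠ Sum.inr s := by
    intro i hi
    have h0 : ∀ i, D.edge (Sum.inr (s, i)) ≠ Sum.inr (s, i + 1) := by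
      intro i
      rcases eq_zero_or_one i with rfl | rfl
      · exact hs
      · intro h
        refine hs ?_
        rw [IsCircle, show Sum.inr (s, 0) = (Sum.inr (s, 1 + 1) : Dart C S) from rfl, ← h, D.edge_edge]
    rcases eq_zero_or_one i with rfl | rfl <;> rcases vert_eq_inr hi with h1 | h1
    · exact D.edge_ne _ h1
    · exact h0 0 h1
    · exact h0 1 h1
    · exact D.edge_ne _ h1
  let v₀ := vert (D.edge (Sum.inr (s, 0)))
  have hv₀ : D.graph.Adj (Sum.inr s) v₀ := hadj (Sum.inr (s, 0)) fun h => hsv 0 h.symm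
  refine htw.of_branchSets (fun v => {z | z = j v ∨ j v = v₀ ∧ z = Sum.inr s})
    (fun v => ⟨j v, Or.inl rfl⟩) ?_ ?_ ?_
  · rintro v w z (rfl | ⟨hv, rfl⟩) (h' | ⟨hw, h'⟩)
    · exact hj h'
    · exact (hjs v h').elim
    · exact (hjs w h'.symm).elim
    · exact hj (hv.trans hw.symm)
  · rintro v z (rfl | ⟨hv, rfl⟩) w (rfl | ⟨hw, rfl⟩)
    · exact .refl
    · exact .single ⟨hw ▸ hv₀.symm, Or.inr ⟨hw, rfl⟩⟩
    · exact .single ⟨hv ▸ hv₀, Or.inl rfl⟩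
    · exact .refl
  · have key : ∀ v w, v ≠ w → (∃ d, vert d = v ∧ vert (D'.edge d) = w) →
        ∃ p, (p = j v ∨ j v = v₀ ∧ p = Sum.inr s) ∧
          ∃ q, (q = j w ∨ j w = v₀ ∧ q = Sum.inr s) ∧ D.graph.Adj p q := by
      rintro v w hvw ⟨d, rfl, rfl⟩
      have hvw' := hj.ne hvw
      rcases h.cases d with h1 | ⟨l, h1, h2⟩
      · refine ⟨_, Or.inl rfl, _, Or.inl rfl, ?_⟩
        rw [← hjv, ← hjv, h1] at hvw' ⊢
        exact hadj _ hvw'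
      · have hd : removeJoint s d = D.edge (Sum.inr (s, l)) := by rw [← h1, D.edge_edge]
        rw [← hjv, ← hjv, h2, hd]
        have ha : ∀ i, D.graph.Adj (Sum.inr s) (vert (D.edge (Sum.inr (s, i)))) := fun i =>
          hadj (Sum.inr (s, i)) fun h => hsv i h.symm
        rcases eq_zero_or_one l with rfl | rfl
        · exact ⟨Sum.inr s, Or.inr ⟨rfl, rfl⟩, _, Or.inl rfl, ha _⟩
        · exact ⟨_, Or.inl rfl, Sum.inr s, Or.inr ⟨rfl, rfl⟩, (ha 1).symm⟩
    intro v w hvw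
    rw [graph, Dart.graph, SimpleGraph.fromRel_adj] at hvw
    rcases hvw.2 with h' | h'
    · exact key v w hvw.1 h'
    · obtain ⟨p, hp, q, hq, hpq⟩ := key w v hvw.1.symm h'
      exact ⟨q, hq, p, hp, hpq.symm⟩

end Removal

/-- All edges between crossings are edges of `G`, and the joints which do not form circles lie
next to the crossings in `Q`, in such a way that their removal produces edges of `G`. -/
structure Centred (D : LinkDiagram C S) (G : SimpleGraph C) (Q : C → Prop) : Prop where
  crossing : ∀ v i w, vert (D.edge (Sum.inl (v, i))) = Sum.inl w → v = w ∨ G.Adj v w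
  joint : ∀ s, D.IsCircle s ∨ ∃ i w, vert (D.edge (Sum.inr (s, i))) = Sum.inl w ∧ Q w
  near : ∀ s i v w, vert (D.edge (Sum.inr (s, i))) = Sum.inl v → Q w → v = w ∨ G.Adj w v

/-- A removed joint is attached to a crossing in `Q`. By `near`, if its removal joins two crossings,
they are equal or adjacent in `G`. -/
theorem Centred.removal {D : LinkDiagram C S} {s : S} {D' : LinkDiagram C {t : S // t ≠ s}}
    {G : SimpleGraph C} {Q : C → Prop} (hD : Centred D G Q) (h : IsRemoval D s D')
    (hs : ¬ D.IsCircle s) : Centred D' G Q := by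
  refine ⟨fun v i w hw => ?_, fun t => ?_, fun t i v w hv hw => ?_⟩
  · rw [← vert_removeJoint_eq_inl (s := s)] at hw
    rcases h.cases (Sum.inl (v, i)) with h1 | ⟨l, h1, h2⟩
    · rw [h1] at hw
      exact hD.crossing v i w hw
    · rw [h2] at hw
      have hv : vert (D.edge (Sum.inr (s, l))) = Sum.inl v := by rw [← h1, D.edge_edge]; rfl
      obtain ⟨i₀, z, hz, hQ⟩ := (hD.joint s).resolve_left hs
      have h3 : i₀ = l ∨ i₀ = l + 1 :=
        (by decide : ∀ i l : ZMod 2, i = l ∨ i = l + 1) i₀ l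
      rcases h3 with rfl | rfl
      · rw [hv] at hz
        obtain rfl := Sum.inl_injective hz
        exact (hD.near s _ w v hw hQ).imp Eq.symm id
      · rw [hw] at hz
        obtain rfl := Sum.inl_injective hz
        exact (hD.near s _ v w hv hQ).imp id SimpleGraph.Adj.symm
  · rcases hD.joint t.1 with h1 | ⟨i, w, hw, hQ⟩
    · exact Or.inl (h.isCircle h1)
    · refine Or.inr ⟨i, w, ?_, hQ⟩
      rw [← vert_removeJoint_eq_inl (s := s), h.of_ne, removeJoint_inr, hw]
      rw [removeJoint_inr, hw]
      simp
  · rw [← vert_removeJoint_eq_inl (s := s)] at hv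
    rcases h.cases (Sum.inr (t, i)) with h1 | ⟨l, h1, h2⟩
    · rw [h1] at hv
      exact hD.near t.1 i v w hv hw
    · rw [h2] at hv
      exact hD.near s _ v w hv hw

theorem Centred.treewidth {D : LinkDiagram C S} {G : SimpleGraph C} {Q : C → Prop}
    (hD : Centred D G Q) (hG : TreewidthLE G 2) : TreewidthLE D.crossingGraph 2 := by
  have := D.finite_crossings
  refine hG.of_injective id Function.injective_id fun x y hxy => ?_
  rw [crossingGraph, SimpleGraph.fromRel_adj] at hxy
  rcases hxy.2 with ⟨i, h⟩ | ⟨i, h⟩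
  · exact (hD.crossing _ _ _ h).resolve_left hxy.1
  · exact ((hD.crossing _ _ _ h).resolve_left hxy.1.symm).symm

theorem Equivalent.refl (D : LinkDiagram C S) : Equivalent D D :=
  .iso ⟨Equiv.refl _, fun _ => rfl, fun _ => Iff.rfl, fun _ => rfl⟩

/-- The array operation `splice` removes a joint, unless it forms a circle. -/
theorem Encodes.resolve {D : LinkDiagram C S} {enc : Dart C S → ℕ} {f : ℕ → ℕ}
    (hf : Encodes D enc f) (s : S) :
    ∃ (S' : Type) (D' : LinkDiagram C S') (enc' : Dart C S' → ℕ),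
      Encodes D' enc' (splice f (enc (Sum.inr (s, 0))) (enc (Sum.inr (s, 1)))) ∧
      Equivalent D D' ∧ (∀ x, enc' (Sum.inl x) = enc (Sum.inl x)) ∧
      (∀ t', D'.IsCircle t' ∨ ∃ t, t ≠ s ∧ ¬ D.IsCircle t ∧
        ∀ i, enc' (Sum.inr (t', i)) = enc (Sum.inr (t, i))) ∧
      (∀ t, t ≠ s → ∃ t', ∀ i, enc' (Sum.inr (t', i)) = enc (Sum.inr (t, i))) ∧
      (∀ G Q, Centred D G Q → Centred D' G Q) ∧
      (TreewidthLE D.graph 2 → TreewidthLE D'.graph 2) := by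
  by_cases hs : D.IsCircle s
  -- A circle is kept as a joint, and the array does not change.
  · refine ⟨S, D, enc, ?_, .refl D, fun _ => rfl, fun t => ?_, fun t _ => ⟨t, fun _ => rfl⟩,
      fun _ _ => id, id⟩
    · rwa [splice, hf.edge, if_pos (congrArg enc hs)]
    · by_cases ht : D.IsCircle t
      · exact Or.inl ht
      · exact Or.inr ⟨t, by rintro rfl; exact ht hs, ht, fun _ => rfl⟩
  · obtain ⟨D', hD', h⟩ := D.exists_unsubdivide s hs
    have h : IsRemoval D s D' := h
    refine ⟨_, D', _, hf.removal h hs, .unsubdivide hD', fun _ => rfl, fun t => ?_,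
      fun t ht => ⟨⟨t, ht⟩, fun _ => rfl⟩, fun _ _ hc => hc.removal h hs, h.treewidth hs⟩
    by_cases ht : D.IsCircle t.1
    · exact Or.inl (h.isCircle ht)
    · exact Or.inr ⟨t.1, t.2, ht, fun _ => rfl⟩

end LinkDiagram

/-! ### Contraction of removed crossings, and diagrams held in an array -/

namespace LinkDiagram

open Dart

variable {C S C₀ S₀ S₁ : Type}

/-- The contraction of all vertices outside `P` into the vertex `w`. -/
def contractGraph (H : SimpleGraph C) (P : C → Prop) (w : {c : C // P c}) :
    SimpleGraph {c : C // P c} :=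
  SimpleGraph.fromRel fun x y => H.Adj x.1 y.1 ∨ (x = w ∧ ∃ k, ¬ P k ∧ H.Adj k y.1)

theorem treewidth_contractGraph [Finite C] {H : SimpleGraph C} (htw : TreewidthLE H 2)
    {P : C → Prop} {w : {c : C // P c}} {a b : C} (hP : ∀ k, ¬ P k → k = a ∨ k = b) (ha : ¬ P a)
    (hwa : H.Adj w.1 a) (hab : b = a ∨ H.Adj a b) : TreewidthLE (contractGraph H P w) 2 := by
  let B : {c : C // P c} → Set C := fun x => {z | z = x.1 ∨ x = w ∧ ¬ P z}
  have haB : a ∈ B w := Or.inr ⟨rfl, ha⟩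
  have hpath : ∀ k, ¬ P k → Relation.ReflTransGen (fun p q => H.Adj p q ∧ q ∈ B w) w.1 k ∧
      Relation.ReflTransGen (fun p q => H.Adj p q ∧ q ∈ B w) k w.1 := by
    have h1 : Relation.ReflTransGen (fun p q => H.Adj p q ∧ q ∈ B w) w.1 a ∧
        Relation.ReflTransGen (fun p q => H.Adj p q ∧ q ∈ B w) a w.1 :=
      ⟨.single ⟨hwa, haB⟩, .single ⟨hwa.symm, Or.inl rfl⟩⟩
    intro k hk
    rcases hP k hk with rfl | rfl
    · exact h1
    · rcases hab with rfl | hab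
      · exact h1
      · exact ⟨h1.1.tail ⟨hab, Or.inr ⟨rfl, hk⟩⟩, h1.2.head ⟨hab.symm, haB⟩⟩
  refine htw.of_branchSets B (fun x => ⟨x.1, Or.inl rfl⟩) ?_ ?_ ?_
  · rintro x y v (rfl | ⟨rfl, hv⟩) (h | ⟨h, hv'⟩)
    · exact Subtype.ext h
    · exact (hv' x.2).elim
    · exact (hv (h ▸ y.2)).elim
    · exact h.symm
  · rintro x v (rfl | ⟨rfl, hv⟩) u (rfl | ⟨h, hu⟩)
    · exact .refl
    · exact h ▸ (hpath u hu).1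
    · exact (hpath v hv).2
    · exact (hpath v hv).2.trans (hpath u hu).1
  · intro x y hxy
    have key : ∀ x y : {c : C // P c}, (H.Adj x.1 y.1 ∨ (x = w ∧ ∃ k, ¬ P k ∧ H.Adj k y.1)) →
        ∃ v ∈ B x, ∃ u ∈ B y, H.Adj v u := by
      rintro x y (h | ⟨rfl, k, hk, h⟩)
      · exact ⟨_, Or.inl rfl, _, Or.inl rfl, h⟩
      · exact ⟨k, Or.inr ⟨rfl, hk⟩, _, Or.inl rfl, h⟩
    rw [contractGraph, SimpleGraph.fromRel_adj] at hxy
    rcases hxy.2 with h | h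
    · exact key x y h
    · obtain ⟨v, hv, u, hu, huv⟩ := key y x h
      exact ⟨u, hu, v, hv, huv.symm⟩

theorem crossingGraph_adj {D : LinkDiagram C S} {v w : C} {i : ZMod 4} (hvw : v ≠ w)
    (h : vert (D.edge (Sum.inl (v, i))) = Sum.inl w) : D.crossingGraph.Adj v w := by
  rw [crossingGraph, SimpleGraph.fromRel_adj]
  exact ⟨hvw, Or.inl ⟨i, h⟩⟩

theorem eq_inl_of_vert {d : Dart C S} {c : C} (h : vert d = Sum.inl c) :
    ∃ j, d = Sum.inl (c, j) := by
  rcases vert_eq_inl h 0 with h | h | h | h <;> exact ⟨_, h⟩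

theorem IsCircle.edge {D : LinkDiagram C S} {s : S} (h : D.IsCircle s) (i : ZMod 2) :
    vert (D.edge (Sum.inr (s, i))) = Sum.inr s := by
  rcases eq_zero_or_one i with rfl | rfl
  · rw [h]; rfl
  · rw [← h, D.edge_edge]; rfl

section Centred

variable {P : C → Prop} {D : LinkDiagram C S} {D₁ : LinkDiagram {c : C // P c} S₁}
  {g : Dart {c : C // P c} S₁ → Dart C S}

theorem centred_crossing (hg : ∀ x, g (D₁.edge x) = D.edge (g x))
    (hgc : ∀ c i, g (Sum.inl (c, i)) = Sum.inl (c.1, i)) {v w : {c : C // P c}} {i : ZMod 4}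
    (h : vert (D₁.edge (Sum.inl (v, i))) = Sum.inl w) : v = w ∨ D.crossingGraph.Adj v.1 w.1 := by
  by_cases hvw : v = w
  · exact Or.inl hvw
  · refine Or.inr (crossingGraph_adj (i := i) (fun h => hvw (Subtype.ext h)) ?_)
    rw [← hgc, ← hg]
    obtain ⟨j, hj⟩ := eq_inl_of_vert h
    rw [hj, hgc]
    rfl

/-- If all joints are circles, their removal creates no edge, so the new crossing graph is a
subgraph of the old one. -/
theorem treewidth_of_circles (hg : ∀ x, g (D₁.edge x) = D.edge (g x))
    (hgc : ∀ c i, g (Sum.inl (c, i)) = Sum.inl (c.1, i)) (htw : TreewidthLE D.crossingGraph 2)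
    (hs : ∀ s, D₁.IsCircle s) :
    ∃ G Q, TreewidthLE G 2 ∧ Centred D₁ G Q := by
  have := D₁.finite_crossings
  refine ⟨D.crossingGraph.comap Subtype.val, fun _ => False,
    htw.of_injective Subtype.val Subtype.val_injective fun x y h => h,
    fun v i w h => centred_crossing hg hgc h, fun s => Or.inl (hs s), fun _ _ _ _ _ h => h.elim⟩

/-- Every new joint that is not a circle is attached to `w`, and its ends replace ends of removed
crossings. So the edges created by removing the joints start at `w` and already occur when the
removed crossings are contracted into `w`. -/
theorem treewidth_of_contraction (hg : ∀ x, g (D₁.edge x) = D.edge (g x))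
    (hgc : ∀ c i, g (Sum.inl (c, i)) = Sum.inl (c.1, i)) (htw : TreewidthLE D.crossingGraph 2)
    (w : {c : C // P c}) {a b : C} (hP : ∀ k, ¬ P k → k = a ∨ k = b) (ha : ¬ P a)
    (hwa : D.crossingGraph.Adj w.1 a) (hab : b = a ∨ D.crossingGraph.Adj a b)
    (hs : ∀ s, D₁.IsCircle s ∨ (∃ i, vert (D₁.edge (Sum.inr (s, i))) = Sum.inl w) ∧
      ∀ i, ∃ k, ¬ P k ∧ vert (g (Sum.inr (s, i))) = Sum.inl k) :
    ∃ G Q, TreewidthLE G 2 ∧ Centred D₁ G Q := by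
  have := D.finite_crossings
  refine ⟨contractGraph D.crossingGraph P w, fun z => z = w,
    treewidth_contractGraph htw hP ha hwa hab, fun v i w h => ?_, fun s => ?_, ?_⟩
  · by_cases hvw : v = w
    · exact Or.inl hvw
    · rw [contractGraph, SimpleGraph.fromRel_adj]
      exact Or.inr ⟨hvw, Or.inl (Or.inl ((centred_crossing hg hgc h).resolve_left hvw))⟩
  · exact (hs s).imp id fun h => ⟨h.1.choose, w, h.1.choose_spec, rfl⟩
  · rintro s i v _ hv rfl
    rcases hs s with h | ⟨-, h⟩
    · rw [h.edge] at hv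
      cases hv
    · obtain ⟨k, hk, hgk⟩ := h i
      refine or_iff_not_imp_left.2 fun hvw => ?_
      rw [contractGraph, SimpleGraph.fromRel_adj]
      refine ⟨fun h => hvw h.symm, Or.inl (Or.inr ⟨rfl, k, hk, ?_⟩)⟩
      obtain ⟨j, hj⟩ := eq_inl_of_vert hgk
      obtain ⟨l, hl⟩ := eq_inl_of_vert hv
      refine crossingGraph_adj (i := j) (fun h => hk (h ▸ v.2)) ?_
      rw [← hj, ← hg, hl, hgc]
      rfl

end Centred

/-- The number of the end `i` of the crossing number `a`. -/
def endCode (a : ℕ) (i : ZMod 4) : ℕ := 4 * a + i.val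

theorem endCode_div (a : ℕ) (i : ZMod 4) : endCode a i / 4 = a := by
  have := ZMod.val_lt i
  unfold endCode
  omega

theorem endCode_cast (a : ℕ) (i : ZMod 4) : ((endCode a i : ℕ) : ZMod 4) = i := by
  have h4 : (4 : ZMod 4) = 0 := by decide
  simp [endCode, h4]

theorem endCode_inj {a b : ℕ} {i j : ZMod 4} (h : endCode a i = endCode b j) : a = b ∧ i = j := by
  have h1 := congrArg (· / 4) h
  have h2 := congrArg (fun k : ℕ => (k : ZMod 4)) h
  simp only [endCode_div, endCode_cast] at h1 h2
  exact ⟨h1, h2⟩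

/-- The map on ends of crossings which is stored in an array. -/
def arrayMap (f : ℕ → ℕ) (d : ℕ × ZMod 4) : ℕ × ZMod 4 :=
  (f (endCode d.1 d.2) / 4, (f (endCode d.1 d.2) : ZMod 4))

/-- The array `f` stores a diagram which is equivalent to `D₀`, whose crossings have the
numbers in `A`, whose joints are circles, and whose crossing graph has treewidth at most two. -/
def Stores (D₀ : LinkDiagram C₀ S₀) (A : Set ℕ) (f : ℕ → ℕ) : Prop :=
  ∃ (C S : Type) (D : LinkDiagram C S) (enc : Dart C S → ℕ) (L : C → ℕ),
    Function.Injective L ∧ Set.range L = A ∧ Encodes D enc f ∧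
    (∀ c i, enc (Sum.inl (c, i)) = endCode (L c) i) ∧ (∀ s, D.IsCircle s) ∧
    TreewidthLE D.crossingGraph 2 ∧ Equivalent D₀ D

theorem exists_edge_of_circles {D : LinkDiagram C S} (hs : ∀ s, D.IsCircle s) :
    ∃ e : C × ZMod 4 → C × ZMod 4, ∀ d, D.edge (Sum.inl d) = Sum.inl (e d) := by
  have : ∀ d, ∃ d', D.edge (Sum.inl d) = Sum.inl d' := by
    intro d
    rcases h : D.edge (Sum.inl d) with d' | ⟨s, i⟩
    · exact ⟨d', rfl⟩
    · have h1 := (hs s).edge i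
      rw [← h, D.edge_edge] at h1
      cases h1
  choose e he using this
  exact ⟨e, he⟩

theorem arrayMap_eq {D : LinkDiagram C S} {enc : Dart C S → ℕ} {L : C → ℕ} {f : ℕ → ℕ}
    {e : C × ZMod 4 → C × ZMod 4} (hf : Encodes D enc f)
    (hL : ∀ c i, enc (Sum.inl (c, i)) = endCode (L c) i)
    (he : ∀ d, D.edge (Sum.inl d) = Sum.inl (e d)) (c : C) (i : ZMod 4) :
    f (endCode (L c) i) = endCode (L (e (c, i)).1) (e (c, i)).2 ∧
    arrayMap f (L c, i) = (L (e (c, i)).1, (e (c, i)).2) := by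
  have : f (endCode (L c) i) = endCode (L (e (c, i)).1) (e (c, i)).2 := by
    rw [← hL, hf.edge, he, ← hL]
  exact ⟨this, by rw [arrayMap, this, endCode_div, endCode_cast]⟩

theorem Stores.isUnlink {D₀ : LinkDiagram C₀ S₀} {f : ℕ → ℕ} (h : Stores D₀ ∅ f) :
    D₀.IsUnlink := by
  obtain ⟨C, S, D, enc, L, hL, hA, -, -, -, -, h⟩ := h
  exact ⟨C, S, D, ⟨fun c => by
    have : L c ∈ Set.range L := ⟨c, rfl⟩
    rwa [hA] at this⟩, h⟩

theorem isUnlink_iff_of_equivalent {D₀ : LinkDiagram C₀ S₀} {D : LinkDiagram C S}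
    (h : Equivalent D₀ D) : D₀.IsUnlink ↔ D.IsUnlink :=
  ⟨fun ⟨C', S', D', hC, h'⟩ => ⟨C', S', D', hC, h.symm.trans h'⟩,
    fun ⟨C', S', D', hC, h'⟩ => ⟨C', S', D', hC, h.trans h'⟩⟩

theorem Stores.not_isUnlink {D₀ : LinkDiagram C₀ S₀} {A : Set ℕ} {f : ℕ → ℕ} (h : Stores D₀ A f)
    (hA : A.Nonempty) (h1 : ∀ a ∈ A, ∀ i, arrayMap f (a, i) ≠ (a, i + 1))
    (h2 : ∀ a ∈ A, ∀ i b l, ¬ IsPokeAt (arrayMap f) a i b l) : ¬ D₀.IsUnlink := by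
  obtain ⟨C, S, D, enc, L, hLi, rfl, hf, hL, hs, htw, h⟩ := h
  obtain ⟨e, he⟩ := exists_edge_of_circles hs
  have hm := fun c i => (arrayMap_eq hf hL he c i).2
  obtain ⟨_, c, rfl⟩ := hA
  have : Nonempty C := ⟨c⟩
  rw [isUnlink_iff_of_equivalent h]
  refine D.not_isUnlink_of_irreducible he htw (fun c i hc => ?_) fun a i b l hp => ?_
  · refine h1 (L c) ⟨c, rfl⟩ i ?_
    rw [hm, hc]
  · refine h2 (L a) ⟨a, rfl⟩ i (L b) l ⟨hLi.ne hp.ne, ?_, ?_, hp.up, ?_⟩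
    · rw [hm, hp.lower]
    · rw [hm, hp.upper]
    · rw [hm, hm]
      rcases hp.closed with h | h | ⟨h, h', h''⟩
      · rw [h]; exact Or.inl rfl
      · rw [h]; exact Or.inr (Or.inl rfl)
      · exact Or.inr (Or.inr ⟨congrArg L h, hLi.ne h', hLi.ne h''⟩)

end LinkDiagram

/-! ### The two moves on stored diagrams -/

namespace LinkDiagram

open Dart

variable {C S C₀ S₀ S₁ : Type}

/-- After a first Reidemeister move, the two remaining ends of the crossing are joined. -/
theorem Stores.untwist {D₀ : LinkDiagram C₀ S₀} {A : Set ℕ} {f : ℕ → ℕ} (h : Stores D₀ A f)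
    {a : ℕ} {i : ZMod 4} (ha : a ∈ A) (hi : arrayMap f (a, i) = (a, i + 1)) :
    Stores D₀ (A \ {a}) (splice f (endCode a (i + 2)) (endCode a (i + 3))) := by
  obtain ⟨C, S, D, enc, L, hLi, rfl, hf, hL, hs, htw, h⟩ := h
  obtain ⟨e, he⟩ := exists_edge_of_circles hs
  have hm := fun c i => (arrayMap_eq hf hL he c i).2
  obtain ⟨c, rfl⟩ := ha
  rw [hm, Prod.mk.injEq] at hi
  have hc : D.edge (Sum.inl (c, i)) = Sum.inl (c, i + 1) := by
    rw [he]
    exact congrArg Sum.inl (Prod.ext (hLi hi.1) hi.2)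
  have hc' : D.edge (Sum.inl (c, i + 1)) = Sum.inl (c, i) := by rw [← hc, D.edge_edge]
  obtain ⟨D₁, hD₁, hg⟩ := D.exists_untwist c i hc
  have hg' := untwistMap_injective (S := S) c i
  have hcirc : ∀ t, D₁.IsCircle (some t) := fun t => hg' ((hg _).trans (hs t))
  have hf₁ : Encodes D₁ (enc ∘ untwistMap c i) f :=
    ⟨hf.injective.comp hg', fun d => by rw [Function.comp, hf.edge, ← hg]; rfl⟩
  obtain ⟨S', D', enc', hf', heq, hinl, hjoint, -, hcent, -⟩ := hf₁.resolve none
  have hGQ : ∃ G Q, TreewidthLE G 2 ∧ Centred D₁ G Q := by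
    by_cases hn : D₁.IsCircle none
    · refine treewidth_of_circles hg (fun _ _ => rfl) htw fun s => ?_
      rcases s with _ | t
      · exact hn
      · exact hcirc t
    · have h0 := hg (Sum.inr (none, 0))
      rw [untwistMap_none_zero, he] at h0
      rcases hd : D₁.edge (Sum.inr (none, 0)) with ⟨w, j⟩ | ⟨_ | t, l⟩
      · rw [hd, untwistMap_inl] at h0
        -- The new edge joins `w` to the other neighbour of `c`; it arises by contracting `c` into
        -- `w`.
        have hwa : D.crossingGraph.Adj w.1 c := by
          refine (crossingGraph_adj (i := i + 2) (fun h => w.2 h.symm) ?_).symm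
          rw [he, ← h0]
          rfl
        refine treewidth_of_contraction hg (fun _ _ => rfl) htw w (a := c) (b := c)
          (fun k hk => Or.inl (not_not.1 hk)) (fun h => h rfl) hwa (Or.inl rfl) fun s => ?_
        rcases s with _ | t
        · refine Or.inr ⟨⟨0, by rw [hd]; rfl⟩, fun l => ⟨c, fun h => h rfl, ?_⟩⟩
          rfl
        · exact Or.inl (hcirc t)
      · rcases eq_zero_or_one l with rfl | rfl
        · exact (D₁.edge_ne _ hd).elim
        · exact (hn hd).elim
      · have := (hcirc t).edge l
        rw [← hd, D₁.edge_edge] at this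
        cases this
  obtain ⟨G, Q, hG, hGQ⟩ := hGQ
  refine ⟨_, S', D', enc', fun c => L c.1, fun x y hxy => Subtype.ext (hLi hxy), ?_, ?_, ?_, ?_,
    (hcent G Q hGQ).treewidth hG, (h.trans (.untwist hD₁)).trans heq⟩
  · ext k
    constructor
    · rintro ⟨x, rfl⟩
      exact ⟨⟨x.1, rfl⟩, fun h => x.2 (hLi h)⟩
    · rintro ⟨⟨x, rfl⟩, hx⟩
      exact ⟨⟨x, fun h => hx (by rw [h]; rfl)⟩, rfl⟩
  · simpa [Function.comp, hL] using hf'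
  · intro x j
    rw [hinl, ← hL]
    rfl
  · intro t'
    rcases hjoint t' with h | ⟨_ | t, ht, htc, -⟩
    · exact h
    · exact (ht rfl).elim
    · exact (htc (hcirc t)).elim

/-- The reason for the condition `closed`. If one string closes to a circle, at most one edge is
created, and contracting the bigon into one of its ends produces it. If both free ends of `a` lead
to the same crossing `w`, all new edges start at `w`, and contracting the bigon into `w` produces
them. -/
theorem treewidth_unpoke {D : LinkDiagram C S} {e : C × ZMod 4 → C × ZMod 4}
    (he : ∀ d, D.edge (Sum.inl d) = Sum.inl (e d)) (hs : ∀ s, D.IsCircle s)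
    (htw : TreewidthLE D.crossingGraph 2) {a b : C} {i l : ZMod 4} (hab : a ≠ b)
    (ea : e (a, i) = (b, l))
    (h3 : e (a, i + 2) = (b, l + 2) ∨ e (a, i + 3) = (b, l + 1) ∨
      ((e (a, i + 2)).1 = (e (a, i + 3)).1 ∧ (e (a, i + 2)).1 ≠ a ∧ (e (a, i + 2)).1 ≠ b))
    {D₁ : LinkDiagram {c : C // c ≠ a ∧ c ≠ b} (Option (Option S))}
    (hg : ∀ x, unpokeMap a b i (l + 3) (D₁.edge x) = D.edge (unpokeMap a b i (l + 3) x)) :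
    ∃ G Q, TreewidthLE G 2 ∧ Centred D₁ G Q := by
  have m2 : l + 3 + 2 = l + 1 := by rw [add_assoc, show (3 : ZMod 4) + 2 = 1 by decide]
  have m3 : l + 3 + 3 = l + 2 := by rw [add_assoc, show (3 : ZMod 4) + 3 = 2 by decide]
  have hg' := unpokeMap_injective (S := S) a b i (l + 3) hab
  have hcirc : ∀ t, D₁.IsCircle (some (some t)) := fun t => hg' ((hg _).trans (hs t))
  have haP : ¬ (a ≠ a ∧ a ≠ b) := fun h => h.1 rfl
  have hbP : ¬ (b ≠ a ∧ b ≠ b) := fun h => h.2 rfl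
  have hP : ∀ k, ¬ (k ≠ a ∧ k ≠ b) → k = a ∨ k = b := fun k hk => by tauto
  have hadj : D.crossingGraph.Adj a b := crossingGraph_adj (i := i) hab (by rw [he, ea]; rfl)
  have hvert : ∀ s : Option (Option S), (s = none ∨ s = some none) → ∀ j, ∃ k,
      ¬ (k ≠ a ∧ k ≠ b) ∧ vert (unpokeMap (S := S) a b i (l + 3) (Sum.inr (s, j))) = Sum.inl k := by
    rintro s (rfl | rfl) j <;> rcases eq_zero_or_one j with rfl | rfl
    · exact ⟨a, haP, rfl⟩
    · exact ⟨b, hbP, rfl⟩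
    · exact ⟨a, haP, rfl⟩
    · exact ⟨b, hbP, rfl⟩
  have hstep : ∀ (s : Option (Option S)) (j : ZMod 4),
      unpokeMap (S := S) a b i (l + 3) (Sum.inr (s, 0)) = Sum.inl (a, j) →
      ∀ w : {c : C // c ≠ a ∧ c ≠ b}, (e (a, j)).1 = w.1 →
      vert (D₁.edge (Sum.inr (s, 0))) = Sum.inl w ∧ D.crossingGraph.Adj w.1 a := by
    intro s j hsj w hw
    have h0 := hg (Sum.inr (s, 0))
    rw [hsj, he] at h0
    refine ⟨?_, (crossingGraph_adj (i := j) w.2.1.symm (by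
      rw [he]; exact congrArg Sum.inl hw)).symm⟩
    have h4 : D₁.edge (Sum.inr (s, 0)) = Sum.inl (w, (e (a, j)).2) := hg' (by
      rw [h0, unpokeMap_inl]
      exact congrArg Sum.inl (Prod.ext hw rfl))
    rw [h4]
    rfl
  -- The case in which the string of the joint `s` closes to a circle; only `s'` can create an edge.
  have hone : ∀ (s s' : Option (Option S)), (s = none ∧ s' = some none ∨ s = some none ∧ s' = none) →
      D₁.IsCircle s → ∃ G Q, TreewidthLE G 2 ∧ Centred D₁ G Q := by
    intro s s' hss hsc
    have hall : ∀ t, t = s ∨ t = s' ∨ D₁.IsCircle t := by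
      rintro (_ | _ | t)
      · tauto
      · tauto
      · exact Or.inr (Or.inr (hcirc t))
    by_cases hn : D₁.IsCircle s'
    · refine treewidth_of_circles hg (fun _ _ => rfl) htw fun t => ?_
      rcases hall t with rfl | rfl | h
      · exact hsc
      · exact hn
      · exact h
    · rcases hd : D₁.edge (Sum.inr (s', 0)) with ⟨w, j⟩ | ⟨t, j⟩
      · obtain ⟨j', hj'⟩ : ∃ j', unpokeMap (S := S) a b i (l + 3) (Sum.inr (s', 0)) =
            Sum.inl (a, j') := by
          rcases hss with ⟨-, rfl⟩ | ⟨-, rfl⟩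
          · exact ⟨i + 3, rfl⟩
          · exact ⟨i + 2, rfl⟩
        have h0 := hg (Sum.inr (s', 0))
        rw [hj', he, hd, unpokeMap_inl] at h0
        obtain ⟨h5, h6⟩ := hstep s' j' hj' w (congrArg Prod.fst (Sum.inl_injective h0)).symm
        refine treewidth_of_contraction hg (fun _ _ => rfl) htw w hP haP h6 (Or.inr hadj)
          fun t => ?_
        rcases hall t with rfl | rfl | h
        · exact Or.inl hsc
        · exact Or.inr ⟨⟨0, h5⟩, hvert t (by tauto)⟩
        · exact Or.inl h
      · exfalso
        have hts : ¬ D₁.IsCircle t → t = s' := fun h => by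
          rcases hall t with rfl | h' | h'
          · exact (h hsc).elim
          · exact h'
          · exact (h h').elim
        by_cases htc : D₁.IsCircle t
        · have := htc.edge j
          rw [← hd, D₁.edge_edge] at this
          cases this
          exact hn htc
        · obtain rfl := hts htc
          rcases eq_zero_or_one j with rfl | rfl
          · exact D₁.edge_ne _ hd
          · exact hn hd
  rcases h3 with h3 | h3 | ⟨h3, h4, h5⟩
  · refine hone none (some none) (Or.inl ⟨rfl, rfl⟩) (hg' ?_)
    rw [hg, unpokeMap_none_zero, unpokeMap_none_one, he, m3]
    rw [h3]
  · refine hone (some none) none (Or.inr ⟨rfl, rfl⟩) (hg' ?_)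
    rw [hg, unpokeMap_some_zero, unpokeMap_some_one, he, m2]
    rw [h3]
  · let w : {c : C // c ≠ a ∧ c ≠ b} :=
      ⟨(e (a, i + 2)).1, h4, h5⟩
    obtain ⟨h6, h7⟩ := hstep none (i + 2) rfl w rfl
    obtain ⟨h8, -⟩ := hstep (some none) (i + 3) rfl w h3.symm
    refine treewidth_of_contraction hg (fun _ _ => rfl) htw w hP haP h7 (Or.inr hadj) ?_
    rintro (_ | _ | t)
    · exact Or.inr ⟨⟨0, h6⟩, hvert _ (Or.inl rfl)⟩
    · exact Or.inr ⟨⟨0, h8⟩, hvert _ (Or.inr rfl)⟩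
    · exact Or.inl (hcirc t)

/-- After a second Reidemeister move, the remaining ends of the crossings are joined in pairs. -/
theorem Stores.unpoke {D₀ : LinkDiagram C₀ S₀} {A : Set ℕ} {f : ℕ → ℕ} (h : Stores D₀ A f)
    {a b : ℕ} {i l : ZMod 4} (ha : a ∈ A) (hp : IsPokeAt (arrayMap f) a i b l) :
    b ∈ A ∧ Stores D₀ (A \ {a, b}) (splice (splice f (endCode a (i + 2)) (endCode b (l + 2)))
      (endCode a (i + 3)) (endCode b (l + 1))) := by
  obtain ⟨C, S, D, enc, L, hLi, rfl, hf, hL, hs, htw, h⟩ := h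
  obtain ⟨e, he⟩ := exists_edge_of_circles hs
  have hm := fun c i => (arrayMap_eq hf hL he c i).2
  obtain ⟨a, rfl⟩ := ha
  obtain ⟨hne, h1, h2, hup, h3⟩ := hp
  rw [hm, Prod.mk.injEq] at h1 h2
  obtain ⟨rfl, rfl⟩ := h1
  set b := (e (a, i)).1 with hb
  set l := (e (a, i)).2 with hl
  rw [hm, hm] at h3
  replace h3 : e (a, i + 2) = (b, l + 2) ∨ e (a, i + 3) = (b, l + 1) ∨
      ((e (a, i + 2)).1 = (e (a, i + 3)).1 ∧ (e (a, i + 2)).1 ≠ a ∧ (e (a, i + 2)).1 ≠ b) := by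
    simp only [Prod.mk.injEq, hLi.eq_iff, ne_eq] at h3
    simpa only [Prod.ext_iff, ne_eq] using h3
  have hab : a ≠ b := fun h => hne (congrArg L h)
  have m1 : l + 3 + 1 = l := by rw [add_assoc, show (3 : ZMod 4) + 1 = 0 by decide, add_zero]
  have m2 : l + 3 + 2 = l + 1 := by rw [add_assoc, show (3 : ZMod 4) + 2 = 1 by decide]
  have m3 : l + 3 + 3 = l + 2 := by rw [add_assoc, show (3 : ZMod 4) + 3 = 2 by decide]
  have ea : D.edge (Sum.inl (a, i)) = Sum.inl (b, l + 3 + 1) := by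
    rw [he, m1]
  have ea1 : D.edge (Sum.inl (a, i + 1)) = Sum.inl (b, l + 3) := by
    rw [he]
    exact congrArg Sum.inl (Prod.ext (hLi h2.1) h2.2)
  obtain ⟨D₁, hD₁, hg⟩ := D.exists_unpoke a b i (l + 3) hab ea ea1 (by rw [m1]; exact hup)
  have hg' := unpokeMap_injective (S := S) a b i (l + 3) hab
  have hcirc : ∀ t, D₁.IsCircle (some (some t)) := fun t => hg' ((hg _).trans (hs t))
  have hf₁ : Encodes D₁ (enc ∘ unpokeMap a b i (l + 3)) f :=
    ⟨hf.injective.comp hg', fun d => by rw [Function.comp, hf.edge, ← hg]; rfl⟩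
  obtain ⟨S₂, D₂, enc₂, hf₂, heq₂, hinl₂, hjoint₂, hback₂, hcent₂, -⟩ := hf₁.resolve none
  -- The joints are resolved one after the other; `t₂` is the second one as it appears after the
  -- first step.
  obtain ⟨t₂, ht₂⟩ := hback₂ (some none) (by simp)
  obtain ⟨S', D', enc', hf', heq, hinl, hjoint, -, hcent, -⟩ := hf₂.resolve t₂
  have hGQ := treewidth_unpoke he hs htw hab (hb ▸ hl ▸ rfl) h3 hg
  obtain ⟨G, Q, hG, hGQ⟩ := hGQ
  refine ⟨⟨b, rfl⟩, _, S', D', enc', fun c => L c.1, fun x y hxy => Subtype.ext (hLi hxy), ?_, ?_, ?_,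
    ?_, (hcent G Q (hcent₂ G Q hGQ)).treewidth hG, ((h.trans (.unpoke hD₁)).trans heq₂).trans heq⟩
  · ext k
    constructor
    · rintro ⟨x, rfl⟩
      refine ⟨⟨x.1, rfl⟩, ?_⟩
      rintro (h | h)
      · exact x.2.1 (hLi h)
      · exact x.2.2 (hLi h)
    · rintro ⟨⟨x, rfl⟩, hx⟩
      exact ⟨⟨x, fun h => hx (Or.inl (by rw [h])), fun h => hx (Or.inr (by rw [h]; rfl))⟩, rfl⟩
  · simpa [Function.comp, hL, ht₂, m2, m3] using hf'
  · intro x j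
    rw [hinl, hinl₂, ← hL]
    rfl
  · intro t'
    rcases hjoint t' with h | ⟨t, ht, htc, -⟩
    · exact h
    · exfalso
      rcases hjoint₂ t with h | ⟨s, hs0, hsc, hst⟩
      · exact htc h
      · rcases s with _ | _ | s
        · exact hs0 rfl
        · refine ht ?_
          have := hf₂.injective ((hst 0).trans (ht₂ 0).symm)
          simpa using this
        · exact hsc (hcirc s)

end LinkDiagram

/-! ### Removal of the subdivision points -/

namespace LinkDiagram

open Dart

variable {C S : Type}

/-- The array `f` stores a diagram which is equivalent to `D₀`, in which the joints with numbers
from `k` on are still present and all other joints are circles. -/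
def Pending {n m : ℕ} (D₀ : LinkDiagram (Fin n) (Fin m)) (k : ℕ) (f : ℕ → ℕ) : Prop :=
  ∃ (S : Type) (D : LinkDiagram (Fin n) S) (enc : Dart (Fin n) S → ℕ), Encodes D enc f ∧
    (∀ c i, enc (Sum.inl (c, i)) = endCode c i) ∧
    (∀ s, D.IsCircle s ∨ ∃ j, k ≤ j ∧ j < m ∧ ∀ i : ZMod 2, enc (Sum.inr (s, i)) = 4 * n + 2 * j + i.val) ∧
    (∀ j, k ≤ j → j < m → ∃ s, ∀ i : ZMod 2, enc (Sum.inr (s, i)) = 4 * n + 2 * j + i.val) ∧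
    TreewidthLE D.graph 2 ∧ Equivalent D₀ D

theorem code_injective {n m : ℕ} : Function.Injective (Dart.code : Dart (Fin n) (Fin m) → ℕ) := by
  rintro (⟨c, i⟩ | ⟨s, i⟩) (⟨c', i'⟩ | ⟨s', i'⟩) h
  · obtain ⟨h1, h2⟩ := endCode_inj (h : endCode c i = endCode c' i')
    rw [Fin.ext h1, h2]
  · have h1 := ZMod.val_lt i
    have h2 := c.2
    simp only [Dart.code] at h
    omega
  · have h1 := ZMod.val_lt i'
    have h2 := c'.2
    simp only [Dart.code] at h
    omega
  · have h1 := ZMod.val_lt i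
    have h2 := ZMod.val_lt i'
    simp only [Dart.code] at h
    have h3 : s = s' := Fin.ext (by omega)
    have h4 : i = i' := ZMod.val_injective 2 (by omega)
    rw [h3, h4]

theorem pending_zero {n m : ℕ} {D : LinkDiagram (Fin n) (Fin m)} {s : RAM.State}
    (hD : D.IsInput s) (htw : TreewidthLE D.graph 2) : Pending D 0 (s.arr 0) :=
  ⟨_, D, Dart.code, ⟨code_injective, hD.arr_zero⟩, fun _ _ => rfl,
    fun s => Or.inr ⟨s, Nat.zero_le _, s.2, fun _ => rfl⟩, fun j _ hj => ⟨⟨j, hj⟩, fun _ => rfl⟩, htw,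
    .refl D⟩

theorem Pending.succ {n m k : ℕ} {D₀ : LinkDiagram (Fin n) (Fin m)} {f : ℕ → ℕ}
    (h : Pending D₀ k f) (hk : k < m) :
    Pending D₀ (k + 1) (splice f (4 * n + 2 * k) (4 * n + 2 * k + 1)) := by
  obtain ⟨S, D, enc, hf, hL, hj, hback, htw, h⟩ := h
  obtain ⟨s, hs⟩ := hback k le_rfl hk
  obtain ⟨S', D', enc', hf', heq, hinl, hjoint', hback', -, htw'⟩ := hf.resolve s
  refine ⟨S', D', enc', ?_, fun c i => by rw [hinl, hL], fun t' => ?_, fun j hj hjm => ?_, htw' htw,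
    h.trans heq⟩
  · rw [hs, hs] at hf'
    exact hf'
  · rcases hjoint' t' with h' | ⟨t, ht, htc, htt⟩
    · exact Or.inl h'
    · obtain ⟨j, hkj, hjm, hj⟩ := (hj t).resolve_left htc
      refine Or.inr ⟨j, ?_, hjm, fun i => by rw [htt, hj]⟩
      rcases hkj.lt_or_eq with h' | rfl
      · exact h'
      · refine (ht ?_).elim
        have := hf.injective ((hj 0).trans (hs 0).symm)
        simpa using this
  · obtain ⟨t, ht⟩ := hback j (by omega) hjm
    obtain ⟨t', ht'⟩ := hback' t (by
      rintro rfl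
      have := (ht 0).symm.trans (hs 0)
      omega)
    exact ⟨t', fun i => by rw [ht', ht]⟩

theorem Pending.stores {n m : ℕ} {D₀ : LinkDiagram (Fin n) (Fin m)} {f : ℕ → ℕ}
    (h : Pending D₀ m f) : Stores D₀ {a | a < n} f := by
  obtain ⟨S, D, enc, hf, hL, hj, -, htw, h⟩ := h
  refine ⟨_, S, D, enc, Fin.val, Fin.val_injective, ?_, hf, hL, fun s => ?_, ?_, h⟩
  · ext a
    exact ⟨by rintro ⟨c, rfl⟩; exact c.2, fun ha => ⟨⟨a, ha⟩, rfl⟩⟩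
  · refine (hj s).resolve_right ?_
    rintro ⟨j, h1, h2, -⟩
    omega
  · refine htw.of_injective Sum.inl Sum.inl_injective fun x y hxy => ?_
    rw [crossingGraph, SimpleGraph.fromRel_adj] at hxy
    rw [graph, Dart.graph, SimpleGraph.fromRel_adj]
    exact ⟨fun h => hxy.1 (Sum.inl_injective h), hxy.2.imp (fun ⟨i, hi⟩ => ⟨_, rfl, hi⟩)
      fun ⟨i, hi⟩ => ⟨_, rfl, hi⟩⟩

end LinkDiagram

/-! ### Verification of programs -/

namespace RAM

/-- An upper bound for the value of an operation. -/
def Op.bound : Op → ℕ → ℕ → ℕ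
  | add, x, y => x + y
  | sub, x, _ => x
  | mul, x, y => x * y
  | div, x, _ => x
  | mod, x, _ => x
  | eq, _, _ => 1
  | lt, _, _ => 1

theorem Op.eval_le_bound (o : Op) {x y x' y' : ℕ} (hx : x ≤ x') (hy : y ≤ y') :
    o.eval x y ≤ o.bound x' y' := by
  cases o <;> simp only [Op.eval, Op.bound]
  · omega
  · omega
  · exact Nat.mul_le_mul hx hy
  · exact (Nat.div_le_self x y).trans hx
  · exact (Nat.mod_le x y).trans hx
  · split_ifs <;> omega
  · split_ifs <;> omega

/-- An upper bound for the value of an expression in a state with entries at most `B`. -/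
def Term.maxVal (B : ℕ) : Term → ℕ
  | const k => k
  | reg _ => B
  | read _ _ => B
  | op o e₁ e₂ => o.bound (e₁.maxVal B) (e₂.maxVal B)

/-- An upper bound for the values which occur in the evaluation of an expression. -/
def Term.peak (B : ℕ) : Term → ℕ
  | const k => k
  | reg _ => B
  | read _ e => max (e.peak B) B
  | op o e₁ e₂ => max (max (e₁.peak B) (e₂.peak B)) (o.bound (e₁.maxVal B) (e₂.maxVal B))

/-- All entries of the memory are at most `B`. -/
structure State.Bounded (B : ℕ) (s : State) : Prop where
  reg : ∀ r, s.reg r ≤ B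
  arr : ∀ a k, s.arr a k ≤ B

variable {B W : ℕ} {s : State}

theorem Term.eval_le (hs : s.Bounded B) (e : Term) : e.eval s ≤ e.maxVal B := by
  induction e with
  | const k => exact le_rfl
  | reg r => exact hs.reg r
  | read a e _ => exact hs.arr a _
  | op o e₁ e₂ h₁ h₂ => exact o.eval_le_bound h₁ h₂

/-- Reduces the word bound to a numerical inequality in `B` that does not depend on the state. -/
theorem Term.fits_of_peak (hs : s.Bounded B) (e : Term) (he : e.peak B ≤ W) : e.Fits W s := by
  induction e with
  | const k => exact he
  | reg r => exact (hs.reg r).trans he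
  | read a e h =>
    exact ⟨h ((le_max_left _ _).trans he), (hs.arr a _).trans ((le_max_right _ _).trans he)⟩
  | op o e₁ e₂ h₁ h₂ =>
    exact ⟨h₁ ((le_max_left _ _).trans ((le_max_left _ _).trans he)),
      h₂ ((le_max_right _ _).trans ((le_max_left _ _).trans he)),
      (Term.eval_le hs (op o e₁ e₂)).trans ((le_max_right _ _).trans he)⟩

/-- A program without loops. -/
def Program.LoopFree : Program → Prop
  | seq p q => p.LoopFree ∧ q.LoopFree
  | ite _ p q => p.LoopFree ∧ q.LoopFree
  | loop _ _ => False
  | _ => True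

/-- A bound for the number of steps of a program without loops. -/
def Program.cost : Program → ℕ
  | skip => 1
  | assign _ e => e.cost + 1
  | write _ i e => i.cost + e.cost + 1
  | seq p q => p.cost + q.cost
  | ite e p q => e.cost + 1 + p.cost + q.cost
  | loop _ _ => 0

/-- Lets correctness proofs ignore time: they only show that a loop body terminates, and its time is
bounded by a constant of the program. -/
theorem Runs.le_cost {p : Program} {s s' : State} {t : ℕ} (h : Runs W p s s' t)
    (hp : p.LoopFree) : t ≤ p.cost := by
  induction h with
  | skip => exact le_rfl
  | assign => exact le_rfl
  | write => exact le_rfl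
  | seq _ _ h₁ h₂ => exact Nat.add_le_add (h₁ hp.1) (h₂ hp.2)
  | ite_true _ _ _ h => have := h hp.1; simp only [Program.cost]; omega
  | ite_false _ _ _ h => have := h hp.2; simp only [Program.cost]; omega
  | loop_true => exact hp.elim
  | loop_false => exact hp.elim

/-- The program `p` runs from `s`, with word bound `W`, to a state with entries at most `B` which
satisfies `Q`. -/
def Reaches (B W : ℕ) (p : Program) (s : State) (Q : State → Prop) : Prop :=
  ∃ s' t, Runs W p s s' t ∧ s'.Bounded B ∧ Q s'

theorem Reaches.mono {p : Program} {Q Q' : State → Prop} (h : Reaches B W p s Q)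
    (hQ : ∀ s', s'.Bounded B → Q s' → Q' s') : Reaches B W p s Q' := by
  obtain ⟨s', t, h1, h2, h3⟩ := h
  exact ⟨s', t, h1, h2, hQ s' h2 h3⟩

theorem Reaches.skip {Q : State → Prop} (hs : s.Bounded B) (hQ : Q s) :
    Reaches B W .skip s Q := ⟨s, 1, .skip s, hs, hQ⟩

theorem Reaches.seq {p q : Program} {Q : State → Prop}
    (h : Reaches B W p s fun s' => s'.Bounded B → Reaches B W q s' Q) :
    Reaches B W (.seq p q) s Q := by
  obtain ⟨s', t, h1, h2, h3⟩ := h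
  obtain ⟨s'', t', h4, h5, h6⟩ := h3 h2
  exact ⟨s'', t + t', .seq h1 h4, h5, h6⟩

theorem Reaches.assign {r : ℕ} {e : Term} {Q : State → Prop} (hs : s.Bounded B)
    (hp : e.peak B ≤ W) (hv : e.eval s ≤ B)
    (hQ : Q ⟨Function.update s.reg r (e.eval s), s.arr⟩) : Reaches B W (.assign r e) s Q := by
  refine ⟨_, _, .assign s r e (e.fits_of_peak hs hp), ⟨fun r' => ?_, hs.arr⟩, hQ⟩
  by_cases h : r' = r
  · subst h
    simpa using hv
  · simpa [h] using hs.reg r'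

theorem Reaches.write {a : ℕ} {i e : Term} {Q : State → Prop} (hs : s.Bounded B)
    (hi : i.peak B ≤ W) (he : e.peak B ≤ W) (hv : e.eval s ≤ B)
    (hQ : Q ⟨s.reg, Function.update s.arr a (Function.update (s.arr a) (i.eval s) (e.eval s))⟩) :
    Reaches B W (.write a i e) s Q := by
  refine ⟨_, _, .write s a i e (i.fits_of_peak hs hi) (e.fits_of_peak hs he),
    ⟨hs.reg, fun a' k => ?_⟩, hQ⟩
  by_cases h : a' = a
  · subst h
    simp only [Function.update_self]
    by_cases hk : k = i.eval s
    · subst hk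
      simpa using hv
    · simpa [hk] using hs.arr a' k
  · simpa [h] using hs.arr a' k

theorem Reaches.ite {e : Term} {p q : Program} {Q : State → Prop} (hs : s.Bounded B)
    (hp : e.peak B ≤ W) (h₁ : e.eval s ≠ 0 → Reaches B W p s Q)
    (h₂ : e.eval s = 0 → Reaches B W q s Q) : Reaches B W (.ite e p q) s Q := by
  by_cases h : e.eval s = 0
  · obtain ⟨s', t, h1, h2, h3⟩ := h₂ h
    exact ⟨s', _, .ite_false (e.fits_of_peak hs hp) h h1, h2, h3⟩
  · obtain ⟨s', t, h1, h2, h3⟩ := h₁ h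
    exact ⟨s', _, .ite_true (e.fits_of_peak hs hp) h h1, h2, h3⟩

/-- A loop with an invariant and a decreasing measure. -/
theorem runs_loop {e : Term} {p : Program} (hlf : p.LoopFree) (hp : e.peak B ≤ W)
    (Inv : State → Prop) (μ : State → ℕ)
    (hstep : ∀ s, s.Bounded B → Inv s → e.eval s ≠ 0 →
      Reaches B W p s fun s' => Inv s' ∧ μ s' < μ s) :
    ∀ s, s.Bounded B → Inv s → ∃ s' t, Runs W (.loop e p) s s' t ∧ s'.Bounded B ∧ Inv s' ∧
      e.eval s' = 0 ∧ t ≤ (μ s + 1) * (e.cost + 1 + p.cost) := by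
  have key : ∀ N s, μ s = N → s.Bounded B → Inv s → ∃ s' t, Runs W (.loop e p) s s' t ∧
      s'.Bounded B ∧ Inv s' ∧ e.eval s' = 0 ∧ t ≤ (N + 1) * (e.cost + 1 + p.cost) := by
    intro N
    induction N using Nat.strong_induction_on with
    | _ N ih =>
      intro s hN hs hI
      by_cases h : e.eval s = 0
      · refine ⟨s, _, .loop_false (e.fits_of_peak hs hp) h, hs, hI, h, ?_⟩
        nlinarith [Nat.zero_le (N * (e.cost + 1 + p.cost))]
      · obtain ⟨s₁, t₁, h1, h2, h3, h4⟩ := hstep s hs hI h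
        obtain ⟨s₂, t₂, h5, h6, h7, h8, h9⟩ := ih (μ s₁) (hN ▸ h4) s₁ rfl h2 h3
        refine ⟨s₂, _, .loop_true (e.fits_of_peak hs hp) h h1 h5, h6, h7, h8, ?_⟩
        have h10 := h1.le_cost hlf
        have h11 : (μ s₁ + 1) * (e.cost + 1 + p.cost) ≤ N * (e.cost + 1 + p.cost) :=
          Nat.mul_le_mul_right _ (by omega)
        rw [add_mul, one_mul]
        omega
  exact fun s => key _ s rfl

end RAM

namespace LinkDiagram

open Dart

/-! ### The tests of the algorithm -/

theorem endCode_self (k : ℕ) : endCode (k / 4) k = k := by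
  rw [endCode, ZMod.val_natCast]
  omega

theorem endCode_add (b k j : ℕ) : endCode b ((k : ZMod 4) + (j : ℕ)) = 4 * b + (k + j) % 4 := by
  rw [endCode, ← Nat.cast_add, ZMod.val_natCast]

theorem arrayMap_eq_iff {f : ℕ → ℕ} {a b : ℕ} {i l : ZMod 4} :
    arrayMap f (a, i) = (b, l) ↔ f (endCode a i) = endCode b l := by
  constructor
  · intro h
    rw [← endCode_self (f (endCode a i))]
    exact congrArg (fun d : ℕ × ZMod 4 => endCode d.1 d.2) h
  · intro h
    rw [arrayMap, h, endCode_div, endCode_cast]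

theorem parity_iff (x y : ℕ) : x % 2 = y % 2 ↔
    (((x : ZMod 4) = 1 ∨ (x : ZMod 4) = 3) ↔ ((y : ZMod 4) = 1 ∨ (y : ZMod 4) = 3)) := by
  have h : ∀ i l : ZMod 4, i.val % 2 = l.val % 2 ↔ ((i = 1 ∨ i = 3) ↔ (l = 1 ∨ l = 3)) := by decide
  rw [← h, ZMod.val_natCast, ZMod.val_natCast]
  omega

/-- Nothing can be done at the end `i` of the crossing `a`. -/
def IsIrreducibleAt (f : ℕ → ℕ) (a : ℕ) (i : ZMod 4) : Prop :=
  arrayMap f (a, i) ≠ (a, i + 1) ∧ ∀ b l, ¬ IsPokeAt (arrayMap f) a i b l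

/-- Both tests read only the four entries of `a`, so after a move only crossings with changed
entries have to be examined again. This locality makes linear time possible. -/
theorem IsIrreducibleAt.congr {f g : ℕ → ℕ} {a : ℕ} {i : ZMod 4}
    (hfg : ∀ j, f (endCode a j) = g (endCode a j)) (h : IsIrreducibleAt f a i) :
    IsIrreducibleAt g a i := by
  have hm : ∀ j, arrayMap g (a, j) = arrayMap f (a, j) := fun j => by
    simp only [arrayMap, hfg]
  refine ⟨by rw [hm]; exact h.1, fun b l hp => h.2 b l ⟨hp.ne, ?_, ?_, hp.up, ?_⟩⟩
  · rw [← hm]; exact hp.lower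
  · rw [← hm]; exact hp.upper
  · rw [← hm, ← hm]; exact hp.closed

theorem twist_iff (f : ℕ → ℕ) (x : ℕ) : f x = 4 * (x / 4) + (x + 1) % 4 ↔
    arrayMap f (x / 4, (x : ZMod 4)) = (x / 4, (x : ZMod 4) + 1) := by
  rw [arrayMap_eq_iff, endCode_self, show (1 : ZMod 4) = ((1 : ℕ) : ZMod 4) by simp, endCode_add]

/-- The numerical test for the second move at the end with number `x`. -/
def PokeTest (f : ℕ → ℕ) (x : ℕ) : Prop :=
  f x / 4 ≠ x / 4 ∧ f (4 * (x / 4) + (x + 1) % 4) = 4 * (f x / 4) + (f x + 3) % 4 ∧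
    x % 2 = f x % 2 ∧
    (f (4 * (x / 4) + (x + 2) % 4) = 4 * (f x / 4) + (f x + 2) % 4 ∨
      f (4 * (x / 4) + (x + 3) % 4) = 4 * (f x / 4) + (f x + 1) % 4 ∨
      (f (4 * (x / 4) + (x + 2) % 4) / 4 = f (4 * (x / 4) + (x + 3) % 4) / 4 ∧
        f (4 * (x / 4) + (x + 2) % 4) / 4 ≠ x / 4 ∧
        f (4 * (x / 4) + (x + 2) % 4) / 4 ≠ f x / 4))

/-- The second crossing and its end are determined by `f x`, so `lower` holds automatically and
needs no test. -/
theorem pokeTest_iff (f : ℕ → ℕ) (x : ℕ) :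
    PokeTest f x ↔ IsPokeAt (arrayMap f) (x / 4) x (f x / 4) (f x) := by
  have e1 : ∀ b k : ℕ, endCode b (((k : ℕ) : ZMod 4) + 1) = 4 * b + (k + 1) % 4 := fun b k => by
    rw [← endCode_add, Nat.cast_one]
  have e2 : ∀ b k : ℕ, endCode b (((k : ℕ) : ZMod 4) + 2) = 4 * b + (k + 2) % 4 := fun b k => by
    rw [← endCode_add]; rfl
  have e3 : ∀ b k : ℕ, endCode b (((k : ℕ) : ZMod 4) + 3) = 4 * b + (k + 3) % 4 := fun b k => by
    rw [← endCode_add]; rfl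
  have hfst : ∀ d, (arrayMap f d).1 = f (endCode d.1 d.2) / 4 := fun _ => rfl
  constructor
  · rintro ⟨h1, h2, h3, h4⟩
    refine ⟨h1.symm, ?_, ?_, (parity_iff _ _).1 h3, ?_⟩
    · rw [arrayMap_eq_iff, endCode_self, endCode_self]
    · rw [arrayMap_eq_iff, e1, e3, h2]
    · rw [arrayMap_eq_iff, arrayMap_eq_iff, hfst, hfst, e2, e3, e2, e1]
      exact h4
  · rintro ⟨h1, -, h2, h3, h4⟩
    rw [arrayMap_eq_iff, arrayMap_eq_iff, hfst, hfst, e2, e3, e2, e1] at h4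
    rw [arrayMap_eq_iff, e1, e3] at h2
    exact ⟨h1.symm, h2, (parity_iff _ _).2 h3, h4⟩

theorem isIrreducibleAt_of_tests {f : ℕ → ℕ} {x : ℕ} (h1 : f x ≠ 4 * (x / 4) + (x + 1) % 4)
    (h2 : ¬ PokeTest f x) : IsIrreducibleAt f (x / 4) x := by
  refine ⟨fun h => h1 ((twist_iff f x).2 h), fun b l hp => ?_⟩
  have := hp.lower
  rw [arrayMap, endCode_self, Prod.mk.injEq] at this
  obtain ⟨rfl, rfl⟩ := this
  exact h2 ((pokeTest_iff f x).2 hp)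

theorem splice_le {f : ℕ → ℕ} {B : ℕ} (hf : ∀ k, f k ≤ B) (x y k : ℕ) : splice f x y k ≤ B := by
  unfold splice
  split_ifs
  · exact hf k
  · simp only [Function.update_apply]
    split_ifs
    · exact hf _
    · exact hf _
    · exact hf _

/-- Entries change only at `f x` and `f y`. -/
theorem splice_endCode {f : ℕ → ℕ} {x y c : ℕ} (hx : f x / 4 ≠ c) (hy : f y / 4 ≠ c) (j : ZMod 4) :
    splice f x y (endCode c j) = f (endCode c j) := by
  unfold splice
  split_ifs
  · rfl
  · rw [Function.update_of_ne, Function.update_of_ne]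
    · rintro h
      exact hx (by rw [← h, endCode_div])
    · rintro h
      exact hy (by rw [← h, endCode_div])

end LinkDiagram

/-! ### The algorithm -/

namespace RAM

open LinkDiagram

/-- The number of the dart which is `j` places after the dart `d` at the crossing `a`. -/
def dartTerm (a d : Term) (j : ℕ) : Term :=
  .op .add (.op .mul (.const 4) a) (.op .mod (.op .add d (.const j)) (.const 4))

theorem eval_dartTerm (s : State) (a d : Term) (j : ℕ) :
    (dartTerm a d j).eval s = 4 * a.eval s + (d.eval s + j) % 4 := rfl

theorem eval_eq_ne_zero (s : State) (e₁ e₂ : Term) :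
    (Term.op .eq e₁ e₂).eval s ≠ 0 ↔ e₁.eval s = e₂.eval s := by
  simp [Term.eval, Op.eval]

theorem eval_lt_ne_zero (s : State) (e₁ e₂ : Term) :
    (Term.op .lt e₁ e₂).eval s ≠ 0 ↔ e₁.eval s < e₂.eval s := by
  simp only [Term.eval, Op.eval]
  split_ifs <;> simp_all

theorem eval_mul_ne_zero (s : State) (e₁ e₂ : Term) :
    (Term.op .mul e₁ e₂).eval s ≠ 0 ↔ e₁.eval s ≠ 0 ∧ e₂.eval s ≠ 0 := by
  simp [Term.eval, Op.eval]

theorem eval_add_ne_zero (s : State) (e₁ e₂ : Term) :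
    (Term.op .add e₁ e₂).eval s ≠ 0 ↔ e₁.eval s ≠ 0 ∨ e₂.eval s ≠ 0 := by
  simp only [Term.eval, Op.eval]
  omega

/-- The expression which tests whether two values are different. -/
def neTerm (e₁ e₂ : Term) : Term := .op .eq (.op .eq e₁ e₂) (.const 0)

theorem eval_neTerm_ne_zero (s : State) (e₁ e₂ : Term) :
    (neTerm e₁ e₂).eval s ≠ 0 ↔ e₁.eval s ≠ e₂.eval s := by
  simp [neTerm, Term.eval, Op.eval]

/-- Splices the array 0 at the ends in the registers 5 and 6. -/
def spliceProgram : Program :=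
  .seq (.assign 7 (.read 0 (.reg 5))) <| .seq (.assign 8 (.read 0 (.reg 6))) <|
    .ite (.op .eq (.reg 7) (.reg 6)) .skip
      (.seq (.write 0 (.reg 7) (.reg 8)) (.write 0 (.reg 8) (.reg 7)))

/-- Pushes the value of `e` on the stack, which is the array 1 with the stack pointer in
register 3. -/
def push (e : Term) : Program :=
  .seq (.write 1 (.reg 3) e) (.assign 3 (.op .add (.reg 3) (.const 1)))

/-- Pushes the four ends at the crossing of the end in register `r`. -/
def pushCrossing (r : ℕ) : Program :=
  .seq (.assign 12 (.op .mul (.const 4) (.op .div (.reg r) (.const 4)))) <|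
    .seq (push (.reg 12)) <| .seq (push (.op .add (.reg 12) (.const 1))) <|
      .seq (push (.op .add (.reg 12) (.const 2))) (push (.op .add (.reg 12) (.const 3)))

/-- Splices, and pushes the ends at the crossings affected. -/
def joinProgram : Program :=
  .seq spliceProgram (.seq (pushCrossing 7) (pushCrossing 8))

/-- The number `y` is on the stack. -/
def OnStack (s : State) (y : ℕ) : Prop := ∃ k < s.reg 3, s.arr 1 k = y

variable {B W : ℕ} {s : State}

/-- The old neighbours remain in registers 7 and 8; `joinProgram` needs them to push the ends at the
crossings affected. -/
theorem reaches_spliceProgram (hs : s.Bounded B) (hW : 5 * B + 10 ≤ W) (hB : 1 ≤ B) :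
    Reaches B W spliceProgram s fun s' =>
      s' = ⟨Function.update (Function.update s.reg 7 (s.arr 0 (s.reg 5))) 8 (s.arr 0 (s.reg 6)),
        Function.update s.arr 0 (splice (s.arr 0) (s.reg 5) (s.reg 6))⟩ := by
  refine .seq (.assign hs (by simp [Term.peak]; omega) (hs.arr _ _) fun hs₁ => ?_)
  refine .seq (.assign hs₁ (by simp [Term.peak]; omega) (hs₁.arr _ _) fun hs₂ => ?_)
  refine .ite hs₂ (by simp [Term.peak, Op.bound]; omega) (fun h => ?_) fun h => ?_
  · rw [eval_eq_ne_zero] at h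
    simp only [Term.eval, Function.update_apply] at h
    refine .skip hs₂ ?_
    simp only [Term.eval, Function.update_apply]
    norm_num at h ⊢
    rw [splice, if_pos h]
  · have h' := mt (eval_eq_ne_zero _ _ _).2 (not_not.2 h)
    simp only [Term.eval, Function.update_apply] at h'
    refine .seq (.write hs₂ (by simp [Term.peak]; omega) (by simp [Term.peak]; omega)
      (hs₂.reg _) fun hs₃ => ?_)
    refine .write hs₃ (by simp [Term.peak]; omega) (by simp [Term.peak]; omega)
      (hs₃.reg _) ?_
    simp only [Term.eval, Function.update_apply]
    norm_num at h' ⊢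
    rw [splice, if_neg h']

/-- The effect of pushing numbers at most `M`. -/
structure Pushed (M k : ℕ) (s s' : State) : Prop where
  arr : ∀ a, a ≠ 1 → s'.arr a = s.arr a
  reg : ∀ r, r ≠ 3 → r ≠ 12 → s'.reg r = s.reg r
  pointer : s'.reg 3 = s.reg 3 + k
  onStack : ∀ y, OnStack s y → OnStack s' y
  le : (∀ k, s.arr 1 k ≤ M) → ∀ k, s'.arr 1 k ≤ M

theorem Pushed.trans {M k l : ℕ} {s s' s'' : State} (h : Pushed M k s s') (h' : Pushed M l s' s'') :
    Pushed M (k + l) s s'' :=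
  ⟨fun a ha => (h'.arr a ha).trans (h.arr a ha), fun r h3 h12 => (h'.reg r h3 h12).trans (h.reg r h3 h12),
    by rw [h'.pointer, h.pointer]; omega, fun y hy => h'.onStack y (h.onStack y hy),
    fun h0 => h'.le (h.le h0)⟩

theorem reaches_push {M : ℕ} {e : Term} (hs : s.Bounded B) (hW : 5 * B + 10 ≤ W)
    (he : e.peak B ≤ W) (hv : e.eval s ≤ M) (hM : M ≤ B) (hsp : s.reg 3 + 1 ≤ B) :
    Reaches B W (push e) s fun s' =>
      Pushed M 1 s s' ∧ OnStack s' (e.eval s) ∧ s'.reg 12 = s.reg 12 := by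
  refine .seq (.write hs (by simp [Term.peak]; omega) he (hv.trans hM) fun hs₁ => ?_)
  refine .assign hs₁ (by simp [Term.peak, Op.bound, Term.maxVal]; omega)
    (by simpa [Term.eval, Op.eval] using hsp) ?_
  refine ⟨⟨fun a ha => ?_, fun r h3 h12 => ?_, ?_, ?_, fun h k => ?_⟩, ⟨s.reg 3, ?_, ?_⟩, ?_⟩
  · simp [ha]
  · simp [h3]
  · simp [Term.eval, Op.eval]
  · rintro y ⟨k, hk, rfl⟩
    refine ⟨k, ?_, ?_⟩
    · simp [Term.eval, Op.eval]; omega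
    · simp [Term.eval, hk.ne]
  · simp only [Function.update_self, Function.update_apply]
    split_ifs
    · exact hv
    · exact h k
  · simp [Term.eval, Op.eval]
  · simp [Term.eval]
  · simp

/-- A bound of the form `4 * N + 3` is stable under passing to another end of the same crossing. -/
theorem reaches_pushCrossing {N r : ℕ} (hs : s.Bounded B) (hW : 5 * B + 10 ≤ W)
    (hM : 4 * N + 3 ≤ B) (hr : s.reg r ≤ 4 * N + 3) (hsp : s.reg 3 + 4 ≤ B) :
    Reaches B W (pushCrossing r) s fun s' =>
      Pushed (4 * N + 3) 4 s s' ∧ ∀ i, OnStack s' (endCode (s.reg r / 4) i) := by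
  refine .seq (.assign hs (by simp [Term.peak, Op.bound, Term.maxVal]; omega)
    (by simp [Term.eval, Op.eval]; omega) fun hs₀ => ?_)
  set s₀ : State := ⟨Function.update s.reg 12 ((Term.op .mul (.const 4)
    (.op .div (.reg r) (.const 4))).eval s), s.arr⟩ with hs₀def
  have h12 : s₀.reg 12 = 4 * (s.reg r / 4) := by simp [hs₀def, Term.eval, Op.eval]
  have h3 : s₀.reg 3 = s.reg 3 := by simp [hs₀def]
  have hp₀ : Pushed (4 * N + 3) 0 s s₀ := by
    refine ⟨fun a _ => rfl, fun r _ h12 => by simp [hs₀def, h12], h3, ?_, fun h => h⟩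
    rintro y ⟨k, hk, hy⟩
    exact ⟨k, by rw [h3]; exact hk, hy⟩
  clear_value s₀
  refine .seq ((reaches_push (M := 4 * N + 3) hs₀ hW (by simp [Term.peak]; omega)
    (by simp only [Term.eval]; omega) hM (by omega)).mono ?_)
  rintro s₁ hs₁ ⟨hp₁, ho₁, ha₁⟩ -
  have := hp₁.pointer
  refine .seq ((reaches_push (M := 4 * N + 3) hs₁ hW
    (by simp [Term.peak, Op.bound, Term.maxVal]; omega)
    (by simp only [Term.eval, Op.eval]; omega) hM (by omega)).mono ?_)
  rintro s₂ hs₂ ⟨hp₂, ho₂, ha₂⟩ -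
  have := hp₂.pointer
  refine .seq ((reaches_push (M := 4 * N + 3) hs₂ hW
    (by simp [Term.peak, Op.bound, Term.maxVal]; omega)
    (by simp only [Term.eval, Op.eval]; omega) hM (by omega)).mono ?_)
  rintro s₃ hs₃ ⟨hp₃, ho₃, ha₃⟩ -
  have := hp₃.pointer
  refine (reaches_push (M := 4 * N + 3) hs₃ hW
    (by simp [Term.peak, Op.bound, Term.maxVal]; omega)
    (by simp only [Term.eval, Op.eval]; omega) hM (by omega)).mono ?_
  rintro s₄ hs₄ ⟨hp₄, ho₄, ha₄⟩
  simp only [Term.eval, Op.eval, ha₃, ha₂, ha₁, h12] at ho₁ ho₂ ho₃ ho₄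
  refine ⟨(((hp₀.trans hp₁).trans hp₂).trans hp₃).trans hp₄, fun i => ?_⟩
  have hi : i.val < 4 := ZMod.val_lt i
  rw [endCode]
  generalize i.val = j at hi
  interval_cases j
  · exact hp₄.onStack _ (hp₃.onStack _ (hp₂.onStack _ ho₁))
  · exact hp₄.onStack _ (hp₃.onStack _ ho₂)
  · exact hp₄.onStack _ ho₃
  · exact ho₄

/-- The effect of `joinProgram`. -/
structure Joined (M : ℕ) (s s' : State) : Prop where
  spliced : s'.arr 0 = splice (s.arr 0) (s.reg 5) (s.reg 6)
  marks : s'.arr 2 = s.arr 2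
  reg : ∀ r, r ≠ 3 → r ≠ 7 → r ≠ 8 → r ≠ 12 → s'.reg r = s.reg r
  pointer : s'.reg 3 = s.reg 3 + 8
  onStack : ∀ y, OnStack s y → OnStack s' y
  le : ∀ k, s'.arr 1 k ≤ M
  left : ∀ i, OnStack s' (endCode (s.arr 0 (s.reg 5) / 4) i)
  right : ∀ i, OnStack s' (endCode (s.arr 0 (s.reg 6) / 4) i)

theorem reaches_joinProgram {N : ℕ} (hs : s.Bounded B) (hW : 5 * B + 10 ≤ W) (hM : 4 * N + 3 ≤ B)
    (h0 : ∀ k, s.arr 0 k ≤ 4 * N + 3) (h1 : ∀ k, s.arr 1 k ≤ 4 * N + 3) (hsp : s.reg 3 + 8 ≤ B) :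
    Reaches B W joinProgram s (Joined (4 * N + 3) s) := by
  refine .seq ((reaches_spliceProgram hs hW (by omega)).mono ?_)
  rintro s₁ hs₁ hdef -
  have e3 : s₁.reg 3 = s.reg 3 := by rw [hdef]; simp
  have e7 : s₁.reg 7 = s.arr 0 (s.reg 5) := by rw [hdef]; simp
  have e8 : s₁.reg 8 = s.arr 0 (s.reg 6) := by rw [hdef]; simp
  have er : ∀ r, r ≠ 7 → r ≠ 8 → s₁.reg r = s.reg r := fun r h7 h8 => by rw [hdef]; simp [h7, h8]
  have ea0 : s₁.arr 0 = splice (s.arr 0) (s.reg 5) (s.reg 6) := by rw [hdef]; simp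
  have ea : ∀ a, a ≠ 0 → s₁.arr a = s.arr a := fun a ha => by rw [hdef]; simp [ha]
  clear hdef
  refine .seq ((reaches_pushCrossing (N := N) hs₁ hW hM (by rw [e7]; exact h0 _)
    (by omega)).mono ?_)
  rintro s₂ hs₂ ⟨hp₂, ho₂⟩ -
  have hp := hp₂.pointer
  have e8' : s₂.reg 8 = s.arr 0 (s.reg 6) := by rw [hp₂.reg 8 (by decide) (by decide), e8]
  refine (reaches_pushCrossing (N := N) hs₂ hW hM (by rw [e8']; exact h0 _) (by omega)).mono ?_
  rintro s₃ hs₃ ⟨hp₃, ho₃⟩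
  have hp₃' := hp₃.pointer
  have hpp := hp₂.trans hp₃
  refine ⟨?_, ?_, fun r r3 r7 r8 r12 => ?_, by omega, fun y hy => hpp.onStack y ?_, hpp.le ?_,
    fun i => ?_, fun i => ?_⟩
  · rw [hpp.arr 0 (by decide), ea0]
  · rw [hpp.arr 2 (by decide), ea 2 (by decide)]
  · rw [hpp.reg r r3 r12, er r r7 r8]
  · obtain ⟨k, hk, hy⟩ := hy
    exact ⟨k, by omega, by rw [ea 1 (by decide)]; exact hy⟩
  · rw [ea 1 (by decide)]
    exact h1
  · rw [← e7]
    exact hp₃.onStack _ (ho₂ i)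
  · rw [← e8']
    exact ho₃ i

/-- Every end at a crossing in `A` is on the stack, or nothing can be done there. -/
def Clean (s : State) (A : Finset ℕ) : Prop :=
  ∀ c ∈ A, ∀ i, OnStack s (endCode c i) ∨ IsIrreducibleAt (s.arr 0) c i

/-- Crossings with changed entries have all their ends on the stack; the others keep their status by
`IsIrreducibleAt.congr`. -/
theorem Joined.clean {M : ℕ} {s s' : State} {A : Finset ℕ} (h : Joined M s s') (hc : Clean s A) :
    Clean s' A := by
  intro c hcA i
  by_cases hx : s.arr 0 (s.reg 5) / 4 = c
  · exact Or.inl (hx ▸ h.left i)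
  by_cases hy : s.arr 0 (s.reg 6) / 4 = c
  · exact Or.inl (hy ▸ h.right i)
  refine (hc c hcA i).imp (h.onStack _) fun hi => hi.congr fun j => ?_
  rw [h.spliced, splice_endCode hx hy]

end RAM

/-! ### Programs for the two moves, and the invariant of the main loop -/

namespace RAM

open LinkDiagram

variable {C₀ S₀ : Type} {B W : ℕ} {s : State}

/-- The test for a move of the first type at the popped end (register 9, crossing in
register 10, other end in register 11). -/
def twistTest : Term := .op .eq (.reg 11) (dartTerm (.reg 10) (.reg 9) 1)

/-- The test for a move of the second type at the popped end. -/
def pokeTest : Term :=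
  .op .mul (neTerm (.reg 13) (.reg 10)) <|
  .op .mul (.op .eq (.read 0 (dartTerm (.reg 10) (.reg 9) 1)) (dartTerm (.reg 13) (.reg 11) 3)) <|
  .op .mul (.op .eq (.op .mod (.reg 9) (.const 2)) (.op .mod (.reg 11) (.const 2))) <|
  .op .add (.op .eq (.reg 14) (dartTerm (.reg 13) (.reg 11) 2)) <|
  .op .add (.op .eq (.reg 15) (dartTerm (.reg 13) (.reg 11) 1)) <|
  .op .mul (.op .eq (.op .div (.reg 14) (.const 4)) (.op .div (.reg 15) (.const 4))) <|
  .op .mul (neTerm (.op .div (.reg 14) (.const 4)) (.reg 10))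
    (neTerm (.op .div (.reg 14) (.const 4)) (.reg 13))

/-- Performs a move of the first type. -/
def untwistProgram : Program :=
  .seq (.write 2 (.reg 10) (.const 0)) <| .seq (.assign 4 (.op .sub (.reg 4) (.const 1))) <|
  .seq (.assign 5 (dartTerm (.reg 10) (.reg 9) 2)) <|
  .seq (.assign 6 (dartTerm (.reg 10) (.reg 9) 3)) joinProgram

/-- Performs a move of the second type. -/
def unpokeProgram : Program :=
  .seq (.write 2 (.reg 10) (.const 0)) <| .seq (.write 2 (.reg 13) (.const 0)) <|
  .seq (.assign 4 (.op .sub (.reg 4) (.const 2))) <|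
  .seq (.assign 5 (dartTerm (.reg 10) (.reg 9) 2)) <|
  .seq (.assign 6 (dartTerm (.reg 13) (.reg 11) 2)) <|
  .seq joinProgram <|
  .seq (.assign 5 (dartTerm (.reg 10) (.reg 9) 3)) <|
  .seq (.assign 6 (dartTerm (.reg 13) (.reg 11) 1)) joinProgram

/-- Tries both moves. -/
def reduceProgram : Program :=
  .seq (.assign 11 (.read 0 (.reg 9))) <|
  .ite twistTest untwistProgram <|
  .seq (.assign 13 (.op .div (.reg 11) (.const 4))) <|
  .seq (.assign 14 (.read 0 (dartTerm (.reg 10) (.reg 9) 2))) <|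
  .seq (.assign 15 (.read 0 (dartTerm (.reg 10) (.reg 9) 3))) <|
  .ite pokeTest unpokeProgram .skip

/-- Takes an end from the stack and tries to reduce the diagram there. -/
def popProgram : Program :=
  .seq (.assign 3 (.op .sub (.reg 3) (.const 1))) <|
  .seq (.assign 9 (.read 1 (.reg 3))) <|
  .seq (.assign 10 (.op .div (.reg 9) (.const 4))) <|
  .ite (.read 2 (.reg 10)) reduceProgram .skip

/-- The memory holds a diagram with set of crossings `A` which is equivalent to `D₀`. -/
structure Holds (D₀ : LinkDiagram C₀ S₀) (N : ℕ) (s : State) (A : Finset ℕ) : Prop where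
  stores : Stores D₀ A (s.arr 0)
  marks : ∀ c, s.arr 2 c = if c ∈ A then 1 else 0
  alive : s.reg 4 = A.card
  ends_le : ∀ k, s.arr 0 k ≤ 4 * N + 3
  stack_le : ∀ k, s.arr 1 k ≤ 4 * N + 3

/-- The invariant of the main loop. -/
def MainInv (D₀ : LinkDiagram C₀ S₀) (N n : ℕ) (s : State) : Prop :=
  ∃ A, Holds D₀ N s A ∧ Clean s A ∧ s.reg 3 + 17 * s.reg 4 ≤ 21 * n

/-- One crossing disappears, which lowers the measure by 17, while eight ends are pushed. -/
theorem reaches_untwistProgram {D₀ : LinkDiagram C₀ S₀} {N M : ℕ} {A : Finset ℕ} (hs : s.Bounded B)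
    (hW : 5 * B + 10 ≤ W) (hM : 4 * N + 3 ≤ B) (hI : Holds D₀ N s A)
    (hsp : s.reg 3 + 17 * s.reg 4 + 1 = M) (hMB : M ≤ B) (ha : s.reg 10 = s.reg 9 / 4)
    (hx : s.reg 9 ≤ 4 * N + 3) (haA : s.reg 10 ∈ A)
    (hc : Clean s (A.erase (s.reg 10)))
    (ht : s.arr 0 (s.reg 9) = 4 * s.reg 10 + (s.reg 9 + 1) % 4) :
    Reaches B W untwistProgram s fun s' =>
      ∃ A, Holds D₀ N s' A ∧ Clean s' A ∧ s'.reg 3 + 17 * s'.reg 4 < M := by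
  have hcard := A.card_pos.2 ⟨_, haA⟩
  have hal := hI.alive
  refine .seq (.write hs (by simp [Term.peak]; omega) (by simp [Term.peak])
    (by simp [Term.eval]) fun hs₁ => ?_)
  refine .seq (.assign hs₁ (by simp [Term.peak, Op.bound, Term.maxVal]; omega)
    (by simp only [Term.eval, Op.eval]; omega) fun hs₂ => ?_)
  refine .seq (.assign hs₂ (by simp [dartTerm, Term.peak, Op.bound, Term.maxVal]; omega)
    (by simp [eval_dartTerm, Term.eval]; omega) fun hs₃ => ?_)
  refine .seq (.assign hs₃ (by simp [dartTerm, Term.peak, Op.bound, Term.maxVal]; omega)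
    (by simp [eval_dartTerm, Term.eval]; omega) fun hs₄ => ?_)
  refine (reaches_joinProgram (N := N) hs₄ hW hM ?_ ?_ ?_).mono fun s' _ hj => ?_
  · exact fun k => by simpa using hI.ends_le k
  · exact fun k => by simpa using hI.stack_le k
  · simp
    omega
  · have hsp' := hj.spliced
    have hm := hj.marks
    have hp := hj.pointer
    have h4 := hj.reg 4 (by decide) (by decide) (by decide) (by decide)
    simp [eval_dartTerm, Term.eval, Op.eval] at hsp' hm hp h4
    refine ⟨A.erase (s.reg 10), ⟨?_, fun c => ?_, ?_, fun k => ?_, hj.le⟩, ?_, by omega⟩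
    · have := hI.stores.untwist (a := s.reg 10) (i := s.reg 9) haA
        (by rw [ha]; rw [ha] at ht; exact (twist_iff _ _).1 ht)
      rw [hsp', Finset.coe_erase]
      rw [show (2 : ZMod 4) = ((2 : ℕ) : ZMod 4) by rfl, show (3 : ZMod 4) = ((3 : ℕ) : ZMod 4) by rfl,
        endCode_add, endCode_add] at this
      exact this
    · rw [hm, Function.update_apply, hI.marks]
      by_cases h : c = s.reg 10 <;> simp [h]
    · rw [h4, hal, Finset.card_erase_of_mem haA]
    · rw [hsp']
      exact splice_le hI.ends_le _ _ _
    · refine hj.clean fun c hc' i => ?_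
      refine (hc c hc' i).imp ?_ fun h => ?_
      · rintro ⟨k, hk, hy⟩
        exact ⟨k, by simpa using hk, by simpa using hy⟩
      · simpa using h

/-- Two crossings disappear, which lowers the measure by 34, while sixteen ends are pushed. -/
theorem reaches_unpokeProgram {D₀ : LinkDiagram C₀ S₀} {N M : ℕ} {A : Finset ℕ} (hs : s.Bounded B)
    (hW : 5 * B + 10 ≤ W) (hM : 4 * N + 3 ≤ B) (hI : Holds D₀ N s A)
    (hsp : s.reg 3 + 17 * s.reg 4 + 1 = M) (hMB : M ≤ B) (ha : s.reg 10 = s.reg 9 / 4)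
    (hy : s.reg 11 = s.arr 0 (s.reg 9)) (hb : s.reg 13 = s.reg 11 / 4)
    (hx : s.reg 9 ≤ 4 * N + 3) (haA : s.reg 10 ∈ A)
    (hc : Clean s (A.erase (s.reg 10))) (ht : PokeTest (s.arr 0) (s.reg 9)) :
    Reaches B W unpokeProgram s fun s' =>
      ∃ A, Holds D₀ N s' A ∧ Clean s' A ∧ s'.reg 3 + 17 * s'.reg 4 < M := by
  have hal := hI.alive
  have hyM : s.reg 11 ≤ 4 * N + 3 := hy ▸ hI.ends_le _
  have hpoke := (pokeTest_iff _ _).1 ht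
  rw [← hy, ← ha, ← hb] at hpoke
  obtain ⟨hbA, hst⟩ := hI.stores.unpoke haA hpoke
  have hbA' : s.reg 13 ∈ A.erase (s.reg 10) := Finset.mem_erase.2 ⟨hpoke.ne.symm, hbA⟩
  have hcard := Finset.card_pos.2 ⟨_, hbA'⟩
  have hcard' := Finset.card_erase_of_mem haA
  refine .seq (.write hs (by simp [Term.peak]; omega) (by simp [Term.peak])
    (by simp [Term.eval]) fun hs₁ => ?_)
  refine .seq (.write hs₁ (by simp [Term.peak]; omega) (by simp [Term.peak])
    (by simp [Term.eval]) fun hs₂ => ?_)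
  refine .seq (.assign hs₂ (by simp [Term.peak, Op.bound, Term.maxVal]; omega)
    (by simp only [Term.eval, Op.eval]; omega) fun hs₃ => ?_)
  refine .seq (.assign hs₃ (by simp [dartTerm, Term.peak, Op.bound, Term.maxVal]; omega)
    (by simp [eval_dartTerm, Term.eval]; omega) fun hs₄ => ?_)
  refine .seq (.assign hs₄ (by simp [dartTerm, Term.peak, Op.bound, Term.maxVal]; omega)
    (by simp [eval_dartTerm, Term.eval]; omega) fun hs₅ => ?_)
  refine .seq ((reaches_joinProgram (N := N) hs₅ hW hM ?_ ?_ ?_).mono fun s₆ hs₆ hj _ => ?_)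
  · exact fun k => by simpa using hI.ends_le k
  · exact fun k => by simpa using hI.stack_le k
  · simp
    omega
  have hsp₆ := hj.spliced
  have hm₆ := hj.marks
  have hp₆ := hj.pointer
  have h4 := hj.reg 4 (by decide) (by decide) (by decide) (by decide)
  have h9 := hj.reg 9 (by decide) (by decide) (by decide) (by decide)
  have h10 := hj.reg 10 (by decide) (by decide) (by decide) (by decide)
  have h11 := hj.reg 11 (by decide) (by decide) (by decide) (by decide)
  have h13 := hj.reg 13 (by decide) (by decide) (by decide) (by decide)
  simp [eval_dartTerm, Term.eval, Op.eval] at hsp₆ hm₆ hp₆ h4 h9 h10 h11 h13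
  have hle₆ := hj.le
  have hclean : Clean s₆ ((A.erase (s.reg 10)).erase (s.reg 13)) := by
    refine hj.clean fun c hc' i => ?_
    refine (hc c (Finset.mem_of_mem_erase hc') i).imp ?_ fun h => ?_
    · rintro ⟨k, hk, hy⟩
      exact ⟨k, by simpa using hk, by simpa using hy⟩
    · simpa using h
  have hends₆ : ∀ k, s₆.arr 0 k ≤ 4 * N + 3 := fun k => by
    rw [hsp₆]
    exact splice_le hI.ends_le _ _ _
  clear hj
  -- The second splice acts on the array left by the first, as in `Stores.unpoke`.
  refine .seq (.assign hs₆ (by simp [dartTerm, Term.peak, Op.bound, Term.maxVal]; omega)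
    (by simp [eval_dartTerm, Term.eval]; omega) fun hs₇ => ?_)
  refine .seq (.assign hs₇ (by simp [dartTerm, Term.peak, Op.bound, Term.maxVal]; omega)
    (by simp [eval_dartTerm, Term.eval]; omega) fun hs₈ => ?_)
  refine (reaches_joinProgram (N := N) hs₈ hW hM ?_ ?_ ?_).mono fun s' _ hj => ?_
  · exact hends₆
  · exact hle₆
  · simp
    omega
  have hsp' := hj.spliced
  have hm := hj.marks
  have hp := hj.pointer
  have h4' := hj.reg 4 (by decide) (by decide) (by decide) (by decide)
  simp [eval_dartTerm, Term.eval] at hsp' hm hp h4'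
  have hcard₂ := Finset.card_erase_of_mem hbA'
  refine ⟨(A.erase (s.reg 10)).erase (s.reg 13), ⟨?_, fun c => ?_, by omega, fun k => ?_, hj.le⟩, ?_,
    by omega⟩
  · have e : (A : Set ℕ) \ {s.reg 10, s.reg 13} = ((A.erase (s.reg 10)).erase (s.reg 13) : Finset ℕ) := by
      ext c
      simp
      tauto
    rw [e] at hst
    rw [hsp', hsp₆, h9, h10, h11, h13]
    rw [show (2 : ZMod 4) = ((2 : ℕ) : ZMod 4) by rfl, show (3 : ZMod 4) = ((3 : ℕ) : ZMod 4) by rfl,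
      show (1 : ZMod 4) = ((1 : ℕ) : ZMod 4) by simp,
      endCode_add, endCode_add, endCode_add, endCode_add] at hst
    exact hst
  · rw [hm, hm₆, Function.update_apply, Function.update_apply, hI.marks]
    by_cases h : c = s.reg 10 <;> by_cases h' : c = s.reg 13 <;> simp [h, h']
  · rw [hsp']
    exact splice_le hends₆ _ _ _
  · refine hj.clean fun c hc' i => ?_
    refine (hclean c hc' i).imp ?_ fun h => ?_
    · rintro ⟨k, hk, hy⟩
      exact ⟨k, by simpa using hk, hy⟩
    · exact h

end RAM

/-! ### Verification of the loop bodies -/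

namespace RAM

open LinkDiagram

variable {C₀ S₀ : Type} {B W : ℕ} {s : State}

theorem Holds.of_arr {D₀ : LinkDiagram C₀ S₀} {N : ℕ} {A : Finset ℕ} {s' : State}
    (h : Holds D₀ N s A) (ha : s'.arr = s.arr) (h4 : s'.reg 4 = s.reg 4) : Holds D₀ N s' A := by
  refine ⟨?_, ?_, ?_, ?_, ?_⟩
  · rw [ha]; exact h.stores
  · rw [ha]; exact h.marks
  · rw [h4]; exact h.alive
  · rw [ha]; exact h.ends_le
  · rw [ha]; exact h.stack_le

theorem Clean.of_arr {A : Finset ℕ} {s' : State} (h : Clean s A) (ha : s'.arr = s.arr)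
    (h3 : s'.reg 3 = s.reg 3) : Clean s' A := by
  intro c hc i
  have := h c hc i
  rwa [OnStack, ← ha, ← h3] at this

/-- The largest contribution is that of `dartTerm`: `4 * B` plus `B + 3`, since a remainder is
estimated by its dividend. -/
theorem peak_pokeTest_le : pokeTest.peak B ≤ 5 * B + 10 := by
  simp only [pokeTest, neTerm, dartTerm, Term.peak, Term.maxVal, Op.bound]
  repeat' apply max_le
  all_goals omega

/-- The popped end is the only one of unknown status. A move deletes its crossing; otherwise both
tests have failed and it is irreducible. -/
theorem reaches_reduceProgram {D₀ : LinkDiagram C₀ S₀} {N M : ℕ} {A : Finset ℕ} (hs : s.Bounded B)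
    (hW : 5 * B + 10 ≤ W) (hM : 4 * N + 3 ≤ B) (hI : Holds D₀ N s A)
    (hsp : s.reg 3 + 17 * s.reg 4 + 1 = M) (hMB : M ≤ B) (ha : s.reg 10 = s.reg 9 / 4)
    (hx : s.reg 9 ≤ 4 * N + 3) (haA : s.reg 10 ∈ A)
    (hc : ∀ c ∈ A, ∀ i, endCode c i = s.reg 9 ∨ OnStack s (endCode c i) ∨
      IsIrreducibleAt (s.arr 0) c i) :
    Reaches B W reduceProgram s fun s' =>
      ∃ A, Holds D₀ N s' A ∧ Clean s' A ∧ s'.reg 3 + 17 * s'.reg 4 < M := by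
  have hclean : Clean s (A.erase (s.reg 10)) := fun c hcA i => by
    refine (hc c (Finset.mem_of_mem_erase hcA) i).resolve_left fun h => ?_
    refine Finset.ne_of_mem_erase hcA ?_
    rw [ha, ← h, endCode_div]
  refine .seq (.assign hs (by simp [Term.peak]; omega) (hs.arr _ _) fun hs₁ => ?_)
  refine .ite hs₁ (by simp [twistTest, dartTerm, Term.peak, Op.bound, Term.maxVal]; omega)
    (fun ht => ?_) fun ht => ?_
  · rw [twistTest, eval_eq_ne_zero] at ht
    simp [eval_dartTerm, Term.eval] at ht
    refine reaches_untwistProgram hs₁ hW hM (hI.of_arr rfl (by simp)) (by simpa using hsp) hMB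
      (by simpa using ha) (by simpa using hx) (by simpa using haA) ?_ (by simpa using ht)
    refine Clean.of_arr (s := s) ?_ rfl (by simp)
    simpa using hclean
  · have ht' := mt (eval_eq_ne_zero _ _ _).2 (not_not.2 ht)
    simp [eval_dartTerm, Term.eval] at ht'
    clear ht
    refine .seq (.assign hs₁ (by simp [Term.peak, Op.bound, Term.maxVal]; omega)
      ((Nat.div_le_self _ _).trans (hs₁.reg 11)) fun hs₂ => ?_)
    refine .seq (.assign hs₂ (by simp [dartTerm, Term.peak, Op.bound, Term.maxVal]; omega)
      (hs₂.arr _ _) fun hs₃ => ?_)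
    refine .seq (.assign hs₃ (by simp [dartTerm, Term.peak, Op.bound, Term.maxVal]; omega)
      (hs₃.arr _ _) fun hs₄ => ?_)
    refine .ite hs₄ (peak_pokeTest_le.trans hW)
      (fun hp => ?_) fun hp => ?_
    · simp only [pokeTest, eval_mul_ne_zero, eval_add_ne_zero, eval_eq_ne_zero,
        eval_neTerm_ne_zero] at hp
      simp [eval_dartTerm, Term.eval, Op.eval] at hp
      refine reaches_unpokeProgram hs₄ hW hM (hI.of_arr rfl (by simp)) (by simpa using hsp) hMB
        (by simpa using ha) (by simp [Term.eval]) (by simp [Term.eval, Op.eval]) (by simpa using hx)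
        (by simpa using haA) ?_ ?_
      · refine Clean.of_arr (s := s) ?_ rfl (by simp)
        simpa using hclean
      · simpa [PokeTest, ← ha] using hp
    · refine .skip hs₄ ⟨A, hI.of_arr rfl (by simp), fun c hcA i => ?_, by simp; omega⟩
      have hp' : ¬ PokeTest (s.arr 0) (s.reg 9) := fun h => by
        refine absurd hp ?_
        simp only [pokeTest, eval_mul_ne_zero, eval_add_ne_zero, eval_eq_ne_zero,
          eval_neTerm_ne_zero]
        simpa [eval_dartTerm, Term.eval, Op.eval, PokeTest, ← ha] using h
      rcases hc c hcA i with h | ⟨k, hk, h⟩ | h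
      · right
        have := isIrreducibleAt_of_tests (by rw [← ha]; exact ht') hp'
        rw [← h, endCode_div, endCode_cast] at this
        exact this
      · exact Or.inl ⟨k, by simpa using hk, h⟩
      · exact Or.inr h

/-- Ends can outlive their crossings on the stack; the marks in array 2 recognize these, and they
are dropped. In any case the pop itself lowers the measure by one. -/
theorem reaches_popProgram {D₀ : LinkDiagram C₀ S₀} {N n : ℕ} (hs : s.Bounded B)
    (hW : 5 * B + 10 ≤ W) (hM : 4 * N + 3 ≤ B) (hn : 21 * n ≤ B) (hI : MainInv D₀ N n s)
    (h3 : s.reg 3 ≠ 0) :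
    Reaches B W popProgram s fun s' =>
      MainInv D₀ N n s' ∧ s'.reg 3 + 17 * s'.reg 4 < s.reg 3 + 17 * s.reg 4 := by
  obtain ⟨A, hA, hc, hle⟩ := hI
  refine .seq (.assign hs (by simp [Term.peak, Op.bound, Term.maxVal]; omega)
    ((Nat.sub_le _ _).trans (hs.reg 3)) fun hs₁ => ?_)
  refine .seq (.assign hs₁ (by simp [Term.peak]; omega) (hs₁.arr _ _) fun hs₂ => ?_)
  refine .seq (.assign hs₂ (by simp [Term.peak, Op.bound, Term.maxVal]; omega)
    ((Nat.div_le_self _ _).trans (hs₂.reg 9)) fun hs₃ => ?_)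
  have key : ∀ c ∈ A, ∀ i, endCode c i = s.arr 1 (s.reg 3 - 1) ∨
      (∃ k < s.reg 3 - 1, s.arr 1 k = endCode c i) ∨ IsIrreducibleAt (s.arr 0) c i := by
    intro c hcA i
    rcases hc c hcA i with ⟨k, hk, h⟩ | h
    · rcases (by omega : k = s.reg 3 - 1 ∨ k < s.reg 3 - 1) with rfl | hk
      · exact Or.inl h.symm
      · exact Or.inr (Or.inl ⟨k, hk, h⟩)
    · exact Or.inr (Or.inr h)
  refine .ite hs₃ (by simp [Term.peak]; omega) (fun h => ?_) fun h => ?_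
  · refine (reaches_reduceProgram (A := A) (M := s.reg 3 + 17 * s.reg 4) hs₃ hW hM
      (hA.of_arr rfl (by simp)) ?_ (by omega) ?_ ?_ ?_ ?_).mono ?_
    · simp [Term.eval, Op.eval]
      omega
    · simp [Term.eval, Op.eval]
    · simpa [Term.eval, Op.eval] using hA.stack_le _
    · simp [Term.eval, Op.eval, hA.marks] at h ⊢
      exact h
    · simpa [Term.eval, Op.eval, OnStack] using key
    · rintro s' - ⟨A', h1, h2, h3⟩
      exact ⟨⟨A', h1, h2, by omega⟩, h3⟩
  · refine .skip hs₃ ⟨⟨A, hA.of_arr rfl (by simp), fun c hcA i => ?_, ?_⟩, ?_⟩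
    · rcases key c hcA i with h' | ⟨k, hk, h'⟩ | h'
      · exfalso
        simp [Term.eval, Op.eval, hA.marks, ← h', endCode_div] at h
        exact h hcA
      · exact Or.inl ⟨k, by simpa [Term.eval, Op.eval] using hk, h'⟩
      · exact Or.inr h'
    · simp [Term.eval, Op.eval]
      omega
    · simp [Term.eval, Op.eval]
      omega

/-- Removes the subdivision points. -/
def suppressProgram : Program :=
  .seq (.assign 5 (.op .add (.op .mul (.const 4) (.reg 0)) (.op .mul (.const 2) (.reg 2)))) <|
  .seq (.assign 6 (.op .add (.reg 5) (.const 1))) <|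
  .seq spliceProgram (.assign 2 (.op .add (.reg 2) (.const 1)))

/-- Marks the crossings and pushes their ends. -/
def fillProgram : Program :=
  .seq (.write 2 (.reg 2) (.const 1)) <|
  .seq (.assign 7 (.op .mul (.const 4) (.reg 2))) <|
  .seq (pushCrossing 7) (.assign 2 (.op .add (.reg 2) (.const 1)))

/-- The decision algorithm. -/
def unlinkProgram : Program :=
  .seq (.loop (.op .lt (.reg 2) (.reg 1)) suppressProgram) <|
  .seq (.seq (.assign 2 (.const 0)) (.assign 4 (.reg 0))) <|
  .seq (.loop (.op .lt (.reg 2) (.reg 0)) fillProgram) <|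
  .seq (.loop (.reg 3) popProgram) (.assign 0 (.op .eq (.reg 4) (.const 0)))

/-- The state of the first loop. -/
structure SuppressInv {n m : ℕ} (D₀ : LinkDiagram (Fin n) (Fin m)) (s : State) : Prop where
  pending : Pending D₀ (s.reg 2) (s.arr 0)
  le : s.reg 2 ≤ m
  reg_zero : s.reg 0 = n
  reg_one : s.reg 1 = m
  pointer : s.reg 3 = 0
  ends_le : ∀ k, s.arr 0 k ≤ 4 * (n + m) + 3
  arr : ∀ a k, a ≠ 0 → s.arr a k = 0

/-- The word bound `6 * B` is needed for the number `4 * reg 0 + 2 * reg 2` of the current joint's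
first dart. -/
theorem reaches_suppressProgram {n m : ℕ} {D₀ : LinkDiagram (Fin n) (Fin m)} (hs : s.Bounded B)
    (hW : 6 * B + 10 ≤ W) (hM : 4 * (n + m) + 3 ≤ B) (hI : SuppressInv D₀ s)
    (hlt : s.reg 2 < s.reg 1) :
    Reaches B W suppressProgram s fun s' =>
      SuppressInv D₀ s' ∧ s'.reg 1 - s'.reg 2 < s.reg 1 - s.reg 2 := by
  have h0 := hI.reg_zero
  have h1 := hI.reg_one
  refine .seq (.assign hs (by simp [Term.peak, Op.bound, Term.maxVal]; omega)
    (by simp only [Term.eval, Op.eval]; omega) fun hs₁ => ?_)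
  refine .seq (.assign hs₁ (by simp [Term.peak, Op.bound, Term.maxVal]; omega)
    (by simp [Term.eval, Op.eval]; omega) fun hs₂ => ?_)
  refine .seq ((reaches_spliceProgram hs₂ (by omega) (by omega)).mono ?_)
  rintro s₃ hs₃ hdef -
  simp [Term.eval, Op.eval] at hdef
  refine .assign hs₃ (by simp [Term.peak, Op.bound, Term.maxVal]; omega)
    (by rw [hdef]; simp [Term.eval, Op.eval]; omega) ?_
  have hp := hI.pending.succ (by omega)
  refine ⟨⟨?_, ?_, ?_, ?_, ?_, fun k => ?_, fun a k ha => ?_⟩, ?_⟩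
  · simpa [hdef, Term.eval, Op.eval, h0] using hp
  · simp [hdef, Term.eval, Op.eval]
    omega
  · simpa [hdef, Term.eval, Op.eval] using h0
  · simpa [hdef, Term.eval, Op.eval] using h1
  · simpa [hdef, Term.eval, Op.eval] using hI.pointer
  · simp only [hdef, Function.update_self]
    exact splice_le hI.ends_le _ _ _
  · simpa [hdef, ha] using hI.arr a k ha
  · simp [hdef, Term.eval, Op.eval]
    omega

/-- The state of the second loop. -/
structure FillInv (D₀ : LinkDiagram C₀ S₀) (N n : ℕ) (s : State) : Prop where
  stores : Stores D₀ {a | a < n} (s.arr 0)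
  le : s.reg 2 ≤ n
  reg_zero : s.reg 0 = n
  alive : s.reg 4 = n
  pointer : s.reg 3 = 4 * s.reg 2
  ends_le : ∀ k, s.arr 0 k ≤ 4 * N + 3
  stack_le : ∀ k, s.arr 1 k ≤ 4 * N + 3
  marks : ∀ c, s.arr 2 c = if c < s.reg 2 then 1 else 0
  onStack : ∀ c < s.reg 2, ∀ i, OnStack s (endCode c i)

theorem reaches_fillProgram {D₀ : LinkDiagram C₀ S₀} {N n : ℕ} (hs : s.Bounded B)
    (hW : 5 * B + 10 ≤ W) (hM : 4 * N + 3 ≤ B) (hn : n ≤ N) (hI : FillInv D₀ N n s)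
    (hlt : s.reg 2 < s.reg 0) :
    Reaches B W fillProgram s fun s' =>
      FillInv D₀ N n s' ∧ s'.reg 0 - s'.reg 2 < s.reg 0 - s.reg 2 := by
  have h0 := hI.reg_zero
  have h3 := hI.pointer
  refine .seq (.write hs (by simp [Term.peak]; omega) (by simp [Term.peak]; omega)
    (by simp [Term.eval]; omega) fun hs₁ => ?_)
  refine .seq (.assign hs₁ (by simp [Term.peak, Op.bound, Term.maxVal]; omega)
    (by simp only [Term.eval, Op.eval]; omega) fun hs₂ => ?_)
  refine .seq ((reaches_pushCrossing (N := N) hs₂ hW hM (by simp [Term.eval, Op.eval]; omega)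
    (by simp; omega)).mono ?_)
  rintro s₃ hs₃ ⟨hp, ho⟩ -
  have hp3 := hp.pointer
  have hp2 := hp.reg 2 (by decide) (by decide)
  have hp0 := hp.reg 0 (by decide) (by decide)
  have hp4 := hp.reg 4 (by decide) (by decide)
  have ha0 := hp.arr 0 (by decide)
  have ha2 := hp.arr 2 (by decide)
  have hle := hp.le (by simpa using hI.stack_le)
  have hst := hp.onStack
  simp [Term.eval, Op.eval] at hp3 hp2 hp0 hp4 ha0 ha2 ho
  refine .assign hs₃ (by simp [Term.peak, Op.bound, Term.maxVal]; omega)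
    (by simp only [Term.eval, Op.eval]; omega) ?_
  have hon : ∀ (v y : ℕ), OnStack s₃ y → OnStack ⟨Function.update s₃.reg 2 v, s₃.arr⟩ y := by
    rintro v y ⟨k, hk, h⟩
    exact ⟨k, by simpa using hk, h⟩
  refine ⟨⟨?_, ?_, ?_, ?_, ?_, fun k => ?_, hle, fun c => ?_, fun c hc i => hon _ _ ?_⟩, ?_⟩
  · simpa [ha0] using hI.stores
  · simp [Term.eval, Op.eval]
    omega
  · simp
    omega
  · simpa [hp4] using hI.alive
  · simp [Term.eval, Op.eval]
    omega
  · simpa [ha0] using hI.ends_le k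
  · simp only [ha2, Function.update_apply, hI.marks, Term.eval, Op.eval, hp2]
    split_ifs <;> simp_all <;> omega
  · simp [Term.eval, Op.eval, hp2] at hc
    rcases (by omega : c = s.reg 2 ∨ c < s.reg 2) with rfl | hc
    · exact ho i
    · refine hst _ ?_
      obtain ⟨k, hk, h⟩ := hI.onStack c hc i
      exact ⟨k, by simpa using hk, by simpa using h⟩
  · simp [Term.eval, Op.eval]
    omega

end RAM

/-! ### Correctness and running time of the whole program -/

namespace RAM

open LinkDiagram

/-- The measure of the main loop starts at `21 * n`, from the `4 * n` ends on the stack and weight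
17 for each crossing. The bound `B` covers the stack pointer as well as the numbers of darts. The
summands 4 and 2 in the time bound account for the loop tests. -/
theorem unlinkProgram_correct {n m B W : ℕ} {D : LinkDiagram (Fin n) (Fin m)} {s : State}
    (htw : TreewidthLE D.graph 2) (hD : D.IsInput s) (hB : 21 * (n + m) + 3 ≤ B)
    (hW : 6 * B + 10 ≤ W) :
    ∃ s' t, Runs W unlinkProgram s s' t ∧
      t ≤ (m + 1) * (4 + suppressProgram.cost) + 4 + (n + 1) * (4 + fillProgram.cost) +
        (21 * n + 1) * (2 + popProgram.cost) + 4 ∧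
      ((D.IsUnlink ∧ s'.reg 0 = 1) ∨ (¬ D.IsUnlink ∧ s'.reg 0 = 0)) := by
  have hr0 := hD.reg_zero
  have hr1 := hD.reg_one
  have hr2 := hD.reg_rest 2 le_rfl
  -- The numbers of darts are below `4 * n + 2 * m`; the coarser bound has the form required by
  -- `reaches_pushCrossing`.
  have hends : ∀ k, s.arr 0 k ≤ 4 * (n + m) + 3 := by
    have hcode : ∀ d : Dart (Fin n) (Fin m), d.code ≤ 4 * (n + m) + 3 := by
      rintro (⟨c, i⟩ | ⟨c, i⟩)
      · have h1 := ZMod.val_lt i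
        have h2 := c.2
        simp only [Dart.code]
        omega
      · have h1 := ZMod.val_lt i
        have h2 := c.2
        simp only [Dart.code]
        omega
    intro k
    by_cases hk : 4 * n + 2 * m ≤ k
    · rw [hD.arr_zero_rest k hk]
      omega
    · obtain ⟨d, hd⟩ : ∃ d : Dart (Fin n) (Fin m), d.code = k := by
        by_cases hk' : k < 4 * n
        · exact ⟨Sum.inl (⟨k / 4, by omega⟩, (k : ZMod 4)), endCode_self k⟩
        · refine ⟨Sum.inr (⟨(k - 4 * n) / 2, by omega⟩, ((k - 4 * n : ℕ) : ZMod 2)), ?_⟩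
          simp only [Dart.code, ZMod.val_natCast]
          omega
      rw [← hd, hD.arr_zero]
      exact hcode _
  have hs : s.Bounded B := by
    refine ⟨fun r => ?_, fun a k => ?_⟩
    · rcases (by omega : r = 0 ∨ r = 1 ∨ 2 ≤ r) with rfl | rfl | hr
      · omega
      · omega
      · rw [hD.reg_rest r hr]
        omega
    · rcases Nat.eq_zero_or_pos a with rfl | ha
      · exact (hends k).trans (by omega)
      · rw [hD.arr_rest a k ha]
        omega
  have hI₀ : SuppressInv D s := by
    refine ⟨?_, by omega, hr0, hr1, hD.reg_rest 3 (by omega), hends,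
      fun a k ha => hD.arr_rest a k (Nat.pos_of_ne_zero ha)⟩
    rw [hr2]
    exact pending_zero hD htw
  obtain ⟨s₁, t₁, hrun₁, hs₁, hI₁, he₁, ht₁⟩ := runs_loop (B := B) (W := W)
    (e := .op .lt (.reg 2) (.reg 1)) (p := suppressProgram) (by simp [suppressProgram, spliceProgram, Program.LoopFree])
    (by simp [Term.peak, Op.bound]; omega) (SuppressInv D) (fun s => s.reg 1 - s.reg 2)
    (fun s hs hI h => reaches_suppressProgram hs (by omega) (by omega) hI
      ((eval_lt_ne_zero _ _ _).1 h)) s hs hI₀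
  have hk₁ : s₁.reg 2 = m := by
    have h1 := hI₁.le
    have h2 := hI₁.reg_one
    have h3 := mt (eval_lt_ne_zero _ _ _).2 (not_not.2 he₁)
    simp only [Term.eval] at h3
    omega
  obtain ⟨s₂, t₂, hrun₂, hs₂, hdef⟩ : Reaches B W (.seq (.assign 2 (.const 0)) (.assign 4 (.reg 0)))
      s₁ fun s' => s' = ⟨Function.update (Function.update s₁.reg 2 0) 4 (s₁.reg 0), s₁.arr⟩ := by
    refine .seq (.assign hs₁ (by simp [Term.peak]) (by simp [Term.eval]) fun hs₂ => ?_)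
    exact .assign hs₂ (by simp [Term.peak]; omega) (hs₂.reg 0) (by simp [Term.eval])
  have ht₂ : t₂ ≤ 4 := hrun₂.le_cost (by simp [Program.LoopFree])
  have hI₂ : FillInv D (n + m) n s₂ := by
    have h0 := hI₁.reg_zero
    have hst := hI₁.pending
    rw [hk₁] at hst
    rw [hdef]
    refine ⟨hst.stores, by simp, by simpa using h0, by simpa using h0,
      by simpa using hI₁.pointer, hI₁.ends_le, fun k => ?_, fun c => ?_, fun c hc => ?_⟩
    · simp [hI₁.arr 1 k (by decide)]
    · simp [hI₁.arr 2 c (by decide)]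
    · simp at hc
  obtain ⟨s₃, t₃, hrun₃, hs₃, hI₃, he₃, ht₃⟩ := runs_loop (B := B) (W := W)
    (e := .op .lt (.reg 2) (.reg 0)) (p := fillProgram) (by simp [fillProgram, pushCrossing, push, Program.LoopFree])
    (by simp [Term.peak, Op.bound]; omega) (FillInv D (n + m) n) (fun s => s.reg 0 - s.reg 2)
    (fun s hs hI h => reaches_fillProgram hs (by omega) (by omega) (by omega) hI
      ((eval_lt_ne_zero _ _ _).1 h)) s₂ hs₂ hI₂
  have hk₃ : s₃.reg 2 = n := by
    have h1 := hI₃.le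
    have h2 := hI₃.reg_zero
    have h3 := mt (eval_lt_ne_zero _ _ _).2 (not_not.2 he₃)
    simp only [Term.eval] at h3
    omega
  have hμ : s₃.reg 3 + 17 * s₃.reg 4 = 21 * n := by
    rw [hI₃.pointer, hI₃.alive, hk₃]
    omega
  have hI₃' : MainInv D (n + m) n s₃ := by
    refine ⟨Finset.range n, ⟨?_, fun c => ?_, ?_, hI₃.ends_le, hI₃.stack_le⟩, fun c hc i => ?_,
      hμ.le⟩
    · rw [Finset.coe_range]
      exact hI₃.stores
    · rw [hI₃.marks, hk₃]
      simp
    · rw [hI₃.alive, Finset.card_range]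
    · exact Or.inl (hI₃.onStack c (by rw [hk₃]; exact Finset.mem_range.1 hc) i)
  obtain ⟨s₄, t₄, hrun₄, hs₄, ⟨A, hA, hclean, -⟩, he₄, ht₄⟩ := runs_loop (B := B) (W := W)
    (e := .reg 3) (p := popProgram) (by simp [popProgram, reduceProgram, untwistProgram,
      unpokeProgram, joinProgram, spliceProgram, pushCrossing, push, Program.LoopFree])
    (by simp [Term.peak]; omega) (MainInv D (n + m) n) (fun s => s.reg 3 + 17 * s.reg 4)
    (fun s hs hI h => reaches_popProgram hs (by omega) (by omega) (by omega) hI h) s₃ hs₃ hI₃'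
  rw [hμ] at ht₄
  have hout : (Term.op .eq (.reg 4) (.const 0)).Fits W s₄ :=
    Term.fits_of_peak hs₄ _ (by simp [Term.peak, Op.bound]; omega)
  refine ⟨_, _, .seq hrun₁ (.seq hrun₂ (.seq hrun₃ (.seq hrun₄ (.assign s₄ 0 _ hout)))), ?_, ?_⟩
  · have h1 : (s.reg 1 - s.reg 2 + 1) * (4 + suppressProgram.cost) =
        (m + 1) * (4 + suppressProgram.cost) := by rw [hr1, hr2, Nat.sub_zero]
    have h3 : (s₂.reg 0 - s₂.reg 2 + 1) * (4 + fillProgram.cost) =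
        (n + 1) * (4 + fillProgram.cost) := by
      have e0 : s₂.reg 0 = n := hI₂.reg_zero
      have e2 : s₂.reg 2 = 0 := by rw [hdef]; simp
      rw [e0, e2, Nat.sub_zero]
    replace ht₁ : t₁ ≤ (s.reg 1 - s.reg 2 + 1) * (4 + suppressProgram.cost) := ht₁
    replace ht₃ : t₃ ≤ (s₂.reg 0 - s₂.reg 2 + 1) * (4 + fillProgram.cost) := ht₃
    replace ht₄ : t₄ ≤ (21 * n + 1) * (2 + popProgram.cost) := ht₄
    rw [h1] at ht₁
    rw [h3] at ht₃
    simp only [Term.cost]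
    omega
  · simp only [Function.update_self, Term.eval, Op.eval]
    rcases A.eq_empty_or_nonempty with rfl | hne
    · left
      have := hA.stores
      rw [Finset.coe_empty] at this
      exact ⟨this.isUnlink, by simp [hA.alive]⟩
    · right
      -- The stack is empty, so `Clean` leaves no end at which a move is possible.
      have hirr : ∀ a ∈ A, ∀ i, IsIrreducibleAt (s₄.arr 0) a i := fun a ha i => by
        refine (hclean a ha i).resolve_left ?_
        rintro ⟨k, hk, -⟩
        have : s₄.reg 3 = 0 := he₄
        omega
      refine ⟨hA.stores.not_isUnlink hne (fun a ha i => (hirr a ha i).1)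
        fun a ha i => (hirr a ha i).2, ?_⟩
      simp [hA.alive, hne.ne_empty]

end RAM

/-- There is a word RAM program which, for all link diagrams with `n` crossings and `m` subdivision
points whose underlying graph has treewidth at most two, decides in time `O(n + m)`, with numbers
bounded by `O(n + m)`, whether the diagram represents the unlink. -/
theorem mainTheorem3 :
    ∃ (P : RAM.Program) (K : ℕ), ∀ (n m : ℕ) (D : LinkDiagram (Fin n) (Fin m)) (s : RAM.State),
      TreewidthLE D.graph 2 → D.IsInput s →
        ∃ (s' : RAM.State) (t : ℕ),
          RAM.Runs (K * (n + m + 1)) P s s' t ∧ t ≤ K * (n + m + 1) ∧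
            ((D.IsUnlink ∧ s'.reg 0 = 1) ∨ (¬ D.IsUnlink ∧ s'.reg 0 = 0)) := by
  -- `c` collects the costs of the three loops per unit of `n + m + 1`; 1000 leaves room for the
  -- additive constants and for the word bound `6 * B + 10` with `B = 21 * (n + m) + 3`.
  let c := 4 + RAM.suppressProgram.cost + (4 + RAM.fillProgram.cost) + 21 * (2 + RAM.popProgram.cost)
  refine ⟨RAM.unlinkProgram, 1000 + c, fun n m D s htw hD => ?_⟩
  obtain ⟨s', t, h1, h2, h3⟩ := RAM.unlinkProgram_correct (B := 21 * (n + m) + 3)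
    (W := (1000 + c) * (n + m + 1)) htw hD le_rfl (by nlinarith [Nat.zero_le (c * (n + m + 1))])
  refine ⟨s', t, h1, h2.trans ?_, h3⟩
  simp only [c]
  generalize RAM.suppressProgram.cost = x
  generalize RAM.fillProgram.cost = y
  generalize RAM.popProgram.cost = z
  nlinarith [Nat.zero_le (n * x), Nat.zero_le (m * y), Nat.zero_le (m * z), Nat.zero_le z,
    Nat.zero_le x, Nat.zero_le y, Nat.zero_le (n * z), Nat.zero_le (n * y), Nat.zero_le (m * x)]
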